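/- Let $L>0$ and let $q:\mathbb R\to\mathbb C$ be $L$-periodic, $q\in C^2([0,L])$, $q\not\equiv0$. Put $\sigma_1=\begin{pmatrix}0&1\\1&0\end{pmatrix}$, $\sigma_3=\mathrm{diag}(1,-1)$, $Q(x)=\begin{pmatrix}0&q(x)\\ \overline{q(x)}&0\end{pmatrix}$, $U=\begin{pmatrix}1&1\\-i&i\end{pmatrix}$, and let $\mathcal L=i\sigma_3(\partial_x-Q)$ be the Dirac operator, so that $\mathcal Lv=zv$ means $v_x=(-iz\sigma_3+Q)v$. **Spectral data.** Let $Y(x,z)$ be the matrix solution with $Y(0,z)=I$, $\Delta(z)=\frac12\operatorname{tr}Y(L,z)$, $\tilde Y=UYU^{-1}=(\tilde y_{ij})$. The spectrum $\Sigma$ is the set of $z$ for which $\mathcal Lv=zv$ has a nonzero bounded solution on $\mathbb R$. The Dirichlet eigenvalues $\mu$ are those for which there is a nonzero solution on $[0,L]$ with $v_1+v_2=0$ at $x=0$ and $x=L$; each has the sign $\sigma(\mu)=-\operatorname{sgn}\log|\tilde y_{22}(L,\mu)|\in\{-1,0,1\}$. Let $(E_{2k-1},E_{2k})$ be the components of $\mathbb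 R\setminus\Sigma$ (the gaps), numbered from left to right by consecutive integers $k$, finitely or infinitely many, one of the gaps having number $0$; $[E_{2k-1},E_{2k}]$ contains exactly one Dirichlet eigenvalue $\gamma_k$, with sign $\sigma_k=\sigma(\gamma_k)$. The spectral data are $S(q)=\{E_{2k-1},E_{2k},\gamma_k,\sigma_k\}_k$. Let $\gamma_*$ be a $\gamma_k$ with $\sigma_k=0$ closest to $0$, $m(t)=\#\{\gamma_k:\sigma_k=0,\ \gamma_*\le\gamma_k\le t\}$ for $t\ge\gamma_*$ and $m(t)=\#\{\gamma_k:\sigma_k=0,\ t<\gamma_k<\gamma_*\}$ for $t<\gamma_*$ ($m\equiv0$ if no $\sigma_k$ is $0$). **The matrix $B$.** With the factors $(1-z/\mu)e^{z/\mu}$ (replaced by $z$ if $\mu=0$), let $f^\pm(z)$ be the product over the Dirichlet eigenvalues with sign $\pm1$, and $f^0(z)=\frac12e^{A_1z+B_1}\times$ the product over those with sign $0$, where $A_1,B_1$ are the constants for which $\tilde y_{12}(L,z)=e^{A_1z+B_1}\times$ the product over all Dirichlet eigenvalues. On $\mathbb C\setminus\mathbb R$ let $\sqrt[4]{\Delta^2-1}$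 be the holomorphic branch which is continuous across gap number $0$ and positive at its midpoint, and $\sqrt{f^0}$ a holomorphic branch (the principal one at the midpoint of gap number $0$, approached from above) whose boundary value from below on gap number $0$ is $(-1)^{m}$ times that from above. Then $$B(z)=\frac{i\sqrt{f^0}}{\sqrt[4]{\Delta^2-1}}\,\mathrm{diag}(f^-,f^+)\ (\operatorname{Im}z>0),\qquad B(z)=\frac{\sqrt{f^0}}{\sqrt[4]{\Delta^2-1}}\,\mathrm{diag}(f^+,f^-)\ (\operatorname{Im}z<0).$$ **RHP 1** (for fixed $x\in\mathbb R$). Let $c_k=\frac12(E_{2k-1}+E_{2k})$ and fix radii $r_k\ge E_{2k}-E_{2k-1}$, bounded and bounded away from $0$, such that all but finitely many of the closed discs $\overline D(c_k,r_k)$ are pairwise disjoint; let $\mathcal D=\mathbb C\setminus(\mathbb R\cup\bigcup_k\overline D(c_k,r_k))$. A $2\times2$ matrix function $\Phi(x,\cdot)$ on $\mathbb C\setminus\mathbb R$ solves RHP 1 if (1) it is holomorphic; (2) it has continuous boundary values $\Phi^\pm$ from $\pm\operatorname{Im}z>0$ on $\mathbb R\setminus\{E_j\}$, and $\Phi=O(|z-E_j|^{-1/4})$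 at each $E_j$; (3) $\Phi^+=\Phi^-V$ on $\mathbb R\setminus\{E_j\}$, where $V=(-1)^{n+m(t)}\mathrm{diag}(f^- /f^+,f^+/f^-)$ on the band $(E_{2n-2},E_{2n-1})$ (with the missing end replaced by $\mp\infty$ for an unbounded band) and $V=(-1)^{n+m(t)}\,i\,e^{-2itx\sigma_3}\sigma_1$ on the gap $(E_{2n-1},E_{2n})$; (4) $\Phi=U(I+O(1/z))B(z)$ as $z\to\infty$ nontangentially to $\mathbb R$, i.e. in every sector $|\operatorname{Im}z|\ge\delta|z|$, $\delta>0$; (5) for some $c,M>0$, $|\phi_{ij}(x,z)|\le Me^{c|z|^2}$ on $\mathcal D$. **Claim.** (a) For every $x\in\mathbb R$ and every solution $\Phi(x,\cdot)$ of RHP 1, $$Q(x)=\lim_{z\to\infty} iz\,\bigl[\sigma_3,\tfrac12U^\dagger\,\Phi(x,z)B^{-1}(z)\bigr],$$ where, for any $\delta>0$, the limit is taken over nonreal $z$ at distance at least $\delta$ from all gaps. Here $\frac12U^\dagger=U^{-1}$. (b) The spectral data determine the potential: if two potentials $q_1,q_2$ as above (with the same $L$) have the same spectral data, then $q_1=q_2$.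 -/

import Mathlib

open Filter Topology Set

noncomputable section

namespace PeriodicDirac

/-- Complex `2 × 2` matrices. -/
abbrev Mat2 : Type := Matrix (Fin 2) (Fin 2) ℂ

/-! ### The Zakharov-Shabat (self-adjoint Dirac) eigenvalue problem -/

/-- First Pauli matrix. -/
def sigma1 : Mat2 := !![0, 1; 1, 0]

/-- Third Pauli matrix. -/
def sigma3 : Mat2 := !![1, 0; 0, -1]

/-- The diagonal matrix `exp (a σ₃)`. -/
def expSigma3 (a : ℂ) : Mat2 := !![Complex.exp a, 0; 0, Complex.exp (-a)]

/-- The constant matrix `U` of the similarity transformation. -/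
def U : Mat2 := !![1, 1; -Complex.I, Complex.I]

/-- The potential matrix `Q(x)`. -/
def potentialMatrix (q : ℝ → ℂ) (x : ℝ) : Mat2 := !![0, q x; star (q x), 0]

/-- The coefficient matrix `-i z σ₃ + Q(x)`; the equation `v' = (-i z σ₃ + Q) v` is
`i σ₃ (∂ₓ - Q) v = z v`. -/
def zsMatrix (q : ℝ → ℂ) (z : ℂ) (x : ℝ) : Mat2 :=
  (-(Complex.I * z)) • sigma3 + potentialMatrix q x

/-- `Y(x, z)` is the principal matrix solution: `Y' = (-i z σ₃ + Q) Y` on `ℝ`, `Y(0, z) = 1`. -/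
structure IsPrincipalSolution (q : ℝ → ℂ) (Y : ℝ → ℂ → Mat2) : Prop where
  initial : ∀ z, Y 0 z = 1
  ode : ∀ (z : ℂ) (x : ℝ) (i j : Fin 2),
    HasDerivAt (fun t => Y t z i j) ((zsMatrix q z x * Y x z) i j) x

/-- The Lax spectrum: those `z` for which there is a nonzero bounded solution on `ℝ`. -/
def laxSpectrum (q : ℝ → ℂ) : Set ℂ :=
  {z | ∃ v : ℝ → Fin 2 → ℂ, v ≠ 0 ∧
    (∀ (x : ℝ) (i : Fin 2),
      HasDerivAt (fun t => v t i) ((zsMatrix q z x).mulVec (v x) i) x) ∧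
    ∃ C : ℝ, ∀ (x : ℝ) (i : Fin 2), ‖v x i‖ ≤ C}

/-- Dirichlet eigenvalues with base point `0`: there is a nontrivial solution on `[0, L]` with
`v₁ + v₂ = 0` at both end points. -/
def IsDirichletEigenvalue (q : ℝ → ℂ) (L : ℝ) (μ : ℂ) : Prop :=
  ∃ v : ℝ → Fin 2 → ℂ, (∃ x ∈ Icc 0 L, v x ≠ 0) ∧
    (∀ x ∈ Icc 0 L, ∀ i : Fin 2,
      HasDerivWithinAt (fun t => v t i) ((zsMatrix q μ x).mulVec (v x) i) (Icc 0 L) x) ∧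
    v 0 0 + v 0 1 = 0 ∧ v L 0 + v L 1 = 0

/-- The Floquet discriminant `Δ(z) = ½ tr Y(L, z)`. -/
def discriminant (Y : ℝ → ℂ → Mat2) (L : ℝ) (z : ℂ) : ℂ := (Y L z).trace / 2

/-- `Ỹ(x, z) = U Y(x, z) U⁻¹`. -/
def modifiedSolution (Y : ℝ → ℂ → Mat2) (x : ℝ) (z : ℂ) : Mat2 := U * Y x z * U⁻¹

/-- The sign `σ = -sgn (log |ỹ₂₂(L, μ)|)` attached to a Dirichlet eigenvalue `μ`. -/
def dirichletSign (Y : ℝ → ℂ → Mat2) (L : ℝ) (μ : ℂ) : SignType :=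
  -SignType.sign (Real.log ‖modifiedSolution Y L μ 1 1‖)

/-! ### Spectral data -/

/-- Labelled spectral data: the set of labels `k` of the nondegenerate gaps (`g₋ ≤ k ≤ g₊`, with
`g₋`, `g₊` finite or infinite), the gap edges `E (2k-1)`, `E (2k)`, and the movable Dirichlet
eigenvalues `γ k` with their signs `σ k`. Values at labels outside `labels` carry no meaning. -/
structure SpectralData where
  labels : Set ℤ
  E : ℤ → ℝ
  γ : ℤ → ℝ
  σ : ℤ → SignType

/-- `S` is the spectral data of the `L`-periodic potential `q`: the spectrum on the real line is
the complement of the disjoint open gaps `(E (2k-1), E (2k))`, numbered from left to right by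
consecutive integers, one gap carrying the label `0`; each `γ k` is the Dirichlet eigenvalue in the
closure of gap number `k`, and `σ k` is its sign. -/
structure IsSpectralData (q : ℝ → ℂ) (L : ℝ) (Y : ℝ → ℂ → Mat2) (S : SpectralData) : Prop where
  ordConnected : S.labels.OrdConnected
  zero_mem : 0 ∈ S.labels
  gap_lt : ∀ k ∈ S.labels, S.E (2 * k - 1) < S.E (2 * k)
  band_lt : ∀ j ∈ S.labels, ∀ k ∈ S.labels, j < k → S.E (2 * j) < S.E (2 * k - 1)
  spectrum : ∀ t : ℝ,
    (t : ℂ) ∈ laxSpectrum q ↔ ∀ k ∈ S.labels, t ∉ Ioo (S.E (2 * k - 1)) (S.E (2 * k))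
  γ_mem : ∀ k ∈ S.labels, S.γ k ∈ Icc (S.E (2 * k - 1)) (S.E (2 * k))
  γ_dirichlet : ∀ k ∈ S.labels, IsDirichletEigenvalue q L (S.γ k)
  σ_eq : ∀ k ∈ S.labels, S.σ k = dirichletSign Y L (S.γ k)

namespace SpectralData

variable (S : SpectralData)

/-- The set of the nondegenerate band edges `E_k`. -/
def bandEdges : Set ℝ := {e | ∃ k ∈ S.labels, e = S.E (2 * k - 1) ∨ e = S.E (2 * k)}

/-- The set of the `γ k` with `σ k = 0`. -/
def zeroSignSet : Set ℝ := {y | ∃ k ∈ S.labels, S.σ k = 0 ∧ S.γ k = y}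

/-- `γs` is a `γ k` with `σ k = 0` closest to zero (no condition if there is none). -/
def IsNearestZeroSign (γs : ℝ) : Prop :=
  S.zeroSignSet.Nonempty → γs ∈ S.zeroSignSet ∧ ∀ y ∈ S.zeroSignSet, |γs| ≤ |y|

open Classical in
/-- The counting function `m(t)`; it vanishes identically if no `σ k` is zero. -/
def count (γs t : ℝ) : ℕ :=
  if γs ≤ t then {y ∈ S.zeroSignSet | γs ≤ y ∧ y ≤ t}.ncard
  else {y ∈ S.zeroSignSet | t < y ∧ y < γs}.ncard

/-- `t` lies in the interior of the band `[E (2n-2), E (2n-1)]`. If there is a leftmost gap, the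
band to its left is unbounded below; if there is a rightmost gap, the band to its right is unbounded
above. -/
def InBand (n : ℤ) (t : ℝ) : Prop :=
  (n - 1 ∈ S.labels ∨ n ∈ S.labels) ∧
    (n - 1 ∈ S.labels → S.E (2 * n - 2) < t) ∧ (n ∈ S.labels → t < S.E (2 * n - 1))

/-- Midpoint of gap number `k`. -/
def center (k : ℤ) : ℝ := (S.E (2 * k - 1) + S.E (2 * k)) / 2

/-- Admissible radii for the discs centred at the midpoints of the gaps: at least the length of the
gap, bounded above and bounded away from zero, and such that all but finitely many of the closed
discs are pairwise disjoint. -/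
structure AdmissibleRadii (r : ℤ → ℝ) : Prop where
  gap_le : ∀ k ∈ S.labels, S.E (2 * k) - S.E (2 * k - 1) ≤ r k
  lower : ∃ c : ℝ, 0 < c ∧ ∀ k ∈ S.labels, c ≤ r k
  upper : ∃ C : ℝ, ∀ k ∈ S.labels, r k ≤ C
  disjoint : ∃ N : ℤ, ∀ j ∈ S.labels, ∀ k ∈ S.labels, j ≠ k → N < |j| → N < |k| →
    Disjoint (Metric.closedBall (S.center j : ℂ) (r j)) (Metric.closedBall (S.center k : ℂ) (r k))

/-- The domain `𝒟`: the complex plane without the real line and without the closed discs. -/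
def growthDomain (r : ℤ → ℝ) : Set ℂ :=
  {z | z.im ≠ 0 ∧ ∀ k ∈ S.labels, z ∉ Metric.closedBall (S.center k : ℂ) (r k)}

/-- Nonreal points at distance at least `δ` from all gaps. -/
def awayFromGaps (δ : ℝ) : Set ℂ :=
  {z | z.im ≠ 0 ∧ ∀ k ∈ S.labels, ∀ t ∈ Icc (S.E (2 * k - 1)) (S.E (2 * k)), δ ≤ dist z (t : ℂ)}

end SpectralData

/-! ### The matrix `B(z)` -/

open Classical in
/-- The factor `(1 - z/μ) exp (z/μ)`, replaced by `z` if `μ = 0`. -/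
def primaryFactor (μ z : ℂ) : ℂ :=
  if μ = 0 then z else (1 - z / μ) * Complex.exp (z / μ)

/-- The product of the primary factors over all Dirichlet eigenvalues (they are simple) with sign
`s`. The functions `f⁺` and `f⁻` are the cases `s = 1` and `s = -1`. -/
def dirichletProduct (q : ℝ → ℂ) (L : ℝ) (Y : ℝ → ℂ → Mat2) (s : SignType) (z : ℂ) : ℂ :=
  ∏' μ : {μ : ℂ // IsDirichletEigenvalue q L μ ∧ dirichletSign Y L μ = s}, primaryFactor μ z

open Classical in
/-- `g` if `g 0 ≠ 0`, and `g z / z` (continued to `z = 0`) if `g 0 = 0`. -/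
def withoutZeroAtOrigin (g : ℂ → ℂ) : ℂ → ℂ := if g 0 = 0 then dslope g 0 else g

/-- The constant `A₁` in the product expansion
`ỹ₁₂(L, z) = exp (A₁ z + B₁) ∏ (primary factors at the Dirichlet eigenvalues)`: every factor with
`μ ≠ 0` is `1 + O(z²)` at the origin, so that `A₁` and `B₁` are read off from the Taylor expansion
of `ỹ₁₂(L, z)` (or of `ỹ₁₂(L, z) / z`) at `z = 0`. -/
def constA (Y : ℝ → ℂ → Mat2) (L : ℝ) : ℂ :=
  logDeriv (withoutZeroAtOrigin fun z => modifiedSolution Y L z 0 1) 0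

/-- The constant `B₁` in the product expansion of `ỹ₁₂(L, z)`. -/
def constB (Y : ℝ → ℂ → Mat2) (L : ℝ) : ℂ :=
  Complex.log (withoutZeroAtOrigin (fun z => modifiedSolution Y L z 0 1) 0)

/-- `f⁰(z) = ½ exp (A₁ z + B₁) ∏_{σ = 0} (primary factors)`. -/
def fZero (q : ℝ → ℂ) (L : ℝ) (Y : ℝ → ℂ → Mat2) (z : ℂ) : ℂ :=
  1 / 2 * Complex.exp (constA Y L * z + constB Y L) * dirichletProduct q L Y 0 z

/-- The branch of the `n`-th root of `g` obtained from the principal root at the real point `x₀` by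
analytic continuation along the straight segment from `x₀` to `z`. -/
def rootFrom (n : ℕ) (g : ℂ → ℂ) (x₀ : ℝ) (z : ℂ) : ℂ :=
  Complex.exp ((Complex.log (g x₀) +
    ∫ t in (0 : ℝ)..1, (z - x₀) * logDeriv g (x₀ + t * (z - x₀))) / n)

/-- The fourth root of `Δ² - 1`: positive at the midpoint of gap number `0`, holomorphic off the
real line and across gap number `0`. (If all gaps are open its branch cuts are the segments
`[E (4n-4), E (4n-1)]`.) -/
def rootDisc (L : ℝ) (Y : ℝ → ℂ → Mat2) (S : SpectralData) (z : ℂ) : ℂ :=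
  rootFrom 4 (fun w => discriminant Y L w ^ 2 - 1) (S.center 0) z

open Classical in
/-- The square root of `f⁰`, holomorphic off the real line, with the branch that jumps by the factor
`(-1) ^ m` across gap number `0`. -/
def rootFZero (q : ℝ → ℂ) (L : ℝ) (Y : ℝ → ℂ → Mat2) (S : SpectralData) (γs : ℝ) (z : ℂ) : ℂ :=
  (if z.im < 0 then (-1) ^ S.count γs (S.center 0) else 1) *
    rootFrom 2 (fZero q L Y) (S.center 0) z

open Classical in
/-- The matrix `B(z)`, for nonreal `z`. -/
def matrixB (q : ℝ → ℂ) (L : ℝ) (Y : ℝ → ℂ → Mat2) (S : SpectralData) (γs : ℝ) (z : ℂ) : Mat2 :=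
  if 0 < z.im then
    (Complex.I * rootFZero q L Y S γs z / rootDisc L Y S z) •
      !![dirichletProduct q L Y (-1) z, 0; 0, dirichletProduct q L Y 1 z]
  else
    (rootFZero q L Y S γs z / rootDisc L Y S z) •
      !![dirichletProduct q L Y 1 z, 0; 0, dirichletProduct q L Y (-1) z]

/-! ### The Riemann-Hilbert problem -/

/-- The jump matrix on the band `[E (2n-2), E (2n-1)]`. -/
def jumpBand (q : ℝ → ℂ) (L : ℝ) (Y : ℝ → ℂ → Mat2) (S : SpectralData) (γs : ℝ)
    (n : ℤ) (t : ℝ) : Mat2 :=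
  ((-1 : ℂ) ^ (n + S.count γs t : ℤ)) •
    !![dirichletProduct q L Y (-1) t / dirichletProduct q L Y 1 t, 0;
       0, dirichletProduct q L Y 1 t / dirichletProduct q L Y (-1) t]

/-- The jump matrix on the gap `[E (2n-1), E (2n)]`. -/
def jumpGap (S : SpectralData) (γs : ℝ) (x : ℝ) (n : ℤ) (t : ℝ) : Mat2 :=
  ((-1 : ℂ) ^ (n + S.count γs t : ℤ) * Complex.I) • (expSigma3 (-2 * Complex.I * t * x) * sigma1)

/-- `Φ` (for a fixed `x`) solves the Riemann-Hilbert problem. Only the values of `Φ` off the real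
line matter; `Φp` and `Φm` are its boundary values from the upper and the lower half plane. In the
normalization condition, `z → ∞` nontangentially to the real line. -/
structure IsRHPSolution (q : ℝ → ℂ) (L : ℝ) (Y : ℝ → ℂ → Mat2) (S : SpectralData) (γs : ℝ)
    (r : ℤ → ℝ) (x : ℝ) (Φ : ℂ → Mat2) : Prop where
  holomorphic : ∀ i j, DifferentiableOn ℂ (fun z => Φ z i j) {z | z.im ≠ 0}
  boundary : ∃ Φp Φm : ℝ → Mat2,
    ContinuousOn Φp S.bandEdgesᶜ ∧ ContinuousOn Φm S.bandEdgesᶜ ∧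
    (∀ t ∉ S.bandEdges, Tendsto Φ (𝓝[{z | 0 < z.im}] (t : ℂ)) (𝓝 (Φp t))) ∧
    (∀ t ∉ S.bandEdges, Tendsto Φ (𝓝[{z | z.im < 0}] (t : ℂ)) (𝓝 (Φm t))) ∧
    (∀ (n : ℤ) (t : ℝ), S.InBand n t → Φp t = Φm t * jumpBand q L Y S γs n t) ∧
    (∀ n ∈ S.labels, ∀ t ∈ Ioo (S.E (2 * n - 1)) (S.E (2 * n)),
      Φp t = Φm t * jumpGap S γs x n t)
  quarticRoot : ∀ e ∈ S.bandEdges, ∀ i j,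
    (fun z => Φ z i j) =O[𝓝[{z | z.im ≠ 0}] (e : ℂ)] fun z => ‖z - e‖ ^ (-(1 / 4) : ℝ)
  normalization : ∃ W : ℂ → Mat2,
    (∀ z : ℂ, z.im ≠ 0 → Φ z = U * (1 + W z) * matrixB q L Y S γs z) ∧
    ∀ δ > 0, ∀ i j, (fun z => W z i j)
      =O[Bornology.cobounded ℂ ⊓ 𝓟 {z | δ * ‖z‖ ≤ |z.im|}] fun z => z⁻¹
  growth : ∃ c > 0, ∃ M > 0, ∀ z ∈ S.growthDomain r, ∀ i j,
    ‖Φ z i j‖ ≤ M * Real.exp (c * ‖z‖ ^ 2)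

end PeriodicDirac

end

open PeriodicDirac

/-!
# Inverse spectral theory of the periodic Dirac operator

Off the real line the Dirac system has two Bloch solutions, one decaying in each direction.
Normalized, and with the exponentials `exp (∓ i z x)` removed, they form the matrix `matX`; it is
described by the root `sRoot` of `Δ² - 1` for which the Bloch multiplier `Δ + s` has modulus
greater than `1` in the upper half plane. The ratio of the components of a Bloch solution is a
bounded periodic solution of a Riccati equation with a large parameter. This gives its expansion
up to the order `1 / z`, first off the real line and away from the lattice of asymptotic band edges
(`riccati_asymptotics`, `blochRatio_asymptotics`), then, by the maximum principle, close to a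
lattice point as long as the distance from the gaps is bounded below. Consequently `matX` tends to
`1`, and the commutator of `σ₃` with its `1 / z` term is the potential (`tendsto_commutator`).

Let two potentials have the same spectral data. The matrices of initial values of their Bloch
solutions have the same jumps, since the root changes its sign across a gap, and compatible
singularities at Dirichlet eigenvalues and band edges. The quotient of their continuations to `x`
therefore extends to an entire function (`exists_entire_transition`), which tends to `1` at
infinity away from the lattice. So the Bloch matrices agree (`matX_eq_of_spectralData`), and so do
the potentials (`eq_of_spectralData`).

A solution `Φ` of the Riemann-Hilbert problem is compared with `matX`. Freed of `U` and of the
diagonal factor of `B`, and multiplied by the inverse Bloch matrix, it becomes `comparison`, whose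
jumps are scalar: `±1` on bands and `±i` in gaps (`hasJump_band`, `hasJump_gap`). The fourth powers
of its entries have no jumps, and divided by the fourth power `(f⁰)² / (Δ² - 1)` of the scalar
factor of `B` they extend to entire functions (`exists_entire_comparisonQuartic`). The critical
points are the band edges: there the jump turns by a factor `±i`, whose sign records, through the
parity of the counting function, whether the edge is a Dirichlet eigenvalue (`count_near`), and
this turn fixes the exponent of the singularity (`isBigO_of_hasJump`).

The growth condition outside the discs bounds the order of these entire functions (`gaussian_univ`,
`exists_growth_comparisonQuartic`), the normalization at infinity gives them the limits `0` and `1`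
in sectors, and the theorem of Phragmén and Lindelöf makes them constant (`eq_of_tendsto_sector`).
Hence `(1 / 2) Uᴴ Φ B⁻¹` is `matX` (`half_conjTranspose_U_mul_eq`), and the reconstruction formula
is `tendsto_commutator`.
-/


noncomputable section

namespace PeriodicDirac

/-! ### Holomorphic extension across the real line -/

lemma dense_im_ne_zero : Dense {z : ℂ | z.im ≠ 0} :=
  (dense_compl_singleton (0 : ℝ)).preimage Complex.isOpenMap_im

lemma isOpen_im_ne_zero : IsOpen {z : ℂ | z.im ≠ 0} :=
  isOpen_ne.preimage Complex.continuous_im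

lemma nhdsWithin_im_ne_zero_neBot (z : ℂ) : (𝓝[{z : ℂ | z.im ≠ 0}] z).NeBot :=
  mem_closure_iff_nhdsWithin_neBot.1 (dense_im_ne_zero z)

/-- A function which is continuous on an open set and holomorphic off the real line is holomorphic:
a rectangle meeting the real line is cut along it, and Cauchy's theorem holds on both halves. -/
lemma differentiableOn_of_continuousOn_of_off_real {U : Set ℂ} (hU : IsOpen U) {f : ℂ → ℂ}
    (hc : ContinuousOn f U) (hd : DifferentiableOn ℂ f (U ∩ {z | z.im ≠ 0})) :
    DifferentiableOn ℂ f U := by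
  refine (Complex.isConservativeOn_and_continuousOn_iff_isDifferentiableOn hU).1 ⟨?_, hc⟩
  intro z w hzw
  rw [← add_eq_zero_iff_eq_neg, Complex.wedgeIntegral_add_wedgeIntegral_eq]
  have hsub : (uIcc z.re w.re ×ℂ uIcc z.im w.im) ⊆ U := hzw
  have hdat : ∀ p ∈ U, p.im ≠ 0 → DifferentiableAt ℂ f p := fun p hp hp0 =>
    hd.differentiableAt ((hU.inter isOpen_im_ne_zero).mem_nhds ⟨hp, hp0⟩)
  -- Cauchy's theorem for a rectangle whose interior does not meet the real line
  have key : ∀ y₀ y₁ : ℝ, (uIcc y₀ y₁ ⊆ uIcc z.im w.im) → (0 : ℝ) ∉ Ioo (min y₀ y₁) (max y₀ y₁) →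
      (∫ x : ℝ in z.re..w.re, f (x + y₀ * Complex.I)) -
        (∫ x : ℝ in z.re..w.re, f (x + y₁ * Complex.I)) +
      Complex.I • (∫ y : ℝ in y₀..y₁, f (w.re + y * Complex.I)) -
      Complex.I • (∫ y : ℝ in y₀..y₁, f (z.re + y * Complex.I)) = 0 := by
    intro y₀ y₁ hy h0
    have := Complex.integral_boundary_rect_eq_zero_of_continuousOn_of_differentiableOn f
      ⟨z.re, y₀⟩ ⟨w.re, y₁⟩ (hc.mono fun p hp => hsub ⟨hp.1, hy hp.2⟩) ?_
    · simpa using this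
    · intro p hp
      refine (hdat p (hsub ⟨Ioo_subset_Icc_self hp.1, hy (Ioo_subset_Icc_self hp.2)⟩)
        ?_).differentiableWithinAt
      intro hp0
      have h2 := hp.2
      simp only [mem_preimage, hp0] at h2
      exact h0 h2
  by_cases h0 : (0 : ℝ) ∈ Ioo (min z.im w.im) (max z.im w.im)
  · have h0' : (0 : ℝ) ∈ uIcc z.im w.im := Ioo_subset_Icc_self h0
    have h1 := key z.im 0 (uIcc_subset_uIcc_left h0') (by
      rintro ⟨ha, hb⟩
      rcases le_total z.im 0 with h | h <;> simp_all)
    have h2 := key 0 w.im (uIcc_subset_uIcc_right h0') (by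
      rintro ⟨ha, hb⟩
      rcases le_total w.im 0 with h | h <;> simp_all)
    have hint : ∀ x : ℝ, x ∈ uIcc z.re w.re → ∀ y₀ y₁ : ℝ, y₀ ∈ uIcc z.im w.im →
        y₁ ∈ uIcc z.im w.im →
        IntervalIntegrable (fun y : ℝ => f (x + y * Complex.I)) MeasureTheory.volume y₀ y₁ := by
      intro x hx y₀ y₁ hy₀ hy₁
      refine ContinuousOn.intervalIntegrable (hc.comp (by fun_prop) fun y hy => hsub ?_)
      have : y ∈ uIcc z.im w.im := uIcc_subset_uIcc hy₀ hy₁ hy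
      simp [Complex.mem_reProdIm, hx, this]
    rw [← intervalIntegral.integral_add_adjacent_intervals
        (hint w.re right_mem_uIcc _ _ left_mem_uIcc h0')
        (hint w.re right_mem_uIcc _ _ h0' right_mem_uIcc),
      ← intervalIntegral.integral_add_adjacent_intervals
        (hint z.re left_mem_uIcc _ _ left_mem_uIcc h0')
        (hint z.re left_mem_uIcc _ _ h0' right_mem_uIcc)]
    simp only [smul_eq_mul] at h1 h2 ⊢
    linear_combination h1 + h2
  · exact key _ _ Subset.rfl h0

/-- A function holomorphic off the real line which has a limit at each real point of an open set
extends holomorphically. -/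
lemma exists_extension_of_limits {U : Set ℂ} (hU : IsOpen U) {T : ℂ → ℂ}
    (hd : DifferentiableOn ℂ T (U ∩ {z | z.im ≠ 0}))
    (hlim : ∀ t : ℝ, (t : ℂ) ∈ U → ∃ l, Tendsto T (𝓝[{z | z.im ≠ 0}] (t : ℂ)) (𝓝 l)) :
    ∃ F : ℂ → ℂ, DifferentiableOn ℂ F U ∧ ∀ z ∈ U, z.im ≠ 0 → F z = T z := by
  have hdat : ∀ p ∈ U, p.im ≠ 0 → DifferentiableAt ℂ T p := fun p hp hp0 =>
    hd.differentiableAt ((hU.inter isOpen_im_ne_zero).mem_nhds ⟨hp, hp0⟩)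
  have heq : ∀ z ∈ U, z.im ≠ 0 → extendFrom {z : ℂ | z.im ≠ 0} T z = T z := fun z hz hz0 =>
    extendFrom_eq (dense_im_ne_zero z) ((hdat z hz hz0).continuousAt.mono_left nhdsWithin_le_nhds)
  refine ⟨extendFrom {z : ℂ | z.im ≠ 0} T, ?_, heq⟩
  refine differentiableOn_of_continuousOn_of_off_real hU
    (continuousOn_extendFrom (fun z _ => dense_im_ne_zero z) ?_) ?_
  · intro z hz
    by_cases hz0 : z.im = 0
    · have : z = (z.re : ℂ) := by apply Complex.ext <;> simp [hz0]
      rw [this] at hz ⊢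
      exact hlim _ hz
    · exact ⟨T z, (hdat z hz hz0).continuousAt.mono_left nhdsWithin_le_nhds⟩
  · exact hd.congr fun z hz => heq z hz.1 hz.2

/-- Holomorphic extension across the real line, up to a locally finite set `Z` of real points where
the function is `o(1 / (z - t))`. -/
lemma exists_extension {U : Set ℂ} (hU : IsOpen U) {T : ℂ → ℂ} {Z : Set ℝ}
    (hd : DifferentiableOn ℂ T (U ∩ {z | z.im ≠ 0}))
    (hZ : ∀ t : ℝ, (t : ℂ) ∈ U → ∀ᶠ t' in 𝓝[≠] t, t' ∉ Z)
    (hlim : ∀ t : ℝ, (t : ℂ) ∈ U → t ∉ Z → ∃ l, Tendsto T (𝓝[{z | z.im ≠ 0}] (t : ℂ)) (𝓝 l))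
    (hsing : ∀ t : ℝ, (t : ℂ) ∈ U → t ∈ Z →
      Tendsto (fun z => (z - t) * T z) (𝓝[{z | z.im ≠ 0}] (t : ℂ)) (𝓝 0)) :
    ∃ F : ℂ → ℂ, DifferentiableOn ℂ F U ∧ ∀ z ∈ U, z.im ≠ 0 → F z = T z := by
  refine exists_extension_of_limits hU hd fun t ht => ?_
  by_cases htZ : t ∉ Z
  · exact hlim t ht htZ
  rw [not_not] at htZ
  -- `(z - t) T z` extends near `t`, with the value `0` at `t`; divide by `z - t`
  obtain ⟨ε, hε, hball⟩ : ∃ ε > 0, Metric.ball (t : ℂ) ε ⊆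
      U ∩ {z : ℂ | z.im = 0 → z.re ≠ t → z.re ∉ Z} := by
    have h1 := hZ t ht
    rw [eventually_nhdsWithin_iff] at h1
    have h2 : ∀ᶠ z : ℂ in 𝓝 (t : ℂ), z.re ≠ t → z.re ∉ Z := by
      have : Tendsto Complex.re (𝓝 (t : ℂ)) (𝓝 t) := by
        simpa using Complex.continuous_re.tendsto (t : ℂ)
      exact this.eventually h1
    exact Metric.mem_nhds_iff.1 (inter_mem (hU.mem_nhds ht) (h2.mono fun z hz _ => hz))
  obtain ⟨H, hHd, hHe⟩ := exists_extension_of_limits (U := Metric.ball (t : ℂ) ε)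
    (T := fun z => (z - t) * T z) Metric.isOpen_ball
    (((differentiable_id.sub_const _).differentiableOn).mul
      (hd.mono fun z hz => ⟨(hball hz.1).1, hz.2⟩)) (by
      intro t' ht'
      by_cases h : t' = t
      · subst h; exact ⟨0, hsing _ ht htZ⟩
      · obtain ⟨l, hl⟩ := hlim t' (hball ht').1 (by simpa [h] using (hball ht').2)
        exact ⟨(t' - t) * l, (((continuous_id.sub continuous_const).tendsto _).mono_left
          nhdsWithin_le_nhds).mul hl⟩)
  have ht0 : (t : ℂ) ∈ Metric.ball (t : ℂ) ε := Metric.mem_ball_self hε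
  have hHc : ContinuousAt H t := (hHd.differentiableAt (Metric.isOpen_ball.mem_nhds ht0)).continuousAt
  have := nhdsWithin_im_ne_zero_neBot (t : ℂ)
  have hev : ∀ᶠ z in 𝓝[{z : ℂ | z.im ≠ 0}] (t : ℂ), H z = (z - t) * T z := by
    filter_upwards [self_mem_nhdsWithin,
      mem_nhdsWithin_of_mem_nhds (Metric.isOpen_ball.mem_nhds ht0)] with z hz hz'
    exact hHe z hz' hz
  have hHt : H t = 0 := by
    have h1 : Tendsto H (𝓝[{z : ℂ | z.im ≠ 0}] (t : ℂ)) (𝓝 (H t)) :=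
      hHc.mono_left nhdsWithin_le_nhds
    exact tendsto_nhds_unique (h1.congr' hev) (hsing t ht htZ)
  have hds : ContinuousAt (dslope H t) t :=
    (((Complex.differentiableOn_dslope (Metric.isOpen_ball.mem_nhds ht0)).2 hHd).differentiableAt
      (Metric.isOpen_ball.mem_nhds ht0)).continuousAt
  refine ⟨dslope H t t, Tendsto.congr' ?_ (hds.mono_left nhdsWithin_le_nhds)⟩
  filter_upwards [hev, self_mem_nhdsWithin] with z hz hz0
  have hne : z ≠ t := by rintro rfl; simp at hz0
  have hne' : z - t ≠ 0 := sub_ne_zero.2 hne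
  rw [dslope_of_ne _ hne, slope_def_field, hHt, hz]
  field_simp
  simp

/-- An estimate off the real line passes to the continuous extension. -/
lemma norm_le_of_im_ne_zero {F : ℂ → ℂ} {g : ℂ → ℝ} {z : ℂ} (hF : ContinuousAt F z)
    (hg : ContinuousAt g z) (h : ∀ᶠ w in 𝓝 z, w.im ≠ 0 → ‖F w‖ ≤ g w) : ‖F z‖ ≤ g z := by
  have := nhdsWithin_im_ne_zero_neBot z
  refine le_of_tendsto_of_tendsto (b := 𝓝[{z : ℂ | z.im ≠ 0}] z) (hF.norm.mono_left nhdsWithin_le_nhds)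
    (hg.mono_left nhdsWithin_le_nhds) (eventually_nhdsWithin_iff.2 h)

/-! ### Zeros and growth of entire functions -/

/-- The maximum principle on a closed disc. -/
lemma norm_le_of_forall_mem_sphere {f : ℂ → ℂ} {c : ℂ} {r C : ℝ}
    (hf : DifferentiableOn ℂ f (Metric.closedBall c r)) (hr : r ≠ 0)
    (hC : ∀ z ∈ Metric.sphere c r, ‖f z‖ ≤ C) {z : ℂ} (hz : z ∈ Metric.closedBall c r) :
    ‖f z‖ ≤ C := by
  refine Complex.norm_le_of_forall_mem_frontier_norm_le (U := Metric.ball c r) Metric.isBounded_ball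
    ?_ ?_ (by rwa [closure_ball c hr])
  · exact DifferentiableOn.diffContOnCl (by rwa [closure_ball c hr])
  · rw [frontier_ball c hr]; exact hC

/-- Finitely many zeros of an entire function can be divided out. -/
lemma exists_eq_prod_mul {f : ℂ → ℂ} (hf : Differentiable ℂ f) (s : Finset ℂ)
    (hs : ∀ a ∈ s, f a = 0) :
    ∃ g : ℂ → ℂ, Differentiable ℂ g ∧ ∀ z, f z = (∏ a ∈ s, (z - a)) * g z := by
  classical
  induction s using Finset.induction_on with
  | empty => exact ⟨f, hf, by simp⟩
  | insert a s ha ih =>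
    obtain ⟨g, hg, hfg⟩ := ih fun b hb => hs b (Finset.mem_insert_of_mem hb)
    have hga : g a = 0 := by
      have h := hs a (Finset.mem_insert_self a s)
      rw [hfg, mul_eq_zero] at h
      refine h.resolve_left (Finset.prod_ne_zero_iff.2 fun b hb => sub_ne_zero.2 ?_)
      rintro rfl; exact ha hb
    refine ⟨dslope g a, ?_, fun z => ?_⟩
    · rw [← differentiableOn_univ] at hg ⊢
      exact (Complex.differentiableOn_dslope univ_mem).2 hg
    · rw [Finset.prod_insert ha, hfg z]
      have := sub_smul_dslope g a z
      rw [hga, sub_zero, smul_eq_mul] at this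
      rw [← this]; ring

/-- Counting zeros: `n` zeros in a disc force growth by the factor `2 ^ n` on the disc of three
times the radius. -/
lemma two_pow_card_mul_norm_le {f : ℂ → ℂ} (hf : Differentiable ℂ f) (s : Finset ℂ) {c : ℂ}
    {r M : ℝ} (hr : 0 < r) (hs : ∀ a ∈ s, f a = 0 ∧ dist a c ≤ r)
    (hM : ∀ z ∈ Metric.sphere c (3 * r), ‖f z‖ ≤ M) : 2 ^ s.card * ‖f c‖ ≤ M := by
  obtain ⟨g, hg, hfg⟩ := exists_eq_prod_mul hf s fun a ha => (hs a ha).1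
  -- On the sphere each factor `z - a` has modulus at least `2 r`; at the centre at most `r`.
  have h1 : ‖g c‖ ≤ M / (2 * r) ^ s.card := by
    refine norm_le_of_forall_mem_sphere (r := 3 * r) hg.differentiableOn (by positivity) ?_
      (Metric.mem_closedBall_self (by positivity))
    intro z hz
    rw [le_div_iff₀ (by positivity)]
    refine le_trans ?_ (hM z hz)
    rw [hfg z, norm_mul, norm_prod, mul_comm]
    refine mul_le_mul_of_nonneg_right ?_ (norm_nonneg _)
    rw [← Finset.prod_const]
    refine Finset.prod_le_prod (fun _ _ => by positivity) fun a ha => ?_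
    have h2 := (hs a ha).2
    have h3 : dist z c ≤ dist z a + dist a c := dist_triangle _ _ _
    rw [Metric.mem_sphere.1 hz] at h3
    rw [← dist_eq_norm]; linarith
  have h2 : ‖f c‖ ≤ r ^ s.card * ‖g c‖ := by
    rw [hfg c, norm_mul, norm_prod]
    refine mul_le_mul_of_nonneg_right ?_ (norm_nonneg _)
    rw [← Finset.prod_const]
    refine Finset.prod_le_prod (fun _ _ => by positivity) fun a ha => ?_
    rw [← dist_eq_norm, dist_comm]; exact (hs a ha).2
  calc 2 ^ s.card * ‖f c‖ ≤ 2 ^ s.card * (r ^ s.card * (M / (2 * r) ^ s.card)) := by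
        gcongr; exact h2.trans (by gcongr)
    _ = M := by rw [mul_pow]; field_simp

/-! ### Solutions of the Dirac system -/

/-- The pair `(v₁, v₂)` solves `v' = (-i z σ₃ + Q) v` on the line. -/
structure IsSol (q : ℝ → ℂ) (z : ℂ) (v₁ v₂ : ℝ → ℂ) : Prop where
  fst : ∀ x, HasDerivAt v₁ (-(Complex.I * z) * v₁ x + q x * v₂ x) x
  snd : ∀ x, HasDerivAt v₂ (star (q x) * v₁ x + Complex.I * z * v₂ x) x

lemma zsMatrix_apply (q : ℝ → ℂ) (z : ℂ) (x : ℝ) :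
    zsMatrix q z x = !![-(Complex.I * z), q x; star (q x), Complex.I * z] := by
  ext i j; fin_cases i <;> fin_cases j <;> simp [zsMatrix, sigma3, potentialMatrix]

namespace IsSol

variable {q : ℝ → ℂ} {z : ℂ} {v₁ v₂ w₁ w₂ : ℝ → ℂ}

lemma comb (hv : IsSol q z v₁ v₂) (hw : IsSol q z w₁ w₂) (a b : ℂ) :
    IsSol q z (fun x => v₁ x * a + w₁ x * b) (fun x => v₂ x * a + w₂ x * b) where
  fst x := (((hv.fst x).mul_const a).add ((hw.fst x).mul_const b)).congr_deriv (by ring)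
  snd x := (((hv.snd x).mul_const a).add ((hw.snd x).mul_const b)).congr_deriv (by ring)

lemma wronskian_eq (hv : IsSol q z v₁ v₂) (hw : IsSol q z w₁ w₂) (x : ℝ) :
    v₁ x * w₂ x - v₂ x * w₁ x = v₁ 0 * w₂ 0 - v₂ 0 * w₁ 0 := by
  have hd : ∀ x, HasDerivAt (fun x => v₁ x * w₂ x - v₂ x * w₁ x) 0 x := fun x =>
    (((hv.fst x).mul (hw.snd x)).sub ((hv.snd x).mul (hw.fst x))).congr_deriv (by ring)
  exact is_const_of_deriv_eq_zero (fun x => (hd x).differentiableAt) (fun x => (hd x).deriv) x 0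

lemma star_swap (hv : IsSol q z v₁ v₂) :
    IsSol q (star z) (fun x => star (v₂ x)) (fun x => star (v₁ x)) where
  fst x := ((hv.snd x).star).congr_deriv (by simp; ring)
  snd x := ((hv.fst x).star).congr_deriv (by simp; ring)

lemma comp_add_const (hv : IsSol q z v₁ v₂) {L : ℝ} (hq : Function.Periodic q L) :
    IsSol q z (fun x => v₁ (x + L)) (fun x => v₂ (x + L)) where
  fst x := by simpa [hq x] using (hv.fst (x + L)).comp_add_const x L
  snd x := by simpa [hq x] using (hv.snd (x + L)).comp_add_const x L

lemma hasDerivAt_norm_sq (hv : IsSol q z v₁ v₂) (x : ℝ) :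
    HasDerivAt (fun x => ‖v₁ x‖ ^ 2)
      (2 * z.im * ‖v₁ x‖ ^ 2 + 2 * (star (v₁ x) * (q x * v₂ x)).re) x ∧
    HasDerivAt (fun x => ‖v₂ x‖ ^ 2)
      (-(2 * z.im * ‖v₂ x‖ ^ 2) + 2 * (star (v₁ x) * (q x * v₂ x)).re) x := by
  constructor
  · refine ((hv.fst x).norm_sq).congr_deriv ?_
    rw [Complex.inner, ← Complex.normSq_eq_norm_sq, Complex.normSq_apply]
    simp; ring
  · refine ((hv.snd x).norm_sq).congr_deriv ?_
    rw [Complex.inner, ← Complex.normSq_eq_norm_sq, Complex.normSq_apply]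
    simp; ring

/-- The energy identity: `|v₁|² - |v₂|²` has derivative `2 Im z (|v₁|² + |v₂|²)`. -/
lemma hasDerivAt_energy (hv : IsSol q z v₁ v₂) (x : ℝ) :
    HasDerivAt (fun x => ‖v₁ x‖ ^ 2 - ‖v₂ x‖ ^ 2)
      (2 * z.im * (‖v₁ x‖ ^ 2 + ‖v₂ x‖ ^ 2)) x :=
  (((hv.hasDerivAt_norm_sq x).1).sub ((hv.hasDerivAt_norm_sq x).2)).congr_deriv (by ring)

lemma abs_deriv_norm_sq_le {K : ℝ} (hK : ∀ x, ‖q x‖ ≤ K) (z : ℂ) (x : ℝ) (a b : ℂ) :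
    |2 * z.im * ‖a‖ ^ 2 + 2 * (star a * (q x * b)).re +
      (-(2 * z.im * ‖b‖ ^ 2) + 2 * (star a * (q x * b)).re)| ≤
      (2 * ‖z‖ + 2 * K) * (‖a‖ ^ 2 + ‖b‖ ^ 2) := by
  have h1 : |(star a * (q x * b)).re| ≤ K * (‖a‖ * ‖b‖) := by
    refine (Complex.abs_re_le_norm _).trans ?_
    rw [norm_mul, norm_mul, norm_star]
    calc ‖a‖ * (‖q x‖ * ‖b‖) ≤ ‖a‖ * (K * ‖b‖) := by gcongr; exact hK x
      _ = _ := by ring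
  have hz := Complex.abs_im_le_norm z
  have hK0 : 0 ≤ K := (norm_nonneg _).trans (hK x)
  have h2 : 2 * (‖a‖ * ‖b‖) ≤ ‖a‖ ^ 2 + ‖b‖ ^ 2 := by nlinarith [sq_nonneg (‖a‖ - ‖b‖)]
  have h3 : |z.im * (‖a‖ ^ 2 - ‖b‖ ^ 2)| ≤ ‖z‖ * (‖a‖ ^ 2 + ‖b‖ ^ 2) := by
    rw [abs_mul]
    refine mul_le_mul hz ?_ (abs_nonneg _) (norm_nonneg _)
    rw [abs_le]; constructor <;> nlinarith [sq_nonneg ‖a‖, sq_nonneg ‖b‖]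
  have h4 : K * (2 * (‖a‖ * ‖b‖)) ≤ K * (‖a‖ ^ 2 + ‖b‖ ^ 2) := by gcongr
  rw [abs_le] at *
  constructor <;> nlinarith

lemma norm_sq_le {K : ℝ} (hv : IsSol q z v₁ v₂) (hK : ∀ x, ‖q x‖ ≤ K) (x : ℝ) :
    ‖v₁ x‖ ^ 2 + ‖v₂ x‖ ^ 2 ≤
      (‖v₁ 0‖ ^ 2 + ‖v₂ 0‖ ^ 2) * Real.exp ((2 * ‖z‖ + 2 * K) * |x|) := by
  set κ := 2 * ‖z‖ + 2 * K with hκ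
  have hd := fun x => ((hv.hasDerivAt_norm_sq x).1).add ((hv.hasDerivAt_norm_sq x).2)
  have hb := fun x => abs_le.1 (abs_deriv_norm_sq_le hK z x (v₁ x) (v₂ x))
  have he : ∀ c x : ℝ, HasDerivAt (fun x : ℝ => Real.exp (c * x)) (Real.exp (c * x) * c) x :=
    fun c x => by simpa using ((hasDerivAt_id x).const_mul c).exp
  rcases le_total 0 x with hx | hx
  · have hmono : Antitone fun x => (‖v₁ x‖ ^ 2 + ‖v₂ x‖ ^ 2) * Real.exp (-κ * x) := by
      refine antitone_of_hasDerivAt_nonpos (fun x => (hd x).mul (he (-κ) x)) fun x => ?_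
      have := (hb x).2
      have h2 := Real.exp_pos (-κ * x)
      simp only [Pi.add_apply, Pi.zero_apply] at *
      nlinarith
    have h := hmono hx
    simp only [mul_zero, Real.exp_zero, mul_one] at h
    rw [abs_of_nonneg hx]
    calc _ = (‖v₁ x‖ ^ 2 + ‖v₂ x‖ ^ 2) * Real.exp (-κ * x) * Real.exp (κ * x) := by
            rw [mul_assoc, ← Real.exp_add]; simp
      _ ≤ _ := by gcongr
  · have hmono : Monotone fun x => (‖v₁ x‖ ^ 2 + ‖v₂ x‖ ^ 2) * Real.exp (κ * x) := by
      refine monotone_of_hasDerivAt_nonneg (fun x => (hd x).mul (he κ x)) fun x => ?_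
      have := (hb x).1
      have h2 := Real.exp_pos (κ * x)
      simp only [Pi.add_apply, Pi.zero_apply] at *
      nlinarith
    have h := hmono hx
    simp only [mul_zero, Real.exp_zero, mul_one] at h
    rw [abs_of_nonpos hx]
    calc _ = (‖v₁ x‖ ^ 2 + ‖v₂ x‖ ^ 2) * Real.exp (κ * x) * Real.exp (κ * -x) := by
            rw [mul_assoc, ← Real.exp_add]; simp
      _ ≤ _ := by gcongr

end IsSol

namespace IsPrincipalSolution

variable {q : ℝ → ℂ} {Y : ℝ → ℂ → Mat2}

lemma isSol (hY : IsPrincipalSolution q Y) (z : ℂ) (j : Fin 2) :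
    IsSol q z (fun x => Y x z 0 j) (fun x => Y x z 1 j) where
  fst x := (hY.ode z x 0 j).congr_deriv (by
    simp [zsMatrix_apply, Matrix.mul_apply, Fin.sum_univ_two])
  snd x := (hY.ode z x 1 j).congr_deriv (by
    simp [zsMatrix_apply, Matrix.mul_apply, Fin.sum_univ_two])

lemma init_apply (hY : IsPrincipalSolution q Y) (z : ℂ) :
    Y 0 z 0 0 = 1 ∧ Y 0 z 0 1 = 0 ∧ Y 0 z 1 0 = 0 ∧ Y 0 z 1 1 = 1 := by
  simp [hY.initial z]

lemma det_eq (hY : IsPrincipalSolution q Y) (x : ℝ) (z : ℂ) :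
    Y x z 0 0 * Y x z 1 1 - Y x z 1 0 * Y x z 0 1 = 1 := by
  have h := (hY.isSol z 0).wronskian_eq (hY.isSol z 1) x
  obtain ⟨h1, h2, h3, h4⟩ := hY.init_apply z
  simpa [h1, h2, h3, h4] using h

lemma sol_eq (hY : IsPrincipalSolution q Y) {z : ℂ} {v₁ v₂ : ℝ → ℂ} (hv : IsSol q z v₁ v₂)
    (x : ℝ) : v₁ x = Y x z 0 0 * v₁ 0 + Y x z 0 1 * v₂ 0 ∧
      v₂ x = Y x z 1 0 * v₁ 0 + Y x z 1 1 * v₂ 0 := by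
  have h0 := hv.wronskian_eq (hY.isSol z 1) x
  have h1 := (hY.isSol z 0).wronskian_eq hv x
  obtain ⟨e1, e2, e3, e4⟩ := hY.init_apply z
  have hd := hY.det_eq x z
  simp only [e1, e2, e3, e4] at h0 h1
  constructor
  · linear_combination -v₁ x * hd + Y x z 0 0 * h0 + Y x z 0 1 * h1
  · linear_combination -v₂ x * hd + Y x z 1 0 * h0 + Y x z 1 1 * h1

/-- The symmetry of the system under complex conjugation. -/
lemma star_symm (hY : IsPrincipalSolution q Y) (x : ℝ) (z : ℂ) :
    Y x (star z) 0 0 = star (Y x z 1 1) ∧ Y x (star z) 1 0 = star (Y x z 0 1) ∧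
    Y x (star z) 0 1 = star (Y x z 1 0) ∧ Y x (star z) 1 1 = star (Y x z 0 0) := by
  have h0 := hY.sol_eq (hY.isSol z 0).star_swap x
  have h1 := hY.sol_eq (hY.isSol z 1).star_swap x
  obtain ⟨e1, e2, e3, e4⟩ := hY.init_apply z
  simp only [e1, e2, e3, e4, star_zero, star_one, mul_zero, mul_one, zero_add, add_zero] at h0 h1
  exact ⟨h1.1.symm, h1.2.symm, h0.1.symm, h0.2.symm⟩

lemma add_period (hY : IsPrincipalSolution q Y) {L : ℝ} (hq : Function.Periodic q L) (x : ℝ)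
    (z : ℂ) : Y (x + L) z = Y x z * Y L z := by
  have h := fun j => hY.sol_eq ((hY.isSol z j).comp_add_const hq) x
  simp only [zero_add] at h
  ext i j
  rw [Matrix.mul_apply, Fin.sum_univ_two]
  fin_cases i
  · exact (h j).1
  · exact (h j).2

lemma norm_le (hY : IsPrincipalSolution q Y) {K : ℝ} (hK : ∀ x, ‖q x‖ ≤ K) (x : ℝ) (z : ℂ)
    (i j : Fin 2) : ‖Y x z i j‖ ≤ Real.exp ((‖z‖ + K) * |x|) := by
  have h := (hY.isSol z j).norm_sq_le hK x
  have hj : ‖Y 0 z 0 j‖ ^ 2 + ‖Y 0 z 1 j‖ ^ 2 = 1 := by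
    rw [hY.initial z]; obtain rfl | rfl : j = 0 ∨ j = 1 := by omega
    all_goals simp
  rw [hj, one_mul] at h
  have h2 : Real.exp ((2 * ‖z‖ + 2 * K) * |x|) = Real.exp ((‖z‖ + K) * |x|) ^ 2 := by
    rw [← Real.exp_nat_mul]; congr 1; push_cast; ring
  rw [h2] at h
  refine le_of_sq_le_sq ?_ (Real.exp_pos _).le
  fin_cases i
  · exact le_trans (le_add_of_nonneg_right (sq_nonneg _)) h
  · exact le_trans (le_add_of_nonneg_left (sq_nonneg _)) h

/-- The first integrand in the variation of constants formula. -/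
def varA (Y : ℝ → ℂ → Mat2) (j : Fin 2) (z z' : ℂ) (s : ℝ) : ℂ :=
  Y s z 1 1 * Y s z' 0 j + Y s z 0 1 * Y s z' 1 j

/-- The second integrand in the variation of constants formula. -/
def varB (Y : ℝ → ℂ → Mat2) (j : Fin 2) (z z' : ℂ) (s : ℝ) : ℂ :=
  Y s z 1 0 * Y s z' 0 j + Y s z 0 0 * Y s z' 1 j

lemma continuous_apply (hY : IsPrincipalSolution q Y) (z : ℂ) (i j : Fin 2) :
    Continuous fun x => Y x z i j :=
  continuous_iff_continuousAt.2 fun x => (hY.ode z x i j).continuousAt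

lemma continuous_varA (hY : IsPrincipalSolution q Y) (j : Fin 2) (z z' : ℂ) :
    Continuous (varA Y j z z') := by
  have h1 := hY.continuous_apply z
  have h2 := hY.continuous_apply z'
  exact ((h1 1 1).mul (h2 0 j)).add ((h1 0 1).mul (h2 1 j))

lemma continuous_varB (hY : IsPrincipalSolution q Y) (j : Fin 2) (z z' : ℂ) :
    Continuous (varB Y j z z') := by
  have h1 := hY.continuous_apply z
  have h2 := hY.continuous_apply z'
  exact ((h1 1 0).mul (h2 0 j)).add ((h1 0 0).mul (h2 1 j))

/-- Variation of constants in the spectral parameter. -/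
lemma sub_eq (hY : IsPrincipalSolution q Y) (x : ℝ) (z z' : ℂ) (i j : Fin 2) :
    Y x z' i j - Y x z i j = (z' - z) * (-Complex.I * (Y x z i 0 * (∫ s in (0 : ℝ)..x, varA Y j z z' s)
      - Y x z i 1 * ∫ s in (0 : ℝ)..x, varB Y j z z' s)) := by
  have hz := hY.isSol z
  have hz' := hY.isSol z'
  have dA : ∀ s, HasDerivAt (fun s => Y s z 1 1 * Y s z' 0 j - Y s z 0 1 * Y s z' 1 j)
      (-Complex.I * (z' - z) * varA Y j z z' s) s := fun s =>
    ((((hz 1).snd s).mul ((hz' j).fst s)).sub (((hz 1).fst s).mul ((hz' j).snd s))).congr_deriv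
      (by simp only [varA]; ring)
  have dB : ∀ s, HasDerivAt (fun s => Y s z 0 0 * Y s z' 1 j - Y s z 1 0 * Y s z' 0 j)
      (Complex.I * (z' - z) * varB Y j z z' s) s := fun s =>
    ((((hz 0).fst s).mul ((hz' j).snd s)).sub (((hz 0).snd s).mul ((hz' j).fst s))).congr_deriv
      (by simp only [varB]; ring)
  have iA := intervalIntegral.integral_eq_sub_of_hasDerivAt (a := 0) (b := x) (fun s _ => dA s)
    (((hY.continuous_varA j z z').const_mul _).intervalIntegrable _ _)
  have iB := intervalIntegral.integral_eq_sub_of_hasDerivAt (a := 0) (b := x) (fun s _ => dB s)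
    (((hY.continuous_varB j z z').const_mul _).intervalIntegrable _ _)
  rw [intervalIntegral.integral_const_mul] at iA iB
  have hd := hY.det_eq x z
  have e := hY.initial z
  have e' := hY.initial z'
  have e0j : Y 0 z' 0 j = (1 : Mat2) 0 j := by rw [e']
  have e1j : Y 0 z' 1 j = (1 : Mat2) 1 j := by rw [e']
  obtain ⟨e1, e2, e3, e4⟩ := hY.init_apply z
  simp only [e1, e2, e3, e4, e0j, e1j] at iA iB
  have hij : Y x z i j = Y x z i 0 * (1 : Mat2) 0 j + Y x z i 1 * (1 : Mat2) 1 j := by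
    obtain rfl | rfl : j = 0 ∨ j = 1 := by omega
    all_goals simp
  rw [hij]
  obtain rfl | rfl : i = 0 ∨ i = 1 := by omega
  · linear_combination (-Y x z' 0 j) * hd - Y x z 0 0 * iA - Y x z 0 1 * iB
  · linear_combination (-Y x z' 1 j) * hd - Y x z 1 0 * iA - Y x z 1 1 * iB

lemma norm_sub_le (hY : IsPrincipalSolution q Y) {K R T : ℝ} (hK : ∀ x, ‖q x‖ ≤ K) {x : ℝ}
    (hx : |x| ≤ T) {z z' : ℂ} (hz : ‖z‖ ≤ R) (hz' : ‖z'‖ ≤ R) (i j : Fin 2) :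
    ‖Y x z' i j - Y x z i j‖ ≤ 4 * T * Real.exp ((R + K) * T) ^ 3 * ‖z' - z‖ := by
  set e := Real.exp ((R + K) * T) with he
  have hK0 : 0 ≤ K := (norm_nonneg _).trans (hK 0)
  have hR0 : 0 ≤ R := (norm_nonneg _).trans hz
  have hT0 : 0 ≤ T := (abs_nonneg _).trans hx
  have hb : ∀ w : ℂ, ‖w‖ ≤ R → ∀ s : ℝ, |s| ≤ T → ∀ k l, ‖Y s w k l‖ ≤ e := fun w hw s hs k l =>
    (hY.norm_le hK s w k l).trans (Real.exp_le_exp.2 (by gcongr))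
  have he0 : 0 ≤ e := (Real.exp_pos _).le
  have hs : ∀ s ∈ uIoc 0 x, |s| ≤ T := fun s hs => by
    have h := uIoc_subset_uIcc hs
    rcases le_total 0 x with h0 | h0
    · rw [uIcc_of_le h0] at h; rw [abs_of_nonneg h.1]; exact h.2.trans ((le_abs_self x).trans hx)
    · rw [uIcc_of_ge h0] at h; rw [abs_of_nonpos h.2]
      exact (neg_le_neg h.1).trans ((neg_le_abs x).trans hx)
  have hm : ∀ a b c d : ℂ, ‖a‖ ≤ e → ‖b‖ ≤ e → ‖c‖ ≤ e → ‖d‖ ≤ e → ‖a * b + c * d‖ ≤ 2 * e ^ 2 := by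
    intro a b c d ha hb hc hd
    calc ‖a * b + c * d‖ ≤ ‖a‖ * ‖b‖ + ‖c‖ * ‖d‖ := by
          refine (norm_add_le _ _).trans ?_; rw [norm_mul, norm_mul]
      _ ≤ e * e + e * e := by gcongr
      _ = _ := by ring
  have hA : ‖∫ s in (0 : ℝ)..x, varA Y j z z' s‖ ≤ 2 * e ^ 2 * T := by
    refine (intervalIntegral.norm_integral_le_of_norm_le_const (C := 2 * e ^ 2)
      fun s h => ?_).trans ?_
    · exact hm _ _ _ _ (hb z hz s (hs s h) _ _) (hb z' hz' s (hs s h) _ _)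
        (hb z hz s (hs s h) _ _) (hb z' hz' s (hs s h) _ _)
    · rw [sub_zero]; gcongr
  have hB : ‖∫ s in (0 : ℝ)..x, varB Y j z z' s‖ ≤ 2 * e ^ 2 * T := by
    refine (intervalIntegral.norm_integral_le_of_norm_le_const (C := 2 * e ^ 2)
      fun s h => ?_).trans ?_
    · exact hm _ _ _ _ (hb z hz s (hs s h) _ _) (hb z' hz' s (hs s h) _ _)
        (hb z hz s (hs s h) _ _) (hb z' hz' s (hs s h) _ _)
    · rw [sub_zero]; gcongr
  rw [hY.sub_eq x z z' i j, norm_mul, norm_mul, norm_neg, Complex.norm_I, one_mul, mul_comm]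
  refine mul_le_mul_of_nonneg_right ?_ (norm_nonneg _)
  refine (_root_.norm_sub_le _ _).trans ?_
  rw [norm_mul, norm_mul]
  calc _ ≤ e * (2 * e ^ 2 * T) + e * (2 * e ^ 2 * T) := by
        gcongr <;> exact hb z hz x hx _ _
    _ = _ := by ring

lemma continuous_uncurry (hY : IsPrincipalSolution q Y) {K : ℝ} (hK : ∀ x, ‖q x‖ ≤ K)
    (i j : Fin 2) : Continuous fun p : ℝ × ℂ => Y p.1 p.2 i j := by
  rw [continuous_iff_continuousAt]
  rintro ⟨x₀, z₀⟩
  have h1 : Tendsto (fun p : ℝ × ℂ => Y p.1 z₀ i j) (𝓝 (x₀, z₀)) (𝓝 (Y x₀ z₀ i j)) :=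
    ((hY.continuous_apply z₀ i j).comp continuous_fst).tendsto (x₀, z₀)
  have h2 : Tendsto (fun p : ℝ × ℂ => Y p.1 p.2 i j - Y p.1 z₀ i j) (𝓝 (x₀, z₀)) (𝓝 0) := by
    have hlim : Tendsto (fun p : ℝ × ℂ => 4 * (|x₀| + 1) *
        Real.exp (((‖z₀‖ + 1) + K) * (|x₀| + 1)) ^ 3 * ‖p.2 - z₀‖) (𝓝 (x₀, z₀)) (𝓝 0) := by
      have : Continuous fun p : ℝ × ℂ => 4 * (|x₀| + 1) *
        Real.exp (((‖z₀‖ + 1) + K) * (|x₀| + 1)) ^ 3 * ‖p.2 - z₀‖ := by fun_prop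
      simpa using this.tendsto (x₀, z₀)
    refine squeeze_zero_norm' ?_ hlim
    have e1 : ∀ᶠ p : ℝ × ℂ in 𝓝 (x₀, z₀), |p.1| < |x₀| + 1 :=
      (continuous_fst.abs.tendsto (x₀, z₀)).eventually_lt_const (lt_add_one _)
    have e2 : ∀ᶠ p : ℝ × ℂ in 𝓝 (x₀, z₀), ‖p.2‖ < ‖z₀‖ + 1 :=
      (continuous_snd.norm.tendsto (x₀, z₀)).eventually_lt_const (lt_add_one _)
    filter_upwards [e1, e2] with p hp1 hp2
    exact hY.norm_sub_le hK hp1.le (by linarith) hp2.le i j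
  have := h2.add h1
  simpa [ContinuousAt] using this

/-- The principal solution is an entire function of the spectral parameter. -/
lemma hasDerivAt_spectral (hY : IsPrincipalSolution q Y) {K : ℝ} (hK : ∀ x, ‖q x‖ ≤ K) (x : ℝ)
    (z : ℂ) (i j : Fin 2) :
    HasDerivAt (fun z => Y x z i j) (-Complex.I * (Y x z i 0 * (∫ s in (0 : ℝ)..x, varA Y j z z s)
      - Y x z i 1 * ∫ s in (0 : ℝ)..x, varB Y j z z s)) z := by
  rw [hasDerivAt_iff_tendsto_slope]
  have hc := hY.continuous_uncurry hK
  have cA : Continuous fun z' => ∫ s in (0 : ℝ)..x, varA Y j z z' s := by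
    refine intervalIntegral.continuous_parametric_intervalIntegral_of_continuous' ?_ 0 x
    have h1 : ∀ k l, Continuous fun p : ℂ × ℝ => Y p.2 z k l := fun k l =>
      (hY.continuous_apply z k l).comp continuous_snd
    have h2 : ∀ k l, Continuous fun p : ℂ × ℝ => Y p.2 p.1 k l := fun k l =>
      (hc k l).comp continuous_swap
    exact ((h1 1 1).mul (h2 0 j)).add ((h1 0 1).mul (h2 1 j))
  have cB : Continuous fun z' => ∫ s in (0 : ℝ)..x, varB Y j z z' s := by
    refine intervalIntegral.continuous_parametric_intervalIntegral_of_continuous' ?_ 0 x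
    have h1 : ∀ k l, Continuous fun p : ℂ × ℝ => Y p.2 z k l := fun k l =>
      (hY.continuous_apply z k l).comp continuous_snd
    have h2 : ∀ k l, Continuous fun p : ℂ × ℝ => Y p.2 p.1 k l := fun k l =>
      (hc k l).comp continuous_swap
    exact ((h1 1 0).mul (h2 0 j)).add ((h1 0 0).mul (h2 1 j))
  have hcont : Continuous fun z' => -Complex.I * (Y x z i 0 * (∫ s in (0 : ℝ)..x, varA Y j z z' s)
      - Y x z i 1 * ∫ s in (0 : ℝ)..x, varB Y j z z' s) := by fun_prop
  refine ((hcont.tendsto z).mono_left nhdsWithin_le_nhds).congr' ?_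
  filter_upwards [self_mem_nhdsWithin] with z' hz'
  rw [slope_def_field, hY.sub_eq x z z' i j, mul_div_cancel_left₀ _ (sub_ne_zero.2 hz')]

lemma differentiable_spectral (hY : IsPrincipalSolution q Y) {K : ℝ} (hK : ∀ x, ‖q x‖ ≤ K) (x : ℝ)
    (i j : Fin 2) : Differentiable ℂ fun z => Y x z i j :=
  fun z => (hY.hasDerivAt_spectral hK x z i j).differentiableAt

end IsPrincipalSolution

/-! ### The monodromy matrix -/

/-- The standing assumptions: an `L`-periodic potential, `C²` on a period, and its principal matrix
solution. -/
structure IsPeriodicDirac (L : ℝ) (q : ℝ → ℂ) (Y : ℝ → ℂ → Mat2) : Prop where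
  pos : 0 < L
  periodic : Function.Periodic q L
  contDiffOn : ContDiffOn ℝ 2 q (Icc 0 L)
  sol : IsPrincipalSolution q Y

section defs

variable (Y : ℝ → ℂ → Mat2) (L : ℝ) (z : ℂ)

/-- The `(1,1)` entry of the monodromy matrix `Y(L, z)`. -/
def mA : ℂ := Y L z 0 0
/-- The `(1,2)` entry of the monodromy matrix `Y(L, z)`. -/
def mB : ℂ := Y L z 0 1
/-- The `(2,1)` entry of the monodromy matrix `Y(L, z)`. -/
def mC : ℂ := Y L z 1 0
/-- The `(2,2)` entry of the monodromy matrix `Y(L, z)`. -/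
def mD : ℂ := Y L z 1 1

/-- Half the difference of the diagonal entries of the monodromy matrix. -/
def halfDiff : ℂ := (mA Y L z - mD Y L z) / 2

/-- The function `Δ² - 1`. -/
def discSq : ℂ := discriminant Y L z ^ 2 - 1

/-- The entire function `-2i ỹ₁₂(L, z)`, whose zeros are the Dirichlet eigenvalues. -/
def dirFun : ℂ := mA Y L z - mB Y L z + mC Y L z - mD Y L z

end defs

lemma discriminant_eq (Y : ℝ → ℂ → Mat2) (L : ℝ) (z : ℂ) :
    discriminant Y L z = (mA Y L z + mD Y L z) / 2 := by
  simp [discriminant, Matrix.trace_fin_two, mA, mD]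

lemma exists_eigenvector {a b c d ρ : ℂ} (h : ρ ^ 2 - (a + d) * ρ + (a * d - c * b) = 0) :
    ∃ x y : ℂ, (x ≠ 0 ∨ y ≠ 0) ∧ a * x + b * y = ρ * x ∧ c * x + d * y = ρ * y := by
  by_cases h1 : b ≠ 0 ∨ ρ - a ≠ 0
  · exact ⟨b, ρ - a, h1, by ring, by linear_combination -h⟩
  by_cases h2 : ρ - d ≠ 0 ∨ c ≠ 0
  · exact ⟨ρ - d, c, h2, by linear_combination -h, by ring⟩
  push Not at h1 h2
  refine ⟨1, 0, Or.inl one_ne_zero, ?_, ?_⟩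
  · linear_combination -h1.2
  · linear_combination h2.2

lemma star_ext_real {t : ℝ} : star (t : ℂ) = t := Complex.conj_ofReal t

namespace IsPeriodicDirac

variable {L : ℝ} {q : ℝ → ℂ} {Y : ℝ → ℂ → Mat2}

lemma continuous_q (h : IsPeriodicDirac L q Y) : Continuous q := by
  have := Fact.mk h.pos
  have h0 : q 0 = q L := by simpa using (h.periodic 0).symm
  have hc := AddCircle.liftIco_zero_continuous h0 h.contDiffOn.continuousOn
  have : q = fun x : ℝ => AddCircle.liftIco L 0 q (x : AddCircle L) := by
    funext x
    have e : ((toIcoMod h.pos 0 x : ℝ) : AddCircle L) = x := by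
      rw [← self_sub_toIcoDiv_zsmul h.pos 0 x, AddCircle.coe_sub, AddCircle.coe_zsmul,
        AddCircle.coe_period, smul_zero, sub_zero]
    rw [← e, AddCircle.liftIco_coe_apply (by simpa using toIcoMod_mem_Ico h.pos 0 x),
      ← self_sub_toIcoDiv_zsmul, h.periodic.sub_zsmul_eq]
  rw [this]
  exact hc.comp (AddCircle.continuous_mk' L)

lemma exists_bound (h : IsPeriodicDirac L q Y) : ∃ K, 0 ≤ K ∧ ∀ x, ‖q x‖ ≤ K := by
  obtain ⟨K, hK⟩ := (h.periodic.isBounded_of_continuous h.pos.ne' h.continuous_q).exists_norm_le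
  have hK' : ∀ x, ‖q x‖ ≤ K := fun x => hK _ (mem_range_self x)
  exact ⟨K, (norm_nonneg _).trans (hK' 0), hK'⟩

lemma differentiable_entry (h : IsPeriodicDirac L q Y) (x : ℝ) (i j : Fin 2) :
    Differentiable ℂ fun z => Y x z i j := by
  obtain ⟨K, -, hK⟩ := h.exists_bound
  exact h.sol.differentiable_spectral hK x i j

lemma continuous_uncurry (h : IsPeriodicDirac L q Y) (i j : Fin 2) :
    Continuous fun p : ℝ × ℂ => Y p.1 p.2 i j := by
  obtain ⟨K, -, hK⟩ := h.exists_bound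
  exact h.sol.continuous_uncurry hK i j

lemma differentiable_mA (h : IsPeriodicDirac L q Y) : Differentiable ℂ (mA Y L) :=
  h.differentiable_entry L 0 0
lemma differentiable_mB (h : IsPeriodicDirac L q Y) : Differentiable ℂ (mB Y L) :=
  h.differentiable_entry L 0 1
lemma differentiable_mC (h : IsPeriodicDirac L q Y) : Differentiable ℂ (mC Y L) :=
  h.differentiable_entry L 1 0
lemma differentiable_mD (h : IsPeriodicDirac L q Y) : Differentiable ℂ (mD Y L) :=
  h.differentiable_entry L 1 1

lemma differentiable_halfDiff (h : IsPeriodicDirac L q Y) : Differentiable ℂ (halfDiff Y L) :=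
  (h.differentiable_mA.sub h.differentiable_mD).div_const 2

lemma differentiable_discriminant (h : IsPeriodicDirac L q Y) :
    Differentiable ℂ (discriminant Y L) := by
  rw [funext (discriminant_eq Y L)]
  exact (h.differentiable_mA.add h.differentiable_mD).div_const 2

lemma differentiable_discSq (h : IsPeriodicDirac L q Y) : Differentiable ℂ (discSq Y L) :=
  (h.differentiable_discriminant.pow 2).sub_const 1

lemma differentiable_dirFun (h : IsPeriodicDirac L q Y) : Differentiable ℂ (dirFun Y L) :=
  (((h.differentiable_mA.sub h.differentiable_mB).add h.differentiable_mC).sub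
    h.differentiable_mD)

lemma det_mon (h : IsPeriodicDirac L q Y) (z : ℂ) :
    mA Y L z * mD Y L z - mC Y L z * mB Y L z = 1 := h.sol.det_eq L z

lemma discSq_eq (h : IsPeriodicDirac L q Y) (z : ℂ) :
    discSq Y L z = halfDiff Y L z ^ 2 + mB Y L z * mC Y L z := by
  rw [discSq, discriminant_eq, halfDiff]
  linear_combination h.det_mon z

lemma mA_eq (Y : ℝ → ℂ → Mat2) (L : ℝ) (z : ℂ) :
    mA Y L z = discriminant Y L z + halfDiff Y L z := by
  rw [discriminant_eq, halfDiff]; ring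

lemma mD_eq (Y : ℝ → ℂ → Mat2) (L : ℝ) (z : ℂ) :
    mD Y L z = discriminant Y L z - halfDiff Y L z := by
  rw [discriminant_eq, halfDiff]; ring

lemma star_symm (h : IsPeriodicDirac L q Y) (z : ℂ) :
    mA Y L (star z) = star (mD Y L z) ∧ mC Y L (star z) = star (mB Y L z) ∧
    mB Y L (star z) = star (mC Y L z) ∧ mD Y L (star z) = star (mA Y L z) :=
  h.sol.star_symm L z

/-- The combination of the columns of `Y` with coefficients `(x, y)`. -/
lemma isSol_comb (h : IsPeriodicDirac L q Y) (z a b : ℂ) :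
    IsSol q z (fun x => Y x z 0 0 * a + Y x z 0 1 * b) (fun x => Y x z 1 0 * a + Y x z 1 1 * b) :=
  (h.sol.isSol z 0).comb (h.sol.isSol z 1) a b

lemma comb_ne_zero (h : IsPeriodicDirac L q Y) {z a b : ℂ} (hab : a ≠ 0 ∨ b ≠ 0) (x : ℝ) :
    Y x z 0 0 * a + Y x z 0 1 * b ≠ 0 ∨ Y x z 1 0 * a + Y x z 1 1 * b ≠ 0 := by
  by_contra! hc
  have hd := h.sol.det_eq x z
  have ha : a = 0 := by
    linear_combination (-a) * hd + Y x z 1 1 * hc.1 - Y x z 0 1 * hc.2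
  have hb : b = 0 := by
    linear_combination (-b) * hd + Y x z 0 0 * hc.2 - Y x z 1 0 * hc.1
  exact hab.elim (· ha) (· hb)

/-- The energy `|v₁|² - |v₂|²` of the solution with initial value `(a, b)`. -/
def energy (Y : ℝ → ℂ → Mat2) (z a b : ℂ) (x : ℝ) : ℝ :=
  ‖Y x z 0 0 * a + Y x z 0 1 * b‖ ^ 2 - ‖Y x z 1 0 * a + Y x z 1 1 * b‖ ^ 2

lemma energy_zero (h : IsPeriodicDirac L q Y) (z a b : ℂ) :
    energy Y z a b 0 = ‖a‖ ^ 2 - ‖b‖ ^ 2 := by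
  simp [energy, h.sol.initial z]

lemma comb_norm_pos (h : IsPeriodicDirac L q Y) {z a b : ℂ} (hab : a ≠ 0 ∨ b ≠ 0) (x : ℝ) :
    0 < ‖Y x z 0 0 * a + Y x z 0 1 * b‖ ^ 2 + ‖Y x z 1 0 * a + Y x z 1 1 * b‖ ^ 2 := by
  rcases h.comb_ne_zero (z := z) hab x with h1 | h1
  · have := norm_pos_iff.2 h1; positivity
  · have := norm_pos_iff.2 h1; positivity

lemma energy_strictMono (h : IsPeriodicDirac L q Y) {z a b : ℂ} (hz : 0 < z.im)
    (hab : a ≠ 0 ∨ b ≠ 0) : StrictMono (energy Y z a b) :=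
  strictMono_of_hasDerivAt_pos (fun x => (h.isSol_comb z a b).hasDerivAt_energy x) fun x =>
    mul_pos (by positivity) (h.comb_norm_pos hab x)

lemma energy_strictAnti (h : IsPeriodicDirac L q Y) {z a b : ℂ} (hz : z.im < 0)
    (hab : a ≠ 0 ∨ b ≠ 0) : StrictAnti (energy Y z a b) :=
  strictAnti_of_hasDerivAt_neg (fun x => (h.isSol_comb z a b).hasDerivAt_energy x) fun x =>
    mul_neg_of_neg_of_pos (by linarith) (h.comb_norm_pos hab x)

lemma energy_const (h : IsPeriodicDirac L q Y) {z a b : ℂ} (hz : z.im = 0) (x : ℝ) :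
    energy Y z a b x = ‖a‖ ^ 2 - ‖b‖ ^ 2 := by
  have hd := fun x => (h.isSol_comb z a b).hasDerivAt_energy x
  simp only [hz, mul_zero, zero_mul] at hd
  rw [← h.energy_zero z]
  exact is_const_of_deriv_eq_zero (fun x => (hd x).differentiableAt) (fun x => (hd x).deriv) x 0

lemma eigen_energy {z ρ a b : ℂ}
    (h1 : mA Y L z * a + mB Y L z * b = ρ * a) (h2 : mC Y L z * a + mD Y L z * b = ρ * b) :
    energy Y z a b L = ‖ρ‖ ^ 2 * (‖a‖ ^ 2 - ‖b‖ ^ 2) := by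
  have e1 : Y L z 0 0 * a + Y L z 0 1 * b = ρ * a := h1
  have e2 : Y L z 1 0 * a + Y L z 1 1 * b = ρ * b := h2
  rw [energy, e1, e2, norm_mul, norm_mul]; ring

/-- For nonreal `z`, a Bloch solution with multiplier `ρ` has energy of the sign of
`(|ρ|² - 1) Im z`. -/
lemma eigen_energy_sign (h : IsPeriodicDirac L q Y) {z ρ a b : ℂ} (hab : a ≠ 0 ∨ b ≠ 0)
    (h1 : mA Y L z * a + mB Y L z * b = ρ * a) (h2 : mC Y L z * a + mD Y L z * b = ρ * b) :
    (0 < z.im → 0 < (‖ρ‖ ^ 2 - 1) * (‖a‖ ^ 2 - ‖b‖ ^ 2)) ∧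
    (z.im < 0 → (‖ρ‖ ^ 2 - 1) * (‖a‖ ^ 2 - ‖b‖ ^ 2) < 0) := by
  have e := eigen_energy h1 h2
  have e0 := h.energy_zero z a b
  constructor
  · intro hz
    have := h.energy_strictMono hz hab h.pos
    rw [e, e0] at this; linarith
  · intro hz
    have := h.energy_strictAnti hz hab h.pos
    rw [e, e0] at this; linarith

lemma eigen_exists (h : IsPeriodicDirac L q Y) {z s : ℂ} (hs : s ^ 2 = discSq Y L z) :
    ∃ x y : ℂ, (x ≠ 0 ∨ y ≠ 0) ∧ mA Y L z * x + mB Y L z * y = (discriminant Y L z + s) * x ∧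
      mC Y L z * x + mD Y L z * y = (discriminant Y L z + s) * y := by
  refine exists_eigenvector ?_
  rw [h.discSq_eq] at hs
  rw [mA_eq, mD_eq]
  linear_combination hs

lemma mult_mul (Y : ℝ → ℂ → Mat2) {L : ℝ} {z s : ℂ} (hs : s ^ 2 = discSq Y L z) :
    (discriminant Y L z + s) * (discriminant Y L z - s) = 1 := by
  rw [discSq] at hs; linear_combination -hs

lemma norm_mult_ne_one (h : IsPeriodicDirac L q Y) {z s : ℂ} (hz : z.im ≠ 0)
    (hs : s ^ 2 = discSq Y L z) : ‖discriminant Y L z + s‖ ≠ 1 := by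
  intro h1
  obtain ⟨x, y, hxy, e1, e2⟩ := h.eigen_exists hs
  obtain ⟨ha, hb⟩ := h.eigen_energy_sign hxy e1 e2
  rw [h1] at ha hb
  rcases lt_or_gt_of_ne hz with h0 | h0
  · simpa using hb h0
  · simpa using ha h0

lemma discSq_ne_zero (h : IsPeriodicDirac L q Y) {z : ℂ} (hz : z.im ≠ 0) : discSq Y L z ≠ 0 := by
  intro h0
  have := h.norm_mult_ne_one hz (s := 0) (by rw [h0]; simp)
  have h1 : discriminant Y L z ^ 2 = 1 := by rw [discSq] at h0; linear_combination h0
  rw [add_zero] at this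
  apply this
  have h2 : ‖discriminant Y L z‖ ^ 2 = 1 := by rw [← norm_pow, h1, norm_one]
  exact (pow_eq_one_iff_of_nonneg (norm_nonneg _) two_ne_zero).1 h2

/-- The Dirichlet eigenvalues are real. -/
lemma dirFun_ne_zero (h : IsPeriodicDirac L q Y) {z : ℂ} (hz : z.im ≠ 0) : dirFun Y L z ≠ 0 := by
  intro h0
  have e0 := h.energy_zero z 1 (-1)
  have eL : energy Y z 1 (-1) L = 0 := by
    have : mA Y L z * 1 + mB Y L z * (-1) = -(mC Y L z * 1 + mD Y L z * (-1)) := by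
      rw [dirFun] at h0; linear_combination h0
    have e1 : Y L z 0 0 * 1 + Y L z 0 1 * (-1) = -(Y L z 1 0 * 1 + Y L z 1 1 * (-1)) := this
    rw [energy, e1, norm_neg, sub_self]
  have hab : (1 : ℂ) ≠ 0 ∨ (-1 : ℂ) ≠ 0 := Or.inl one_ne_zero
  simp only [norm_one, norm_neg, sub_self] at e0
  rcases lt_or_gt_of_ne hz with h1 | h1
  · exact absurd (h.energy_strictAnti h1 hab h.pos) (by rw [eL, e0]; exact lt_irrefl _)
  · exact absurd (h.energy_strictMono h1 hab h.pos) (by rw [eL, e0]; exact lt_irrefl _)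

end IsPeriodicDirac

/-! ### The Bloch multipliers off the real line -/

open Classical in
/-- The square root `s` of `Δ² - 1` off the real line, normalized so that the Bloch multiplier
`Δ + s` is larger than one in modulus in the upper half plane and smaller in the lower one. -/
def sRoot (Y : ℝ → ℂ → Mat2) (L : ℝ) (z : ℂ) : ℂ :=
  if 1 < ‖discriminant Y L z + discSq Y L z ^ (1 / 2 : ℂ)‖ ↔ 0 < z.im then
    discSq Y L z ^ (1 / 2 : ℂ) else -discSq Y L z ^ (1 / 2 : ℂ)

namespace IsPeriodicDirac

variable {L : ℝ} {q : ℝ → ℂ} {Y : ℝ → ℂ → Mat2}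

lemma cpow_half_sq (w : ℂ) : (w ^ (1 / 2 : ℂ)) ^ 2 = w := by
  rw [← Complex.cpow_nat_mul]; simp

lemma sRoot_sq (Y : ℝ → ℂ → Mat2) (L : ℝ) (z : ℂ) : sRoot Y L z ^ 2 = discSq Y L z := by
  rw [sRoot]; split_ifs
  · exact cpow_half_sq _
  · rw [neg_sq]; exact cpow_half_sq _

lemma norm_mult_neg (h : IsPeriodicDirac L q Y) {z s : ℂ} (hz : z.im ≠ 0)
    (hs : s ^ 2 = discSq Y L z) :
    1 < ‖discriminant Y L z + s‖ ↔ ¬ 1 < ‖discriminant Y L z + -s‖ := by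
  have h1 := congrArg norm (mult_mul Y hs)
  rw [norm_mul, norm_one, sub_eq_add_neg] at h1
  have h2 := h.norm_mult_ne_one hz hs
  have hp : 0 < ‖discriminant Y L z + -s‖ := by
    rcases (norm_nonneg (discriminant Y L z + -s)).eq_or_lt with h0 | h0
    · rw [← h0, mul_zero] at h1; exact absurd h1 zero_ne_one
    · exact h0
  constructor
  · intro h3 h4; nlinarith
  · intro h3
    push Not at h3
    rcases lt_or_gt_of_ne h2 with h4 | h4
    · nlinarith
    · exact h4

lemma one_lt_norm_iff (h : IsPeriodicDirac L q Y) {z : ℂ} (hz : z.im ≠ 0) :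
    1 < ‖discriminant Y L z + sRoot Y L z‖ ↔ 0 < z.im := by
  have hn := h.norm_mult_neg hz (cpow_half_sq (discSq Y L z))
  rw [sRoot]
  split_ifs with hc
  · exact hc
  · rw [hn] at hc; tauto

lemma norm_lt_one_of_im_neg (h : IsPeriodicDirac L q Y) {z : ℂ} (hz : z.im < 0) :
    ‖discriminant Y L z + sRoot Y L z‖ < 1 := by
  have h1 := h.norm_mult_ne_one hz.ne (sRoot_sq Y L z)
  have h2 := (h.one_lt_norm_iff hz.ne).not.2 hz.le.not_gt
  exact lt_of_le_of_ne (not_lt.1 h2) h1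

lemma sRoot_ne_zero (h : IsPeriodicDirac L q Y) {z : ℂ} (hz : z.im ≠ 0) : sRoot Y L z ≠ 0 := by
  intro h0
  have := sRoot_sq Y L z
  rw [h0] at this
  exact h.discSq_ne_zero hz (by rw [← this]; simp)

lemma eq_sRoot_of_norm (h : IsPeriodicDirac L q Y) {z s : ℂ} (hz : z.im ≠ 0)
    (hs : s ^ 2 = discSq Y L z) (hn : 1 < ‖discriminant Y L z + s‖ ↔ 0 < z.im) :
    s = sRoot Y L z := by
  have h1 := sRoot_sq Y L z
  rw [← hs, sq_eq_sq_iff_eq_or_eq_neg] at h1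
  rcases h1 with h1 | h1
  · exact h1.symm
  · exfalso
    have h2 := h.norm_mult_neg hz hs
    have h3 := h.one_lt_norm_iff hz
    rw [h1] at h3
    tauto

/-- The estimates `|u| < 1`, `|w| < 1` for `u = c / (α + s)`, `w = -b / (α + s)`, where `(1, u)` and
`(w, 1)` are the initial values of the Bloch solutions. -/
lemma bloch_bounds (h : IsPeriodicDirac L q Y) {z : ℂ} (hz : z.im ≠ 0) :
    halfDiff Y L z + sRoot Y L z ≠ 0 ∧ ‖mC Y L z‖ < ‖halfDiff Y L z + sRoot Y L z‖ ∧
      ‖mB Y L z‖ < ‖halfDiff Y L z + sRoot Y L z‖ := by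
  set s := sRoot Y L z with hs
  set a₀ := halfDiff Y L z with ha₀
  have hs2 : s ^ 2 = discSq Y L z := sRoot_sq Y L z
  have hs0 : s ≠ 0 := h.sRoot_ne_zero hz
  obtain ⟨x, y, hxy, e1, e2⟩ := h.eigen_exists hs2
  obtain ⟨x', y', hxy', e1', e2'⟩ := h.eigen_exists (s := -s) (by rw [neg_sq]; exact hs2)
  have hE := h.eigen_energy_sign hxy e1 e2
  have hE' := h.eigen_energy_sign hxy' e1' e2'
  have hn := h.one_lt_norm_iff hz
  have hn' := h.norm_mult_neg hz hs2
  have hne := h.norm_mult_ne_one hz hs2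
  have hne' := h.norm_mult_ne_one (s := -s) hz (by rw [neg_sq]; exact hs2)
  rw [← hs] at hn
  -- the first Bloch solution has positive energy, the second one negative energy
  have hpos : ‖y‖ < ‖x‖ ∧ ‖x'‖ < ‖y'‖ := by
    have aux : ∀ {p r : ℝ}, 0 ≤ p → 0 ≤ r → 0 < p ^ 2 - r ^ 2 → r < p := fun hp hr h =>
      lt_of_pow_lt_pow_left₀ 2 hp (by linarith)
    rcases lt_or_gt_of_ne hz with h0 | h0
    · have k1 : ‖discriminant Y L z + s‖ < 1 := h.norm_lt_one_of_im_neg h0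
      have k2 : 1 < ‖discriminant Y L z + -s‖ := by
        by_contra hc; exact (hn'.2 hc).not_gt k1
      have g1 := hE.2 h0
      have g2 := hE'.2 h0
      have k1' : ‖discriminant Y L z + s‖ ^ 2 - 1 < 0 := by
        nlinarith [norm_nonneg (discriminant Y L z + s)]
      have k2' : 0 < ‖discriminant Y L z + -s‖ ^ 2 - 1 := by nlinarith
      exact ⟨aux (norm_nonneg _) (norm_nonneg _) (by nlinarith),
        aux (norm_nonneg _) (norm_nonneg _) (by nlinarith)⟩
    · have k1 : 1 < ‖discriminant Y L z + s‖ := hn.2 h0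
      have k2 : ‖discriminant Y L z + -s‖ < 1 :=
        lt_of_le_of_ne (not_lt.1 (hn'.1 k1)) hne'
      have g1 := hE.1 h0
      have g2 := hE'.1 h0
      have k1' : 0 < ‖discriminant Y L z + s‖ ^ 2 - 1 := by nlinarith
      have k2' : ‖discriminant Y L z + -s‖ ^ 2 - 1 < 0 := by
        nlinarith [norm_nonneg (discriminant Y L z + -s)]
      exact ⟨aux (norm_nonneg _) (norm_nonneg _) (by nlinarith),
        aux (norm_nonneg _) (norm_nonneg _) (by nlinarith)⟩
  have hx0 : x ≠ 0 := norm_pos_iff.1 ((norm_nonneg _).trans_lt hpos.1)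
  have hy0 : y' ≠ 0 := norm_pos_iff.1 ((norm_nonneg _).trans_lt hpos.2)
  rw [mA_eq] at e1 e1'
  rw [mD_eq] at e2 e2'
  have f1 : mC Y L z * x = (a₀ + s) * y := by linear_combination e2
  have f1' : (a₀ - s) * x = - mB Y L z * y := by linear_combination e1
  have f2 : (a₀ + s) * x' = -mB Y L z * y' := by linear_combination e1'
  have hD : a₀ + s ≠ 0 := by
    intro h0
    rw [h0, zero_mul] at f2
    have hb : mB Y L z = 0 := by
      have := f2.symm; simpa [hy0] using this
    rw [hb] at f1'
    have : a₀ - s = 0 := by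
      have h3 : (a₀ - s) * x = 0 := by rw [f1']; ring
      exact (mul_eq_zero.1 h3).resolve_right hx0
    apply hs0
    linear_combination (h0 - this) / 2
  have hDp := norm_pos_iff.2 hD
  refine ⟨hD, ?_, ?_⟩
  · have := congrArg norm f1
    rw [norm_mul, norm_mul] at this
    have hxp := norm_pos_iff.2 hx0
    have h3 : ‖mC Y L z‖ * ‖x‖ < ‖a₀ + s‖ * ‖x‖ := by
      rw [this]; exact mul_lt_mul_of_pos_left hpos.1 hDp
    exact lt_of_mul_lt_mul_right h3 hxp.le
  · have := congrArg norm f2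
    rw [norm_mul, norm_mul, norm_neg] at this
    have hyp := norm_pos_iff.2 hy0
    have h3 : ‖mB Y L z‖ * ‖y'‖ < ‖a₀ + s‖ * ‖y'‖ := by
      rw [← this]; exact mul_lt_mul_of_pos_left hpos.2 hDp
    exact lt_of_mul_lt_mul_right h3 hyp.le

lemma eq_sRoot_of_bound (h : IsPeriodicDirac L q Y) {z s : ℂ} (hz : z.im ≠ 0)
    (hs : s ^ 2 = discSq Y L z) (hn : ‖mC Y L z‖ < ‖halfDiff Y L z + s‖) : s = sRoot Y L z := by
  have h1 := sRoot_sq Y L z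
  rw [← hs, sq_eq_sq_iff_eq_or_eq_neg] at h1
  rcases h1 with h1 | h1
  · exact h1.symm
  · exfalso
    obtain ⟨-, -, hb⟩ := h.bloch_bounds hz
    rw [h1] at hb
    have e : (halfDiff Y L z + s) * (halfDiff Y L z + -s) = -(mB Y L z * mC Y L z) := by
      rw [h.discSq_eq] at hs; linear_combination -hs
    have e' := congrArg norm e
    rw [norm_mul, norm_neg, norm_mul] at e'
    have := mul_lt_mul'' hb hn (norm_nonneg _) (norm_nonneg _)
    linarith [mul_comm ‖halfDiff Y L z + s‖ ‖halfDiff Y L z + -s‖]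

end IsPeriodicDirac

/-! ### The monodromy matrix on the real line -/

lemma exists_local_root {f : ℂ → ℂ} {z₀ r : ℂ} {n : ℕ} (hn : n ≠ 0) (hf : AnalyticAt ℂ f z₀)
    (h0 : f z₀ ≠ 0) (hr : r ^ n = f z₀) :
    ∃ g : ℂ → ℂ, AnalyticAt ℂ g z₀ ∧ g z₀ = r ∧ ∀ᶠ z in 𝓝 z₀, g z ^ n = f z := by
  have hn' : (n : ℂ) ≠ 0 := Nat.cast_ne_zero.2 hn
  refine ⟨fun z => r * Complex.exp (Complex.log (f z / f z₀) / n), ?_, ?_, ?_⟩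
  · refine analyticAt_const.mul (AnalyticAt.cexp (AnalyticAt.div ?_ analyticAt_const hn'))
    exact (hf.div analyticAt_const h0).clog (by simp [div_self h0])
  · simp [div_self h0]
  · filter_upwards [hf.continuousAt.eventually_ne h0] with z hz
    rw [mul_pow, ← Complex.exp_nat_mul, mul_div_cancel₀ _ hn', Complex.exp_log (div_ne_zero hz h0),
      hr, mul_div_cancel₀ _ h0]

namespace IsPeriodicDirac

variable {L : ℝ} {q : ℝ → ℂ} {Y : ℝ → ℂ → Mat2}

lemma mD_real (h : IsPeriodicDirac L q Y) (t : ℝ) : mD Y L t = star (mA Y L t) := by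
  have := (h.star_symm t).2.2.2
  rwa [star_ext_real] at this

lemma mC_real (h : IsPeriodicDirac L q Y) (t : ℝ) : mC Y L t = star (mB Y L t) := by
  have := (h.star_symm t).2.1
  rwa [star_ext_real] at this

lemma discriminant_real (h : IsPeriodicDirac L q Y) (t : ℝ) :
    discriminant Y L t = ((mA Y L t).re : ℂ) := by
  rw [discriminant_eq, h.mD_real]
  apply Complex.ext <;> simp

lemma halfDiff_real (h : IsPeriodicDirac L q Y) (t : ℝ) :
    halfDiff Y L t = Complex.I * ((mA Y L t).im : ℂ) := by
  rw [halfDiff, h.mD_real]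
  apply Complex.ext <;> simp

lemma discSq_real (h : IsPeriodicDirac L q Y) (t : ℝ) :
    discSq Y L t = (((mA Y L t).re ^ 2 - 1 : ℝ) : ℂ) := by
  rw [discSq, h.discriminant_real]; push_cast; ring

lemma discSq_real' (h : IsPeriodicDirac L q Y) (t : ℝ) :
    (mA Y L t).re ^ 2 - 1 = ‖mB Y L t‖ ^ 2 - (mA Y L t).im ^ 2 := by
  have h1 := h.discSq_eq t
  rw [h.discSq_real, h.halfDiff_real, h.mC_real, mul_pow, Complex.I_sq] at h1
  have h2 : mB Y L t * star (mB Y L t) = ((‖mB Y L t‖ ^ 2 : ℝ) : ℂ) := by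
    have := Complex.mul_conj (mB Y L t)
    rw [Complex.normSq_eq_norm_sq] at this
    exact this
  rw [h2] at h1
  have h3 : (((mA Y L t).re ^ 2 - 1 : ℝ) : ℂ) =
    ((‖mB Y L t‖ ^ 2 - (mA Y L t).im ^ 2 : ℝ) : ℂ) := by rw [h1]; push_cast; ring
  exact_mod_cast h3

/-- The derivative of the monodromy matrix at a real point is `-i M J P` with `J = diag(1, -1)` and
`P = ∫ Y* Y` a positive definite matrix with equal diagonal entries `p` and off-diagonal entries
`w`, `conj w`. -/
lemma exists_deriv_monodromy (h : IsPeriodicDirac L q Y) (t : ℝ) :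
    ∃ (p : ℝ) (w : ℂ), ‖w‖ < p ∧
      HasDerivAt (mA Y L) (-Complex.I * (mA Y L t * p - mB Y L t * star w)) t ∧
      HasDerivAt (mB Y L) (-Complex.I * (mA Y L t * w - mB Y L t * p)) t ∧
      HasDerivAt (mC Y L) (-Complex.I * (mC Y L t * p - mD Y L t * star w)) t ∧
      HasDerivAt (mD Y L) (-Complex.I * (mC Y L t * w - mD Y L t * p)) t := by
  obtain ⟨K, -, hK⟩ := h.exists_bound
  have hd := fun i j => h.sol.hasDerivAt_spectral hK L (t : ℂ) i j
  have hsym : ∀ s, Y s t 1 1 = star (Y s t 0 0) ∧ Y s t 1 0 = star (Y s t 0 1) := fun s => by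
    have := h.sol.star_symm s t
    rw [star_ext_real] at this
    exact ⟨this.2.2.2, this.2.1⟩
  have hc := fun i j => h.sol.continuous_apply t i j
  set f : ℝ → ℝ := fun s => ‖Y s t 0 0‖ ^ 2 + ‖Y s t 0 1‖ ^ 2 with hf
  have hfc : Continuous f := ((hc 0 0).norm.pow 2).add ((hc 0 1).norm.pow 2)
  set g : ℝ → ℂ := fun s => 2 * (star (Y s t 0 0) * Y s t 0 1) with hg
  have hgc : Continuous g := continuous_const.mul ((hc 0 0).star.mul (hc 0 1))
  have hns : ∀ a : ℂ, star a * a = ((‖a‖ ^ 2 : ℝ) : ℂ) := fun a => by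
    rw [mul_comm]
    have := Complex.mul_conj a
    rw [Complex.normSq_eq_norm_sq] at this
    exact this
  have eA0 : ∫ s in (0 : ℝ)..L, IsPrincipalSolution.varA Y 0 t t s =
      ((∫ s in (0 : ℝ)..L, f s : ℝ) : ℂ) := by
    rw [← intervalIntegral.integral_ofReal]
    refine intervalIntegral.integral_congr fun s _ => ?_
    simp only [IsPrincipalSolution.varA, (hsym s).1, (hsym s).2, hf]
    rw [mul_comm (Y s t 0 1), hns, hns]; push_cast; ring
  have eB1 : ∫ s in (0 : ℝ)..L, IsPrincipalSolution.varB Y 1 t t s =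
      ((∫ s in (0 : ℝ)..L, f s : ℝ) : ℂ) := by
    rw [← intervalIntegral.integral_ofReal]
    refine intervalIntegral.integral_congr fun s _ => ?_
    simp only [IsPrincipalSolution.varB, (hsym s).1, (hsym s).2, hf]
    rw [mul_comm (Y s t 0 0), hns, hns]; push_cast; ring
  have eA1 : ∫ s in (0 : ℝ)..L, IsPrincipalSolution.varA Y 1 t t s = ∫ s in (0 : ℝ)..L, g s := by
    refine intervalIntegral.integral_congr fun s _ => ?_
    simp only [IsPrincipalSolution.varA, (hsym s).1, hg]; ring
  have eB0 : ∫ s in (0 : ℝ)..L, IsPrincipalSolution.varB Y 0 t t s =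
      star (∫ s in (0 : ℝ)..L, g s) := by
    have : star (∫ s in (0 : ℝ)..L, g s) = ∫ s in (0 : ℝ)..L, star (g s) :=
      intervalIntegral.intervalIntegral_conj.symm
    rw [this]
    refine intervalIntegral.integral_congr fun s _ => ?_
    simp [IsPrincipalSolution.varB, (hsym s).2, hg]; ring
  refine ⟨∫ s in (0 : ℝ)..L, f s, ∫ s in (0 : ℝ)..L, g s, ?_, ?_, ?_, ?_, ?_⟩
  · refine (intervalIntegral.norm_integral_le_integral_norm h.pos.le).trans_lt ?_
    rw [← sub_pos, ← intervalIntegral.integral_sub (hfc.intervalIntegrable _ _)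
      (hgc.norm.intervalIntegrable _ _)]
    refine intervalIntegral.intervalIntegral_pos_of_pos
      ((hfc.sub hgc.norm).intervalIntegrable _ _) (fun s => ?_) h.pos
    have e : f s - ‖g s‖ = (‖Y s t 0 0‖ - ‖Y s t 0 1‖) ^ 2 := by
      simp only [hf, hg, norm_mul, norm_star, Complex.norm_ofNat]; ring
    rw [e]
    refine sq_pos_of_ne_zero (sub_ne_zero.2 fun hEq => ?_)
    have hdet := h.sol.det_eq s t
    rw [(hsym s).1, (hsym s).2, mul_comm (Y s t 0 0), hns, hns, hEq, sub_self] at hdet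
    exact zero_ne_one hdet
  · have := hd 0 0; rwa [eA0, eB0] at this
  · have := hd 0 1; rwa [eA1, eB1] at this
  · have := hd 1 0; rwa [eA0, eB0] at this
  · have := hd 1 1; rwa [eA1, eB1] at this

/-- At a real Dirichlet eigenvalue `ỹ₁₁ ỹ₂₂ = 1`. -/
lemma dirichlet_mul (h : IsPeriodicDirac L q Y) {z : ℂ} (h0 : dirFun Y L z = 0) :
    (mA Y L z + mC Y L z) * (mA Y L z - mB Y L z) = 1 := by
  rw [dirFun] at h0
  linear_combination h.det_mon z + mA Y L z * h0

lemma dirichlet_sum (h0 : dirFun Y L z = 0) :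
    (mA Y L z + mC Y L z) + (mA Y L z - mB Y L z) = 2 * discriminant Y L z := by
  rw [dirFun] at h0
  rw [discriminant_eq]
  linear_combination h0

/-- The zeros of `ỹ₁₂` on the real line are simple, and its derivative there has the sign of
`ỹ₁₁`. -/
lemma dirFun_deriv (h : IsPeriodicDirac L q Y) {t : ℝ} (h0 : dirFun Y L t = 0) :
    ∃ κ : ℝ, 0 < κ ∧ HasDerivAt (dirFun Y L) (-Complex.I * ((mA Y L t + mC Y L t) * κ)) t := by
  obtain ⟨p, w, hw, hA, hB, hC, hD⟩ := h.exists_deriv_monodromy t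
  have hre := (Complex.abs_re_le_norm w)
  refine ⟨2 * (p - w.re), by linarith [le_abs_self w.re], ?_⟩
  refine (((hA.sub hB).add hC).sub hD).congr_deriv ?_
  have hbd : mB Y L t + mD Y L t = mA Y L t + mC Y L t := by
    rw [dirFun] at h0; linear_combination -h0
  have hww : w + star w = 2 * (w.re : ℂ) := by
    rw [show star w = (starRingEnd ℂ) w from rfl, Complex.add_conj]
    push_cast; ring
  push_cast
  linear_combination (-Complex.I * (p - star w)) * hbd - Complex.I * (-(mA Y L t + mC Y L t)) * hww

lemma dirFun_deriv_ne_zero (h : IsPeriodicDirac L q Y) {t : ℝ} (h0 : dirFun Y L t = 0) :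
    ∃ d : ℂ, d ≠ 0 ∧ HasDerivAt (dirFun Y L) d t := by
  obtain ⟨κ, hκ, hd⟩ := h.dirFun_deriv h0
  have hne : mA Y L t + mC Y L t ≠ 0 := left_ne_zero_of_mul_eq_one (h.dirichlet_mul h0)
  exact ⟨_, mul_ne_zero (neg_ne_zero.2 Complex.I_ne_zero)
    (mul_ne_zero hne (by exact_mod_cast hκ.ne')), hd⟩

/-- A real point with `Δ = ±1` where the monodromy matrix is not `±1` is a simple zero of
`Δ² - 1`. -/
lemma discSq_deriv_ne_zero (h : IsPeriodicDirac L q Y) {t : ℝ} (h0 : discSq Y L t = 0)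
    (hne : halfDiff Y L t ≠ 0) : ∃ d : ℂ, d ≠ 0 ∧ HasDerivAt (discSq Y L) d t := by
  obtain ⟨p, w, hw, hA, -, -, hD⟩ := h.exists_deriv_monodromy t
  have hΔ : HasDerivAt (discriminant Y L)
      (((mA Y L t).im * p + (star (mB Y L t) * w).im : ℝ) : ℂ) t := by
    rw [funext (discriminant_eq Y L)]
    refine ((hA.add hD).div_const 2).congr_deriv ?_
    rw [h.mC_real, h.mD_real]
    apply Complex.ext
    · simp; ring
    · simp
  have hα : (mA Y L t).im ≠ 0 := by
    intro h1; apply hne; rw [h.halfDiff_real, h1]; simp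
  have hb : ‖mB Y L t‖ = |(mA Y L t).im| := by
    have h1 := h.discSq_real' t
    rw [h.discSq_real] at h0
    have h2 : (mA Y L t).re ^ 2 - 1 = 0 := by exact_mod_cast h0
    have h3 : ‖mB Y L t‖ ^ 2 = |(mA Y L t).im| ^ 2 := by rw [sq_abs]; linarith
    exact (pow_left_inj₀ (norm_nonneg _) (abs_nonneg _) two_ne_zero).1 h3
  have hr : (mA Y L t).im * p + (star (mB Y L t) * w).im ≠ 0 := by
    intro hc
    have h1 : |(mA Y L t).im * p| = |(star (mB Y L t) * w).im| := by
      rw [eq_neg_of_add_eq_zero_left hc, abs_neg]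
    have h2 : |(star (mB Y L t) * w).im| ≤ |(mA Y L t).im| * ‖w‖ := by
      refine (Complex.abs_im_le_norm _).trans ?_
      rw [norm_mul, norm_star, hb]
    rw [← h1, abs_mul] at h2
    have h3 := le_of_mul_le_mul_left h2 (abs_pos.2 hα)
    linarith [le_abs_self p]
  have hΔ0 : discriminant Y L t ≠ 0 := by
    intro hc; rw [discSq, hc] at h0; norm_num at h0
  refine ⟨_, ?_, (hΔ.pow 2).sub_const 1⟩
  simp only [Nat.cast_ofNat, Nat.add_one_sub_one, pow_one]
  exact mul_ne_zero (mul_ne_zero two_ne_zero hΔ0) (by exact_mod_cast hr)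

/-- If `Δ² = 1` and the diagonal entries agree, the monodromy matrix is `±1`. -/
lemma monodromy_of_halfDiff_eq_zero (h : IsPeriodicDirac L q Y) {t : ℝ} (h0 : discSq Y L t = 0)
    (h1 : halfDiff Y L t = 0) : mB Y L t = 0 ∧ mC Y L t = 0 ∧ dirFun Y L t = 0 := by
  have hα : (mA Y L t).im = 0 := by
    rw [h.halfDiff_real] at h1
    have := (mul_eq_zero.1 h1).resolve_left Complex.I_ne_zero
    exact_mod_cast this
  have hb : mB Y L t = 0 := by
    have h1 := h.discSq_real' t
    rw [h.discSq_real] at h0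
    have h2 : (mA Y L t).re ^ 2 - 1 = 0 := by exact_mod_cast h0
    rw [h2, hα] at h1
    have : ‖mB Y L t‖ ^ 2 = 0 := by linarith
    simpa using this
  have hc : mC Y L t = 0 := by rw [h.mC_real, hb, star_zero]
  refine ⟨hb, hc, ?_⟩
  rw [dirFun, hb, hc, mA_eq, mD_eq, h1]; ring

/-- Where the monodromy matrix is `±1`, `Δ² - 1` has a double zero with negative leading
coefficient. -/
lemma tendsto_discSq_div_sq (h : IsPeriodicDirac L q Y) {t : ℝ} (h0 : discSq Y L t = 0)
    (h1 : halfDiff Y L t = 0) :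
    ∃ κ : ℝ, 0 < κ ∧
      Tendsto (fun z => discSq Y L z / (z - t) ^ 2) (𝓝[≠] (t : ℂ)) (𝓝 (-(κ : ℂ))) := by
  obtain ⟨p, w, hw, hA, hB, hC, hD⟩ := h.exists_deriv_monodromy t
  obtain ⟨hb, hc, -⟩ := h.monodromy_of_halfDiff_eq_zero h0 h1
  have hΔ : discriminant Y L t ^ 2 = 1 := by rw [discSq] at h0; linear_combination h0
  have hH : HasDerivAt (halfDiff Y L) (-Complex.I * (discriminant Y L t * p)) t := by
    refine ((hA.sub hD).div_const 2).congr_deriv ?_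
    rw [hb, hc, mA_eq, mD_eq, h1]; ring
  refine ⟨p ^ 2 - ‖w‖ ^ 2, by nlinarith [norm_nonneg w], ?_⟩
  have hs := (((hasDerivAt_iff_tendsto_slope.1 hH).pow 2).add
    ((hasDerivAt_iff_tendsto_slope.1 hB).mul (hasDerivAt_iff_tendsto_slope.1 hC)))
  have hlim : (-Complex.I * (discriminant Y L t * p)) ^ 2 +
      -Complex.I * (mA Y L t * w - mB Y L t * p) * (-Complex.I * (mC Y L t * p - mD Y L t * star w))
      = -((p ^ 2 - ‖w‖ ^ 2 : ℝ) : ℂ) := by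
    have hww : w * star w = ((‖w‖ ^ 2 : ℝ) : ℂ) := by
      have := Complex.mul_conj w
      rw [Complex.normSq_eq_norm_sq] at this
      exact this
    rw [hb, hc, mA_eq, mD_eq, h1]
    push_cast at hww ⊢
    linear_combination (discriminant Y L t ^ 2 * p ^ 2 - discriminant Y L t ^ 2 * (w * star w)) *
      Complex.I_sq + (-(p : ℂ) ^ 2 + w * star w) * hΔ + hww
  rw [hlim] at hs
  refine hs.congr' ?_
  filter_upwards [self_mem_nhdsWithin] with z hz
  have hz' : z - t ≠ 0 := sub_ne_zero.2 hz
  rw [slope_def_field, slope_def_field, slope_def_field, h1, hb, hc, h.discSq_eq z]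
  field_simp
  ring

lemma eventually_discSq_neg (h : IsPeriodicDirac L q Y) {t : ℝ} (h0 : discSq Y L t = 0)
    (h1 : halfDiff Y L t = 0) : ∀ᶠ x : ℝ in 𝓝[≠] t, (mA Y L x).re ^ 2 - 1 < 0 := by
  obtain ⟨κ, hκ, hlim⟩ := h.tendsto_discSq_div_sq h0 h1
  have hreal : Tendsto (fun x : ℝ => (x : ℂ)) (𝓝[≠] t) (𝓝[≠] (t : ℂ)) := by
    refine tendsto_nhdsWithin_of_tendsto_nhds_of_eventually_within _
      ((Complex.continuous_ofReal.tendsto t).mono_left nhdsWithin_le_nhds) ?_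
    filter_upwards [self_mem_nhdsWithin] with x hx
    simpa using hx
  have h2 := (Complex.continuous_re.tendsto _).comp (hlim.comp hreal)
  have h3 : (-(κ : ℂ)).re < 0 := by simpa using hκ
  filter_upwards [h2.eventually_lt_const h3, self_mem_nhdsWithin] with x hx hxt
  simp only [Function.comp_apply, h.discSq_real] at hx
  have e : (((mA Y L x).re ^ 2 - 1 : ℝ) : ℂ) / ((x : ℂ) - t) ^ 2 =
      (((((mA Y L x).re ^ 2 - 1) / (x - t) ^ 2 : ℝ)) : ℂ) := by push_cast; ring
  rw [e, Complex.ofReal_re] at hx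
  have h4 : 0 < (x - t) ^ 2 := sq_pos_of_ne_zero (sub_ne_zero.2 hxt)
  by_contra hc
  exact absurd hx (not_lt.2 (div_nonneg (not_lt.1 hc) h4.le))

/-! ### Boundary behaviour of the multipliers -/

/-- Inside a gap (`|Δ| > 1`) the root `s` continues analytically, up to its sign, from both sides. -/
lemma sRoot_near_gap (h : IsPeriodicDirac L q Y) {t : ℝ} (ht : 1 < (mA Y L t).re ^ 2) :
    ∃ s : ℂ → ℂ, AnalyticAt ℂ s t ∧ (∀ᶠ z in 𝓝 (t : ℂ), s z ^ 2 = discSq Y L z) ∧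
      1 < ‖discriminant Y L t + s t‖ ∧
      (∀ᶠ z in 𝓝 (t : ℂ), 0 < z.im → sRoot Y L z = s z) ∧
      (∀ᶠ z in 𝓝 (t : ℂ), z.im < 0 → sRoot Y L z = -s z) := by
  set Δ := (mA Y L t).re with hΔ
  -- the real square root with the sign of `Δ`
  obtain ⟨r, hr2, hr⟩ : ∃ r : ℝ, r ^ 2 = Δ ^ 2 - 1 ∧ 1 < |Δ + r| := by
    have h0 : 0 ≤ Δ ^ 2 - 1 := by linarith
    have hs := Real.sq_sqrt h0
    have hp : 0 < √(Δ ^ 2 - 1) := Real.sqrt_pos.2 (by linarith)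
    have hΔ1 : 1 < |Δ| := by
      rw [← one_lt_sq_iff₀ (abs_nonneg _), sq_abs]; exact ht
    rcases le_total 0 Δ with h1 | h1
    · refine ⟨√(Δ ^ 2 - 1), hs, ?_⟩
      rw [abs_of_nonneg h1] at hΔ1
      rw [abs_of_nonneg (by positivity)]; linarith
    · refine ⟨-√(Δ ^ 2 - 1), by rw [neg_sq, hs], ?_⟩
      rw [abs_of_nonpos h1] at hΔ1
      rw [abs_of_nonpos (by linarith)]; linarith
  have hne : discSq Y L t ≠ 0 := by
    rw [h.discSq_real]
    have : Δ ^ 2 - 1 ≠ 0 := by linarith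
    exact_mod_cast this
  obtain ⟨s, hsa, hst, hs2⟩ := exists_local_root (n := 2) (r := (r : ℂ)) two_ne_zero
    (h.differentiable_discSq.analyticAt (t : ℂ)) hne (by
      rw [h.discSq_real, ← hΔ, ← hr2]; push_cast; ring)
  have hn : 1 < ‖discriminant Y L t + s t‖ := by
    rw [hst, h.discriminant_real, ← hΔ, ← Complex.ofReal_add, Complex.norm_real]
    exact hr
  have hev : ∀ᶠ z in 𝓝 (t : ℂ), 1 < ‖discriminant Y L z + s z‖ :=
    ((h.differentiable_discriminant.continuous.continuousAt.add hsa.continuousAt).norm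
      ).eventually_const_lt hn
  refine ⟨s, hsa, hs2, hn, ?_, ?_⟩
  · filter_upwards [hs2, hev] with z h1 h2 hz
    exact (h.eq_sRoot_of_norm hz.ne' h1 (by tauto)).symm
  · filter_upwards [hs2, hev] with z h1 h2 hz
    refine (h.eq_sRoot_of_norm (s := -s z) hz.ne (by rw [neg_sq, h1]) ?_).symm
    have h3 := (h.norm_mult_neg hz.ne h1).1 h2
    exact iff_of_false h3 hz.le.not_gt

/-- Inside a band (`|Δ| < 1`) the root `s` continues analytically across the real line. -/
lemma sRoot_near_band (h : IsPeriodicDirac L q Y) {t : ℝ} (ht : (mA Y L t).re ^ 2 < 1) :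
    ∃ s : ℂ → ℂ, AnalyticAt ℂ s t ∧ (∀ᶠ z in 𝓝 (t : ℂ), s z ^ 2 = discSq Y L z) ∧
      ‖mC Y L t‖ < ‖halfDiff Y L t + s t‖ ∧
      (∀ᶠ z in 𝓝 (t : ℂ), z.im ≠ 0 → sRoot Y L z = s z) := by
  set Δ := (mA Y L t).re with hΔ
  set α := (mA Y L t).im with hα
  have hab := h.discSq_real' t
  rw [← hΔ, ← hα] at hab
  have hC : ‖mC Y L t‖ = ‖mB Y L t‖ := by rw [h.mC_real, norm_star]
  -- the root with the sign of the imaginary part of `a`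
  obtain ⟨r, hr2, hr⟩ : ∃ r : ℝ, r ^ 2 = 1 - Δ ^ 2 ∧ ‖mC Y L t‖ < |α + r| := by
    have h0 : 0 ≤ 1 - Δ ^ 2 := by linarith
    have hs := Real.sq_sqrt h0
    have hp : 0 < √(1 - Δ ^ 2) := Real.sqrt_pos.2 (by linarith)
    have hb : ‖mC Y L t‖ < |α| := by
      rw [hC]
      refine lt_of_pow_lt_pow_left₀ 2 (abs_nonneg _) ?_
      rw [sq_abs]; linarith
    rcases le_total 0 α with h1 | h1
    · refine ⟨√(1 - Δ ^ 2), hs, ?_⟩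
      rw [abs_of_nonneg h1] at hb
      rw [abs_of_nonneg (by positivity)]; linarith
    · refine ⟨-√(1 - Δ ^ 2), by rw [neg_sq, hs], ?_⟩
      rw [abs_of_nonpos h1] at hb
      rw [abs_of_nonpos (by linarith)]; linarith
  have hne : discSq Y L t ≠ 0 := by
    rw [h.discSq_real]
    have : Δ ^ 2 - 1 ≠ 0 := by linarith
    exact_mod_cast this
  obtain ⟨s, hsa, hst, hs2⟩ := exists_local_root (n := 2) (r := Complex.I * (r : ℂ)) two_ne_zero
    (h.differentiable_discSq.analyticAt (t : ℂ)) hne (by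
      rw [h.discSq_real, ← hΔ, mul_pow, Complex.I_sq]
      have : Δ ^ 2 - 1 = -r ^ 2 := by linarith
      rw [this]; push_cast; ring)
  have hn : ‖mC Y L t‖ < ‖halfDiff Y L t + s t‖ := by
    rw [hst, h.halfDiff_real, ← mul_add, norm_mul, Complex.norm_I, one_mul, ← Complex.ofReal_add,
      Complex.norm_real]
    exact hr
  have hev : ∀ᶠ z in 𝓝 (t : ℂ), ‖mC Y L z‖ < ‖halfDiff Y L z + s z‖ :=
    (h.differentiable_mC.continuous.norm.continuousAt).eventually_lt
      ((h.differentiable_halfDiff.continuous.continuousAt.add hsa.continuousAt).norm) hn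
  refine ⟨s, hsa, hs2, hn, ?_⟩
  filter_upwards [hs2, hev] with z h1 h2 hz
  exact (h.eq_sRoot_of_bound hz h1 h2).symm

lemma analyticAt_sRoot (h : IsPeriodicDirac L q Y) {z₀ : ℂ} (hz : z₀.im ≠ 0) :
    AnalyticAt ℂ (sRoot Y L) z₀ := by
  obtain ⟨s, hsa, hst, hs2⟩ := exists_local_root (n := 2) (r := sRoot Y L z₀) two_ne_zero
    (h.differentiable_discSq.analyticAt z₀) (h.discSq_ne_zero hz) (sRoot_sq Y L z₀)
  refine hsa.congr ?_
  have hb : ‖mC Y L z₀‖ < ‖halfDiff Y L z₀ + s z₀‖ := by rw [hst]; exact (h.bloch_bounds hz).2.1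
  have hev : ∀ᶠ z in 𝓝 z₀, ‖mC Y L z‖ < ‖halfDiff Y L z + s z‖ :=
    (h.differentiable_mC.continuous.norm.continuousAt).eventually_lt
      ((h.differentiable_halfDiff.continuous.continuousAt.add hsa.continuousAt).norm) hb
  filter_upwards [hs2, hev, isOpen_im_ne_zero.mem_nhds hz] with z h1 h2 h3
  exact h.eq_sRoot_of_bound h3 h1 h2

/-! ### Spectrum and Dirichlet eigenvalues -/

/-- On the spectrum a Bloch solution has a unimodular multiplier and is bounded; where `|Δ| > 1`,
the Cayley-Hamilton recursion over periods makes a bounded solution vanish. -/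
lemma mem_laxSpectrum_iff (h : IsPeriodicDirac L q Y) (t : ℝ) :
    (t : ℂ) ∈ laxSpectrum q ↔ (mA Y L t).re ^ 2 ≤ 1 := by
  constructor
  · rintro ⟨v, hv0, hv, C, hC⟩
    by_contra! hΔ
    have hsol : IsSol q t (fun x => v x 0) (fun x => v x 1) :=
      ⟨fun x => (hv x 0).congr_deriv (by
        simp [zsMatrix_apply, Matrix.mulVec, dotProduct, Fin.sum_univ_two]),
       fun x => (hv x 1).congr_deriv (by
        simp [zsMatrix_apply, Matrix.mulVec, dotProduct, Fin.sum_univ_two])⟩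
    -- the recursion over periods coming from the Cayley-Hamilton theorem
    have hrec : ∀ x i, 2 * discriminant Y L t * v (x + L) i = v (x + L + L) i + v x i := by
      intro x i
      have e0 := h.sol.sol_eq hsol x
      have e1 := h.sol.sol_eq hsol (x + L)
      have e2 := h.sol.sol_eq hsol (x + L + L)
      rw [h.sol.add_period h.periodic (x + L), h.sol.add_period h.periodic x] at e2
      rw [h.sol.add_period h.periodic x] at e1
      have hd : Y L t 0 0 * Y L t 1 1 - Y L t 1 0 * Y L t 0 1 = 1 := h.sol.det_eq L t
      simp only [Matrix.mul_apply, Fin.sum_univ_two] at e1 e2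
      rw [discriminant_eq, mA, mD]
      obtain rfl | rfl : i = 0 ∨ i = 1 := by omega
      · rw [e0.1, e1.1, e2.1]
        linear_combination (Y x t 0 0 * v 0 0 + Y x t 0 1 * v 0 1) * hd
      · rw [e0.2, e1.2, e2.2]
        linear_combination (Y x t 1 0 * v 0 0 + Y x t 1 1 * v 0 1) * hd
    have hΔ1 : 1 < ‖discriminant Y L t‖ := by
      rw [h.discriminant_real, Complex.norm_real, Real.norm_eq_abs,
        ← one_lt_sq_iff₀ (abs_nonneg _), sq_abs]
      exact hΔ
    set D := ‖discriminant Y L t‖ with hD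
    have hiter : ∀ n : ℕ, ∀ x i, ‖v x i‖ ≤ C * D⁻¹ ^ n := by
      intro n
      induction n with
      | zero => simpa using hC
      | succ n ih =>
        intro x i
        have e := congrArg norm (hrec (x - L) i)
        rw [sub_add_cancel, norm_mul, norm_mul, Complex.norm_ofNat, ← hD] at e
        have h1 := (norm_add_le (v (x + L) i) (v (x - L) i))
        have h2 := ih (x + L) i
        have h3 := ih (x - L) i
        have h4 : D * ‖v x i‖ ≤ C * D⁻¹ ^ n := by nlinarith
        rw [pow_succ, ← mul_assoc, ← div_eq_mul_inv, le_div_iff₀ (by linarith)]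
        linarith
    apply hv0
    funext x i
    have hlim : Tendsto (fun n : ℕ => C * D⁻¹ ^ n) atTop (𝓝 (C * 0)) :=
      (tendsto_pow_atTop_nhds_zero_of_lt_one (inv_nonneg.2 (by linarith))
        (inv_lt_one_of_one_lt₀ hΔ1)).const_mul C
    have : ‖v x i‖ ≤ C * 0 := ge_of_tendsto' hlim fun n => hiter n x i
    simpa using this
  · intro hΔ
    set Δ := (mA Y L t).re with hΔd
    have hs : (Complex.I * (√(1 - Δ ^ 2) : ℂ)) ^ 2 = discSq Y L t := by
      rw [h.discSq_real, ← hΔd, mul_pow, Complex.I_sq, ← Complex.ofReal_pow,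
        Real.sq_sqrt (by linarith)]
      push_cast; ring
    obtain ⟨a, b, hab, e1, e2⟩ := h.eigen_exists hs
    set ρ := discriminant Y L t + Complex.I * (√(1 - Δ ^ 2) : ℂ) with hρ
    have hρ1 : ‖ρ‖ = 1 := by
      have : ‖ρ‖ ^ 2 = 1 := by
        rw [← Complex.normSq_eq_norm_sq, hρ, h.discriminant_real, ← hΔd, Complex.normSq_apply]
        simp
        nlinarith [Real.mul_self_sqrt (show 0 ≤ 1 - Δ ^ 2 by linarith)]
      exact (pow_eq_one_iff_of_nonneg (norm_nonneg _) two_ne_zero).1 this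
    have hsol := h.isSol_comb t a b
    have hper : ∀ x, Y (x + L) t 0 0 * a + Y (x + L) t 0 1 * b =
          ρ * (Y x t 0 0 * a + Y x t 0 1 * b) ∧
        Y (x + L) t 1 0 * a + Y (x + L) t 1 1 * b = ρ * (Y x t 1 0 * a + Y x t 1 1 * b) := by
      intro x
      rw [h.sol.add_period h.periodic x]
      simp only [Matrix.mul_apply, Fin.sum_univ_two]
      rw [mA, mB] at e1
      rw [mC, mD] at e2
      constructor
      · linear_combination Y x t 0 0 * e1 + Y x t 0 1 * e2
      · linear_combination Y x t 1 0 * e1 + Y x t 1 1 * e2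
    have hc1 : Continuous fun x => ‖Y x t 0 0 * a + Y x t 0 1 * b‖ :=
      (continuous_iff_continuousAt.2 fun x => (hsol.fst x).continuousAt).norm
    have hc2 : Continuous fun x => ‖Y x t 1 0 * a + Y x t 1 1 * b‖ :=
      (continuous_iff_continuousAt.2 fun x => (hsol.snd x).continuousAt).norm
    have hp1 : Function.Periodic (fun x => ‖Y x t 0 0 * a + Y x t 0 1 * b‖) L := fun x => by
      simp only [(hper x).1, norm_mul, hρ1, one_mul]
    have hp2 : Function.Periodic (fun x => ‖Y x t 1 0 * a + Y x t 1 1 * b‖) L := fun x => by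
      simp only [(hper x).2, norm_mul, hρ1, one_mul]
    obtain ⟨C1, hC1⟩ := (hp1.isBounded_of_continuous h.pos.ne' hc1).exists_norm_le
    obtain ⟨C2, hC2⟩ := (hp2.isBounded_of_continuous h.pos.ne' hc2).exists_norm_le
    refine ⟨fun x => ![Y x t 0 0 * a + Y x t 0 1 * b, Y x t 1 0 * a + Y x t 1 1 * b], ?_, ?_,
      max C1 C2, ?_⟩
    · intro h0
      have h1 := congrFun h0 0
      rcases h.comb_ne_zero (z := t) hab 0 with h2 | h2
      · exact h2 (by simpa using congrFun h1 0)
      · exact h2 (by simpa using congrFun h1 1)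
    · intro x i
      obtain rfl | rfl : i = 0 ∨ i = 1 := by omega
      · exact (hsol.fst x).congr_deriv (by
          simp [zsMatrix_apply, Matrix.mulVec, dotProduct, Fin.sum_univ_two])
      · exact (hsol.snd x).congr_deriv (by
          simp [zsMatrix_apply, Matrix.mulVec, dotProduct, Fin.sum_univ_two])
    · intro x i
      obtain rfl | rfl : i = 0 ∨ i = 1 := by omega
      · have := hC1 _ (mem_range_self x)
        rw [norm_norm] at this
        exact this.trans (le_max_left _ _)
      · have := hC2 _ (mem_range_self x)
        rw [norm_norm] at this
        exact this.trans (le_max_right _ _)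

lemma isDirichletEigenvalue_iff (h : IsPeriodicDirac L q Y) (μ : ℂ) :
    IsDirichletEigenvalue q L μ ↔ dirFun Y L μ = 0 := by
  constructor
  · rintro ⟨v, ⟨x₀, hx₀, hv0⟩, hv, hb0, hbL⟩
    have hd0 : ∀ x ∈ Icc 0 L, HasDerivWithinAt (fun t => v t 0)
        (-(Complex.I * μ) * v x 0 + q x * v x 1) (Icc 0 L) x := fun x hx =>
      (hv x hx 0).congr_deriv (by
        simp [zsMatrix_apply, Matrix.mulVec, dotProduct, Fin.sum_univ_two])
    have hd1 : ∀ x ∈ Icc 0 L, HasDerivWithinAt (fun t => v t 1)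
        (star (q x) * v x 0 + Complex.I * μ * v x 1) (Icc 0 L) x := fun x hx =>
      (hv x hx 1).congr_deriv (by
        simp [zsMatrix_apply, Matrix.mulVec, dotProduct, Fin.sum_univ_two])
    -- the Wronskians with the columns of `Y` are constant
    have hw : ∀ j, ∀ x ∈ Icc 0 L, Y x μ 0 j * v x 1 - Y x μ 1 j * v x 0 =
        Y 0 μ 0 j * v 0 1 - Y 0 μ 1 j * v 0 0 := by
      intro j
      have hd : ∀ x ∈ Icc 0 L, HasDerivWithinAt (fun x => Y x μ 0 j * v x 1 - Y x μ 1 j * v x 0)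
          0 (Icc 0 L) x := fun x hx =>
        ((((h.sol.isSol μ j).fst x).hasDerivWithinAt.mul (hd1 x hx)).sub
          (((h.sol.isSol μ j).snd x).hasDerivWithinAt.mul (hd0 x hx))).congr_deriv (by ring)
      refine constant_of_has_deriv_right_zero (fun x hx => (hd x hx).continuousWithinAt) ?_
      intro x hx
      exact (hd x (Ico_subset_Icc_self hx)).mono_of_mem_nhdsWithin (Icc_mem_nhdsGE_of_mem hx)
    obtain ⟨i1, i2, i3, i4⟩ := h.sol.init_apply μ
    have hrep : ∀ x ∈ Icc 0 L, v x 0 = v 0 0 * (Y x μ 0 0 - Y x μ 0 1) ∧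
        v x 1 = v 0 0 * (Y x μ 1 0 - Y x μ 1 1) := by
      intro x hx
      have w0 := hw 0 x hx
      have w1 := hw 1 x hx
      rw [i1, i3] at w0
      rw [i2, i4] at w1
      have hd := h.sol.det_eq x μ
      constructor
      · linear_combination (-v x 0) * hd - Y x μ 0 0 * w1 + Y x μ 0 1 * w0 + Y x μ 0 1 * hb0
      · linear_combination (-v x 1) * hd - Y x μ 1 0 * w1 + Y x μ 1 1 * w0 + Y x μ 1 1 * hb0
    have hne : v 0 0 ≠ 0 := by
      intro h0
      apply hv0
      funext i
      obtain ⟨e0, e1⟩ := hrep x₀ hx₀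
      rw [h0, zero_mul] at e0 e1
      obtain rfl | rfl : i = 0 ∨ i = 1 := by omega
      · exact e0
      · exact e1
    obtain ⟨e0, e1⟩ := hrep L (right_mem_Icc.2 h.pos.le)
    rw [e0, e1, ← mul_add] at hbL
    have := (mul_eq_zero.1 hbL).resolve_left hne
    rw [dirFun, mA, mB, mC, mD]
    linear_combination this
  · intro h0
    have hsol := h.isSol_comb μ 1 (-1)
    refine ⟨fun x => ![Y x μ 0 0 * 1 + Y x μ 0 1 * (-1), Y x μ 1 0 * 1 + Y x μ 1 1 * (-1)],
      ⟨0, left_mem_Icc.2 h.pos.le, ?_⟩, ?_, ?_, ?_⟩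
    · intro hc
      have := congrFun hc 0
      simp [h.sol.initial] at this
    · intro x _ i
      obtain rfl | rfl : i = 0 ∨ i = 1 := by omega
      · exact ((hsol.fst x).congr_deriv (by
          simp [zsMatrix_apply, Matrix.mulVec, dotProduct, Fin.sum_univ_two])).hasDerivWithinAt
      · exact ((hsol.snd x).congr_deriv (by
          simp [zsMatrix_apply, Matrix.mulVec, dotProduct, Fin.sum_univ_two])).hasDerivWithinAt
    · simp [h.sol.initial]
    · rw [dirFun, mA, mB, mC, mD] at h0
      simp only [Matrix.cons_val_zero, Matrix.cons_val_one]
      linear_combination h0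

lemma U_mul_conj : (U : Mat2) * ((1 / 2 : ℂ) • U.conjTranspose) = 1 := by
  ext i j
  obtain rfl | rfl : i = 0 ∨ i = 1 := by omega
  all_goals
    obtain rfl | rfl : j = 0 ∨ j = 1 := by omega
    all_goals
      simp [U, Matrix.mul_apply, Fin.sum_univ_two, Matrix.conjTranspose_apply]
      try first | linear_combination (-1 : ℂ) * Complex.I_sq | norm_num

lemma U_inv : (U : Mat2)⁻¹ = (1 / 2 : ℂ) • U.conjTranspose :=
  Matrix.inv_eq_right_inv U_mul_conj

lemma modifiedSolution_eq (Y : ℝ → ℂ → Mat2) (L : ℝ) (z : ℂ) (h0 : dirFun Y L z = 0) :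
    modifiedSolution Y L z 1 1 = mA Y L z - mB Y L z := by
  rw [modifiedSolution, U_inv]
  rw [dirFun, mA, mB, mC, mD] at h0
  simp [U, Matrix.mul_apply, Fin.sum_univ_two, Matrix.conjTranspose_apply, Matrix.vecMul,
    dotProduct, mA, mB]
  linear_combination (Y L z 1 0 / 2 - Y L z 0 0 / 2 + Y L z 0 1 / 2 - Y L z 1 1 / 2) *
    Complex.I_sq - h0 / 2

lemma dirichletSign_eq (Y : ℝ → ℂ → Mat2) (L : ℝ) {z : ℂ} (h0 : dirFun Y L z = 0) :
    dirichletSign Y L z = -SignType.sign (Real.log ‖mA Y L z - mB Y L z‖) := by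
  rw [dirichletSign, modifiedSolution_eq Y L z h0]

end IsPeriodicDirac

/-! ### Periodic solutions of a Riccati equation with a large parameter -/

section Riccati

variable {L : ℝ}

lemma norm_exp_mul_ofReal (lam : ℂ) (x : ℝ) : ‖Complex.exp (lam * x)‖ = Real.exp (lam.re * x) := by
  rw [Complex.norm_exp]; simp

lemma hasDerivWithinAt_exp_mul {lam : ℂ} {y g : ℝ → ℂ} {S : Set ℝ} {x : ℝ}
    (hy : HasDerivWithinAt y (lam * y x + g x) S x) :
    HasDerivWithinAt (fun s : ℝ => Complex.exp (-lam * s) * y s) (Complex.exp (-lam * x) * g x)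
      S x := by
  have he : HasDerivAt (fun s : ℝ => Complex.exp (-lam * s)) (Complex.exp (-lam * x) * -lam) x := by
    have h1 : HasDerivAt (fun s : ℝ => -lam * (s : ℂ)) (-lam) x := by
      simpa using (Complex.ofRealCLM.hasDerivAt (x := x)).const_mul (-lam)
    exact h1.cexp
  exact (he.hasDerivWithinAt.mul hy).congr_deriv (by ring)

/-- Duhamel's estimate for `y' = λ y + g` with `Re λ ≤ 0`. -/
lemma norm_sub_exp_mul_le {lam : ℂ} (hlam : lam.re ≤ 0) {y g : ℝ → ℂ} {ε : ℝ}
    (hy : ∀ x ∈ Icc 0 L, HasDerivWithinAt y (lam * y x + g x) (Icc 0 L) x)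
    (hg : ∀ x ∈ Icc 0 L, ‖g x‖ ≤ ε) {x : ℝ} (hx : x ∈ Icc 0 L) :
    ‖y x - Complex.exp (lam * x) * y 0‖ ≤ ε * L := by
  have hε : 0 ≤ ε := (norm_nonneg _).trans (hg x hx)
  have hsub : Icc 0 x ⊆ Icc 0 L := Icc_subset_Icc le_rfl hx.2
  have h1 := norm_image_sub_le_of_norm_deriv_le_segment' (a := 0) (b := x)
    (C := Real.exp (-lam.re * x) * ε)
    (fun s hs => (hasDerivWithinAt_exp_mul (hy s (hsub hs))).mono hsub) (fun s hs => by
      rw [norm_mul, norm_exp_mul_ofReal, Complex.neg_re]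
      refine mul_le_mul (Real.exp_le_exp.2 ?_) (hg s (hsub (Ico_subset_Icc_self hs)))
        (norm_nonneg _) (Real.exp_pos _).le
      exact mul_le_mul_of_nonneg_left hs.2.le (by linarith)) x (right_mem_Icc.2 hx.1)
  have e : y x - Complex.exp (lam * x) * y 0 = Complex.exp (lam * x) *
      (Complex.exp (-lam * x) * y x - Complex.exp (-lam * (0 : ℝ)) * y 0) := by
    rw [mul_sub, ← mul_assoc, ← Complex.exp_add]; simp
  rw [e, norm_mul, norm_exp_mul_ofReal]
  calc Real.exp (lam.re * x) * _ ≤ Real.exp (lam.re * x) * (Real.exp (-lam.re * x) * ε * (x - 0)) := by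
        gcongr
    _ = ε * x := by rw [← mul_assoc, ← mul_assoc, ← Real.exp_add]; simp
    _ ≤ ε * L := by gcongr; exact hx.2

/-- Duhamel's estimate for `y' = λ y + g` with `Re λ < 0`, using the decay. -/
lemma norm_sub_exp_mul_le' {lam : ℂ} (hlam : lam.re < 0) {y g : ℝ → ℂ} {ε : ℝ}
    (hy : ∀ x ∈ Icc 0 L, HasDerivWithinAt y (lam * y x + g x) (Icc 0 L) x)
    (hg : ∀ x ∈ Icc 0 L, ‖g x‖ ≤ ε) {x : ℝ} (hx : x ∈ Icc 0 L) :
    ‖y x - Complex.exp (lam * x) * y 0‖ ≤ ε / (-lam.re) := by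
  set η := -lam.re with hη
  have hη0 : 0 < η := by linarith
  have hε : 0 ≤ ε := (norm_nonneg _).trans (hg x hx)
  have hsub : Icc 0 x ⊆ Icc 0 L := Icc_subset_Icc le_rfl hx.2
  have hd := fun s hs => hasDerivWithinAt_exp_mul (hy s hs)
  have hB : ∀ s : ℝ, HasDerivAt (fun s : ℝ => ε * Real.exp (η * s) / η - ε / η)
      (ε * Real.exp (η * s)) s := fun s => by
    have h1 : HasDerivAt (fun s : ℝ => Real.exp (η * s)) (Real.exp (η * s) * η) s := by
      simpa using ((hasDerivAt_id s).const_mul η).exp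
    exact (((h1.const_mul ε).div_const η).sub_const _).congr_deriv (by field_simp)
  have h1 := image_norm_le_of_norm_deriv_right_le_deriv_boundary (a := 0) (b := x)
    (f := fun s : ℝ => Complex.exp (-lam * s) * y s - Complex.exp (-lam * (0 : ℝ)) * y 0)
    (f' := fun s : ℝ => Complex.exp (-lam * s) * g s)
    (B := fun s : ℝ => ε * Real.exp (η * s) / η - ε / η) (B' := fun s => ε * Real.exp (η * s))
    (fun s hs => (((hd s (hsub hs)).mono hsub).sub_const _).continuousWithinAt)
    (fun s hs => ((hd s (hsub (Ico_subset_Icc_self hs))).mono_of_mem_nhdsWithin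
      (Icc_mem_nhdsGE_of_mem ⟨hs.1, hs.2.trans_le hx.2⟩)).sub_const _)
    (by simp) hB (fun s hs => by
      rw [norm_mul, norm_exp_mul_ofReal, Complex.neg_re, mul_comm]
      gcongr
      exact hg s (hsub (Ico_subset_Icc_self hs))) (right_mem_Icc.2 hx.1)
  have e : y x - Complex.exp (lam * x) * y 0 = Complex.exp (lam * x) *
      (Complex.exp (-lam * x) * y x - Complex.exp (-lam * (0 : ℝ)) * y 0) := by
    rw [mul_sub, ← mul_assoc, ← Complex.exp_add]; simp
  rw [e, norm_mul, norm_exp_mul_ofReal]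
  calc Real.exp (lam.re * x) * _ ≤ Real.exp (lam.re * x) * (ε * Real.exp (η * x) / η - ε / η) := by
        gcongr
    _ ≤ Real.exp (lam.re * x) * (ε * Real.exp (η * x) / η) := by
        gcongr; linarith [div_nonneg hε hη0.le]
    _ = ε / η * (Real.exp (lam.re * x) * Real.exp (η * x)) := by ring
    _ = ε / η := by rw [← Real.exp_add, hη]; simp

/-- `u` is an `L`-periodic solution of `u' = 2 i z u + p - r u²` on `[0, L]` with `|u| ≤ 1`. -/
structure IsRiccati (L : ℝ) (p r : ℝ → ℂ) (z : ℂ) (u : ℝ → ℂ) : Prop where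
  ode : ∀ x ∈ Icc 0 L, HasDerivAt u (2 * Complex.I * z * u x + p x - r x * u x ^ 2) x
  periodic : u L = u 0
  bound : ∀ x ∈ Icc 0 L, ‖u x‖ ≤ 1

lemma re_two_I_mul (z : ℂ) : (2 * Complex.I * z).re = -(2 * z.im) := by simp

lemma norm_two_I_mul (z : ℂ) : ‖2 * Complex.I * z‖ = 2 * ‖z‖ := by simp

/-- Deep in the upper half plane a bounded periodic solution is small. -/
lemma IsRiccati.norm_le_of_im {p r u : ℝ → ℂ} {z : ℂ} {K κ : ℝ} (hL : 0 < L)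
    (hu : IsRiccati L p r z u) (hp : ∀ x ∈ Icc 0 L, ‖p x‖ ≤ K) (hr : ∀ x ∈ Icc 0 L, ‖r x‖ ≤ K)
    (hz : 0 < z.im) (hκ : 0 < κ) (hκ1 : κ ≤ 1)
    (hzκ : κ ≤ ‖1 - Complex.exp (2 * Complex.I * z * L)‖) :
    ∀ x ∈ Icc 0 L, ‖u x‖ ≤ 2 * K / (κ * z.im) := by
  have hK : 0 ≤ K := (norm_nonneg _).trans (hp 0 (left_mem_Icc.2 hL.le))
  have hre : (2 * Complex.I * z).re < 0 := by rw [re_two_I_mul]; linarith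
  have hg : ∀ x ∈ Icc 0 L, ‖p x - r x * u x ^ 2‖ ≤ 2 * K := fun x hx => by
    refine (norm_sub_le _ _).trans ?_
    rw [norm_mul, norm_pow]
    have h1 := hu.bound x hx
    have h2 : ‖u x‖ ^ 2 ≤ 1 := pow_le_one₀ (norm_nonneg _) h1
    nlinarith [hp x hx, hr x hx, norm_nonneg (r x)]
  have hd : ∀ x ∈ Icc 0 L, ‖u x - Complex.exp (2 * Complex.I * z * x) * u 0‖ ≤ K / z.im := by
    intro x hx
    have := norm_sub_exp_mul_le' hre (y := u) (g := fun x => p x - r x * u x ^ 2)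
      (fun x hx => ((hu.ode x hx).congr_deriv (by ring)).hasDerivWithinAt) hg hx
    rw [re_two_I_mul, neg_neg, mul_div_mul_left _ _ two_ne_zero] at this
    exact this
  -- Periodicity turns the decay over one period into a bound of the initial value.
  have h0 : ‖u 0‖ ≤ K / (κ * z.im) := by
    have h1 := hd L (right_mem_Icc.2 hL.le)
    rw [hu.periodic] at h1
    have e : u 0 - Complex.exp (2 * Complex.I * z * L) * u 0 =
      (1 - Complex.exp (2 * Complex.I * z * L)) * u 0 := by ring
    rw [e, norm_mul] at h1
    rw [le_div_iff₀ (by positivity)]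
    rw [le_div_iff₀ hz] at h1
    nlinarith [mul_le_mul_of_nonneg_right hzκ (mul_nonneg (norm_nonneg (u 0)) hz.le)]
  intro x hx
  have h1 := hd x hx
  have h2 : ‖Complex.exp (2 * Complex.I * z * x)‖ ≤ 1 := by
    rw [norm_exp_mul_ofReal, Real.exp_le_one_iff]
    exact mul_nonpos_of_nonpos_of_nonneg hre.le hx.1
  have h3 : K / z.im ≤ K / (κ * z.im) := by
    apply div_le_div_of_nonneg_left hK (by positivity)
    nlinarith
  calc ‖u x‖ = ‖(u x - Complex.exp (2 * Complex.I * z * x) * u 0) +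
        Complex.exp (2 * Complex.I * z * x) * u 0‖ := by congr 1; ring
    _ ≤ ‖u x - Complex.exp (2 * Complex.I * z * x) * u 0‖ +
        ‖Complex.exp (2 * Complex.I * z * x) * u 0‖ := norm_add_le _ _
    _ ≤ K / z.im + 1 * (K / (κ * z.im)) := by
        rw [norm_mul]; gcongr
    _ ≤ 2 * K / (κ * z.im) := by rw [mul_div_assoc]; linarith

/-- The asymptotic expansion of a bounded periodic solution, with an error quadratic in an a priori
bound: `u + p / λ + p' / λ²` solves a linear equation with a small right-hand side. -/
lemma IsRiccati.norm_add_le {p p₁ p₂ r u : ℝ → ℂ} {z : ℂ} {K κ A : ℝ} (hL : 0 < L)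
    (hu : IsRiccati L p r z u)
    (hp1 : ∀ x ∈ Icc 0 L, HasDerivWithinAt p (p₁ x) (Icc 0 L) x)
    (hp2 : ∀ x ∈ Icc 0 L, HasDerivWithinAt p₁ (p₂ x) (Icc 0 L) x) (hp0 : p L = p 0)
    (hp1K : ∀ x ∈ Icc 0 L, ‖p₁ x‖ ≤ K) (hp2K : ∀ x ∈ Icc 0 L, ‖p₂ x‖ ≤ K)
    (hr : ∀ x ∈ Icc 0 L, ‖r x‖ ≤ K) (hz : 0 < z.im) (hκ : 0 < κ) (hκ1 : κ ≤ 1)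
    (hzκ : κ ≤ ‖1 - Complex.exp (2 * Complex.I * z * L)‖) (hA : ∀ x ∈ Icc 0 L, ‖u x‖ ≤ A) :
    ∀ x ∈ Icc 0 L, ‖u x + p x / (2 * Complex.I * z)‖ ≤
      (3 * K + 2 * K * L) / κ * (1 / ‖z‖ ^ 2 + A ^ 2) := by
  set lam := 2 * Complex.I * z with hlam
  have hz0 : z ≠ 0 := by rintro rfl; simp at hz
  have hl0 : lam ≠ 0 := by simp [hlam, hz0]
  have hK : 0 ≤ K := (norm_nonneg _).trans (hr 0 (left_mem_Icc.2 hL.le))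
  have hA0 : 0 ≤ A := (norm_nonneg _).trans (hA 0 (left_mem_Icc.2 hL.le))
  have hre : lam.re ≤ 0 := by rw [hlam, re_two_I_mul]; linarith
  set B := 1 / ‖z‖ ^ 2 with hB
  have hB0 : 0 ≤ B := by positivity
  have hlB : 1 / ‖lam‖ ^ 2 ≤ B := by
    rw [hlam, norm_two_I_mul, hB]
    have := norm_pos_iff.2 hz0
    apply one_div_le_one_div_of_le (by positivity)
    nlinarith
  have hdiv : ∀ a : ℂ, ‖a‖ ≤ K → ‖a / lam ^ 2‖ ≤ K * B := fun a ha => by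
    rw [norm_div, norm_pow, div_eq_mul_one_div]
    gcongr
  -- The first two terms of the formal solution are added, so that `y` satisfies the linear equation
  -- with coefficient `λ` up to an error of order `|λ|⁻² + A²`.
  set y : ℝ → ℂ := fun x => u x + p x / lam + p₁ x / lam ^ 2 with hy
  have hyd : ∀ x ∈ Icc 0 L, HasDerivWithinAt y (lam * y x + (p₂ x / lam ^ 2 - r x * u x ^ 2))
      (Icc 0 L) x := fun x hx => by
    refine (((hu.ode x hx).hasDerivWithinAt.add ((hp1 x hx).div_const lam)).add
      ((hp2 x hx).div_const (lam ^ 2))).congr_deriv ?_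
    simp only [hy]; field_simp; ring
  have hg : ∀ x ∈ Icc 0 L, ‖p₂ x / lam ^ 2 - r x * u x ^ 2‖ ≤ K * B + K * A ^ 2 := fun x hx => by
    refine (norm_sub_le _ _).trans ?_
    rw [norm_mul, norm_pow]
    have h1 := hA x hx
    gcongr
    · exact hdiv _ (hp2K x hx)
    · exact hr x hx
  have hd := fun x hx => norm_sub_exp_mul_le hre hyd hg (x := x) hx
  set ε := K * B + K * A ^ 2 with hε
  have hε0 : 0 ≤ ε := by positivity
  have h0 : ‖y 0‖ ≤ (2 * K * B + ε * L) / κ := by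
    have h1 := hd L (right_mem_Icc.2 hL.le)
    have e : (1 - Complex.exp (lam * L)) * y 0 = (y L - Complex.exp (lam * L) * y 0) -
        (p₁ L / lam ^ 2 - p₁ 0 / lam ^ 2) := by
      simp only [hy, hu.periodic, hp0]; ring
    have h2 : ‖(1 - Complex.exp (lam * L)) * y 0‖ ≤ ε * L + (K * B + K * B) := by
      rw [e]
      refine (norm_sub_le _ _).trans (add_le_add h1 ((norm_sub_le _ _).trans (add_le_add ?_ ?_)))
      · exact hdiv _ (hp1K L (right_mem_Icc.2 hL.le))
      · exact hdiv _ (hp1K 0 (left_mem_Icc.2 hL.le))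
    rw [norm_mul] at h2
    rw [le_div_iff₀ hκ]
    nlinarith [mul_le_mul_of_nonneg_right hzκ (norm_nonneg (y 0))]
  intro x hx
  have h2 : ‖Complex.exp (lam * x)‖ ≤ 1 := by
    rw [norm_exp_mul_ofReal, Real.exp_le_one_iff]
    exact mul_nonpos_of_nonpos_of_nonneg hre hx.1
  have h3 : ‖y x‖ ≤ (2 * K * B + ε * L) / κ + ε * L := by
    calc ‖y x‖ = ‖Complex.exp (lam * x) * y 0 + (y x - Complex.exp (lam * x) * y 0)‖ := by
          congr 1; ring
      _ ≤ 1 * ((2 * K * B + ε * L) / κ) + ε * L := by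
          refine (_root_.norm_add_le _ _).trans (add_le_add ?_ (hd x hx))
          rw [norm_mul]; gcongr
      _ = _ := by rw [one_mul]
  have h4 : ‖u x + p x / lam‖ ≤ ‖y x‖ + K * B := by
    have e : u x + p x / lam = y x - p₁ x / lam ^ 2 := by simp only [hy]; ring
    rw [e]
    exact (norm_sub_le _ _).trans (add_le_add le_rfl (hdiv _ (hp1K x hx)))
  refine h4.trans ((add_le_add h3 le_rfl).trans ?_)
  have h5 : ∀ a : ℝ, 0 ≤ a → a ≤ a / κ := fun a ha => le_div_self ha hκ hκ1
  calc _ ≤ (2 * K * B + ε * L) / κ + ε * L / κ + K * B / κ := by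
        gcongr
        · exact h5 _ (by positivity)
        · exact h5 _ (by positivity)
    _ = (3 * K * B + 2 * K * L * B + 2 * K * L * A ^ 2) / κ := by rw [hε]; ring
    _ ≤ (3 * K * B + 2 * K * L * B + (3 * K + 2 * K * L) * A ^ 2) / κ := by
        gcongr; linarith
    _ = _ := by ring

lemma exists_derivs_of_contDiffOn {p : ℝ → ℂ} (hL : 0 < L) (hp : ContDiffOn ℝ 2 p (Icc 0 L)) :
    ∃ (p₁ p₂ : ℝ → ℂ) (K : ℝ), 0 ≤ K ∧
      (∀ x ∈ Icc 0 L, HasDerivWithinAt p (p₁ x) (Icc 0 L) x) ∧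
      (∀ x ∈ Icc 0 L, HasDerivWithinAt p₁ (p₂ x) (Icc 0 L) x) ∧
      (∀ x ∈ Icc 0 L, ‖p x‖ ≤ K) ∧ (∀ x ∈ Icc 0 L, ‖p₁ x‖ ≤ K) ∧ ∀ x ∈ Icc 0 L, ‖p₂ x‖ ≤ K := by
  have hu : UniqueDiffOn ℝ (Icc 0 L) := uniqueDiffOn_Icc hL
  have h1 : ContDiffOn ℝ 1 (derivWithin p (Icc 0 L)) (Icc 0 L) :=
    hp.derivWithin hu (by norm_num)
  have h2 : ContDiffOn ℝ 0 (derivWithin (derivWithin p (Icc 0 L)) (Icc 0 L)) (Icc 0 L) :=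
    h1.derivWithin hu (by norm_num)
  obtain ⟨K0, hK0⟩ := isCompact_Icc.exists_bound_of_continuousOn hp.continuousOn
  obtain ⟨K1, hK1⟩ := isCompact_Icc.exists_bound_of_continuousOn h1.continuousOn
  obtain ⟨K2, hK2⟩ := isCompact_Icc.exists_bound_of_continuousOn h2.continuousOn
  have h0L : (0 : ℝ) ∈ Icc 0 L := left_mem_Icc.2 hL.le
  refine ⟨_, _, max K0 (max K1 K2), ?_, fun x hx =>
    ((hp.differentiableOn (by norm_num)) x hx).hasDerivWithinAt, fun x hx =>
    ((h1.differentiableOn (by norm_num)) x hx).hasDerivWithinAt, fun x hx =>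
    (hK0 x hx).trans (le_max_left _ _), fun x hx =>
    (hK1 x hx).trans ((le_max_left _ _).trans (le_max_right _ _)), fun x hx =>
    (hK2 x hx).trans ((le_max_right _ _).trans (le_max_right _ _))⟩
  exact (norm_nonneg _).trans ((hK0 0 h0L).trans (le_max_left _ _))

/-- Asymptotics of a continuous family of bounded periodic solutions in the upper half plane. For
large `|z|` the quadratic a priori estimate leaves only small or large solutions; on a vertical ray
on which `|1 - exp (2 i z L)|` is bounded below, the solution is small far up, and hence everywhere
by continuity. -/
lemma riccati_asymptotics (hL : 0 < L) {p r : ℝ → ℂ} {u : ℝ → ℂ → ℂ}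
    (hp : ContDiffOn ℝ 2 p (Icc 0 L)) (hp0 : p L = p 0) {Kr : ℝ} (hr : ∀ x ∈ Icc 0 L, ‖r x‖ ≤ Kr)
    (hu : ∀ z : ℂ, 0 < z.im → IsRiccati L p r z fun x => u x z)
    (hc : ContinuousOn (fun P : ℝ × ℂ => u P.1 P.2) (Icc 0 L ×ˢ {z | 0 < z.im})) {κ : ℝ}
    (hκ : 0 < κ) (hκ1 : κ ≤ 1) :
    ∃ C R : ℝ, 0 ≤ C ∧ ∀ z : ℂ, 0 < z.im → R ≤ ‖z‖ → (∀ y : ℝ, z.im ≤ y →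
      κ ≤ ‖1 - Complex.exp (2 * Complex.I * (z.re + y * Complex.I) * L)‖) →
      ∀ x ∈ Icc 0 L, ‖u x z + p x / (2 * Complex.I * z)‖ ≤ C / ‖z‖ ^ 2 := by
  obtain ⟨p₁, p₂, K', hK'0, hp1, hp2, hpK', hp1K', hp2K'⟩ := exists_derivs_of_contDiffOn hL hp
  set K := max K' Kr with hKdef
  have hpK : ∀ x ∈ Icc 0 L, ‖p x‖ ≤ K := fun x hx => (hpK' x hx).trans (le_max_left _ _)
  have hp1K : ∀ x ∈ Icc 0 L, ‖p₁ x‖ ≤ K := fun x hx => (hp1K' x hx).trans (le_max_left _ _)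
  have hp2K : ∀ x ∈ Icc 0 L, ‖p₂ x‖ ≤ K := fun x hx => (hp2K' x hx).trans (le_max_left _ _)
  have hrK : ∀ x ∈ Icc 0 L, ‖r x‖ ≤ K := fun x hx => (hr x hx).trans (le_max_right _ _)
  have hK : 0 ≤ K := hK'0.trans (le_max_left _ _)
  clear_value K
  set C0 := (3 * K + 2 * K * L) / κ + 1 with hC0
  have hC0pos : 1 ≤ C0 := by rw [hC0]; linarith [show 0 ≤ (3 * K + 2 * K * L) / κ by positivity]
  have hmain : ∀ z : ℂ, 0 < z.im → κ ≤ ‖1 - Complex.exp (2 * Complex.I * z * L)‖ → ∀ A,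
      (∀ x ∈ Icc 0 L, ‖u x z‖ ≤ A) → ∀ x ∈ Icc 0 L,
      ‖u x z + p x / (2 * Complex.I * z)‖ ≤ C0 * (1 / ‖z‖ ^ 2 + A ^ 2) := by
    intro z hz hzκ A hA x hx
    refine ((hu z hz).norm_add_le hL hp1 hp2 hp0 hp1K hp2K hrK hz hκ hκ1 hzκ hA x hx).trans ?_
    gcongr
    rw [hC0]; linarith
  set C1 := K + C0 with hC1
  have hmain' : ∀ z : ℂ, 0 < z.im → 1 ≤ ‖z‖ → κ ≤ ‖1 - Complex.exp (2 * Complex.I * z * L)‖ → ∀ A,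
      (∀ x ∈ Icc 0 L, ‖u x z‖ ≤ A) → ∀ x ∈ Icc 0 L, ‖u x z‖ ≤ C1 / ‖z‖ + C0 * A ^ 2 := by
    intro z hz hz1 hzκ A hA x hx
    have h1 := hmain z hz hzκ A hA x hx
    have h2 : ‖p x / (2 * Complex.I * z)‖ ≤ K / ‖z‖ := by
      rw [norm_div, norm_two_I_mul]
      have h0 : 0 < ‖z‖ := by linarith
      exact div_le_div₀ hK (hpK x hx) h0 (by linarith)
    have h3 : 1 / ‖z‖ ^ 2 ≤ 1 / ‖z‖ := by
      apply one_div_le_one_div_of_le (by linarith); nlinarith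
    calc ‖u x z‖ = ‖(u x z + p x / (2 * Complex.I * z)) - p x / (2 * Complex.I * z)‖ := by
          congr 1; ring
      _ ≤ C0 * (1 / ‖z‖ ^ 2 + A ^ 2) + K / ‖z‖ := (norm_sub_le _ _).trans (add_le_add h1 h2)
      _ ≤ C0 * (1 / ‖z‖ + A ^ 2) + K / ‖z‖ := by gcongr
      _ = _ := by rw [hC1]; ring
  -- The threshold `c` satisfies `C0 c² = c / 2`: the quadratic estimate excludes the value `c` for
  -- the maximum of `|u|` once `C1 / |z| < c / 2`.
  set c := 1 / (2 * C0) with hcdef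
  have hc0 : 0 < c := by positivity
  have hC1pos : 0 < C1 := by rw [hC1]; linarith
  have hCc : C0 * c = 1 / 2 := by rw [hcdef]; field_simp
  refine ⟨C0 * (1 + (2 * C1) ^ 2), max 1 (2 * C1 / c + 1), by positivity, ?_⟩
  intro z hz hzR hzκ x hx
  have hz1 : 1 ≤ ‖z‖ := (le_max_left _ _).trans hzR
  have hzC : 2 * C1 / c + 1 ≤ ‖z‖ := (le_max_right _ _).trans hzR
  -- the point at height `y` above `z`
  set ζ : ℝ → ℂ := fun y => z.re + (max y z.im : ℝ) * Complex.I with hζ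
  have hζim : ∀ y, (ζ y).im = max y z.im := fun y => by simp [hζ]
  have hζre : ∀ y, (ζ y).re = z.re := fun y => by simp [hζ]
  have hζpos : ∀ y, 0 < (ζ y).im := fun y => by rw [hζim]; exact hz.trans_le (le_max_right _ _)
  have hζn : ∀ y, ‖z‖ ≤ ‖ζ y‖ := fun y => by
    rw [← sq_le_sq₀ (norm_nonneg _) (norm_nonneg _), ← Complex.normSq_eq_norm_sq,
      ← Complex.normSq_eq_norm_sq, Complex.normSq_apply, Complex.normSq_apply, hζim, hζre]
    nlinarith [le_max_right y z.im]
  have hζκ : ∀ y, κ ≤ ‖1 - Complex.exp (2 * Complex.I * ζ y * L)‖ := fun y =>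
    hzκ _ (le_max_right _ _)
  have hζz : ζ z.im = z := by simp [hζ]
  set f : ℝ → ℝ → ℝ := fun y x => ‖u (projIcc 0 L hL.le x) (ζ y)‖ with hf
  have hfc : Continuous (fun P : ℝ × ℝ => f P.1 P.2) := by
    have h1 : Continuous fun P : ℝ × ℝ =>
        (((projIcc 0 L hL.le P.2 : Icc (0 : ℝ) L) : ℝ), ζ P.1) := by
      refine Continuous.prodMk ?_ ?_
      · exact continuous_subtype_val.comp (continuous_projIcc.comp continuous_snd)
      · simp only [hζ]; fun_prop
    exact (hc.comp_continuous h1 fun P => ⟨(projIcc 0 L hL.le P.2).2, hζpos P.1⟩).norm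
  have hfu : ∀ y, ∀ x ∈ Icc 0 L, f y x = ‖u x (ζ y)‖ := fun y x hx => by
    simp [hf, projIcc_of_mem hL.le hx]
  have hne : (Icc 0 L).Nonempty := nonempty_Icc.2 hL.le
  set m : ℝ → ℝ := fun y => sSup (f y '' Icc 0 L) with hm
  have hmc : Continuous m := isCompact_Icc.continuous_sSup hfc
  have hle : ∀ y, ∀ x ∈ Icc 0 L, ‖u x (ζ y)‖ ≤ m y := fun y x hx => by
    rw [← hfu y x hx]
    refine le_csSup ⟨1, ?_⟩ (mem_image_of_mem _ hx)
    rintro _ ⟨x', hx', rfl⟩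
    rw [hfu y x' hx']
    exact (hu _ (hζpos y)).bound x' hx'
  have hle' : ∀ y B, (∀ x ∈ Icc 0 L, ‖u x (ζ y)‖ ≤ B) → m y ≤ B := fun y B hB => by
    refine csSup_le (hne.image _) ?_
    rintro _ ⟨x', hx', rfl⟩
    rw [hfu y x' hx']
    exact hB x' hx'
  have hm0 : ∀ y, 0 ≤ m y := fun y => (norm_nonneg _).trans (hle y 0 (left_mem_Icc.2 hL.le))
  have hkey : ∀ y, m y ≤ C1 / ‖z‖ + C0 * m y ^ 2 := fun y => hle' y _ fun x hx => by
    refine (hmain' (ζ y) (hζpos y) (hz1.trans (hζn y)) (hζκ y) (m y) (hle y) x hx).trans ?_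
    gcongr
    exact hζn y
  have hC1z : C1 / ‖z‖ < c / 2 := by
    rw [div_lt_iff₀ (by linarith)]
    have h1 : 2 * C1 / c < ‖z‖ := by linarith
    rw [div_lt_iff₀ hc0] at h1
    linarith
  have hmc' : ∀ y, m y ≠ c := fun y hy => by
    have h1 := hkey y
    rw [hy] at h1
    have h2 : C0 * c ^ 2 = c / 2 := by rw [pow_two, ← mul_assoc, hCc]; ring
    linarith
  -- far up the solution is small
  obtain ⟨Yb, hYb1, hYb2⟩ : ∃ Yb, z.im ≤ Yb ∧ m Yb < c := by
    set Yb := max z.im (2 * K / (κ * c) + 1) with hYb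
    have h1 : 2 * K / (κ * c) < Yb := lt_of_lt_of_le (lt_add_one _) (le_max_right _ _)
    refine ⟨Yb, le_max_left _ _, lt_of_le_of_ne (hle' _ _ fun x hx => ?_) (hmc' _)⟩
    have h2 := (hu _ (hζpos Yb)).norm_le_of_im hL hpK hrK (hζpos Yb) hκ hκ1 (hζκ Yb) x hx
    refine h2.trans ?_
    have h3 : (ζ Yb).im = Yb := by rw [hζim]; exact max_eq_left (le_max_left _ _)
    have hYp : 0 < Yb := hz.trans_le (le_max_left _ _)
    rw [h3, div_le_iff₀ (by positivity)]
    rw [div_lt_iff₀ (by positivity)] at h1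
    nlinarith
  -- By continuity the maximum cannot cross the threshold on the way down to `z`.
  have hmz : m z.im < c := by
    by_contra! hcon
    obtain ⟨y, -, hy⟩ := intermediate_value_Icc' hYb1 hmc.continuousOn ⟨hYb2.le, hcon⟩
    exact hmc' y hy
  have hmz2 : m z.im ≤ 2 * C1 / ‖z‖ := by
    have h1 := hkey z.im
    have h2 : C0 * m z.im ^ 2 ≤ m z.im / 2 := by
      have h3 : C0 * m z.im ≤ 1 / 2 := by
        rw [← hCc]; exact mul_le_mul_of_nonneg_left hmz.le (by linarith)
      nlinarith [hm0 z.im]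
    rw [mul_div_assoc]; linarith
  have hA : ∀ x ∈ Icc 0 L, ‖u x z‖ ≤ 2 * C1 / ‖z‖ := fun x hx => by
    have := hle z.im x hx
    rw [hζz] at this
    exact this.trans hmz2
  have hκz : κ ≤ ‖1 - Complex.exp (2 * Complex.I * z * L)‖ := by
    have := hζκ z.im
    rwa [hζz] at this
  refine (hmain z hz hκz _ hA x hx).trans (le_of_eq ?_)
  have : ‖z‖ ≠ 0 := by linarith
  field_simp

end Riccati

/-- The nonreal points at distance at least `δ` from the lattice `(π / L) ℤ`. -/
def awayFromLattice (L δ : ℝ) : Set ℂ :=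
  {z | z.im ≠ 0 ∧ ∀ k : ℤ, δ ≤ dist z ((k * Real.pi / L : ℝ) : ℂ)}

/-- Away from the lattice `(π / L) ℤ` in the upper half plane, `1 - exp (2 i z L)` is bounded below,
also at all points above. -/
lemma exists_kappa {L δ : ℝ} (hL : 0 < L) (hδ : 0 < δ) : ∃ κ : ℝ, 0 < κ ∧ κ ≤ 1 ∧
    ∀ z ∈ awayFromLattice L δ, 0 < z.im → ∀ y : ℝ, z.im ≤ y →
      κ ≤ ‖1 - Complex.exp (2 * Complex.I * (z.re + y * Complex.I) * L)‖ := by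
  set σ := min (1 / 2) (2 / Real.pi * (L * (δ / 2))) with hσ
  have hσ0 : 0 < σ := lt_min (by norm_num) (by positivity)
  have hσ1 : σ ≤ 1 / 2 := min_le_left _ _
  set κ₁ := 1 - Real.exp (-(δ * L)) with hκ₁
  have hκ₁0 : 0 < κ₁ := by
    rw [hκ₁, sub_pos, Real.exp_lt_one_iff]
    have := mul_pos hδ hL; linarith
  refine ⟨min κ₁ σ, lt_min hκ₁0 hσ0, (min_le_right _ _).trans (by linarith), ?_⟩
  intro z hz hzim y hy
  have e : Complex.exp (2 * Complex.I * (z.re + y * Complex.I) * L) =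
      Real.exp (-(2 * y * L)) * (Complex.cos (2 * L * z.re) + Complex.sin (2 * L * z.re) * Complex.I) := by
    rw [← Complex.exp_mul_I, Complex.ofReal_exp, ← Complex.exp_add]
    congr 1
    push_cast
    linear_combination (2 * y * L) * Complex.I_sq
  have hy0 : 0 < y := hzim.trans_le hy
  by_cases h1 : δ / 2 ≤ z.im
  · refine (min_le_left _ _).trans ?_
    have h2 : ‖Complex.exp (2 * Complex.I * (z.re + y * Complex.I) * L)‖ ≤ Real.exp (-(δ * L)) := by
      rw [Complex.norm_exp, Real.exp_le_exp]
      simp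
      nlinarith
    have h3 := norm_sub_norm_le (1 : ℂ) (Complex.exp (2 * Complex.I * (z.re + y * Complex.I) * L))
    rw [norm_one] at h3
    rw [hκ₁]; linarith
  · refine (min_le_right _ _).trans ?_
    push Not at h1
    -- the sine of `L Re z` is bounded below
    have hsin : σ ≤ |Real.sin (L * z.re)| := by
      set k := round (L * z.re / Real.pi) with hk
      have hpi := Real.pi_pos
      set t := L * z.re - k * Real.pi with ht
      have ht1 : |t| ≤ Real.pi / 2 := by
        have := abs_sub_round (L * z.re / Real.pi)
        have e2 : t = (L * z.re / Real.pi - k) * Real.pi := by rw [ht]; field_simp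
        rw [e2, abs_mul, abs_of_pos hpi]
        nlinarith
      have ht2 : L * (δ / 2) ≤ |t| := by
        have h2 := hz.2 k
        rw [Complex.dist_eq] at h2
        have h3 := Complex.norm_le_abs_re_add_abs_im (z - ((k * Real.pi / L : ℝ) : ℂ))
        simp only [Complex.sub_re, Complex.ofReal_re, Complex.sub_im, Complex.ofReal_im,
          sub_zero, abs_of_pos hzim] at h3
        have h4 : δ / 2 ≤ |z.re - k * Real.pi / L| := by linarith
        have e2 : t = L * (z.re - k * Real.pi / L) := by rw [ht]; field_simp
        rw [e2, abs_mul, abs_of_pos hL]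
        gcongr
      have h2 : |Real.sin (L * z.re)| = |Real.sin t| := by
        rw [ht, Real.sin_sub_int_mul_pi, abs_mul, abs_zpow]; simp
      rw [h2]
      refine (min_le_right _ _).trans ?_
      calc 2 / Real.pi * (L * (δ / 2)) ≤ 2 / Real.pi * |t| := by gcongr
        _ ≤ |Real.sin t| := Real.mul_abs_le_abs_sin ht1
    set ρ := Real.exp (-(2 * y * L)) with hρ
    have hcos : Real.cos (2 * L * z.re) = 1 - 2 * Real.sin (L * z.re) ^ 2 := by
      have := Real.cos_sq' (L * z.re)
      rw [mul_assoc, Real.cos_two_mul, this]; ring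
    have hs2 : σ ^ 2 ≤ Real.sin (L * z.re) ^ 2 := by
      rw [← sq_abs (Real.sin _)]; gcongr
    have hsq : σ ^ 2 ≤ ‖1 - Complex.exp (2 * Complex.I * (z.re + y * Complex.I) * L)‖ ^ 2 := by
      rw [e, ← Complex.normSq_eq_norm_sq, Complex.normSq_apply]
      have e1 : Complex.cos (2 * L * z.re) = (Real.cos (2 * L * z.re) : ℂ) := by push_cast; rfl
      have e2 : Complex.sin (2 * L * z.re) = (Real.sin (2 * L * z.re) : ℂ) := by push_cast; rfl
      have h5 := Real.sin_sq_add_cos_sq (2 * L * z.re)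
      have hρ0 : 0 < ρ := Real.exp_pos _
      have h6 : Real.cos (2 * L * z.re) ≤ 1 - 2 * σ ^ 2 := by rw [hcos]; linarith
      have h7 : σ ^ 2 ≤ 1 / 4 := by nlinarith
      rw [e1, e2]
      generalize Real.cos (2 * L * z.re) = cθ at *
      generalize Real.sin (2 * L * z.re) = sθ at *
      have h8 : (1 - ρ * cθ) * (1 - ρ * cθ) + ρ * sθ * (ρ * sθ) = 1 - 2 * ρ * cθ + ρ ^ 2 := by
        linear_combination ρ ^ 2 * h5
      have h9 : σ ^ 2 ≤ 1 - 2 * ρ * cθ + ρ ^ 2 := by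
        nlinarith [mul_le_mul_of_nonneg_left h6 hρ0.le, sq_nonneg (ρ - (1 - 2 * σ ^ 2)),
          sq_nonneg σ, mul_nonneg (sq_nonneg σ) (sub_nonneg.2 h7)]
      clear_value ρ
      simpa using h9.trans_eq h8.symm
    exact (pow_le_pow_iff_left₀ hσ0.le (norm_nonneg _) two_ne_zero).1 hsq

/-! ### Bloch solutions for nonreal spectral parameter -/

section defs

variable (Y : ℝ → ℂ → Mat2) (L : ℝ)

/-- The first entry of the eigenvector `(D, c)` of the monodromy matrix with eigenvalue `Δ + s`. -/
def blochD (z : ℂ) : ℂ := halfDiff Y L z + sRoot Y L z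

/-- The first component of the Bloch solution with initial value `(D, c)`. -/
def bloch1 (x : ℝ) (z : ℂ) : ℂ := Y x z 0 0 * blochD Y L z + Y x z 0 1 * mC Y L z

/-- The second component of the Bloch solution with initial value `(D, c)`. -/
def bloch2 (x : ℝ) (z : ℂ) : ℂ := Y x z 1 0 * blochD Y L z + Y x z 1 1 * mC Y L z

/-- The ratio of the components of the Bloch solution. -/
def blochRatio (x : ℝ) (z : ℂ) : ℂ := bloch2 Y L x z / bloch1 Y L x z

end defs

namespace IsPeriodicDirac

variable {L : ℝ} {q : ℝ → ℂ} {Y : ℝ → ℂ → Mat2}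

lemma blochD_eigen (h : IsPeriodicDirac L q Y) (z : ℂ) :
    mA Y L z * blochD Y L z + mB Y L z * mC Y L z =
      (discriminant Y L z + sRoot Y L z) * blochD Y L z ∧
    mC Y L z * blochD Y L z + mD Y L z * mC Y L z =
      (discriminant Y L z + sRoot Y L z) * mC Y L z := by
  have hs := sRoot_sq Y L z
  rw [h.discSq_eq] at hs
  rw [mA_eq, mD_eq, blochD]
  constructor
  · linear_combination -hs
  · ring

lemma blochD_ne_zero (h : IsPeriodicDirac L q Y) {z : ℂ} (hz : z.im ≠ 0) : blochD Y L z ≠ 0 :=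
  (h.bloch_bounds hz).1

lemma norm_mC_lt (h : IsPeriodicDirac L q Y) {z : ℂ} (hz : z.im ≠ 0) :
    ‖mC Y L z‖ < ‖blochD Y L z‖ := (h.bloch_bounds hz).2.1

lemma norm_mB_lt (h : IsPeriodicDirac L q Y) {z : ℂ} (hz : z.im ≠ 0) :
    ‖mB Y L z‖ < ‖blochD Y L z‖ := (h.bloch_bounds hz).2.2

lemma mult_ne_zero (Y : ℝ → ℂ → Mat2) (L : ℝ) (z : ℂ) :
    discriminant Y L z + sRoot Y L z ≠ 0 := fun h0 => by
  have := mult_mul Y (sRoot_sq Y L z)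
  rw [h0, zero_mul] at this
  exact zero_ne_one this

lemma norm_bloch2_lt (h : IsPeriodicDirac L q Y) {z : ℂ} (hz : z.im ≠ 0) {x : ℝ}
    (hx : x ∈ Icc 0 L) : ‖bloch2 Y L x z‖ < ‖bloch1 Y L x z‖ := by
  have hab : blochD Y L z ≠ 0 ∨ mC Y L z ≠ 0 := Or.inl (h.blochD_ne_zero hz)
  have h0 : 0 < ‖blochD Y L z‖ ^ 2 - ‖mC Y L z‖ ^ 2 :=
    sub_pos.2 (pow_lt_pow_left₀ (h.norm_mC_lt hz) (norm_nonneg _) two_ne_zero)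
  have hE : 0 < energy Y z (blochD Y L z) (mC Y L z) x := by
    rcases lt_or_gt_of_ne hz with hz | hz
    · have h1 := (h.energy_strictAnti hz hab).antitone hx.2
      rw [eigen_energy (h.blochD_eigen z).1 (h.blochD_eigen z).2] at h1
      refine lt_of_lt_of_le (mul_pos ?_ h0) h1
      have := norm_pos_iff.2 (mult_ne_zero Y L z)
      positivity
    · have h1 := (h.energy_strictMono hz hab).monotone hx.1
      rw [h.energy_zero] at h1
      exact h0.trans_le h1
  exact (pow_lt_pow_iff_left₀ (norm_nonneg _) (norm_nonneg _) two_ne_zero).1 (sub_pos.1 hE)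

lemma bloch1_ne_zero (h : IsPeriodicDirac L q Y) {z : ℂ} (hz : z.im ≠ 0) {x : ℝ}
    (hx : x ∈ Icc 0 L) : bloch1 Y L x z ≠ 0 :=
  norm_pos_iff.1 ((norm_nonneg _).trans_lt (h.norm_bloch2_lt hz hx))

lemma norm_blochRatio_le (h : IsPeriodicDirac L q Y) {z : ℂ} (hz : z.im ≠ 0) {x : ℝ}
    (hx : x ∈ Icc 0 L) : ‖blochRatio Y L x z‖ ≤ 1 := by
  rw [blochRatio, norm_div]
  exact div_le_one_of_le₀ (h.norm_bloch2_lt hz hx).le (norm_nonneg _)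

lemma hasDerivAt_blochRatio (h : IsPeriodicDirac L q Y) {z : ℂ} (hz : z.im ≠ 0) {x : ℝ}
    (hx : x ∈ Icc 0 L) : HasDerivAt (fun x => blochRatio Y L x z)
      (2 * Complex.I * z * blochRatio Y L x z + star (q x) - q x * blochRatio Y L x z ^ 2) x := by
  have hs := h.isSol_comb z (blochD Y L z) (mC Y L z)
  have hne := h.bloch1_ne_zero hz hx
  refine ((hs.snd x).div (hs.fst x) hne).congr_deriv ?_
  change _ = 2 * Complex.I * z * (bloch2 Y L x z / bloch1 Y L x z) + star (q x) -
    q x * (bloch2 Y L x z / bloch1 Y L x z) ^ 2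
  change ((star (q x) * bloch1 Y L x z + Complex.I * z * bloch2 Y L x z) * bloch1 Y L x z -
    bloch2 Y L x z * (-(Complex.I * z) * bloch1 Y L x z + q x * bloch2 Y L x z)) /
    bloch1 Y L x z ^ 2 = _
  field_simp
  ring

lemma bloch1_period (h : IsPeriodicDirac L q Y) (z : ℂ) :
    bloch1 Y L L z = (discriminant Y L z + sRoot Y L z) * blochD Y L z := (h.blochD_eigen z).1

lemma bloch2_period (h : IsPeriodicDirac L q Y) (z : ℂ) :
    bloch2 Y L L z = (discriminant Y L z + sRoot Y L z) * mC Y L z := (h.blochD_eigen z).2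

lemma bloch1_zero (h : IsPeriodicDirac L q Y) (z : ℂ) : bloch1 Y L 0 z = blochD Y L z := by
  simp [bloch1, h.sol.initial z]

lemma bloch2_zero (h : IsPeriodicDirac L q Y) (z : ℂ) : bloch2 Y L 0 z = mC Y L z := by
  simp [bloch2, h.sol.initial z]

lemma bloch_add_period (h : IsPeriodicDirac L q Y) (x : ℝ) (z : ℂ) :
    bloch1 Y L (x + L) z = (discriminant Y L z + sRoot Y L z) * bloch1 Y L x z ∧
    bloch2 Y L (x + L) z = (discriminant Y L z + sRoot Y L z) * bloch2 Y L x z := by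
  obtain ⟨h1, h2⟩ := h.blochD_eigen z
  rw [bloch1, bloch2, bloch1, bloch2, h.sol.add_period h.periodic x z]
  simp only [Matrix.mul_apply, Fin.sum_univ_two]
  rw [mA, mB, mC] at h1
  rw [mC, mD] at h2
  constructor
  · simp only [mC]; linear_combination Y x z 0 0 * h1 + Y x z 0 1 * h2
  · simp only [mC]; linear_combination Y x z 1 0 * h1 + Y x z 1 1 * h2

lemma blochRatio_period (h : IsPeriodicDirac L q Y) (z : ℂ) :
    blochRatio Y L L z = blochRatio Y L 0 z := by
  rw [blochRatio, blochRatio, h.bloch1_period, h.bloch2_period, h.bloch1_zero, h.bloch2_zero,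
    mul_div_mul_left _ _ (mult_ne_zero Y L z)]

lemma continuousOn_blochRatio (h : IsPeriodicDirac L q Y) :
    ContinuousOn (fun P : ℝ × ℂ => blochRatio Y L P.1 P.2) (Icc 0 L ×ˢ {z | z.im ≠ 0}) := by
  have hD : ContinuousOn (fun P : ℝ × ℂ => blochD Y L P.2) (Icc 0 L ×ˢ {z | z.im ≠ 0}) := by
    intro P hP
    have h1 : ContinuousAt (blochD Y L) P.2 :=
      (h.differentiable_halfDiff.continuous.continuousAt).add (h.analyticAt_sRoot hP.2).continuousAt
    exact (h1.comp (f := Prod.snd) continuousAt_snd).continuousWithinAt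
  have hC : ContinuousOn (fun P : ℝ × ℂ => mC Y L P.2) (Icc 0 L ×ˢ {z | z.im ≠ 0}) :=
    (h.differentiable_mC.continuous.comp continuous_snd).continuousOn
  refine ContinuousOn.div ?_ ?_ fun P hP => h.bloch1_ne_zero hP.2 hP.1
  · exact ((h.continuous_uncurry 1 0).continuousOn.mul hD).add
      ((h.continuous_uncurry 1 1).continuousOn.mul hC)
  · exact ((h.continuous_uncurry 0 0).continuousOn.mul hD).add
      ((h.continuous_uncurry 0 1).continuousOn.mul hC)

lemma periodic_zero (h : IsPeriodicDirac L q Y) : q L = q 0 := by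
  simpa using h.periodic 0

lemma isRiccati (h : IsPeriodicDirac L q Y) {z : ℂ} (hz : z.im ≠ 0) :
    IsRiccati L (fun x => star (q x)) q z fun x => blochRatio Y L x z where
  ode _ hx := h.hasDerivAt_blochRatio hz hx
  periodic := h.blochRatio_period z
  bound _ hx := h.norm_blochRatio_le hz hx

/-- The reflection `x ↦ L - x`, `z ↦ -z` exchanges the half planes. -/
lemma isRiccati_reflect (h : IsPeriodicDirac L q Y) {z : ℂ} (hz : z.im ≠ 0) :
    IsRiccati L (fun x => -star (q (L - x))) (fun x => -q (L - x)) z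
      fun x => blochRatio Y L (L - x) (-z) where
  ode x hx := by
    have hx' : L - x ∈ Icc 0 L := ⟨by linarith [hx.2], by linarith [hx.1]⟩
    have h1 := h.hasDerivAt_blochRatio (z := -z) (by simpa using hz) hx'
    have h2 : HasDerivAt (fun x : ℝ => L - x) (-1) x := by
      simpa using (hasDerivAt_id x).const_sub L
    refine (h1.scomp x h2).congr_deriv ?_
    rw [neg_smul, one_smul]
    ring
  periodic := by simpa using (h.blochRatio_period (-z)).symm
  bound x hx := h.norm_blochRatio_le (by simpa using hz) ⟨by linarith [hx.2], by linarith [hx.1]⟩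

lemma neg_mem_awayFromLattice {δ : ℝ} {z : ℂ} (hz : z ∈ awayFromLattice L δ) :
    -z ∈ awayFromLattice L δ := by
  refine ⟨by simpa using hz.1, fun k => ?_⟩
  have := hz.2 (-k)
  rw [Complex.dist_eq] at this ⊢
  have e : -z - ((k * Real.pi / L : ℝ) : ℂ) = -(z - (((-k : ℤ) * Real.pi / L : ℝ) : ℂ)) := by
    push_cast; ring
  rwa [e, norm_neg]

lemma star_mem_awayFromLattice {δ : ℝ} {z : ℂ} (hz : z ∈ awayFromLattice L δ) :
    star z ∈ awayFromLattice L δ := by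
  refine ⟨by simpa using hz.1, fun k => ?_⟩
  have := hz.2 k
  rw [Complex.dist_eq] at this ⊢
  rw [← norm_star]
  simpa using this

lemma contDiffOn_star {p : ℝ → ℂ} {s : Set ℝ} (hp : ContDiffOn ℝ 2 p s) :
    ContDiffOn ℝ 2 (fun x => star (p x)) s :=
  (Complex.conjCLE.contDiff.comp_contDiffOn hp :)

/-- The expansion of the Bloch ratio away from the lattice, in both half planes: a reflection
carries the lower one to the upper one. -/
lemma blochRatio_asymptotics (h : IsPeriodicDirac L q Y) {δ : ℝ} (hδ : 0 < δ) :
    ∃ C R : ℝ, 0 ≤ C ∧ 0 < R ∧ ∀ z ∈ awayFromLattice L δ, R ≤ ‖z‖ → ∀ x ∈ Icc 0 L,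
      ‖blochRatio Y L x z + star (q x) / (2 * Complex.I * z)‖ ≤ C / ‖z‖ ^ 2 := by
  obtain ⟨K, hK0, hK⟩ := h.exists_bound
  obtain ⟨κ, hκ, hκ1, hκz⟩ := exists_kappa h.pos hδ
  have hp := contDiffOn_star h.contDiffOn
  have hrefl : MapsTo (fun x : ℝ => L - x) (Icc 0 L) (Icc 0 L) := fun x hx =>
    ⟨by linarith [hx.2], by linarith [hx.1]⟩
  obtain ⟨C1, R1, hC1, h1⟩ := riccati_asymptotics h.pos (u := blochRatio Y L) hp
    (by rw [h.periodic_zero]) (fun x _ => hK x) (fun z hz => h.isRiccati hz.ne')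
    (h.continuousOn_blochRatio.mono (prod_mono le_rfl fun z (hz : 0 < z.im) => hz.ne')) hκ hκ1
  obtain ⟨C2, R2, hC2, h2⟩ := riccati_asymptotics h.pos
    (p := fun x => -star (q (L - x))) (r := fun x => -q (L - x))
    (u := fun x z => blochRatio Y L (L - x) (-z))
    ((hp.comp (contDiff_const.sub contDiff_id).contDiffOn hrefl).neg)
    (by simp [h.periodic_zero]) (fun x _ => by rw [norm_neg]; exact hK _)
    (fun z hz => h.isRiccati_reflect hz.ne') (by
      refine h.continuousOn_blochRatio.comp (f := fun P : ℝ × ℂ => (L - P.1, -P.2)) (by fun_prop) ?_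
      intro P hP
      exact ⟨hrefl hP.1, by simpa using (show 0 < P.2.im from hP.2).ne'⟩) hκ hκ1
  refine ⟨max C1 C2, max 1 (max R1 R2), hC1.trans (le_max_left _ _), by positivity, ?_⟩
  intro z hz hzR x hx
  have hzR1 : R1 ≤ ‖z‖ := (le_max_left _ _).trans ((le_max_right _ _).trans hzR)
  have hzR2 : R2 ≤ ‖z‖ := (le_max_right _ _).trans ((le_max_right _ _).trans hzR)
  rcases lt_or_gt_of_ne hz.1 with hi | hi
  · have hz' := neg_mem_awayFromLattice hz
    have hi' : 0 < (-z).im := by simpa using hi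
    have := h2 (-z) hi' (by rwa [norm_neg]) (hκz _ hz' hi') (L - x) (hrefl hx)
    rw [norm_neg, neg_neg, sub_sub_cancel] at this
    refine le_trans (le_of_eq ?_) (this.trans ?_)
    · congr 2; rw [mul_neg, div_neg, neg_div, neg_neg]
    · gcongr; exact le_max_right _ _
  · refine (h1 z hi hzR1 (hκz _ hz hi) x hx).trans ?_
    gcongr; exact le_max_left _ _

lemma eventually_discSq_ne_zero (h : IsPeriodicDirac L q Y) (z : ℂ) :
    ∀ᶠ w in 𝓝[≠] z, discSq Y L w ≠ 0 := by
  have ha : AnalyticOnNhd ℂ (discSq Y L) univ :=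
    Complex.analyticOnNhd_univ_iff_differentiable.2 h.differentiable_discSq
  rcases (ha z (mem_univ _)).eventually_eq_zero_or_eventually_ne_zero with h0 | h0
  · exact absurd (ha.eqOn_zero_of_preconnected_of_eventuallyEq_zero isPreconnected_univ
      (mem_univ z) h0 (mem_univ Complex.I)) (h.discSq_ne_zero (by simp))
  · exact h0

lemma eventually_dirFun_ne_zero (h : IsPeriodicDirac L q Y) (z : ℂ) :
    ∀ᶠ w in 𝓝[≠] z, dirFun Y L w ≠ 0 := by
  have ha : AnalyticOnNhd ℂ (dirFun Y L) univ :=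
    Complex.analyticOnNhd_univ_iff_differentiable.2 h.differentiable_dirFun
  rcases (ha z (mem_univ _)).eventually_eq_zero_or_eventually_ne_zero with h0 | h0
  · exact absurd (ha.eqOn_zero_of_preconnected_of_eventuallyEq_zero isPreconnected_univ
      (mem_univ z) h0 (mem_univ Complex.I)) (h.dirFun_ne_zero (by simp))
  · exact h0

lemma tendsto_ofReal_nhdsNE (t : ℝ) : Tendsto (fun x : ℝ => (x : ℂ)) (𝓝[≠] t) (𝓝[≠] (t : ℂ)) :=
  tendsto_nhdsWithin_iff.2 ⟨(Complex.continuous_ofReal.tendsto t).mono_left nhdsWithin_le_nhds,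
    eventually_mem_nhdsWithin.mono fun _ hx => by simpa using hx⟩

/-- The Bloch ratio continues analytically across the spectrum. -/
lemma exists_extension_blochRatio (h : IsPeriodicDirac L q Y) {V : Set ℂ} (hV : IsOpen V)
    (hs : ∀ t : ℝ, (t : ℂ) ∈ V → (mA Y L t).re ^ 2 ≤ 1) {x : ℝ} (hx : x ∈ Icc 0 L) :
    ∃ F : ℂ → ℂ, DifferentiableOn ℂ F V ∧ ∀ z ∈ V, z.im ≠ 0 → F z = blochRatio Y L x z := by
  have hY := fun i j => h.differentiable_entry x i j
  refine exists_extension hV (Z := {t : ℝ | discSq Y L t = 0}) ?_ ?_ ?_ ?_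
  · intro z hz
    have hD : DifferentiableAt ℂ (blochD Y L) z :=
      (h.differentiable_halfDiff z).add (h.analyticAt_sRoot hz.2).differentiableAt
    exact (((hY 1 0 z).mul hD).add ((hY 1 1 z).mul (h.differentiable_mC z))).div
      (((hY 0 0 z).mul hD).add ((hY 0 1 z).mul (h.differentiable_mC z)))
      (h.bloch1_ne_zero hz.2 hx) |>.differentiableWithinAt
  · exact fun t _ => (tendsto_ofReal_nhdsNE t).eventually (h.eventually_discSq_ne_zero t)
  · intro t htV ht
    have hlt : (mA Y L t).re ^ 2 < 1 := by
      refine lt_of_le_of_ne (hs t htV) fun h1 => ht ?_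
      change discSq Y L t = 0
      rw [h.discSq_real, h1]; simp
    obtain ⟨s, hsa, -, hsC, hse⟩ := h.sRoot_near_band hlt
    set D := fun z => halfDiff Y L z + s z with hD
    have hDc : ContinuousAt D t := h.differentiable_halfDiff.continuous.continuousAt.add
      hsa.continuousAt
    set b1 := fun z => Y x z 0 0 * D z + Y x z 0 1 * mC Y L z with hb1
    set b2 := fun z => Y x z 1 0 * D z + Y x z 1 1 * mC Y L z with hb2
    -- On the real line the energy is constant in `x`, and positive at `x = 0`.
    have hne : b1 t ≠ 0 := by
      have h1 := h.energy_const (z := t) (a := D t) (b := mC Y L t) (by simp) x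
      have h2 : 0 < ‖D t‖ ^ 2 - ‖mC Y L t‖ ^ 2 :=
        sub_pos.2 (pow_lt_pow_left₀ hsC (norm_nonneg _) two_ne_zero)
      rw [← h1, energy] at h2
      intro h0
      simp only [hb1] at h0
      rw [h0, norm_zero] at h2
      nlinarith [sq_nonneg ‖Y x t 1 0 * D t + Y x t 1 1 * mC Y L t‖]
    have hcont : ContinuousAt (fun z => b2 z / b1 z) t :=
      (((hY 1 0).continuous.continuousAt.mul hDc).add
        ((hY 1 1).continuous.continuousAt.mul h.differentiable_mC.continuous.continuousAt)).div
        (((hY 0 0).continuous.continuousAt.mul hDc).add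
        ((hY 0 1).continuous.continuousAt.mul h.differentiable_mC.continuous.continuousAt)) hne
    refine ⟨_, (hcont.tendsto.mono_left nhdsWithin_le_nhds).congr' ?_⟩
    filter_upwards [nhdsWithin_le_nhds hse, self_mem_nhdsWithin] with z hz hzi
    simp only [blochRatio, bloch1, bloch2, blochD, hz hzi, hb1, hb2, hD]
  · intro t _ _
    have h1 : Tendsto (fun z : ℂ => z - t) (𝓝[{z | z.im ≠ 0}] (t : ℂ)) (𝓝 0) := by
      have : Tendsto (fun z : ℂ => z - t) (𝓝 (t : ℂ)) (𝓝 ((t : ℂ) - t)) :=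
        (continuous_id.sub continuous_const).tendsto _
      rw [sub_self] at this
      exact this.mono_left nhdsWithin_le_nhds
    refine squeeze_zero_norm' (a := fun z : ℂ => ‖z - t‖) ?_ (by simpa using h1.norm)
    filter_upwards [self_mem_nhdsWithin] with z hz
    rw [norm_mul]
    exact mul_le_of_le_one_right (norm_nonneg _) (h.norm_blochRatio_le hz hx)

/-- The nonreal points at distance at least `δ` from the resolvent set on the real line. -/
def _root_.PeriodicDirac.awayFromResolvent (Y : ℝ → ℂ → Mat2) (L δ : ℝ) : Set ℂ :=
  {z | z.im ≠ 0 ∧ ∀ t : ℝ, dist z t < δ → (mA Y L t).re ^ 2 ≤ 1}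

/-- Near a point of the lattice `(π / L) ℤ` which is far from the gaps, the asymptotics follow from
those on a circle by the maximum principle. -/
lemma blochRatio_asymptotics' (h : IsPeriodicDirac L q Y) {δ : ℝ} (hδ : 0 < δ) :
    ∃ C R : ℝ, 0 ≤ C ∧ 0 < R ∧ ∀ z ∈ awayFromResolvent Y L δ, R ≤ ‖z‖ → ∀ x ∈ Icc 0 L,
      ‖blochRatio Y L x z + star (q x) / (2 * Complex.I * z)‖ ≤ C / ‖z‖ ^ 2 := by
  have hL := h.pos
  have hpi := Real.pi_pos
  set ρ := min δ (Real.pi / L) / 4 with hρdef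
  have hρ : 0 < ρ := by positivity
  have hρ1 : 4 * ρ ≤ δ := by rw [hρdef]; linarith [min_le_left δ (Real.pi / L)]
  have hρ2 : 4 * ρ ≤ Real.pi / L := by rw [hρdef]; linarith [min_le_right δ (Real.pi / L)]
  obtain ⟨C, R, hC, hR, hCR⟩ := h.blochRatio_asymptotics hρ
  refine ⟨C, R + 4 * ρ, hC, by positivity, ?_⟩
  intro z hz hzR x hx
  by_cases hzl : z ∈ awayFromLattice L ρ
  · exact hCR z hzl (by linarith) x hx
  obtain ⟨k, hk⟩ : ∃ k : ℤ, dist z ((k * Real.pi / L : ℝ) : ℂ) < ρ := by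
    by_contra! hcon
    exact hzl ⟨hz.1, hcon⟩
  set a : ℂ := ((k * Real.pi / L : ℝ) : ℂ) with ha
  obtain ⟨F, hFd, hF⟩ := h.exists_extension_blochRatio (V := Metric.ball a (3 * ρ))
    Metric.isOpen_ball (fun t ht => hz.2 t (by
      have := dist_triangle_right z t a
      rw [Metric.mem_ball] at ht
      linarith)) hx
  have hbig : ∀ w ∈ Metric.ball a (3 * ρ), R < ‖w‖ := fun w hw => by
    rw [Metric.mem_ball] at hw
    have h1 := dist_triangle_right z w a
    have h2 := norm_sub_norm_le z w
    rw [dist_eq_norm] at h1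
    linarith
  have hsub : Metric.closedBall a (2 * ρ) ⊆ Metric.ball a (3 * ρ) :=
    Metric.closedBall_subset_ball (by linarith)
  -- The error times `z²`, which is holomorphic across the real line.
  set f : ℂ → ℂ := fun w => w ^ 2 * F w + w * star (q x) / (2 * Complex.I) with hf
  have hfd : DifferentiableOn ℂ f (Metric.ball a (3 * ρ)) := by
    have : DifferentiableOn ℂ (fun w : ℂ => w * star (q x) / (2 * Complex.I))
      (Metric.ball a (3 * ρ)) := by fun_prop
    exact ((differentiableOn_id.pow 2).mul hFd).add this
  have hfe : ∀ w ∈ Metric.ball a (3 * ρ), w.im ≠ 0 →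
      f w = w ^ 2 * (blochRatio Y L x w + star (q x) / (2 * Complex.I * w)) := fun w hw hwi => by
    have hw0 : w ≠ 0 := by rintro rfl; simp at hwi
    simp only [hf]
    rw [hF w hw hwi]
    field_simp
  have hpt : ∀ w ∈ Metric.ball a (3 * ρ), w ∈ awayFromLattice L ρ → ‖f w‖ ≤ C := fun w hw hwl => by
    rw [hfe w hw hwl.1, norm_mul, norm_pow]
    have h1 := hCR w hwl (hbig w hw).le x hx
    have h2 : 0 < ‖w‖ ^ 2 := by have := hbig w hw; have : 0 < ‖w‖ := by linarith
                                positivity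
    rwa [le_div_iff₀ h2, mul_comm] at h1
  -- The circle of radius `2 ρ` keeps the distance `ρ` from all lattice points, which are at least
  -- `4 ρ` apart.
  have hsph : ∀ w ∈ Metric.sphere a (2 * ρ), ‖f w‖ ≤ C := by
    intro w hw
    have hwb : w ∈ Metric.ball a (3 * ρ) := hsub (Metric.sphere_subset_closedBall hw)
    refine norm_le_of_im_ne_zero (g := fun _ => C)
      (hfd.continuousOn.continuousAt (Metric.isOpen_ball.mem_nhds hwb)) continuousAt_const ?_
    filter_upwards [Metric.isOpen_ball.mem_nhds hwb, Metric.ball_mem_nhds w hρ] with w' hw' hww hi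
    refine hpt w' hw' ⟨hi, fun j => ?_⟩
    rw [Metric.mem_sphere] at hw
    rw [Metric.mem_ball] at hww
    by_cases hjk : j = k
    · subst hjk
      have := dist_triangle w w' a
      rw [dist_comm w w'] at this
      linarith
    · have h1 : Real.pi / L ≤ dist a ((j * Real.pi / L : ℝ) : ℂ) := by
        rw [ha, Complex.dist_eq, ← Complex.ofReal_sub, Complex.norm_real, Real.norm_eq_abs]
        have e : (k : ℝ) * Real.pi / L - j * Real.pi / L = ((k - j : ℤ) : ℝ) * (Real.pi / L) := by
          push_cast; ring
        rw [e, abs_mul, abs_of_pos (show 0 < Real.pi / L by positivity)]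
        have h2 : (1 : ℝ) ≤ |((k - j : ℤ) : ℝ)| := by
          rw [← Int.cast_abs]
          exact_mod_cast Int.one_le_abs (sub_ne_zero.2 (Ne.symm hjk))
        exact le_mul_of_one_le_left (by positivity) h2
      have h3 := dist_triangle_left a ((j * Real.pi / L : ℝ) : ℂ) w'
      have h4 := dist_triangle w' w a
      linarith
  have hzb : z ∈ Metric.closedBall a (2 * ρ) := by
    rw [Metric.mem_closedBall]; linarith
  have hfin := norm_le_of_forall_mem_sphere (hfd.mono hsub) (by positivity) hsph hzb
  rw [hfe z (hsub hzb) hz.1, norm_mul, norm_pow] at hfin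
  have h2 : 0 < ‖z‖ ^ 2 := by have : 0 < ‖z‖ := by linarith
                              positivity
  rwa [le_div_iff₀ h2, mul_comm]

end IsPeriodicDirac

/-! ### The normalized Bloch matrix -/

section defs

variable (Y : ℝ → ℂ → Mat2) (L : ℝ)

/-- The first component of the Bloch solution, normalized to behave like `exp (-i z x)`, with the
exponential removed. -/
def chi1 (x : ℝ) (z : ℂ) : ℂ :=
  bloch1 Y L x z / (blochD Y L z + mC Y L z) * Complex.exp (Complex.I * z * x)

/-- The second component of the normalized Bloch solution, with the exponential removed. -/
def chi2 (x : ℝ) (z : ℂ) : ℂ :=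
  bloch2 Y L x z / (blochD Y L z + mC Y L z) * Complex.exp (Complex.I * z * x)

/-- The matrix of the two normalized Bloch solutions, with the exponentials removed. The second
column is obtained from the first by the symmetry `z ↦ conj z`. -/
def matX (x : ℝ) (z : ℂ) : Mat2 :=
  !![chi1 Y L x z, star (chi2 Y L x (star z)); chi2 Y L x z, star (chi1 Y L x (star z))]

/-- Up to the factor `2 s`, the inverse of the matrix of initial values of the two normalized Bloch
solutions, as a function of the root `s` of `Δ² - 1`. -/
def matN (s z : ℂ) : Mat2 :=
  !![halfDiff Y L z + s + mC Y L z, mB Y L z - halfDiff Y L z + s;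
     -mC Y L z - halfDiff Y L z + s, halfDiff Y L z - mB Y L z + s]

/-- The adjugate of `matN`. -/
def matNadj (s z : ℂ) : Mat2 :=
  !![halfDiff Y L z - mB Y L z + s, halfDiff Y L z - mB Y L z - s;
     halfDiff Y L z + mC Y L z - s, halfDiff Y L z + s + mC Y L z]

/-- The inverse of the normalized Bloch matrix. -/
def matXinv (x : ℝ) (z : ℂ) : Mat2 :=
  (2 * sRoot Y L z)⁻¹ • (expSigma3 (-(Complex.I * z * x)) * matN Y L (sRoot Y L z) z *
    (Y x z).adjugate)

end defs

lemma expSigma3_mul (a b : ℂ) : expSigma3 a * expSigma3 b = expSigma3 (a + b) := by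
  ext i j
  fin_cases i <;> fin_cases j <;>
    simp [expSigma3, Matrix.mul_apply, Complex.exp_add, mul_comm]

lemma expSigma3_zero : expSigma3 0 = 1 := by
  ext i j; fin_cases i <;> fin_cases j <;> simp [expSigma3]

lemma sigma1_mul_self : sigma1 * sigma1 = 1 := by
  ext i j; fin_cases i <;> fin_cases j <;> simp [sigma1]

lemma sigma1_mul_expSigma3 (a : ℂ) : sigma1 * expSigma3 a = expSigma3 (-a) * sigma1 := by
  ext i j
  fin_cases i <;> fin_cases j <;> simp [sigma1, expSigma3, Matrix.mul_apply]

lemma matN_neg (Y : ℝ → ℂ → Mat2) (L : ℝ) (s z : ℂ) :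
    matN Y L (-s) z = -(sigma1 * matN Y L s z) := by
  ext i j
  fin_cases i <;> fin_cases j <;> simp [sigma1, matN] <;> ring

lemma matN_mul_matNadj (Y : ℝ → ℂ → Mat2) (L : ℝ) (s z : ℂ) :
    matN Y L s z * matNadj Y L s z = (2 * s * dirFun Y L z) • (1 : Mat2) ∧
    matNadj Y L s z * matN Y L s z = (2 * s * dirFun Y L z) • (1 : Mat2) := by
  have e : dirFun Y L z = 2 * halfDiff Y L z - mB Y L z + mC Y L z := by
    rw [dirFun, halfDiff]; ring
  rw [e]
  constructor
  · ext i j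
    fin_cases i <;> fin_cases j <;> simp [matN, matNadj, Matrix.mul_apply] <;> ring
  · ext i j
    fin_cases i <;> fin_cases j <;> simp [matN, matNadj, Matrix.mul_apply] <;> ring

namespace IsPeriodicDirac

variable {L : ℝ} {q : ℝ → ℂ} {Y : ℝ → ℂ → Mat2}

lemma det_Y (h : IsPeriodicDirac L q Y) (x : ℝ) (z : ℂ) : (Y x z).det = 1 := by
  rw [Matrix.det_fin_two]
  linear_combination h.sol.det_eq x z

lemma discriminant_star (h : IsPeriodicDirac L q Y) (z : ℂ) :
    discriminant Y L (star z) = star (discriminant Y L z) := by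
  obtain ⟨h1, -, -, h4⟩ := h.star_symm z
  rw [discriminant_eq, discriminant_eq, h1, h4]
  simp [add_comm]

lemma halfDiff_star (h : IsPeriodicDirac L q Y) (z : ℂ) :
    halfDiff Y L (star z) = -star (halfDiff Y L z) := by
  obtain ⟨h1, -, -, h4⟩ := h.star_symm z
  rw [halfDiff, halfDiff, h1, h4]
  simp; ring

lemma sRoot_star (h : IsPeriodicDirac L q Y) {z : ℂ} (hz : z.im ≠ 0) :
    sRoot Y L (star z) = -star (sRoot Y L z) := by
  symm
  refine h.eq_sRoot_of_norm (by simpa using hz) ?_ ?_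
  · rw [neg_sq, ← star_pow, sRoot_sq, discSq, discSq, h.discriminant_star]; simp
  · rw [h.discriminant_star, ← star_neg, ← star_add, norm_star]
    have h1 := h.norm_mult_neg hz (sRoot_sq Y L z)
    have h2 := h.one_lt_norm_iff hz
    have h3 : (star z).im = -z.im := by simp
    rw [h3, Left.neg_pos_iff]
    constructor
    · intro h4
      by_contra! h5
      exact (h1.1 (h2.2 (lt_of_le_of_ne h5 (Ne.symm hz)))) h4
    · intro h4
      by_contra h5
      exact absurd (h2.1 (h1.2 h5)) (by linarith)

lemma blochD_star (h : IsPeriodicDirac L q Y) {z : ℂ} (hz : z.im ≠ 0) :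
    blochD Y L (star z) = -star (blochD Y L z) := by
  rw [blochD, blochD, h.halfDiff_star, h.sRoot_star hz, star_add]; ring

lemma blochD_add_mC_ne_zero (h : IsPeriodicDirac L q Y) {z : ℂ} (hz : z.im ≠ 0) :
    blochD Y L z + mC Y L z ≠ 0 := fun h0 => by
  have h1 := h.norm_mC_lt hz
  rw [eq_neg_of_add_eq_zero_left h0, norm_neg] at h1
  exact lt_irrefl _ h1

lemma blochD_sub_mB_ne_zero (h : IsPeriodicDirac L q Y) {z : ℂ} (hz : z.im ≠ 0) :
    blochD Y L z - mB Y L z ≠ 0 := fun h0 => by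
  have h1 := h.norm_mB_lt hz
  rw [sub_eq_zero.1 h0] at h1
  exact lt_irrefl _ h1

lemma dirFun_mul_blochD (h : IsPeriodicDirac L q Y) (z : ℂ) :
    dirFun Y L z * blochD Y L z =
      (blochD Y L z + mC Y L z) * (blochD Y L z - mB Y L z) := by
  have e : dirFun Y L z = 2 * halfDiff Y L z - mB Y L z + mC Y L z := by
    rw [dirFun, halfDiff]; ring
  have hs := sRoot_sq Y L z
  rw [h.discSq_eq] at hs
  rw [e, blochD]
  linear_combination -hs

/-- The normalized Bloch matrix in terms of the monodromy matrix; the denominator is the function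
whose zeros are the Dirichlet eigenvalues. -/
lemma matX_eq (h : IsPeriodicDirac L q Y) (x : ℝ) {z : ℂ} (hz : z.im ≠ 0) :
    matX Y L x z = (dirFun Y L z)⁻¹ • (Y x z * matNadj Y L (sRoot Y L z) z *
      expSigma3 (Complex.I * z * x)) := by
  have hD := h.dirFun_ne_zero hz
  have h1 := h.blochD_add_mC_ne_zero hz
  have h2 := h.blochD_sub_mB_ne_zero hz
  have hz' : (star z).im ≠ 0 := by simpa using hz
  obtain ⟨s1, s2, s3, s4⟩ := h.sol.star_symm x z
  have hE : dirFun Y L z * blochD Y L z =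
      (blochD Y L z + mC Y L z) * (blochD Y L z - mB Y L z) := h.dirFun_mul_blochD z
  have hs := sRoot_sq Y L z
  rw [h.discSq_eq] at hs
  -- the entries of the adjugate in terms of the eigenvectors
  have e1 : blochD Y L z / (blochD Y L z + mC Y L z) =
      (halfDiff Y L z - mB Y L z + sRoot Y L z) / dirFun Y L z := by
    rw [div_eq_div_iff h1 hD, mul_comm, hE, blochD]; ring
  have e2 : mC Y L z / (blochD Y L z + mC Y L z) =
      (halfDiff Y L z + mC Y L z - sRoot Y L z) / dirFun Y L z := by
    have e : dirFun Y L z = 2 * halfDiff Y L z - mB Y L z + mC Y L z := by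
      rw [dirFun, halfDiff]; ring
    rw [div_eq_div_iff h1 hD, e, blochD]; linear_combination hs
  have e3 : mB Y L z / (mB Y L z - blochD Y L z) =
      (halfDiff Y L z - mB Y L z - sRoot Y L z) / dirFun Y L z := by
    have e : dirFun Y L z = 2 * halfDiff Y L z - mB Y L z + mC Y L z := by
      rw [dirFun, halfDiff]; ring
    rw [div_eq_div_iff (by rw [← neg_ne_zero]; simpa using h2) hD, e, blochD]
    linear_combination -hs
  have e4 : -blochD Y L z / (mB Y L z - blochD Y L z) =
      (halfDiff Y L z + sRoot Y L z + mC Y L z) / dirFun Y L z := by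
    rw [div_eq_div_iff (by rw [← neg_ne_zero]; simpa using h2) hD]
    rw [blochD] at hE ⊢; linear_combination -hE
  have hst : blochD Y L (star z) + mC Y L (star z) = star (mB Y L z - blochD Y L z) := by
    rw [h.blochD_star hz, (h.star_symm z).2.1, star_sub]; ring
  have hex : star (Complex.exp (Complex.I * star z * x)) = Complex.exp (-(Complex.I * z * x)) := by
    change (starRingEnd ℂ) _ = _
    rw [← Complex.exp_conj]; congr 1; simp
  have c1 : star (chi2 Y L x (star z)) = (Y x z 0 0 * (mB Y L z / (mB Y L z - blochD Y L z)) +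
      Y x z 0 1 * (-blochD Y L z / (mB Y L z - blochD Y L z))) *
        Complex.exp (-(Complex.I * z * x)) := by
    rw [chi2, star_mul', star_div₀, hex, hst, star_star, bloch2, s2, s4, h.blochD_star hz,
      (h.star_symm z).2.1]
    simp only [star_add, star_mul', star_neg, star_star]
    ring
  have c2 : star (chi1 Y L x (star z)) = (Y x z 1 0 * (mB Y L z / (mB Y L z - blochD Y L z)) +
      Y x z 1 1 * (-blochD Y L z / (mB Y L z - blochD Y L z))) *
        Complex.exp (-(Complex.I * z * x)) := by
    rw [chi1, star_mul', star_div₀, hex, hst, star_star, bloch1, s1, s3, h.blochD_star hz,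
      (h.star_symm z).2.1]
    simp only [star_add, star_mul', star_neg, star_star]
    ring
  have c3 : chi1 Y L x z = (Y x z 0 0 * (blochD Y L z / (blochD Y L z + mC Y L z)) +
      Y x z 0 1 * (mC Y L z / (blochD Y L z + mC Y L z))) * Complex.exp (Complex.I * z * x) := by
    rw [chi1, bloch1]; ring
  have c4 : chi2 Y L x z = (Y x z 1 0 * (blochD Y L z / (blochD Y L z + mC Y L z)) +
      Y x z 1 1 * (mC Y L z / (blochD Y L z + mC Y L z))) * Complex.exp (Complex.I * z * x) := by
    rw [chi2, bloch2]; ring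
  rw [matX, c1, c2, c3, c4, e1, e2, e3, e4]
  ext i j
  fin_cases i <;> fin_cases j <;>
    simp [matNadj, expSigma3, Matrix.mul_apply] <;> ring

lemma matX_mul_matXinv (h : IsPeriodicDirac L q Y) (x : ℝ) {z : ℂ} (hz : z.im ≠ 0) :
    matX Y L x z * matXinv Y L x z = 1 := by
  have hD := h.dirFun_ne_zero hz
  have hs := h.sRoot_ne_zero hz
  rw [h.matX_eq x hz, matXinv, Matrix.smul_mul, Matrix.mul_smul, smul_smul]
  have e : Y x z * matNadj Y L (sRoot Y L z) z * expSigma3 (Complex.I * z * x) *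
      (expSigma3 (-(Complex.I * z * x)) * matN Y L (sRoot Y L z) z * (Y x z).adjugate) =
      Y x z * (matNadj Y L (sRoot Y L z) z * ((expSigma3 (Complex.I * z * x) *
      expSigma3 (-(Complex.I * z * x))) * matN Y L (sRoot Y L z) z)) * (Y x z).adjugate := by
    simp only [Matrix.mul_assoc]
  rw [e, expSigma3_mul, add_neg_cancel, expSigma3_zero, Matrix.one_mul,
    (matN_mul_matNadj Y L _ z).2, Matrix.mul_smul, Matrix.mul_one, Matrix.smul_mul,
    Matrix.mul_adjugate, h.det_Y, smul_smul, smul_smul]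
  rw [show (dirFun Y L z)⁻¹ * (2 * sRoot Y L z)⁻¹ * (2 * sRoot Y L z * dirFun Y L z) * 1 = 1 by
    field_simp, one_smul]

lemma matXinv_mul_matX (h : IsPeriodicDirac L q Y) (x : ℝ) {z : ℂ} (hz : z.im ≠ 0) :
    matXinv Y L x z * matX Y L x z = 1 := mul_eq_one_comm.1 (h.matX_mul_matXinv x hz)

lemma blochRatio_zero (h : IsPeriodicDirac L q Y) (z : ℂ) :
    blochRatio Y L 0 z = mC Y L z / blochD Y L z := by
  rw [blochRatio, h.bloch1_zero, h.bloch2_zero]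

/-- If the Bloch ratio is at most `ε` on a period, the first component of the Bloch solution is
close to `exp (-i z x)`. -/
lemma norm_bloch1_sub_le (h : IsPeriodicDirac L q Y) {K : ℝ} (hK : ∀ x, ‖q x‖ ≤ K) {z : ℂ}
    (hz : z.im ≠ 0) {ε : ℝ} (hε : ∀ x ∈ Icc 0 L, ‖blochRatio Y L x z‖ ≤ ε) {x : ℝ}
    (hx : x ∈ Icc 0 L) :
    ‖bloch1 Y L x z / blochD Y L z * Complex.exp (Complex.I * z * x) - 1‖ ≤
      K * ε * Real.exp (K * ε * L) * L := by
  have hD := h.blochD_ne_zero hz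
  have hK0 : 0 ≤ K := (norm_nonneg _).trans (hK 0)
  have hε0 : 0 ≤ ε := (norm_nonneg _).trans (hε x hx)
  set y : ℝ → ℂ := fun x => bloch1 Y L x z / blochD Y L z * Complex.exp (Complex.I * z * x) with hy
  have hyd : ∀ x ∈ Icc 0 L, HasDerivAt y (q x * blochRatio Y L x z * y x) x := by
    intro x hx
    have hs := (h.isSol_comb z (blochD Y L z) (mC Y L z)).fst x
    have he : HasDerivAt (fun x : ℝ => Complex.exp (Complex.I * z * x))
        (Complex.exp (Complex.I * z * x) * (Complex.I * z)) x := by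
      have h1 : HasDerivAt (fun s : ℝ => Complex.I * z * (s : ℂ)) (Complex.I * z) x := by
        simpa using (Complex.ofRealCLM.hasDerivAt (x := x)).const_mul (Complex.I * z)
      exact h1.cexp
    have hne := h.bloch1_ne_zero hz hx
    refine ((hs.div_const (blochD Y L z)).mul he).congr_deriv ?_
    change (-(Complex.I * z) * bloch1 Y L x z + q x * bloch2 Y L x z) / blochD Y L z * _ +
      bloch1 Y L x z / blochD Y L z * _ = q x * (bloch2 Y L x z / bloch1 Y L x z) *
        (bloch1 Y L x z / blochD Y L z * _)
    field_simp
    ring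
  have hy0 : y 0 = 1 := by simp [hy, h.bloch1_zero, hD]
  have hcoef : ∀ x ∈ Icc 0 L, ‖q x * blochRatio Y L x z * y x‖ ≤ K * ε * ‖y x‖ := fun x hx => by
    rw [norm_mul, norm_mul]
    gcongr
    · exact hK x
    · exact hε x hx
  -- The inequality of Gronwall for the linear equation with coefficient `q u`, where `u` is the
  -- Bloch ratio.
  have hbd : ∀ x ∈ Icc 0 L, ‖y x‖ ≤ Real.exp (K * ε * L) := by
    intro x hx
    have h1 := norm_le_gronwallBound_of_norm_deriv_right_le (f := y) (δ := 1) (K := K * ε) (ε := 0)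
      (a := 0) (b := L) (fun x hx => (hyd x hx).continuousAt.continuousWithinAt)
      (fun x hx => (hyd x (Ico_subset_Icc_self hx)).hasDerivWithinAt) (by simp [hy0])
      (fun x hx => by simpa using hcoef x (Ico_subset_Icc_self hx)) x hx
    rw [gronwallBound_ε0, one_mul, sub_zero] at h1
    refine h1.trans (Real.exp_le_exp.2 ?_)
    exact mul_le_mul_of_nonneg_left hx.2 (by positivity)
  have h2 := (convex_Icc 0 L).norm_image_sub_le_of_norm_hasDerivWithin_le (f := y)
    (C := K * ε * Real.exp (K * ε * L)) (fun x hx => (hyd x hx).hasDerivWithinAt)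
    (fun x hx => (hcoef x hx).trans (by gcongr; exact hbd x hx)) (left_mem_Icc.2 h.pos.le) hx
  rw [hy0, sub_zero, Real.norm_eq_abs, abs_of_nonneg hx.1] at h2
  refine h2.trans ?_
  gcongr
  exact hx.2

/-- The defining property of a filter at infinity along which the Bloch ratio has its asymptotic
expansion. -/
structure _root_.PeriodicDirac.IsBlochFilter (L : ℝ) (q : ℝ → ℂ) (Y : ℝ → ℂ → Mat2)
    (l : Filter ℂ) : Prop where
  le_cobounded : l ≤ Bornology.cobounded ℂ
  tendsto_star : Tendsto star l l
  bound : ∃ C : ℝ, 0 ≤ C ∧ ∀ᶠ z in l, z.im ≠ 0 ∧ ∀ x ∈ Icc 0 L,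
    ‖blochRatio Y L x z + star (q x) / (2 * Complex.I * z)‖ ≤ C / ‖z‖ ^ 2

section Asymptotics

variable {l : Filter ℂ}

lemma tendsto_chi_Icc (h : IsPeriodicDirac L q Y) (hl : IsBlochFilter L q Y l) {x : ℝ}
    (hx : x ∈ Icc 0 L) : Tendsto (chi1 Y L x) l (𝓝 1) ∧
      Tendsto (fun z => z * chi2 Y L x z) l (𝓝 (-(star (q x) / (2 * Complex.I)))) := by
  obtain ⟨K, hK0, hK⟩ := h.exists_bound
  obtain ⟨C, hC, hb⟩ := hl.bound
  have hinv : Tendsto (fun z : ℂ => 1 / ‖z‖) l (𝓝 0) := by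
    simp only [one_div]
    exact tendsto_inv_atTop_zero.comp
      ((tendsto_norm_cobounded_atTop (E := ℂ)).mono_left hl.le_cobounded)
  have hlarge : ∀ᶠ z in l, 1 ≤ ‖z‖ :=
    ((tendsto_norm_cobounded_atTop (E := ℂ)).mono_left hl.le_cobounded).eventually_ge_atTop 1
  set ε : ℂ → ℝ := fun z => (K + C) * (1 / ‖z‖) with hεdef
  have hε0 : Tendsto ε l (𝓝 0) := by
    have h1 := hinv.const_mul (K + C)
    rwa [mul_zero] at h1
  have hu : ∀ᶠ z in l, ∀ x ∈ Icc 0 L, ‖blochRatio Y L x z‖ ≤ ε z := by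
    filter_upwards [hb, hlarge] with z hz hz1 x hx
    have h1 := hz.2 x hx
    have h2 : ‖star (q x) / (2 * Complex.I * z)‖ ≤ K * (1 / ‖z‖) := by
      rw [norm_div, norm_star, norm_two_I_mul, mul_one_div]
      exact div_le_div₀ hK0 (hK x) (by linarith) (by linarith)
    have h3 : C / ‖z‖ ^ 2 ≤ C * (1 / ‖z‖) := by
      rw [mul_one_div]
      apply div_le_div_of_nonneg_left hC (by linarith); nlinarith
    calc ‖blochRatio Y L x z‖ = ‖(blochRatio Y L x z + star (q x) / (2 * Complex.I * z)) -
          star (q x) / (2 * Complex.I * z)‖ := by congr 1; ring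
      _ ≤ C * (1 / ‖z‖) + K * (1 / ‖z‖) := (norm_sub_le _ _).trans (add_le_add (h1.trans h3) h2)
      _ = ε z := by rw [hεdef]; ring
  have hy : Tendsto (fun z => bloch1 Y L x z / blochD Y L z * Complex.exp (Complex.I * z * x)) l
      (𝓝 1) := by
    rw [tendsto_iff_norm_sub_tendsto_zero]
    refine squeeze_zero' (Eventually.of_forall fun z => norm_nonneg _)
      (g := fun z => K * ε z * Real.exp (K * ε z * L) * L) ?_ ?_
    · filter_upwards [hu, hb] with z hz hz'
      exact h.norm_bloch1_sub_le hK hz'.1 hz hx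
    · have h1 := hε0.const_mul K
      have h2 := (Real.continuous_exp.tendsto _).comp (h1.mul_const L)
      simpa using (h1.mul h2).mul_const L
  have hu0 : Tendsto (blochRatio Y L 0) l (𝓝 0) := by
    refine squeeze_zero_norm' ?_ hε0
    filter_upwards [hu] with z hz
    exact hz 0 (left_mem_Icc.2 h.pos.le)
  have h1 : Tendsto (chi1 Y L x) l (𝓝 1) := by
    have h2 := hy.div (hu0.const_add 1) (by simp)
    simp only [add_zero, div_one] at h2
    refine h2.congr' ?_
    filter_upwards [hb] with z hz
    have hD := h.blochD_ne_zero hz.1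
    have hDc := h.blochD_add_mC_ne_zero hz.1
    simp only [Pi.div_apply, chi1, h.blochRatio_zero]
    have e : 1 + mC Y L z / blochD Y L z = (blochD Y L z + mC Y L z) / blochD Y L z := by
      field_simp
    rw [e]
    field_simp
  refine ⟨h1, ?_⟩
  have h3 : Tendsto (fun z => z * blochRatio Y L x z) l (𝓝 (-(star (q x) / (2 * Complex.I)))) := by
    rw [tendsto_iff_norm_sub_tendsto_zero]
    refine squeeze_zero' (Eventually.of_forall fun z => norm_nonneg _)
      (g := fun z => C * (1 / ‖z‖)) ?_ (by simpa using hinv.const_mul C)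
    filter_upwards [hb, hlarge] with z hz hz1
    have hz0 : z ≠ 0 := by rintro rfl; simp at hz
    have e : z * blochRatio Y L x z - -(star (q x) / (2 * Complex.I)) =
        z * (blochRatio Y L x z + star (q x) / (2 * Complex.I * z)) := by field_simp; ring
    rw [e, norm_mul]
    have h4 : 0 < ‖z‖ := by linarith
    calc ‖z‖ * _ ≤ ‖z‖ * (C / ‖z‖ ^ 2) := by gcongr; exact hz.2 x hx
      _ = C * (1 / ‖z‖) := by field_simp
  have h4 := h3.mul h1
  rw [mul_one] at h4
  refine h4.congr' ?_
  filter_upwards [hb] with z hz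
  have := h.bloch1_ne_zero hz.1 hx
  rw [chi1, chi2, blochRatio]
  field_simp

/-- The Bloch multiplier `Δ + s` behaves like `exp (-i z L)`. -/
lemma tendsto_mult (h : IsPeriodicDirac L q Y) (hl : IsBlochFilter L q Y l) :
    Tendsto (fun z => (discriminant Y L z + sRoot Y L z) * Complex.exp (Complex.I * z * L)) l
      (𝓝 1) := by
  have h1 := (h.tendsto_chi_Icc hl (right_mem_Icc.2 h.pos.le)).1.div
    (h.tendsto_chi_Icc hl (left_mem_Icc.2 h.pos.le)).1 one_ne_zero
  rw [div_one] at h1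
  refine h1.congr' ?_
  obtain ⟨C, -, hb⟩ := hl.bound
  filter_upwards [hb] with z hz
  have hD := h.blochD_ne_zero hz.1
  have hDc := h.blochD_add_mC_ne_zero hz.1
  simp only [Pi.div_apply, chi1, h.bloch1_zero, h.bloch1_period]
  simp
  field_simp

/-- The limits on one period hold on the whole line: translation by `L` multiplies `chi1` and `chi2`
by a factor that tends to `1`. -/
lemma tendsto_chi (h : IsPeriodicDirac L q Y) (hl : IsBlochFilter L q Y l) (x : ℝ) :
    Tendsto (chi1 Y L x) l (𝓝 1) ∧
      Tendsto (fun z => z * chi2 Y L x z) l (𝓝 (-(star (q x) / (2 * Complex.I)))) := by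
  set P : ℝ → Prop := fun x => Tendsto (chi1 Y L x) l (𝓝 1) ∧
      Tendsto (fun z => z * chi2 Y L x z) l (𝓝 (-(star (q x) / (2 * Complex.I)))) with hP
  have hm := h.tendsto_mult hl
  have hm' := hm.inv₀ one_ne_zero
  rw [inv_one] at hm'
  have hexp : ∀ (x : ℝ) (z : ℂ), Complex.exp (Complex.I * z * ((x + L : ℝ) : ℂ)) =
      Complex.exp (Complex.I * z * x) * Complex.exp (Complex.I * z * L) := fun x z => by
    rw [← Complex.exp_add]; push_cast; ring_nf
  have e1 : ∀ x z, chi1 Y L (x + L) z = (discriminant Y L z + sRoot Y L z) *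
      Complex.exp (Complex.I * z * L) * chi1 Y L x z := fun x z => by
    rw [chi1, chi1, (h.bloch_add_period x z).1, hexp]; ring
  have e2 : ∀ x z, chi2 Y L (x + L) z = (discriminant Y L z + sRoot Y L z) *
      Complex.exp (Complex.I * z * L) * chi2 Y L x z := fun x z => by
    rw [chi2, chi2, (h.bloch_add_period x z).2, hexp]; ring
  have hne : ∀ z, (discriminant Y L z + sRoot Y L z) * Complex.exp (Complex.I * z * L) ≠ 0 :=
    fun z => mul_ne_zero (mult_ne_zero Y L z) (Complex.exp_ne_zero _)
  have hper : Function.Periodic P L := fun x => propext ⟨fun hx => by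
      constructor
      · have := hm'.mul hx.1
        rw [one_mul] at this
        refine this.congr fun z => ?_
        rw [e1, inv_mul_cancel_left₀ (hne z)]
      · have := hm'.mul hx.2
        rw [one_mul, h.periodic] at this
        refine this.congr fun z => ?_
        rw [e2, mul_left_comm z, inv_mul_cancel_left₀ (hne z)], fun hx => by
      constructor
      · have := hm.mul hx.1
        rw [one_mul] at this
        exact this.congr fun z => (e1 x z).symm
      · have := hm.mul hx.2
        rw [one_mul, ← h.periodic] at this
        refine this.congr fun z => ?_
        rw [e2, mul_left_comm z]⟩
  obtain ⟨y, hy, hxy⟩ := hper.exists_mem_Ico₀ h.pos x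
  change P x
  rw [hxy]
  exact h.tendsto_chi_Icc hl (Ico_subset_Icc_self hy)

lemma tendsto_chi2 (h : IsPeriodicDirac L q Y) (hl : IsBlochFilter L q Y l) (x : ℝ) :
    Tendsto (chi2 Y L x) l (𝓝 0) := by
  have h1 := (tendsto_inv₀_cobounded (α := ℂ)).mono_left hl.le_cobounded
  have h2 := h1.mul (h.tendsto_chi hl x).2
  rw [zero_mul] at h2
  obtain ⟨C, -, hb⟩ := hl.bound
  refine h2.congr' ?_
  filter_upwards [hb] with z hz
  have hz0 : z ≠ 0 := by rintro rfl; simp at hz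
  rw [inv_mul_cancel_left₀ hz0]

lemma tendsto_matX (h : IsPeriodicDirac L q Y) (hl : IsBlochFilter L q Y l) (x : ℝ) :
    Tendsto (matX Y L x) l (𝓝 1) := by
  have h1 := (h.tendsto_chi hl x).1
  have h2 := h.tendsto_chi2 hl x
  have h3 := (h1.comp hl.tendsto_star).star
  have h4 := (h2.comp hl.tendsto_star).star
  refine tendsto_pi_nhds.2 fun i => tendsto_pi_nhds.2 fun j => ?_
  fin_cases i <;> fin_cases j
  · simpa [matX] using h1
  · simpa [matX] using h4
  · simpa [matX] using h2
  · simpa [matX] using h3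

/-- The reconstruction of the potential from the normalized Bloch matrix. -/
lemma tendsto_commutator (h : IsPeriodicDirac L q Y) (hl : IsBlochFilter L q Y l) (x : ℝ) :
    Tendsto (fun z : ℂ => (Complex.I * z) • (sigma3 * matX Y L x z - matX Y L x z * sigma3)) l
      (𝓝 (potentialMatrix q x)) := by
  have h2 := (h.tendsto_chi hl x).2
  have h4 := (h2.comp hl.tendsto_star).star
  have e : ∀ z : ℂ, (Complex.I * z) • (sigma3 * matX Y L x z - matX Y L x z * sigma3) =
      !![0, (2 * Complex.I) * (z * star (chi2 Y L x (star z)));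
        -(2 * Complex.I) * (z * chi2 Y L x z), 0] := fun z => by
    ext i j
    fin_cases i <;> fin_cases j <;> simp [sigma3, matX] <;> ring
  simp only [e]
  refine tendsto_pi_nhds.2 fun i => tendsto_pi_nhds.2 fun j => ?_
  fin_cases i <;> fin_cases j
  · simpa [potentialMatrix] using tendsto_const_nhds
  · have := h4.const_mul (2 * Complex.I)
    simp only [Function.comp_def, star_mul', star_star] at this
    refine (this.congr fun z => rfl).trans (le_of_eq ?_)
    congr 1
    simp [potentialMatrix]
    field_simp
  · have := h2.const_mul (-(2 * Complex.I))
    refine (this.congr fun z => rfl).trans (le_of_eq ?_)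
    congr 1
    simp [potentialMatrix]
    field_simp
  · simpa [potentialMatrix] using tendsto_const_nhds

lemma tendsto_matXinv (h : IsPeriodicDirac L q Y) (hl : IsBlochFilter L q Y l) (x : ℝ) :
    Tendsto (matXinv Y L x) l (𝓝 1) := by
  have h1 := h.tendsto_matX hl x
  have h2 : Tendsto (fun z => (matX Y L x z).det⁻¹ • (matX Y L x z).adjugate) l (𝓝 1) := by
    have h3 := ((continuous_id (X := Mat2)).matrix_adjugate.tendsto 1).comp h1
    have h4 := ((continuous_id (X := Mat2)).matrix_det.tendsto 1).comp h1
    have h5 := (h4.inv₀ (by simp)).smul h3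
    simpa using h5
  obtain ⟨C, -, hb⟩ := hl.bound
  refine h2.congr' ?_
  filter_upwards [hb] with z hz
  have h6 := h.matX_mul_matXinv x hz.1
  rw [← Matrix.inv_eq_right_inv h6, Matrix.inv_def, Ring.inverse_eq_inv']

end Asymptotics

lemma tendsto_star_cobounded : Tendsto (star : ℂ → ℂ) (Bornology.cobounded ℂ)
    (Bornology.cobounded ℂ) := by
  rw [← tendsto_norm_atTop_iff_cobounded]
  simpa using tendsto_norm_cobounded_atTop (E := ℂ)

lemma isBlochFilter_awayFromLattice (h : IsPeriodicDirac L q Y) {δ : ℝ} (hδ : 0 < δ) :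
    IsBlochFilter L q Y (Bornology.cobounded ℂ ⊓ 𝓟 (awayFromLattice L δ)) where
  le_cobounded := inf_le_left
  tendsto_star := tendsto_star_cobounded.inf
    (tendsto_principal_principal.2 fun z hz => star_mem_awayFromLattice hz)
  bound := by
    obtain ⟨C, R, hC, -, hb⟩ := h.blochRatio_asymptotics hδ
    refine ⟨C, hC, ?_⟩
    rw [eventually_inf_principal]
    filter_upwards [(tendsto_norm_cobounded_atTop (E := ℂ)).eventually_ge_atTop R] with z hz hz'
    exact ⟨hz'.1, hb z hz' hz⟩

lemma isBlochFilter_awayFromResolvent (h : IsPeriodicDirac L q Y) {δ : ℝ} (hδ : 0 < δ) :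
    IsBlochFilter L q Y (Bornology.cobounded ℂ ⊓ 𝓟 (awayFromResolvent Y L δ)) where
  le_cobounded := inf_le_left
  tendsto_star := tendsto_star_cobounded.inf (tendsto_principal_principal.2 fun z hz =>
    ⟨by simpa using hz.1, fun t ht => hz.2 t (by
      rw [Complex.dist_eq] at ht ⊢
      rw [← norm_star]
      simpa using ht)⟩)
  bound := by
    obtain ⟨C, R, hC, -, hb⟩ := h.blochRatio_asymptotics' hδ
    refine ⟨C, hC, ?_⟩
    rw [eventually_inf_principal]
    filter_upwards [(tendsto_norm_cobounded_atTop (E := ℂ)).eventually_ge_atTop R] with z hz hz'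
    exact ⟨hz'.1, hb z hz' hz⟩

/-- The root `s` of `Δ² - 1` is bounded below away from the lattice. -/
lemma exists_le_norm_sRoot (h : IsPeriodicDirac L q Y) {δ : ℝ} (hδ : 0 < δ) :
    ∃ c R : ℝ, 0 < c ∧ ∀ z ∈ awayFromLattice L δ, R ≤ ‖z‖ → c ≤ ‖sRoot Y L z‖ := by
  obtain ⟨κ, hκ, hκ1, hκz⟩ := exists_kappa h.pos hδ
  have hm := h.tendsto_mult (h.isBlochFilter_awayFromLattice hδ)
  have hm' := hm.inv₀ one_ne_zero
  rw [inv_one] at hm'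
  have hev : ∀ᶠ z in Bornology.cobounded ℂ ⊓ 𝓟 (awayFromLattice L δ),
      ‖(discriminant Y L z + sRoot Y L z) * Complex.exp (Complex.I * z * L) - 1‖ < κ / 4 ∧
      ‖((discriminant Y L z + sRoot Y L z) * Complex.exp (Complex.I * z * L))⁻¹ - 1‖ < κ / 4 := by
    have hκ4 : 0 < κ / 4 := by linarith
    filter_upwards [Metric.tendsto_nhds.1 hm _ hκ4, Metric.tendsto_nhds.1 hm' _ hκ4] with z h1 h2
    rw [← dist_eq_norm, ← dist_eq_norm]
    exact ⟨h1, h2⟩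
  rw [eventually_inf_principal] at hev
  obtain ⟨R, -, hR⟩ := (Filter.hasBasis_cobounded_norm (E := ℂ)).eventually_iff.1 hev
  have hup : ∀ z ∈ awayFromLattice L δ, R ≤ ‖z‖ → 0 < z.im → κ / 4 ≤ ‖sRoot Y L z‖ := by
    intro z hz hzR hi
    obtain ⟨h1, h2⟩ := hR (show z ∈ {x : ℂ | R ≤ ‖x‖} from hzR) hz
    set e := (discriminant Y L z + sRoot Y L z) * Complex.exp (Complex.I * z * L) with he
    set η := Complex.exp (Complex.I * z * L) with hη
    have hη1 : ‖η‖ ≤ 1 := by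
      rw [hη, norm_exp_mul_ofReal, Real.exp_le_one_iff]
      have := mul_pos hi h.pos
      simp; linarith
    have hκ' := hκz z hz hi z.im le_rfl
    rw [Complex.re_add_im, show 2 * Complex.I * z * (L : ℂ) = Complex.I * z * L + Complex.I * z * L by
      ring, Complex.exp_add, ← hη] at hκ'
    have hmm := mult_mul Y (sRoot_sq Y L z)
    have hne := mult_ne_zero Y L z
    have hηne : η ≠ 0 := Complex.exp_ne_zero _
    have hinv : e⁻¹ * η * η = (discriminant Y L z - sRoot Y L z) * η := by
      rw [he, mul_inv, ← eq_inv_of_mul_eq_one_right hmm]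
      field_simp
    -- With `η = exp (i z L)` and `Δ ± s ≈ η^(∓1)` this says `2 s η ≈ 1 - η²`, which is bounded
    -- below.
    have e3 : 2 * sRoot Y L z * η = (1 - η * η) + (e - 1) - (e⁻¹ - 1) * (η * η) := by
      have : (e⁻¹ - 1) * (η * η) = (discriminant Y L z - sRoot Y L z) * η - η * η := by
        rw [← hinv]; ring
      rw [this, he]; ring
    have h3 : κ - κ / 4 - κ / 4 ≤ ‖2 * sRoot Y L z * η‖ := by
      rw [e3]
      have h4 : ‖(e⁻¹ - 1) * (η * η)‖ ≤ κ / 4 := by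
        rw [norm_mul, norm_mul]
        calc _ ≤ κ / 4 * (1 * 1) := by gcongr
          _ = κ / 4 := by ring
      have h5 := norm_sub_norm_le ((1 - η * η) + (e - 1)) ((e⁻¹ - 1) * (η * η))
      have h6 := norm_sub_norm_le (1 - η * η) (-(e - 1))
      rw [sub_neg_eq_add, norm_neg] at h6
      linarith
    rw [norm_mul, norm_mul, Complex.norm_two] at h3
    nlinarith [norm_nonneg (sRoot Y L z), norm_nonneg η]
  refine ⟨κ / 4, R, by linarith, fun z hz hzR => ?_⟩
  rcases lt_or_gt_of_ne hz.1 with hi | hi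
  · have := hup (star z) (star_mem_awayFromLattice hz) (by rwa [norm_star]) (by simpa using hi)
    rwa [h.sRoot_star hz.1, norm_neg, norm_star] at this
  · exact hup z hz hzR hi

end IsPeriodicDirac

/-! ### Gaps, Dirichlet eigenvalues and the counting function -/

/-- A real function with negative derivative at all its zeros has at most one zero on an interval. -/
lemma not_two_zeros {g : ℝ → ℝ} {x y : ℝ} (hxy : x < y) (hg : ContinuousOn g (Icc x y))
    (hd : ∀ t ∈ Icc x y, g t = 0 → ∃ d < 0, HasDerivAt g d t) (hx : g x = 0) : g y ≠ 0 := by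
  intro hy
  obtain ⟨d, hd0, hdx⟩ := hd x (left_mem_Icc.2 hxy.le) hx
  have h1 : ∀ᶠ t in 𝓝[>] x, g t < 0 := by
    have h2 := ((hasDerivAt_iff_tendsto_slope.1 hdx).mono_left
      (nhdsWithin_mono (s := Ioi x) x fun t (ht : x < t) => ht.ne')).eventually_lt_const hd0
    filter_upwards [h2, self_mem_nhdsWithin] with t ht htx
    rw [slope_def_field, hx, sub_zero, div_lt_iff₀ (sub_pos.2 htx), zero_mul] at ht
    exact ht
  obtain ⟨x', hx'0, hx'1⟩ := (h1.and (Ioo_mem_nhdsGT hxy)).exists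
  -- Right of `x` the function is negative; at its next zero the derivative cannot be negative.
  set s : Set ℝ := {t ∈ Icc x' y | 0 ≤ g t} with hs
  have hsub : Icc x' y ⊆ Icc x y := Icc_subset_Icc hx'1.1.le le_rfl
  have hsc : IsCompact s := by
    have : s = Icc x' y ∩ g ⁻¹' Ici 0 := rfl
    rw [this]
    exact isCompact_Icc.of_isClosed_subset ((hg.mono hsub).preimage_isClosed_of_isClosed
      isClosed_Icc isClosed_Ici) inter_subset_left
  have hmem := hsc.sInf_mem ⟨y, ⟨hx'1.2.le, le_rfl⟩, hy.ge⟩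
  set m := sInf s with hm
  have hlt : x' < m := lt_of_le_of_ne hmem.1.1 fun h0 => by
    rw [← h0] at hmem
    exact absurd hmem.2 (not_le.2 hx'0)
  have hneg : ∀ t ∈ Ico x' m, g t < 0 := fun t ht => by
    by_contra! h0
    exact absurd (csInf_le hsc.bddBelow ⟨⟨ht.1, ht.2.le.trans hmem.1.2⟩, h0⟩) (not_le.2 ht.2)
  have hgm : g m = 0 := by
    refine le_antisymm ?_ hmem.2
    have hc : ContinuousWithinAt g (Ioo x' m) m :=
      (hg m (hsub hmem.1)).mono fun t ht => ⟨hx'1.1.le.trans ht.1.le, ht.2.le.trans hmem.1.2⟩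
    have hne : (𝓝[Ioo x' m] m).NeBot := by
      rw [← mem_closure_iff_nhdsWithin_neBot, closure_Ioo hlt.ne]
      exact right_mem_Icc.2 hlt.le
    exact le_of_tendsto hc (eventually_mem_nhdsWithin.mono fun t ht => (hneg t ⟨ht.1.le, ht.2⟩).le)
  obtain ⟨d', hd'0, hd'⟩ := hd m (hsub hmem.1) hgm
  have h2 := ((hasDerivAt_iff_tendsto_slope.1 hd').mono_left
      (nhdsWithin_mono (s := Iio m) m fun t (ht : t < m) => ht.ne)).eventually_lt_const hd'0
  obtain ⟨t, ht, ht'⟩ := (h2.and (Ioo_mem_nhdsLT hlt)).exists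
  rw [slope_def_field, hgm, sub_zero, div_lt_iff_of_neg (sub_neg.2 ht'.2), zero_mul] at ht
  exact absurd ht (not_lt.2 (hneg t ⟨ht'.1.le, ht'.2⟩).le)

lemma finite_zeros_Icc {f : ℂ → ℂ} (hf : ∀ z, ∀ᶠ w in 𝓝[≠] z, f w ≠ 0) (a b : ℝ) :
    {t : ℝ | t ∈ Icc a b ∧ f t = 0}.Finite := by
  by_contra hinf
  obtain ⟨t, -, ht⟩ := Set.Infinite.exists_accPt_of_subset_isCompact hinf isCompact_Icc
    (fun t ht => ht.1)
  rw [accPt_iff_frequently] at ht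
  have h1 := (eventually_nhdsWithin_iff.1 ((IsPeriodicDirac.tendsto_ofReal_nhdsNE t).eventually (hf t)))
  obtain ⟨x, hx1, hx2⟩ := (ht.and_eventually h1).exists
  exact hx2 hx1.1 hx1.2.2

namespace IsPeriodicDirac

variable {L : ℝ} {q : ℝ → ℂ} {Y : ℝ → ℂ → Mat2}

lemma continuous_re_mA (h : IsPeriodicDirac L q Y) : Continuous fun t : ℝ => (mA Y L t).re :=
  Complex.continuous_re.comp (h.differentiable_mA.continuous.comp Complex.continuous_ofReal)

lemma discSq_real_eq_zero_iff (h : IsPeriodicDirac L q Y) (t : ℝ) :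
    discSq Y L t = 0 ↔ (mA Y L t).re ^ 2 = 1 := by
  rw [h.discSq_real, Complex.ofReal_eq_zero, sub_eq_zero]

lemma dirFun_real (h : IsPeriodicDirac L q Y) (t : ℝ) :
    dirFun Y L t = 2 * Complex.I * ((mA Y L t).im - (mB Y L t).im : ℝ) := by
  rw [dirFun, h.mC_real, h.mD_real]
  apply Complex.ext <;> simp; ring

/-- At a real Dirichlet eigenvalue the eigenvalues `r = ỹ₁₁` and `r⁻¹ = ỹ₂₂` of the monodromy matrix
are real. -/
lemma dirichlet_real (h : IsPeriodicDirac L q Y) {t : ℝ} (h0 : dirFun Y L t = 0) :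
    ∃ r : ℝ, r ≠ 0 ∧ mA Y L t + mC Y L t = r ∧ mA Y L t - mB Y L t = (r⁻¹ : ℝ) ∧
      r + r⁻¹ = 2 * (mA Y L t).re := by
  have him : (mA Y L t).im - (mB Y L t).im = 0 := by
    have := h.dirFun_real t
    rw [h0, eq_comm, mul_eq_zero] at this
    exact_mod_cast this.resolve_left (by simp)
  have e1 : mA Y L t + mC Y L t = (((mA Y L t).re + (mB Y L t).re : ℝ) : ℂ) := by
    rw [h.mC_real]
    apply Complex.ext
    · simp
    · simp; linarith
  have e2 : mA Y L t - mB Y L t = (((mA Y L t).re - (mB Y L t).re : ℝ) : ℂ) := by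
    apply Complex.ext
    · simp
    · simp; linarith
  have hm := h.dirichlet_mul h0
  rw [e1, e2, ← Complex.ofReal_mul] at hm
  have hm' : ((mA Y L t).re + (mB Y L t).re) * ((mA Y L t).re - (mB Y L t).re) = 1 := by
    exact_mod_cast hm
  refine ⟨_, left_ne_zero_of_mul_eq_one hm', e1, ?_, ?_⟩
  · rw [e2, ← eq_inv_of_mul_eq_one_right hm']
  · rw [← eq_inv_of_mul_eq_one_right hm']; ring

lemma dirichletSign_eq_zero_iff (h : IsPeriodicDirac L q Y) {t : ℝ} (h0 : dirFun Y L t = 0) :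
    dirichletSign Y L t = 0 ↔ (mA Y L t).re ^ 2 ≤ 1 := by
  obtain ⟨r, hr, -, h2, h3⟩ := h.dirichlet_real h0
  rw [dirichletSign_eq Y L h0, h2, Complex.norm_real, Real.norm_eq_abs]
  have e : (mA Y L t).re ^ 2 - 1 = ((r - r⁻¹) / 2) ^ 2 := by
    have : (mA Y L t).re = (r + r⁻¹) / 2 := by linarith
    rw [this]; field_simp; ring
  have h4 : (mA Y L t).re ^ 2 ≤ 1 ↔ |r⁻¹| = 1 := by
    rw [← sub_nonpos, e]
    constructor
    · intro h5
      have h6 : (r - r⁻¹) / 2 = 0 := by nlinarith [sq_nonneg ((r - r⁻¹) / 2)]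
      have h7 : r = r⁻¹ := by linarith
      have h8 : r⁻¹ ^ 2 = 1 := by nth_rewrite 1 [pow_two, ← h7]; exact mul_inv_cancel₀ hr
      rw [← sq_abs] at h8
      exact (pow_eq_one_iff_of_nonneg (abs_nonneg _) two_ne_zero).1 h8
    · intro h5
      have h6 : r⁻¹ ^ 2 = 1 := by rw [← sq_abs, h5, one_pow]
      have h7 : r = r⁻¹ := by
        field_simp at h6 ⊢
        exact h6.symm
      have h8 : r - r⁻¹ = 0 := by linarith
      rw [h8]; simp
  rw [h4]
  have hpos : 0 < |r⁻¹| := abs_pos.2 (inv_ne_zero hr)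
  constructor
  · intro h5
    have h6 : SignType.sign (Real.log |r⁻¹|) = 0 := by
      generalize SignType.sign (Real.log |r⁻¹|) = σ at h5
      cases σ <;> simp_all
    rw [sign_eq_zero_iff, Real.log_eq_zero] at h6
    rcases h6 with h6 | h6 | h6
    · exact absurd h6 hpos.ne'
    · exact h6
    · linarith
  · intro h5
    rw [h5, Real.log_one, sign_zero]; rfl

/-- Which row of `matN` vanishes at a Dirichlet eigenvalue inside a gap. -/
lemma matN_row_eq_zero (h : IsPeriodicDirac L q Y) {t : ℝ} (h0 : dirFun Y L t = 0) {s : ℂ}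
    (hs : s ^ 2 = discSq Y L t) (hn : 1 < ‖discriminant Y L t + s‖) :
    (dirichletSign Y L t = -1 → ∀ j, matN Y L s t 0 j = 0) ∧
    (dirichletSign Y L t = 1 → ∀ j, matN Y L s t 1 j = 0) := by
  have hm := h.dirichlet_mul h0
  have hsum := dirichlet_sum h0
  have hlog : dirichletSign Y L t = -SignType.sign (Real.log ‖mA Y L t - mB Y L t‖) :=
    dirichletSign_eq Y L h0
  have hne : mA Y L t - mB Y L t ≠ 0 := right_ne_zero_of_mul_eq_one hm
  have hpos := norm_pos_iff.2 hne
  -- At a Dirichlet eigenvalue the multiplier `Δ + s` is `ỹ₁₁` or `ỹ₂₂`.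
  have hprod : (discriminant Y L t + s - (mA Y L t - mB Y L t)) *
      (discriminant Y L t + s - (mA Y L t + mC Y L t)) = 0 := by
    rw [discSq] at hs
    linear_combination hs + hm - (discriminant Y L t + s) * hsum
  have hnm : ‖mA Y L t + mC Y L t‖ * ‖mA Y L t - mB Y L t‖ = 1 := by
    rw [← norm_mul, hm, norm_one]
  have ea := mA_eq Y L t
  have e1 : matN Y L s t 0 0 = (mA Y L t + mC Y L t) - (discriminant Y L t - s) := by
    simp [matN]; rw [ea]; ring
  have e2 : matN Y L s t 0 1 = (discriminant Y L t + s) - (mA Y L t - mB Y L t) := by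
    simp [matN]; rw [ea]; ring
  have e3 : matN Y L s t 1 0 = (discriminant Y L t + s) - (mA Y L t + mC Y L t) := by
    simp [matN]; rw [ea]; ring
  have e4 : matN Y L s t 1 1 = (mA Y L t - mB Y L t) - (discriminant Y L t - s) := by
    simp [matN]; rw [ea]; ring
  rcases mul_eq_zero.1 hprod with h1 | h1
  · have h2 : 1 < ‖mA Y L t - mB Y L t‖ := by rwa [sub_eq_zero.1 h1] at hn
    have h3 : dirichletSign Y L t = -1 := by rw [hlog, sign_pos (Real.log_pos h2)]
    refine ⟨fun _ j => ?_, fun h4 => ?_⟩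
    · obtain rfl | rfl : j = 0 ∨ j = 1 := by omega
      · rw [e1]; linear_combination hsum + h1
      · rw [e2, h1]
    · rw [h3] at h4; exact absurd h4 (by decide)
  · have h2 : ‖mA Y L t - mB Y L t‖ < 1 := by
      have h5 : 1 < ‖mA Y L t + mC Y L t‖ := by rwa [sub_eq_zero.1 h1] at hn
      nlinarith
    have h3 : dirichletSign Y L t = 1 := by
      rw [hlog, sign_neg (Real.log_neg hpos h2)]; rfl
    refine ⟨fun h4 => ?_, fun _ j => ?_⟩
    · rw [h3] at h4; exact absurd h4 (by decide)
    · obtain rfl | rfl : j = 0 ∨ j = 1 := by omega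
      · rw [e3, h1]
      · rw [e4]; linear_combination hsum + h1

/-- On an interval where `|Δ| ≥ 1` there is at most one Dirichlet eigenvalue. -/
lemma dirFun_unique (h : IsPeriodicDirac L q Y) {x y : ℝ} (hxy : x < y)
    (hΔ : ∀ t ∈ Icc x y, 1 ≤ (mA Y L t).re ^ 2) (hx : dirFun Y L x = 0) : dirFun Y L y ≠ 0 := by
  intro hy
  set g : ℝ → ℝ := fun t => (dirFun Y L t).im with hg
  have hgc : Continuous g := Complex.continuous_im.comp
    (h.differentiable_dirFun.continuous.comp Complex.continuous_ofReal)
  have hg0 : ∀ t : ℝ, g t = 0 → dirFun Y L t = 0 := fun t ht => by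
    have e := h.dirFun_real t
    have e2 : g t = 2 * ((mA Y L t).im - (mB Y L t).im) := by
      rw [hg]; simp only [e]; simp
    rw [ht] at e2
    have e3 : (mA Y L t).im - (mB Y L t).im = 0 := by linarith
    rw [e, e3]; simp
  have hgd : ∀ t : ℝ, dirFun Y L t = 0 → ∃ r κ : ℝ, 0 < κ ∧ r ≠ 0 ∧
      r + r⁻¹ = 2 * (mA Y L t).re ∧ HasDerivAt g (-(r * κ)) t := fun t ht => by
    obtain ⟨κ, hκ, hd⟩ := h.dirFun_deriv ht
    obtain ⟨r, hr, h1, -, h3⟩ := h.dirichlet_real ht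
    refine ⟨r, κ, hκ, hr, h3, ?_⟩
    have h4 : HasDerivAt (fun t : ℝ => dirFun Y L t) (-Complex.I * ((mA Y L t + mC Y L t) * κ)) t :=
      hd.comp_ofReal
    have h5 := Complex.imCLM.hasFDerivAt.comp_hasDerivAt t h4
    refine h5.congr_deriv ?_
    rw [h1]; simp
  have hxg : g x = 0 := by simp [hg, hx]
  have hyg : g y = 0 := by simp [hg, hy]
  have hne : ∀ t ∈ Icc x y, (mA Y L t).re ≠ 0 := fun t ht h0 => by
    have := hΔ t ht
    rw [h0] at this; norm_num at this
  have hsign : (∀ t ∈ Icc x y, 0 < (mA Y L t).re) ∨ ∀ t ∈ Icc x y, (mA Y L t).re < 0 := by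
    rcases lt_or_gt_of_ne (hne x (left_mem_Icc.2 hxy.le)) with h1 | h1
    · right
      intro t ht
      by_contra! h2
      obtain ⟨w, hw, hw0⟩ := intermediate_value_Icc ht.1 h.continuous_re_mA.continuousOn ⟨h1.le, h2⟩
      exact hne w ⟨hw.1, hw.2.trans ht.2⟩ hw0
    · left
      intro t ht
      by_contra! h2
      obtain ⟨w, hw, hw0⟩ := intermediate_value_Icc' ht.1 h.continuous_re_mA.continuousOn ⟨h2, h1.le⟩
      exact hne w ⟨hw.1, hw.2.trans ht.2⟩ hw0
  -- At a zero the derivative has the sign of `-r`, and `r` has the sign of `Δ`.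
  rcases hsign with hpos | hneg
  · refine not_two_zeros hxy hgc.continuousOn (fun t ht h0 => ?_) hxg hyg
    obtain ⟨r, κ, hκ, hr, hsum, hd⟩ := hgd t (hg0 t h0)
    refine ⟨_, ?_, hd⟩
    have hr0 : 0 < r := by
      rcases lt_or_gt_of_ne hr with h1 | h1
      · have := inv_lt_zero.2 h1
        linarith [hpos t ht]
      · exact h1
    linarith [mul_pos hr0 hκ]
  · refine not_two_zeros (g := fun t => -g t) hxy hgc.neg.continuousOn (fun t ht h0 => ?_)
      (by simp [hxg]) (by simp [hyg])
    obtain ⟨r, κ, hκ, hr, hsum, hd⟩ := hgd t (hg0 t (neg_eq_zero.1 h0))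
    refine ⟨_, ?_, hd.neg⟩
    have hr0 : r < 0 := by
      rcases lt_or_gt_of_ne hr with h1 | h1
      · exact h1
      · have := inv_pos.2 h1
        linarith [hneg t ht]
    linarith [mul_neg_of_neg_of_pos hr0 hκ]

end IsPeriodicDirac

namespace SpectralData

variable {S : SpectralData} {γs : ℝ}

lemma exists_isolated {Z : Set ℝ} (hZ : ∀ a b : ℝ, (Z ∩ Icc a b).Finite) (e : ℝ) :
    ∃ ε > 0, ∀ y ∈ Z, |y - e| < ε → y = e := by
  have hfin := ((hZ (e - 1) (e + 1)).subset (sdiff_subset (t := {e})))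
  obtain ⟨ε, hε, hb⟩ := Metric.isOpen_iff.1 hfin.isClosed.isOpen_compl e (fun hc => hc.2 rfl)
  refine ⟨min ε 1, by positivity, fun y hy hye => ?_⟩
  by_contra hne
  have h1 := hb (show y ∈ Metric.ball e ε by
    rw [Metric.mem_ball, Real.dist_eq]; exact hye.trans_le (min_le_left _ _))
  have h2 := abs_lt.1 (hye.trans_le (min_le_right _ _))
  exact h1 ⟨⟨hy, by linarith, by linarith⟩, hne⟩

/-- The counting function is locally constant off the set of Dirichlet eigenvalues with sign `0`,
and changes its parity at the points of this set. -/
lemma count_near (hZ : ∀ a b : ℝ, (S.zeroSignSet ∩ Icc a b).Finite) (hγ : S.IsNearestZeroSign γs)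
    (e : ℝ) : ∃ ε > 0, ∃ A B : ℕ, (∀ t ∈ Ioo (e - ε) e, S.count γs t = A) ∧
      (∀ t ∈ Ioo e (e + ε), S.count γs t = B) ∧ (e ∈ S.zeroSignSet → Odd (A + B)) ∧
      (e ∉ S.zeroSignSet → A = B) := by
  set Z := S.zeroSignSet with hZdef
  obtain ⟨ε, hε, hiso⟩ := exists_isolated hZ e
  by_cases hne : Z.Nonempty
  swap
  · rw [not_nonempty_iff_eq_empty] at hne
    have h0 : ∀ t, S.count γs t = 0 := fun t => by
      rw [count, ← hZdef, hne]; simp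
    exact ⟨ε, hε, 0, 0, fun t _ => h0 t, fun t _ => h0 t, fun he => by simp [hne] at he,
      fun _ => rfl⟩
  have hγZ : γs ∈ Z := (hγ hne).1
  have hlt : ∀ y ∈ Z, y ≠ e → ∀ t, |t - e| < ε → (y ≤ t ↔ y < e) := by
    intro y hy hye t ht
    have h1 : ε ≤ |y - e| := by by_contra! h2; exact hye (hiso y hy h2)
    rw [abs_lt] at ht
    rcases le_abs.1 h1 with h1 | h1
    · constructor <;> intro <;> linarith
    · constructor <;> intro <;> linarith
  refine ⟨ε, hε, ?_⟩
  have habsL : ∀ t ∈ Ioo (e - ε) e, |t - e| < ε := fun t ht => by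
    rw [abs_lt]; constructor <;> linarith [ht.1, ht.2]
  have habsR : ∀ t ∈ Ioo e (e + ε), |t - e| < ε := fun t ht => by
    rw [abs_lt]; constructor <;> linarith [ht.1, ht.2]
  rcases lt_trichotomy γs e with hge | hge | hge
  · -- the base point lies to the left
    refine ⟨{y ∈ Z | γs ≤ y ∧ y < e}.ncard, {y ∈ Z | γs ≤ y ∧ y ≤ e}.ncard, ?_, ?_, ?_, ?_⟩
    · intro t ht
      rw [count, if_pos ((hlt γs hγZ hge.ne t (habsL t ht)).2 hge)]
      congr 1; ext y
      refine and_congr_right fun hy => and_congr_right fun _ => ?_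
      by_cases hye : y = e
      · subst hye; simp [ht.2]
      · exact hlt y hy hye t (habsL t ht)
    · intro t ht
      rw [count, if_pos ((hlt γs hγZ hge.ne t (habsR t ht)).2 hge)]
      congr 1; ext y
      refine and_congr_right fun hy => and_congr_right fun _ => ?_
      by_cases hye : y = e
      · subst hye; simp [ht.1.le]
      · rw [hlt y hy hye t (habsR t ht), ← hlt y hy hye e (by simpa using hε)]
    · intro he
      have e1 : {y ∈ Z | γs ≤ y ∧ y ≤ e} = insert e {y ∈ Z | γs ≤ y ∧ y < e} := by
        ext y
        simp only [mem_ofPred_eq, mem_insert_iff]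
        constructor
        · rintro ⟨h1, h2, h3⟩
          rcases h3.eq_or_lt with h4 | h4
          · exact Or.inl h4
          · exact Or.inr ⟨h1, h2, h4⟩
        · rintro (rfl | ⟨h1, h2, h3⟩)
          · exact ⟨he, hge.le, le_rfl⟩
          · exact ⟨h1, h2, h3.le⟩
      have hfin : {y ∈ Z | γs ≤ y ∧ y < e}.Finite :=
        (hZ γs e).subset fun y hy => ⟨hy.1, hy.2.1, hy.2.2.le⟩
      rw [e1, ncard_insert_of_notMem (by simp) hfin]
      exact ⟨_, by ring⟩
    · intro he
      congr 1; ext y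
      refine and_congr_right fun hy => and_congr_right fun _ => ?_
      have : y ≠ e := fun h1 => he (h1 ▸ hy)
      exact ⟨le_of_lt, fun h1 => lt_of_le_of_ne h1 this⟩
  · subst hge
    refine ⟨0, 1, ?_, ?_, fun _ => by decide, fun he => absurd hγZ he⟩
    · intro t ht
      rw [count, if_neg (not_le.2 ht.2)]
      convert ncard_empty ℝ
      ext y
      simp only [mem_ofPred_eq, mem_empty_iff_false, iff_false]
      rintro ⟨hy, h1, h2⟩
      exact absurd ((hlt y hy h2.ne t (habsL t ht)).2 h2) (not_le.2 h1)
    · intro t ht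
      rw [count, if_pos ht.1.le]
      convert ncard_singleton γs
      ext y
      simp only [mem_ofPred_eq, mem_singleton_iff]
      constructor
      · rintro ⟨hy, h1, h2⟩
        by_contra h3
        exact absurd ((hlt y hy h3 t (habsR t ht)).1 h2) (not_lt.2 h1)
      · rintro rfl
        exact ⟨hγZ, le_rfl, ht.1.le⟩
  · -- the base point lies to the right
    refine ⟨{y ∈ Z | e ≤ y ∧ y < γs}.ncard, {y ∈ Z | e < y ∧ y < γs}.ncard, ?_, ?_, ?_, ?_⟩
    · intro t ht
      rw [count, if_neg fun h1 => absurd ((hlt γs hγZ hge.ne' t (habsL t ht)).1 h1) (not_lt.2 hge.le)]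
      congr 1; ext y
      refine and_congr_right fun hy => and_congr_left fun _ => ?_
      by_cases hye : y = e
      · subst hye; simp [ht.2]
      · have := hlt y hy hye t (habsL t ht)
        rw [← not_le, this, not_lt]
    · intro t ht
      rw [count, if_neg fun h1 => absurd ((hlt γs hγZ hge.ne' t (habsR t ht)).1 h1) (not_lt.2 hge.le)]
      congr 1; ext y
      refine and_congr_right fun hy => and_congr_left fun _ => ?_
      by_cases hye : y = e
      · subst hye; simp [ht.1.le]
      · have := hlt y hy hye t (habsR t ht)
        rw [← not_le, this, not_lt]
        exact ⟨fun h1 => lt_of_le_of_ne h1 (Ne.symm hye), le_of_lt⟩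
    · intro he
      have e1 : {y ∈ Z | e ≤ y ∧ y < γs} = insert e {y ∈ Z | e < y ∧ y < γs} := by
        ext y
        simp only [mem_ofPred_eq, mem_insert_iff]
        constructor
        · rintro ⟨h1, h2, h3⟩
          rcases h2.eq_or_lt with h4 | h4
          · exact Or.inl h4.symm
          · exact Or.inr ⟨h1, h4, h3⟩
        · rintro (rfl | ⟨h1, h2, h3⟩)
          · exact ⟨he, le_rfl, hge⟩
          · exact ⟨h1, h2.le, h3⟩
      have hfin : {y ∈ Z | e < y ∧ y < γs}.Finite :=
        (hZ e γs).subset fun y hy => ⟨hy.1, hy.2.1.le, hy.2.2.le⟩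
      rw [e1, ncard_insert_of_notMem (by simp) hfin]
      exact ⟨{y ∈ Z | e < y ∧ y < γs}.ncard, by ring⟩
    · intro he
      congr 1; ext y
      refine and_congr_right fun hy => and_congr_left fun _ => ?_
      have : y ≠ e := fun h1 => he (h1 ▸ hy)
      exact ⟨fun h1 => lt_of_le_of_ne h1 (Ne.symm this), le_of_lt⟩

end SpectralData

namespace IsSpectralData

variable {L : ℝ} {q : ℝ → ℂ} {Y : ℝ → ℂ → Mat2} {S : SpectralData}

lemma mem_gap (h : IsPeriodicDirac L q Y) (hS : IsSpectralData q L Y S) {k : ℤ} (hk : k ∈ S.labels)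
    {t : ℝ} (ht : t ∈ Ioo (S.E (2 * k - 1)) (S.E (2 * k))) : 1 < (mA Y L t).re ^ 2 := by
  by_contra! h1
  exact (hS.spectrum t).1 ((h.mem_laxSpectrum_iff t).2 h1) k hk ht

lemma exists_gap (h : IsPeriodicDirac L q Y) (hS : IsSpectralData q L Y S) {t : ℝ}
    (ht : 1 < (mA Y L t).re ^ 2) : ∃ k ∈ S.labels, t ∈ Ioo (S.E (2 * k - 1)) (S.E (2 * k)) := by
  by_contra! h1
  exact absurd ((h.mem_laxSpectrum_iff t).1 ((hS.spectrum t).2 h1)) (not_le.2 ht)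

lemma one_le_of_mem_Icc (h : IsPeriodicDirac L q Y) (hS : IsSpectralData q L Y S) {k : ℤ}
    (hk : k ∈ S.labels) {t : ℝ} (ht : t ∈ Icc (S.E (2 * k - 1)) (S.E (2 * k))) :
    1 ≤ (mA Y L t).re ^ 2 := by
  rw [← closure_Ioo (hS.gap_lt k hk).ne] at ht
  have hcl : IsClosed {t : ℝ | 1 ≤ (mA Y L t).re ^ 2} :=
    isClosed_le continuous_const (h.continuous_re_mA.pow 2)
  exact closure_minimal (fun t ht => (mem_gap h hS hk ht).le) hcl ht

lemma edge_notMem_gap (hS : IsSpectralData q L Y S) {e : ℝ} (he : e ∈ S.bandEdges) {j : ℤ}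
    (hj : j ∈ S.labels) : e ∉ Ioo (S.E (2 * j - 1)) (S.E (2 * j)) := by
  obtain ⟨k, hk, he⟩ := he
  intro hm
  have hgk := hS.gap_lt k hk
  rcases lt_trichotomy j k with h1 | h1 | h1
  · have := hS.band_lt j hj k hk h1
    rcases he with rfl | rfl <;> linarith [hm.1, hm.2]
  · subst h1
    rcases he with rfl | rfl
    · exact lt_irrefl _ hm.1
    · exact lt_irrefl _ hm.2
  · have := hS.band_lt k hk j hj h1
    rcases he with rfl | rfl <;> linarith [hm.1, hm.2]

lemma edge_re_sq (h : IsPeriodicDirac L q Y) (hS : IsSpectralData q L Y S) {e : ℝ}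
    (he : e ∈ S.bandEdges) : (mA Y L e).re ^ 2 = 1 := by
  refine le_antisymm ?_ ?_
  · by_contra! h1
    obtain ⟨k, hk, hm⟩ := exists_gap h hS h1
    exact hS.edge_notMem_gap he hk hm
  · obtain ⟨k, hk, rfl | rfl⟩ := he
    · exact one_le_of_mem_Icc h hS hk (left_mem_Icc.2 (hS.gap_lt k hk).le)
    · exact one_le_of_mem_Icc h hS hk (right_mem_Icc.2 (hS.gap_lt k hk).le)

lemma edge_discSq (h : IsPeriodicDirac L q Y) (hS : IsSpectralData q L Y S) {e : ℝ}
    (he : e ∈ S.bandEdges) : discSq Y L e = 0 :=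
  (h.discSq_real_eq_zero_iff e).2 (edge_re_sq h hS he)

/-- At an edge of a gap the monodromy matrix is not `±1`. -/
lemma edge_halfDiff (h : IsPeriodicDirac L q Y) (hS : IsSpectralData q L Y S) {e : ℝ}
    (he : e ∈ S.bandEdges) : halfDiff Y L e ≠ 0 := by
  intro h0
  have hev := h.eventually_discSq_neg (edge_discSq h hS he) h0
  obtain ⟨k, hk, rfl | rfl⟩ := he
  · have h1 := hev.filter_mono (nhdsWithin_mono (s := Ioi _) _ fun t (ht : S.E (2 * k - 1) < t) => ht.ne')
    obtain ⟨t, ht1, ht2⟩ := (h1.and (Ioo_mem_nhdsGT (hS.gap_lt k hk))).exists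
    linarith [mem_gap h hS hk ht2]
  · have h1 := hev.filter_mono (nhdsWithin_mono (s := Iio _) _ fun t (ht : t < S.E (2 * k)) => ht.ne)
    obtain ⟨t, ht1, ht2⟩ := (h1.and (Ioo_mem_nhdsLT (hS.gap_lt k hk))).exists
    linarith [mem_gap h hS hk ht2]

lemma finite_bandEdges (h : IsPeriodicDirac L q Y) (hS : IsSpectralData q L Y S) (a b : ℝ) :
    (S.bandEdges ∩ Icc a b).Finite :=
  (finite_zeros_Icc h.eventually_discSq_ne_zero a b).subset fun _ he =>
    ⟨he.2, edge_discSq h hS he.1⟩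

lemma E_strictMonoOn (hS : IsSpectralData q L Y S) :
    StrictMonoOn (fun k => S.E (2 * k)) S.labels := fun j hj k hk hjk =>
  (hS.band_lt j hj k hk hjk).trans (hS.gap_lt k hk)

lemma finite_labels (h : IsPeriodicDirac L q Y) (hS : IsSpectralData q L Y S) (a b : ℝ) :
    {k ∈ S.labels | S.E (2 * k) ∈ Icc a b}.Finite := by
  refine Set.Finite.of_finite_image (f := fun k => S.E (2 * k))
    ((finite_bandEdges h hS a b).subset ?_) (hS.E_strictMonoOn.injOn.mono fun k hk => hk.1)
  rintro _ ⟨k, ⟨hk, hk2⟩, rfl⟩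
  exact ⟨⟨k, hk, Or.inr rfl⟩, hk2⟩

lemma inBand_or_gap (h : IsPeriodicDirac L q Y) (hS : IsSpectralData q L Y S) {t : ℝ}
    (ht : t ∉ S.bandEdges) :
    (∃ k ∈ S.labels, t ∈ Ioo (S.E (2 * k - 1)) (S.E (2 * k))) ∨ ∃ n, S.InBand n t := by
  by_cases hgap : ∃ k ∈ S.labels, t ∈ Ioo (S.E (2 * k - 1)) (S.E (2 * k))
  · exact Or.inl hgap
  right
  push Not at hgap
  have hcase : ∀ k ∈ S.labels, S.E (2 * k) < t ∨ t < S.E (2 * k - 1) := fun k hk => by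
    by_contra! hcon
    refine hgap k hk ⟨lt_of_le_of_ne hcon.2 fun h1 => ht ⟨k, hk, Or.inl h1.symm⟩,
      lt_of_le_of_ne hcon.1 fun h1 => ht ⟨k, hk, Or.inr h1⟩⟩
  have hup : ∀ j ∈ S.labels, ∀ k ∈ S.labels, j ≤ k → t < S.E (2 * j - 1) → t < S.E (2 * k - 1) := by
    intro j hj k hk hjk hlt
    rcases hjk.eq_or_lt with rfl | hjk
    · exact hlt
    · linarith [hS.band_lt j hj k hk hjk, hS.gap_lt j hj]
  rcases hcase 0 hS.zero_mem with h0 | h0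
  · -- the last gap to the left of `t`
    obtain ⟨n, ⟨hn, hnt⟩, hmax⟩ := Int.exists_greatest_of_bdd
      (P := fun k => k ∈ S.labels ∧ S.E (2 * k) < t) (by
        obtain ⟨b, hb⟩ := (finite_labels h hS (S.E (2 * 0)) t).bddAbove
        refine ⟨max b 0, fun k hk => ?_⟩
        rcases le_or_gt k 0 with h1 | h1
        · exact h1.trans (le_max_right _ _)
        · exact (hb ⟨hk.1, (hS.E_strictMonoOn hS.zero_mem hk.1 h1).le, hk.2.le⟩).trans
            (le_max_left _ _)) ⟨0, hS.zero_mem, h0⟩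
    refine ⟨n + 1, Or.inl (by simpa using hn), fun _ => ?_, fun hn1 => ?_⟩
    · rw [show 2 * (n + 1) - 2 = 2 * n by ring]; exact hnt
    · rcases hcase _ hn1 with h1 | h1
      · have := hmax _ ⟨hn1, h1⟩; omega
      · exact h1
  · obtain ⟨n, ⟨hn, hnt⟩, hmin⟩ := Int.exists_least_of_bdd
      (P := fun k => k ∈ S.labels ∧ t < S.E (2 * k - 1)) (by
        obtain ⟨b, hb⟩ := (finite_labels h hS t (S.E (2 * 0))).bddBelow
        refine ⟨min b 0, fun k hk => ?_⟩
        rcases le_or_gt 0 k with h1 | h1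
        · exact (min_le_right _ _).trans h1
        · exact (min_le_left _ _).trans (hb ⟨hk.1, (hk.2.trans (hS.gap_lt k hk.1)).le,
            (hS.E_strictMonoOn hk.1 hS.zero_mem h1).le⟩)) ⟨0, hS.zero_mem, h0⟩
    refine ⟨n, Or.inr hn, fun hn1 => ?_, fun _ => hnt⟩
    rw [show 2 * n - 2 = 2 * (n - 1) by ring]
    rcases hcase _ hn1 with h1 | h1
    · exact h1
    · have := hmin _ ⟨hn1, h1⟩; omega

lemma InBand.notMem_gap (hS : IsSpectralData q L Y S) {n : ℤ} {t : ℝ} (ht : S.InBand n t) {k : ℤ}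
    (hk : k ∈ S.labels) : t ∉ Ioo (S.E (2 * k - 1)) (S.E (2 * k)) := by
  intro hm
  obtain ⟨h1, h2, h3⟩ := ht
  rcases le_or_gt n k with hnk | hnk
  · have hn : n ∈ S.labels := by
      rcases h1 with h1 | h1
      · exact hS.ordConnected.out h1 hk ⟨by omega, hnk⟩
      · exact h1
    have h4 := h3 hn
    rcases hnk.eq_or_lt with rfl | hnk
    · linarith [hm.1]
    · linarith [hS.band_lt n hn k hk hnk, hS.gap_lt n hn, hm.1]
  · have hn : n - 1 ∈ S.labels := by
      rcases h1 with h1 | h1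
      · exact h1
      · exact hS.ordConnected.out hk h1 ⟨by omega, by omega⟩
    have h4 := h2 hn
    rw [show 2 * n - 2 = 2 * (n - 1) by ring] at h4
    rcases (show k ≤ n - 1 by omega).eq_or_lt with rfl | hnk
    · linarith [hm.2]
    · linarith [hS.band_lt k hk _ hn hnk, hS.gap_lt _ hn, hm.2]

lemma InBand.re_sq_le (h : IsPeriodicDirac L q Y) (hS : IsSpectralData q L Y S) {n : ℤ} {t : ℝ}
    (ht : S.InBand n t) : (mA Y L t).re ^ 2 ≤ 1 := by
  by_contra! h1
  obtain ⟨k, hk, hm⟩ := exists_gap h hS h1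
  exact InBand.notMem_gap hS ht hk hm

lemma isOpen_inBand (S : SpectralData) (n : ℤ) : IsOpen {t | S.InBand n t} := by
  have e : {t | S.InBand n t} = {t | n - 1 ∈ S.labels ∨ n ∈ S.labels} ∩
      ({t | n - 1 ∈ S.labels → S.E (2 * n - 2) < t} ∩ {t | n ∈ S.labels → t < S.E (2 * n - 1)}) := by
    ext t; rfl
  rw [e]
  refine isOpen_const.inter (IsOpen.inter ?_ ?_)
  · by_cases hn : n - 1 ∈ S.labels
    · simp only [hn, true_imp_iff]; exact isOpen_Ioi
    · simp [hn]
  · by_cases hn : n ∈ S.labels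
    · simp only [hn, true_imp_iff]; exact isOpen_Iio
    · simp [hn]

/-- In the interior of a band either `|Δ| < 1`, or the monodromy matrix is `±1`. -/
lemma InBand.halfDiff_eq_zero (h : IsPeriodicDirac L q Y) (hS : IsSpectralData q L Y S) {n : ℤ}
    {t : ℝ} (ht : S.InBand n t) (h0 : discSq Y L t = 0) : halfDiff Y L t = 0 := by
  by_contra hne
  obtain ⟨d, hd0, hd⟩ := h.discSq_deriv_ne_zero h0 hne
  have hev : ∀ᶠ x : ℝ in 𝓝 t, (mA Y L x).re ^ 2 ≤ 1 :=
    Filter.mem_of_superset ((isOpen_inBand S n).mem_nhds ht) fun x hx => InBand.re_sq_le h hS hx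
  have hmax : IsLocalMax (fun x : ℝ => (discSq Y L x).re) t := by
    filter_upwards [hev] with x hx
    rw [h0, h.discSq_real, Complex.ofReal_re, Complex.zero_re]
    linarith
  have hd' : HasDerivAt (fun x : ℝ => discSq Y L x) d t := hd.comp_ofReal
  have hre : HasDerivAt (fun x : ℝ => (discSq Y L x).re) d.re t :=
    Complex.reCLM.hasFDerivAt.comp_hasDerivAt t hd'
  have him : HasDerivAt (fun x : ℝ => (discSq Y L x).im) d.im t :=
    Complex.imCLM.hasFDerivAt.comp_hasDerivAt t hd'
  have him0 : (fun x : ℝ => (discSq Y L x).im) = fun _ => 0 := by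
    funext x; rw [h.discSq_real, Complex.ofReal_im]
  rw [him0] at him
  exact hd0 (Complex.ext (hmax.hasDerivAt_eq_zero hre) (him.unique (hasDerivAt_const t (0 : ℝ))))

lemma eq_γ (h : IsPeriodicDirac L q Y) (hS : IsSpectralData q L Y S) {k : ℤ} (hk : k ∈ S.labels)
    {t : ℝ} (ht : t ∈ Icc (S.E (2 * k - 1)) (S.E (2 * k))) (h0 : dirFun Y L t = 0) :
    t = S.γ k := by
  have hγ := hS.γ_mem k hk
  have hγ0 := (h.isDirichletEigenvalue_iff _).1 (hS.γ_dirichlet k hk)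
  rcases lt_trichotomy t (S.γ k) with h1 | h1 | h1
  · exact absurd hγ0 (h.dirFun_unique h1 (fun x hx => one_le_of_mem_Icc h hS hk
      ⟨ht.1.trans hx.1, hx.2.trans hγ.2⟩) h0)
  · exact h1
  · exact absurd h0 (h.dirFun_unique h1 (fun x hx => one_le_of_mem_Icc h hS hk
      ⟨hγ.1.trans hx.1, hx.2.trans ht.2⟩) hγ0)

/-- The `γ k` with sign `0` are the band edges that are Dirichlet eigenvalues. -/
lemma mem_zeroSignSet_iff (h : IsPeriodicDirac L q Y) (hS : IsSpectralData q L Y S) {y : ℝ} :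
    y ∈ S.zeroSignSet ↔ y ∈ S.bandEdges ∧ dirFun Y L y = 0 := by
  constructor
  · rintro ⟨k, hk, hσ, rfl⟩
    have hγ0 := (h.isDirichletEigenvalue_iff _).1 (hS.γ_dirichlet k hk)
    refine ⟨?_, hγ0⟩
    rw [hS.σ_eq k hk, h.dirichletSign_eq_zero_iff hγ0] at hσ
    have hm := hS.γ_mem k hk
    by_contra hne
    refine absurd (mem_gap h hS hk ⟨lt_of_le_of_ne hm.1 fun h1 => hne ⟨k, hk, Or.inl h1.symm⟩,
      lt_of_le_of_ne hm.2 fun h1 => hne ⟨k, hk, Or.inr h1⟩⟩) (not_lt.2 hσ)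
  · rintro ⟨he, h0⟩
    have hre := edge_re_sq h hS he
    obtain ⟨k, hk, hek⟩ := he
    have hm : y ∈ Icc (S.E (2 * k - 1)) (S.E (2 * k)) := by
      have := hS.gap_lt k hk
      rcases hek with rfl | rfl
      · exact left_mem_Icc.2 this.le
      · exact right_mem_Icc.2 this.le
    have hy := eq_γ h hS hk hm h0
    refine ⟨k, hk, ?_, hy.symm⟩
    rw [hS.σ_eq k hk, ← hy, h.dirichletSign_eq_zero_iff h0, hre]

lemma finite_zeroSignSet (h : IsPeriodicDirac L q Y) (hS : IsSpectralData q L Y S) (a b : ℝ) :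
    (S.zeroSignSet ∩ Icc a b).Finite :=
  (finite_bandEdges h hS a b).subset fun _ hy => ⟨((mem_zeroSignSet_iff h hS).1 hy.1).1, hy.2⟩

lemma awayFromGaps_subset (h : IsPeriodicDirac L q Y) (hS : IsSpectralData q L Y S) (δ : ℝ) :
    S.awayFromGaps δ ⊆ awayFromResolvent Y L δ := fun z hz => ⟨hz.1, fun t ht => by
  by_contra! h1
  obtain ⟨k, hk, hm⟩ := exists_gap h hS h1
  exact absurd ht (not_lt.2 (hz.2 k hk t (Ioo_subset_Icc_self hm)))⟩

end IsSpectralData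

open Asymptotics

/-! ### Local behaviour of the Bloch matrix at the real line -/

lemma nhdsWithin_im_ne_zero_le (t : ℝ) : 𝓝[{z : ℂ | z.im ≠ 0}] (t : ℂ) ≤ 𝓝[≠] (t : ℂ) :=
  nhdsWithin_mono _ fun z (hz : z.im ≠ 0) => by
    rintro rfl
    simp at hz

/-- A function with a simple zero vanishes to exactly first order. -/
lemma isTheta_of_hasDerivAt {f : ℂ → ℂ} {t d : ℂ} (hf : HasDerivAt f d t) (hd : d ≠ 0)
    (h0 : f t = 0) : f =Θ[𝓝[≠] t] fun z => z - t := by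
  refine IsTheta.symm (isTheta_of_div_tendsto_nhds_ne_zero (c := d) ?_ hd)
  refine (hasDerivAt_iff_tendsto_slope.1 hf).congr fun z => ?_
  rw [slope_def_field, h0, sub_zero]

lemma tendsto_norm_sub_rpow (t : ℂ) {a : ℝ} (ha : 0 < a) (l : Filter ℂ) (hl : l ≤ 𝓝 t) :
    Tendsto (fun z : ℂ => ‖z - t‖ ^ a) l (𝓝 0) := by
  have h1 : Continuous fun z : ℂ => ‖z - t‖ ^ a :=
    (continuous_norm.comp (continuous_id.sub continuous_const)).rpow_const fun _ => Or.inr ha.le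
  have h2 := h1.tendsto t
  rw [sub_self, norm_zero, Real.zero_rpow ha.ne'] at h2
  exact h2.mono_left hl

/-- Multiplication of powers of `|z - t|`. -/
lemma isBigO_rpow_mul {f g : ℂ → ℂ} {t : ℂ} {a b : ℝ} {l : Filter ℂ} (hl : l ≤ 𝓝[≠] t)
    (hf : f =O[l] fun z => ‖z - t‖ ^ a) (hg : g =O[l] fun z => ‖z - t‖ ^ b) :
    (fun z => f z * g z) =O[l] fun z => ‖z - t‖ ^ (a + b) := by
  refine (hf.mul hg).congr' (Eventually.of_forall fun _ => rfl) ?_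
  filter_upwards [hl self_mem_nhdsWithin] with z hz
  rw [← Real.rpow_add (norm_pos_iff.2 (sub_ne_zero.2 hz))]

lemma isBigO_one_rpow {f : ℂ → ℂ} {t : ℂ} {l : Filter ℂ} :
    (f =O[l] fun z => ‖z - t‖ ^ (0 : ℝ)) ↔ f =O[l] fun _ => (1 : ℝ) := by
  simp only [Real.rpow_zero]

lemma isTheta_rpow_inv {f : ℂ → ℂ} {t : ℂ} {a : ℝ} {l : Filter ℂ}
    (hf : f =Θ[l] fun z => ‖z - t‖ ^ a) : (fun z => (f z)⁻¹) =Θ[l] fun z => ‖z - t‖ ^ (-a) := by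
  refine hf.inv.trans_eventuallyEq (Eventually.of_forall fun z => ?_)
  exact (Real.rpow_neg (norm_nonneg _) a).symm

lemma isTheta_sub_rpow (t : ℂ) (l : Filter ℂ) :
    (fun z : ℂ => z - t) =Θ[l] fun z => ‖z - t‖ ^ (1 : ℝ) := by
  simp only [Real.rpow_one]
  exact (isTheta_norm_right.2 (isTheta_refl _ _))

lemma isBigO_sub_of_differentiableAt {f : ℂ → ℂ} {t : ℂ} (hf : DifferentiableAt ℂ f t) (h0 : f t = 0) :
    f =O[𝓝 t] fun z => ‖z - t‖ ^ (1 : ℝ) := by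
  have := hf.hasDerivAt.isBigO_sub
  simp only [h0, sub_zero] at this
  simp only [Real.rpow_one]
  exact this.norm_right

lemma isBigO_rpow_of_le {f : ℂ → ℂ} {t : ℂ} {a b : ℝ} (hab : b ≤ a) {l : Filter ℂ} (hl : l ≤ 𝓝[≠] t)
    (hf : f =O[l] fun z => ‖z - t‖ ^ a) : f =O[l] fun z => ‖z - t‖ ^ b := by
  refine hf.trans (IsBigO.of_bound 1 ?_)
  filter_upwards [hl self_mem_nhdsWithin, (hl.trans nhdsWithin_le_nhds) (Metric.ball_mem_nhds t one_pos)]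
    with z hz hz1
  rw [mem_ball_iff_norm] at hz1
  rw [one_mul, Real.norm_of_nonneg (by positivity), Real.norm_of_nonneg (by positivity)]
  exact Real.rpow_le_rpow_of_exponent_ge (norm_pos_iff.2 (sub_ne_zero.2 hz)) hz1.le hab

namespace IsPeriodicDirac

variable {L : ℝ} {q : ℝ → ℂ} {Y : ℝ → ℂ → Mat2}

lemma norm_sRoot (Y : ℝ → ℂ → Mat2) (L : ℝ) (z : ℂ) :
    ‖sRoot Y L z‖ = ‖discSq Y L z‖ ^ (1 / 2 : ℝ) := by
  rw [← sRoot_sq, norm_pow, ← Real.sqrt_eq_rpow, Real.sqrt_sq (norm_nonneg _)]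

lemma sRoot_isTheta {t : ℂ} {a : ℝ} {l : Filter ℂ}
    (hd : discSq Y L =Θ[l] fun z => ‖z - t‖ ^ a) :
    sRoot Y L =Θ[l] fun z => ‖z - t‖ ^ (a / 2) := by
  rw [← isTheta_norm_left]
  have h1 := (isTheta_norm_left.2 hd).rpow (r := 1 / 2)
    (Eventually.of_forall fun z => norm_nonneg _) (Eventually.of_forall fun z => by positivity)
  have e : ∀ z : ℂ, (‖z - t‖ ^ a) ^ (1 / 2 : ℝ) = ‖z - t‖ ^ (a / 2) := fun z => by
    rw [← Real.rpow_mul (norm_nonneg _), mul_one_div]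
  simp only [e, ← norm_sRoot] at h1
  exact h1

lemma sRoot_isTheta_edge (h : IsPeriodicDirac L q Y) {t : ℝ} (h0 : discSq Y L t = 0)
    (hne : halfDiff Y L t ≠ 0) :
    sRoot Y L =Θ[𝓝[≠] (t : ℂ)] fun z => ‖z - t‖ ^ (1 / 2 : ℝ) := by
  obtain ⟨d, hd0, hd⟩ := h.discSq_deriv_ne_zero h0 hne
  exact sRoot_isTheta ((isTheta_of_hasDerivAt hd hd0 h0).trans (isTheta_sub_rpow _ _))

lemma discSq_isTheta_collapsed (h : IsPeriodicDirac L q Y) {t : ℝ} (h0 : discSq Y L t = 0)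
    (h1 : halfDiff Y L t = 0) :
    discSq Y L =Θ[𝓝[≠] (t : ℂ)] fun z => ‖z - t‖ ^ (2 : ℝ) := by
  obtain ⟨κ, hκ, hlim⟩ := h.tendsto_discSq_div_sq h0 h1
  have h2 := (isTheta_of_div_tendsto_nhds_ne_zero hlim (by simpa using hκ.ne')).symm
  refine h2.trans ?_
  simp only [Real.rpow_ofNat]
  exact (isTheta_norm_right.2 (isTheta_refl _ _)).trans_eventuallyEq
    (Eventually.of_forall fun z => norm_pow _ _)

lemma sRoot_isTheta_collapsed (h : IsPeriodicDirac L q Y) {t : ℝ} (h0 : discSq Y L t = 0)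
    (h1 : halfDiff Y L t = 0) :
    sRoot Y L =Θ[𝓝[≠] (t : ℂ)] fun z => ‖z - t‖ ^ (1 : ℝ) := by
  have := sRoot_isTheta (h.discSq_isTheta_collapsed h0 h1)
  norm_num at this ⊢
  exact this

lemma sRoot_isBigO_one (h : IsPeriodicDirac L q Y) (t : ℂ) :
    sRoot Y L =O[𝓝 t] fun _ => (1 : ℝ) := by
  have h1 := ((h.differentiable_discSq.continuous.norm.rpow_const (p := 1 / 2)
    fun _ => Or.inr (by norm_num)).tendsto t).isBigO_one ℝ
  simp only [← norm_sRoot] at h1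
  exact h1.of_norm_left

/-- A bound for the entries of `matN` in terms of bounds for the two functions that make it up. -/
lemma matN_isBigO {l : Filter ℂ} {g : ℂ → ℝ} (h1 : (fun z => halfDiff Y L z + mC Y L z) =O[l] g)
    (h2 : (fun z => halfDiff Y L z - mB Y L z) =O[l] g) (h3 : sRoot Y L =O[l] g) (i j : Fin 2) :
    (fun z => matN Y L (sRoot Y L z) z i j) =O[l] g := by
  obtain rfl | rfl : i = 0 ∨ i = 1 := by omega
  · obtain rfl | rfl : j = 0 ∨ j = 1 := by omega
    · exact (h1.add h3).congr_left fun z => by simp [matN]; ring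
    · exact (h3.sub h2).congr_left fun z => by simp [matN]; ring
  · obtain rfl | rfl : j = 0 ∨ j = 1 := by omega
    · exact (h3.sub h1).congr_left fun z => by simp [matN]; ring
    · exact (h2.add h3).congr_left fun z => by simp [matN]

lemma matN_isBigO_one (h : IsPeriodicDirac L q Y) (t : ℂ) (i j : Fin 2) :
    (fun z => matN Y L (sRoot Y L z) z i j) =O[𝓝 t] fun _ => (1 : ℝ) :=
  matN_isBigO
    ((h.differentiable_halfDiff.continuous.add h.differentiable_mC.continuous).tendsto t
      |>.isBigO_one ℝ)
    ((h.differentiable_halfDiff.continuous.sub h.differentiable_mB.continuous).tendsto t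
      |>.isBigO_one ℝ) (h.sRoot_isBigO_one t) i j

lemma matN_isBigO_collapsed (h : IsPeriodicDirac L q Y) {t : ℝ} (h0 : discSq Y L t = 0)
    (h1 : halfDiff Y L t = 0) (i j : Fin 2) :
    (fun z => matN Y L (sRoot Y L z) z i j) =O[𝓝[≠] (t : ℂ)] fun z => ‖z - t‖ ^ (1 : ℝ) := by
  obtain ⟨hb, hc, -⟩ := h.monodromy_of_halfDiff_eq_zero h0 h1
  refine matN_isBigO ?_ ?_ (h.sRoot_isTheta_collapsed h0 h1).1 i j
  · exact (isBigO_sub_of_differentiableAt ((h.differentiable_halfDiff _).add (h.differentiable_mC _))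
      (by simp [h1, hc])).mono nhdsWithin_le_nhds
  · exact (isBigO_sub_of_differentiableAt ((h.differentiable_halfDiff _).sub (h.differentiable_mB _))
      (by simp [h1, hb])).mono nhdsWithin_le_nhds

/-- At an edge which is a Dirichlet eigenvalue all entries of `matN` vanish to the order of the
root `s`. -/
lemma matN_isBigO_edge (h : IsPeriodicDirac L q Y) {t : ℝ} (h0 : discSq Y L t = 0)
    (hne : halfDiff Y L t ≠ 0) (hD : dirFun Y L t = 0) (i j : Fin 2) :
    (fun z => matN Y L (sRoot Y L z) z i j) =O[𝓝[≠] (t : ℂ)] fun z => ‖z - t‖ ^ (1 / 2 : ℝ) := by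
  have hm := h.dirichlet_mul hD
  have hs := dirichlet_sum hD
  rw [discSq, sub_eq_zero] at h0
  -- At the edge `ỹ₁₁` and `ỹ₂₂` are the roots of `(X - Δ)²`.
  have e1 : mA Y L t + mC Y L t = discriminant Y L t := by
    have : (mA Y L t + mC Y L t - discriminant Y L t) ^ 2 = 0 := by
      linear_combination (mA Y L t + mC Y L t) * hs - hm + h0
    exact sub_eq_zero.1 (pow_eq_zero_iff two_ne_zero |>.1 this)
  have e2 : mA Y L t - mB Y L t = discriminant Y L t := by linear_combination hs - e1
  have ea := mA_eq Y L t
  refine matN_isBigO ?_ ?_ (h.sRoot_isTheta_edge (by rw [discSq, h0, sub_self]) hne).1 i j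
  · exact isBigO_rpow_of_le (by norm_num) le_rfl ((isBigO_sub_of_differentiableAt
      ((h.differentiable_halfDiff _).add (h.differentiable_mC _))
      (by simp only [Pi.add_apply]; linear_combination e1 - ea)).mono nhdsWithin_le_nhds)
  · exact isBigO_rpow_of_le (by norm_num) le_rfl ((isBigO_sub_of_differentiableAt
      ((h.differentiable_halfDiff _).sub (h.differentiable_mB _))
      (by simp only [Pi.sub_apply]; linear_combination e2 - ea)).mono nhdsWithin_le_nhds)

lemma matNadj_apply (Y : ℝ → ℂ → Mat2) (L : ℝ) (s z : ℂ) :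
    matNadj Y L s z 0 0 = matN Y L s z 1 1 ∧ matNadj Y L s z 0 1 = -matN Y L s z 0 1 ∧
    matNadj Y L s z 1 0 = -matN Y L s z 1 0 ∧ matNadj Y L s z 1 1 = matN Y L s z 0 0 := by
  refine ⟨?_, ?_, ?_, ?_⟩ <;> simp [matN, matNadj] <;> ring

lemma matNadj_isBigO {l : Filter ℂ} {g : ℂ → ℝ}
    (hN : ∀ i j, (fun z => matN Y L (sRoot Y L z) z i j) =O[l] g) (i j : Fin 2) :
    (fun z => matNadj Y L (sRoot Y L z) z i j) =O[l] g := by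
  obtain rfl | rfl : i = 0 ∨ i = 1 := by omega
  · obtain rfl | rfl : j = 0 ∨ j = 1 := by omega
    · exact (hN 1 1).congr_left fun z => (matNadj_apply Y L _ z).1.symm
    · exact (hN 0 1).neg_left.congr_left fun z => (matNadj_apply Y L _ z).2.1.symm
  · obtain rfl | rfl : j = 0 ∨ j = 1 := by omega
    · exact (hN 1 0).neg_left.congr_left fun z => (matNadj_apply Y L _ z).2.2.1.symm
    · exact (hN 0 0).congr_left fun z => (matNadj_apply Y L _ z).2.2.2.symm

lemma matNadj_neg (Y : ℝ → ℂ → Mat2) (L : ℝ) (s z : ℂ) :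
    matNadj Y L (-s) z = matNadj Y L s z * sigma1 := by
  ext i j
  fin_cases i <;> fin_cases j <;> simp [sigma1, matNadj, Matrix.mul_apply] <;> ring

lemma dirFun_inv_isBigO (h : IsPeriodicDirac L q Y) {t : ℝ} (h0 : dirFun Y L t = 0) :
    (fun z => (dirFun Y L z)⁻¹) =O[𝓝[≠] (t : ℂ)] fun z => ‖z - t‖ ^ (-1 : ℝ) := by
  obtain ⟨d, hd0, hd⟩ := h.dirFun_deriv_ne_zero h0
  exact (isTheta_rpow_inv ((isTheta_of_hasDerivAt hd hd0 h0).trans (isTheta_sub_rpow _ _))).1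

lemma inv_isBigO_one {f : ℂ → ℂ} {t : ℂ} (hf : ContinuousAt f t) (h0 : f t ≠ 0) :
    (fun z => (f z)⁻¹) =O[𝓝 t] fun _ => (1 : ℝ) := (hf.inv₀ h0).tendsto.isBigO_one ℝ

lemma sRoot_inv_isBigO_one (h : IsPeriodicDirac L q Y) {t : ℂ} (h0 : discSq Y L t ≠ 0) :
    (fun z => (sRoot Y L z)⁻¹) =O[𝓝 t] fun _ => (1 : ℝ) := by
  have h1 : ContinuousAt (fun z => ‖discSq Y L z‖ ^ (1 / 2 : ℝ)) t :=
    (h.differentiable_discSq.continuous.norm.rpow_const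
      fun _ => Or.inr (by norm_num)).continuousAt
  have h2 := (h1.inv₀ (Real.rpow_pos_of_pos (norm_pos_iff.2 h0) _).ne').tendsto.isBigO_one ℝ
  refine IsBigO.of_norm_left (h2.congr_left fun z => ?_)
  rw [norm_inv, norm_sRoot]; rfl

lemma dirFun_ne_zero_of_band (h : IsPeriodicDirac L q Y) {t : ℝ} (ht : (mA Y L t).re ^ 2 < 1) :
    dirFun Y L t ≠ 0 := fun h0 => by
  obtain ⟨r, hr, -, -, h3⟩ := h.dirichlet_real h0
  have e : (mA Y L t).re ^ 2 - 1 = ((r - r⁻¹) / 2) ^ 2 := by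
    have : (mA Y L t).re = (r + r⁻¹) / 2 := by linarith
    rw [this]; field_simp; ring
  nlinarith [sq_nonneg ((r - r⁻¹) / 2)]

/-- Inside the spectrum the matrix of initial values of the Bloch solutions and its inverse are
bounded. -/
lemma initial_isBigO_band (h : IsPeriodicDirac L q Y) {t : ℝ}
    (ht : (mA Y L t).re ^ 2 < 1 ∨ discSq Y L t = 0 ∧ halfDiff Y L t = 0) (i j : Fin 2) :
    (fun z => matNadj Y L (sRoot Y L z) z i j * (dirFun Y L z)⁻¹) =O[𝓝[≠] (t : ℂ)]
      (fun z => ‖z - t‖ ^ (0 : ℝ)) ∧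
    (fun z => matN Y L (sRoot Y L z) z i j * (sRoot Y L z)⁻¹) =O[𝓝[≠] (t : ℂ)]
      (fun z => ‖z - t‖ ^ (0 : ℝ)) := by
  rcases ht with ht | ⟨h0, h1⟩
  · have hd0 : discSq Y L t ≠ 0 := fun h0 => by
      rw [h.discSq_real_eq_zero_iff] at h0; linarith
    have hN := fun i j => (isBigO_one_rpow (t := (t : ℂ))).2
      ((h.matN_isBigO_one t i j).mono (nhdsWithin_le_nhds (s := {(t : ℂ)}ᶜ)))
    have hD := (isBigO_one_rpow (t := (t : ℂ))).2
      ((inv_isBigO_one (h.differentiable_dirFun.continuous.continuousAt)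
      (h.dirFun_ne_zero_of_band ht)).mono (nhdsWithin_le_nhds (s := {(t : ℂ)}ᶜ)))
    have hs := (isBigO_one_rpow (t := (t : ℂ))).2
      ((h.sRoot_inv_isBigO_one hd0).mono (nhdsWithin_le_nhds (s := {(t : ℂ)}ᶜ)))
    constructor
    · simpa using isBigO_rpow_mul le_rfl (matNadj_isBigO hN i j) hD
    · simpa using isBigO_rpow_mul le_rfl (hN i j) hs
  · have hN := h.matN_isBigO_collapsed h0 h1
    have hD := h.dirFun_inv_isBigO (h.monodromy_of_halfDiff_eq_zero h0 h1).2.2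
    have hs := (isTheta_rpow_inv (h.sRoot_isTheta_collapsed h0 h1)).1
    constructor
    · simpa using isBigO_rpow_mul le_rfl (matNadj_isBigO hN i j) hD
    · simpa using isBigO_rpow_mul le_rfl (hN i j) hs

/-- At a band edge one of the two factors is bounded and the other is `O(|z - t| ^ (-1/2))`; which
is which depends on whether the edge is a Dirichlet eigenvalue. -/
lemma initial_isBigO_edge (h : IsPeriodicDirac L q Y) {t : ℝ} (h0 : discSq Y L t = 0)
    (hne : halfDiff Y L t ≠ 0) (i j : Fin 2) :
    (dirFun Y L t ≠ 0 →
      (fun z => matNadj Y L (sRoot Y L z) z i j * (dirFun Y L z)⁻¹) =O[𝓝[≠] (t : ℂ)]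
        (fun z => ‖z - t‖ ^ (0 : ℝ)) ∧
      (fun z => matN Y L (sRoot Y L z) z i j * (sRoot Y L z)⁻¹) =O[𝓝[≠] (t : ℂ)]
        (fun z => ‖z - t‖ ^ (-(1 / 2) : ℝ))) ∧
    (dirFun Y L t = 0 →
      (fun z => matNadj Y L (sRoot Y L z) z i j * (dirFun Y L z)⁻¹) =O[𝓝[≠] (t : ℂ)]
        (fun z => ‖z - t‖ ^ (-(1 / 2) : ℝ)) ∧
      (fun z => matN Y L (sRoot Y L z) z i j * (sRoot Y L z)⁻¹) =O[𝓝[≠] (t : ℂ)]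
        (fun z => ‖z - t‖ ^ (0 : ℝ))) := by
  have hs := (isTheta_rpow_inv (h.sRoot_isTheta_edge h0 hne)).1
  constructor
  · intro hD0
    have hN := fun i j => (isBigO_one_rpow (t := (t : ℂ))).2
      ((h.matN_isBigO_one t i j).mono (nhdsWithin_le_nhds (s := {(t : ℂ)}ᶜ)))
    have hD := (isBigO_one_rpow (t := (t : ℂ))).2
      ((inv_isBigO_one (h.differentiable_dirFun.continuous.continuousAt)
      hD0).mono (nhdsWithin_le_nhds (s := {(t : ℂ)}ᶜ)))
    constructor
    · simpa using isBigO_rpow_mul le_rfl (matNadj_isBigO hN i j) hD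
    · simpa using isBigO_rpow_mul le_rfl (hN i j) hs
  · intro hD0
    have hN := h.matN_isBigO_edge h0 hne hD0
    have hD := h.dirFun_inv_isBigO hD0
    constructor
    · have := isBigO_rpow_mul le_rfl (matNadj_isBigO hN i j) hD
      norm_num at this ⊢
      exact this
    · simpa using isBigO_rpow_mul le_rfl (hN i j) hs

end IsPeriodicDirac

/-! ### Entire functions bounded away from the lattice -/

/-- The maximum principle on the circles `|z| = (n + 1/2) π / L`, which avoid the lattice. -/
lemma norm_le_of_awayFromLattice {L : ℝ} (hL : 0 < L) {f : ℂ → ℂ} (hf : Differentiable ℂ f)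
    {M : ℝ → ℝ} (hM : Monotone M) {R : ℝ}
    (hb : ∀ z ∈ awayFromLattice L (Real.pi / (4 * L)), R ≤ ‖z‖ → ‖f z‖ ≤ M ‖z‖) (z : ℂ) :
    ‖f z‖ ≤ M (max ‖z‖ R + 3 * (Real.pi / L)) := by
  have hpi := Real.pi_pos
  set d := Real.pi / L with hd
  have hd0 : 0 < d := by positivity
  have hd4 : Real.pi / (4 * L) = d / 4 := by rw [hd]; field_simp
  rw [hd4] at hb
  set m := max ‖z‖ R with hm
  have hm0 : 0 ≤ m := (norm_nonneg z).trans (le_max_left _ _)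
  set n := ⌈m / d⌉₊ + 1 with hn
  set r := (n + 1 / 2 : ℝ) * d with hr
  have hn1 : m / d ≤ ⌈m / d⌉₊ := Nat.le_ceil _
  have hn2 : (⌈m / d⌉₊ : ℝ) < m / d + 1 := Nat.ceil_lt_add_one (by positivity)
  have hncast : (n : ℝ) = ⌈m / d⌉₊ + 1 := by rw [hn]; push_cast; ring
  have hmd : m / d * d = m := by field_simp
  have hr1 : m + d ≤ r := by rw [hr, hncast]; nlinarith
  have hr2 : r ≤ m + 5 / 2 * d := by rw [hr, hncast]; nlinarith
  have hsph : ∀ w ∈ Metric.sphere (0 : ℂ) r, ‖f w‖ ≤ M (r + d / 4) := by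
    intro w hw
    rw [mem_sphere_zero_iff_norm] at hw
    refine norm_le_of_im_ne_zero (g := fun _ => M (r + d / 4)) hf.continuous.continuousAt
      continuousAt_const ?_
    filter_upwards [Metric.ball_mem_nhds w (show 0 < d / 4 by linarith)] with w' hw' hi
    rw [mem_ball_iff_norm] at hw'
    have h1 : ‖w'‖ ≤ r + d / 4 := by
      have := norm_le_insert' w' w
      linarith
    have h2 : r - d / 4 ≤ ‖w'‖ := by
      have := norm_le_insert' w w'
      rw [norm_sub_rev] at this
      linarith
    refine (hb w' ⟨hi, fun k => ?_⟩ (by linarith [le_max_right ‖z‖ R])).trans (hM h1)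
    have h3 : ‖((k * Real.pi / L : ℝ) : ℂ)‖ = |(k : ℝ)| * d := by
      rw [Complex.norm_real, Real.norm_eq_abs, mul_div_assoc, abs_mul, abs_of_pos hd0]
    have h4 := abs_norm_sub_norm_le w' ((k * Real.pi / L : ℝ) : ℂ)
    rw [Complex.dist_eq]
    rw [h3] at h4
    refine le_trans ?_ h4
    -- the half integer `n + 1/2` has distance at least `1/2` from the integer `|k|`
    have h5 : |(k : ℝ)| ≤ n ∨ (n : ℝ) + 1 ≤ |(k : ℝ)| := by
      rw [← Int.cast_abs]
      rcases le_or_gt |k| n with h5 | h5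
      · left; exact_mod_cast h5
      · right; exact_mod_cast h5
    rw [le_abs]
    rcases h5 with h5 | h5
    · left; rw [hr] at h2; nlinarith
    · right; rw [hr] at h1; nlinarith
  refine (norm_le_of_forall_mem_sphere hf.differentiableOn (by linarith) hsph (z := z) ?_).trans
    (hM (by linarith))
  rw [mem_closedBall_zero_iff]
  linarith [le_max_left ‖z‖ R]

lemma eq_of_tendsto_awayFromLattice {L : ℝ} (hL : 0 < L) {f : ℂ → ℂ} (hf : Differentiable ℂ f)
    {c : ℂ} (hlim : Tendsto f (Bornology.cobounded ℂ ⊓ 𝓟 (awayFromLattice L (Real.pi / (4 * L))))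
      (𝓝 c)) (z : ℂ) : f z = c := by
  rw [← sub_eq_zero, ← norm_le_zero_iff]
  refine le_of_forall_pos_le_add fun ε hε => ?_
  have hev := Metric.tendsto_nhds.1 hlim ε hε
  rw [eventually_inf_principal] at hev
  obtain ⟨R, -, hR⟩ := (Filter.hasBasis_cobounded_norm (E := ℂ)).eventually_iff.1 hev
  rw [zero_add]
  refine norm_le_of_awayFromLattice hL (hf.sub_const c) (M := fun _ => ε) monotone_const (R := R)
    (fun w hw hwR => ?_) z
  rw [← dist_eq_norm]
  exact (hR (show w ∈ {x : ℂ | R ≤ ‖x‖} from hwR) hw).le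

lemma awayFromLattice_neBot {L δ : ℝ} :
    (Bornology.cobounded ℂ ⊓ 𝓟 (awayFromLattice L δ)).NeBot := by
  have h1 : Tendsto (fun y : ℝ => (y : ℂ) * Complex.I) atTop
      (Bornology.cobounded ℂ ⊓ 𝓟 (awayFromLattice L δ)) := by
    refine tendsto_inf.2 ⟨?_, tendsto_principal.2 ?_⟩
    · rw [← tendsto_norm_atTop_iff_cobounded]
      simpa using tendsto_abs_atTop_atTop
    · filter_upwards [eventually_ge_atTop δ, eventually_gt_atTop 0] with y hy hy0
      refine ⟨by simpa using hy0.ne', fun k => hy.trans ?_⟩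
      rw [Complex.dist_eq]
      refine le_trans ?_ (Complex.abs_im_le_norm _)
      simp [le_abs_self]
  exact neBot_of_le h1

/-! ### The spectral data determine the potential -/

lemma tendsto_sub_mul {K : ℂ → ℂ} {t : ℝ} {a : ℝ} (ha : -1 < a)
    (hK : K =O[𝓝[≠] (t : ℂ)] fun z => ‖z - t‖ ^ a) :
    Tendsto (fun z => (z - t) * K z) (𝓝[{z | z.im ≠ 0}] (t : ℂ)) (𝓝 0) := by
  have h1 := isBigO_rpow_mul le_rfl (isTheta_sub_rpow (t : ℂ) (𝓝[≠] (t : ℂ))).1 hK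
  exact (h1.trans_tendsto (tendsto_norm_sub_rpow _ (by linarith) _ nhdsWithin_le_nhds)).mono_left
    (nhdsWithin_im_ne_zero_le t)

namespace IsPeriodicDirac

variable {L : ℝ} {q : ℝ → ℂ} {Y : ℝ → ℂ → Mat2}

lemma continuousAt_matN (h : IsPeriodicDirac L q Y) {s : ℂ → ℂ} {t : ℂ} (hs : ContinuousAt s t)
    (i j : Fin 2) : ContinuousAt (fun z => matN Y L (s z) z i j) t := by
  have hα := h.differentiable_halfDiff.continuous.continuousAt (x := t)
  have hb := h.differentiable_mB.continuous.continuousAt (x := t)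
  have hc := h.differentiable_mC.continuous.continuousAt (x := t)
  obtain rfl | rfl : i = 0 ∨ i = 1 := by omega
  · obtain rfl | rfl : j = 0 ∨ j = 1 := by omega
    · exact (hα.add hs).add hc
    · exact (hb.sub hα).add hs
  · obtain rfl | rfl : j = 0 ∨ j = 1 := by omega
    · exact (hc.neg.sub hα).add hs
    · exact (hα.sub hb).add hs

lemma continuousAt_matNadj (h : IsPeriodicDirac L q Y) {s : ℂ → ℂ} {t : ℂ} (hs : ContinuousAt s t)
    (i j : Fin 2) : ContinuousAt (fun z => matNadj Y L (s z) z i j) t := by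
  have hN := h.continuousAt_matN hs
  obtain rfl | rfl : i = 0 ∨ i = 1 := by omega
  · obtain rfl | rfl : j = 0 ∨ j = 1 := by omega
    · exact (hN 1 1).congr (Eventually.of_forall fun z => (matNadj_apply Y L _ z).1.symm)
    · exact (hN 0 1).neg.congr (Eventually.of_forall fun z => (matNadj_apply Y L _ z).2.1.symm)
  · obtain rfl | rfl : j = 0 ∨ j = 1 := by omega
    · exact (hN 1 0).neg.congr (Eventually.of_forall fun z => (matNadj_apply Y L _ z).2.2.1.symm)
    · exact (hN 0 0).congr (Eventually.of_forall fun z => (matNadj_apply Y L _ z).2.2.2.symm)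

end IsPeriodicDirac

section Uniqueness

variable {L : ℝ} {q₁ q₂ : ℝ → ℂ} {Y₁ Y₂ : ℝ → ℂ → Mat2} {S : SpectralData}

/-- The quotient of the matrices of initial values of the Bloch solutions of two potentials with
the same spectral data continues to an entire function: the jumps cancel, and so do the
singularities. -/
lemma exists_entire_transition (h₁ : IsPeriodicDirac L q₁ Y₁) (h₂ : IsPeriodicDirac L q₂ Y₂)
    (hS₁ : IsSpectralData q₁ L Y₁ S) (hS₂ : IsSpectralData q₂ L Y₂ S) (i j : Fin 2) :
    ∃ F : ℂ → ℂ, Differentiable ℂ F ∧ ∀ z : ℂ, z.im ≠ 0 → F z =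
      (matNadj Y₁ L (sRoot Y₁ L z) z * matN Y₂ L (sRoot Y₂ L z) z) i j *
        ((dirFun Y₁ L z)⁻¹ * (sRoot Y₂ L z)⁻¹) := by
  set P : ℂ → ℂ → ℂ → ℂ := fun s₁ s₂ z => (matNadj Y₁ L s₁ z * matN Y₂ L s₂ z) i j with hP
  have hPneg : ∀ s₁ s₂ z, P (-s₁) (-s₂) z = -P s₁ s₂ z := fun s₁ s₂ z => by
    simp only [hP]
    rw [IsPeriodicDirac.matNadj_neg, matN_neg, Matrix.mul_neg, Matrix.mul_assoc,
      ← Matrix.mul_assoc sigma1, sigma1_mul_self, Matrix.one_mul, Matrix.neg_apply]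
  have hPc : ∀ {s₁ s₂ : ℂ → ℂ} {t : ℂ}, ContinuousAt s₁ t → ContinuousAt s₂ t →
      ContinuousAt (fun z => P (s₁ z) (s₂ z) z) t := fun h1 h2 => by
    simp only [hP, Matrix.mul_apply, Fin.sum_univ_two]
    exact ((h₁.continuousAt_matNadj h1 i 0).mul (h₂.continuousAt_matN h2 0 j)).add
      ((h₁.continuousAt_matNadj h1 i 1).mul (h₂.continuousAt_matN h2 1 j))
  have hgap : ∀ t : ℝ, 1 < (mA Y₁ L t).re ^ 2 ↔ 1 < (mA Y₂ L t).re ^ 2 := fun t => by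
    constructor
    · intro ht
      obtain ⟨k, hk, hm⟩ := IsSpectralData.exists_gap h₁ hS₁ ht
      exact IsSpectralData.mem_gap h₂ hS₂ hk hm
    · intro ht
      obtain ⟨k, hk, hm⟩ := IsSpectralData.exists_gap h₂ hS₂ ht
      exact IsSpectralData.mem_gap h₁ hS₁ hk hm
  set K : ℂ → ℂ := fun z => P (sRoot Y₁ L z) (sRoot Y₂ L z) z *
    ((dirFun Y₁ L z)⁻¹ * (sRoot Y₂ L z)⁻¹) with hK
  -- in a gap both roots change their sign, and the quotient does not
  have hKgap : ∀ t : ℝ, 1 < (mA Y₁ L t).re ^ 2 → ∃ s₁ s₂ : ℂ → ℂ, ContinuousAt s₁ t ∧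
      ContinuousAt s₂ t ∧ s₁ t ^ 2 = discSq Y₁ L t ∧ s₂ t ^ 2 = discSq Y₂ L t ∧
      1 < ‖discriminant Y₁ L t + s₁ t‖ ∧ 1 < ‖discriminant Y₂ L t + s₂ t‖ ∧
      ∀ᶠ z in 𝓝[{z | z.im ≠ 0}] (t : ℂ),
        P (s₁ z) (s₂ z) z * ((dirFun Y₁ L z)⁻¹ * (s₂ z)⁻¹) = K z := by
    intro t ht
    obtain ⟨s₁, ha₁, hsq₁, hn₁, hp₁, hm₁⟩ := h₁.sRoot_near_gap ht
    obtain ⟨s₂, ha₂, hsq₂, hn₂, hp₂, hm₂⟩ := h₂.sRoot_near_gap ((hgap t).1 ht)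
    refine ⟨s₁, s₂, ha₁.continuousAt, ha₂.continuousAt, hsq₁.self_of_nhds, hsq₂.self_of_nhds,
      hn₁, hn₂, ?_⟩
    filter_upwards [nhdsWithin_le_nhds hp₁, nhdsWithin_le_nhds hp₂, nhdsWithin_le_nhds hm₁,
      nhdsWithin_le_nhds hm₂, self_mem_nhdsWithin] with z e1 e2 e3 e4 hz
    rcases lt_or_gt_of_ne (show z.im ≠ 0 from hz) with hz | hz
    · simp only [hK]
      rw [e3 hz, e4 hz, hPneg, inv_neg]; ring
    · simp only [hK]
      rw [e1 hz, e2 hz]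
  have hKsum : ∀ z, K z =
      (matNadj Y₁ L (sRoot Y₁ L z) z i 0 * (dirFun Y₁ L z)⁻¹) *
        (matN Y₂ L (sRoot Y₂ L z) z 0 j * (sRoot Y₂ L z)⁻¹) +
      (matNadj Y₁ L (sRoot Y₁ L z) z i 1 * (dirFun Y₁ L z)⁻¹) *
        (matN Y₂ L (sRoot Y₂ L z) z 1 j * (sRoot Y₂ L z)⁻¹) := fun z => by
    simp only [hK, hP, Matrix.mul_apply, Fin.sum_univ_two]; ring
  suffices hext : ∃ F : ℂ → ℂ, DifferentiableOn ℂ F univ ∧ ∀ z ∈ univ, z.im ≠ 0 → F z = K z by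
    obtain ⟨F, hF, hFe⟩ := hext
    exact ⟨F, differentiableOn_univ.1 hF, fun z hz => hFe z (mem_univ z) hz⟩
  refine exists_extension
    (Z := {t : ℝ | discSq Y₁ L t = 0 ∨ discSq Y₂ L t = 0 ∨ dirFun Y₁ L t = 0})
    isOpen_univ ?_ ?_ ?_ ?_
  · rintro z ⟨-, hz⟩
    have d1 := (h₁.analyticAt_sRoot hz).differentiableAt
    have d2 := (h₂.analyticAt_sRoot hz).differentiableAt
    have hN : ∀ a b, DifferentiableAt ℂ (fun z => matN Y₂ L (sRoot Y₂ L z) z a b) z := by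
      intro a b
      have hα := h₂.differentiable_halfDiff z
      have hb := h₂.differentiable_mB z
      have hc := h₂.differentiable_mC z
      fin_cases a <;> fin_cases b
      · exact (hα.add d2).add hc
      · exact (hb.sub hα).add d2
      · exact (hc.neg.sub hα).add d2
      · exact (hα.sub hb).add d2
    have hNa : ∀ a b, DifferentiableAt ℂ (fun z => matNadj Y₁ L (sRoot Y₁ L z) z a b) z := by
      intro a b
      have hα := h₁.differentiable_halfDiff z
      have hb := h₁.differentiable_mB z
      have hc := h₁.differentiable_mC z
      fin_cases a <;> fin_cases b
      · exact (hα.sub hb).add d1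
      · exact (hα.sub hb).sub d1
      · exact (hα.add hc).sub d1
      · exact (hα.add d1).add hc
    have hD := (h₁.differentiable_dirFun z).inv (h₁.dirFun_ne_zero hz)
    have hs := d2.inv (h₂.sRoot_ne_zero hz)
    rw [funext hKsum]
    exact ((((hNa i 0).mul hD).mul ((hN 0 j).mul hs)).add
      (((hNa i 1).mul hD).mul ((hN 1 j).mul hs))).differentiableWithinAt
  · intro t _
    filter_upwards [(IsPeriodicDirac.tendsto_ofReal_nhdsNE t).eventually
      (h₁.eventually_discSq_ne_zero t), (IsPeriodicDirac.tendsto_ofReal_nhdsNE t).eventually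
      (h₂.eventually_discSq_ne_zero t), (IsPeriodicDirac.tendsto_ofReal_nhdsNE t).eventually
      (h₁.eventually_dirFun_ne_zero t)] with x e1 e2 e3
    rintro (hx | hx | hx)
    exacts [e1 hx, e2 hx, e3 hx]
  · intro t _ htZ
    simp only [mem_ofPred_eq, not_or] at htZ
    obtain ⟨hd1, hd2, hD⟩ := htZ
    rcases lt_or_ge 1 ((mA Y₁ L t).re ^ 2) with ht | ht
    · obtain ⟨s₁, s₂, hc1, hc2, hsq1, hsq2, -, -, he⟩ := hKgap t ht
      have hs0 : s₂ t ≠ 0 := by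
        intro h0; rw [h0] at hsq2; simp at hsq2; exact hd2 hsq2.symm
      have hc : ContinuousAt (fun z => P (s₁ z) (s₂ z) z * ((dirFun Y₁ L z)⁻¹ * (s₂ z)⁻¹)) t :=
        (hPc hc1 hc2).mul ((h₁.differentiable_dirFun.continuous.continuousAt.inv₀ hD).mul
          (hc2.inv₀ hs0))
      exact ⟨_, (hc.tendsto.mono_left nhdsWithin_le_nhds).congr' he⟩
    · have ht1 : (mA Y₁ L t).re ^ 2 < 1 := lt_of_le_of_ne ht fun h0 =>
        hd1 ((h₁.discSq_real_eq_zero_iff t).2 h0)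
      have ht2 : (mA Y₂ L t).re ^ 2 < 1 := lt_of_le_of_ne
        (not_lt.1 fun h0 => absurd ((hgap t).2 h0) (not_lt.2 ht)) fun h0 =>
        hd2 ((h₂.discSq_real_eq_zero_iff t).2 h0)
      obtain ⟨s₁, ha₁, -, -, he₁⟩ := h₁.sRoot_near_band ht1
      obtain ⟨s₂, ha₂, hsq₂, -, he₂⟩ := h₂.sRoot_near_band ht2
      have hs0 : s₂ t ≠ 0 := by
        intro h0
        have := hsq₂.self_of_nhds
        rw [h0] at this; simp at this; exact hd2 this.symm
      have hc : ContinuousAt (fun z => P (s₁ z) (s₂ z) z * ((dirFun Y₁ L z)⁻¹ * (s₂ z)⁻¹)) t :=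
        (hPc ha₁.continuousAt ha₂.continuousAt).mul
          ((h₁.differentiable_dirFun.continuous.continuousAt.inv₀ hD).mul
          (ha₂.continuousAt.inv₀ hs0))
      refine ⟨_, (hc.tendsto.mono_left nhdsWithin_le_nhds).congr' ?_⟩
      filter_upwards [nhdsWithin_le_nhds he₁, nhdsWithin_le_nhds he₂, self_mem_nhdsWithin]
        with z e1 e2 hz
      simp only [hK]
      rw [e1 hz, e2 hz]
  · intro t _ htZ
    by_cases hedge : t ∈ S.bandEdges
    · -- at an edge one of the two factors is bounded
      have hd1 := IsSpectralData.edge_discSq h₁ hS₁ hedge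
      have hd2 := IsSpectralData.edge_discSq h₂ hS₂ hedge
      have ha1 := IsSpectralData.edge_halfDiff h₁ hS₁ hedge
      have ha2 := IsSpectralData.edge_halfDiff h₂ hS₂ hedge
      have hDD : dirFun Y₁ L t = 0 ↔ dirFun Y₂ L t = 0 := by
        have e1 := IsSpectralData.mem_zeroSignSet_iff h₁ hS₁ (y := t)
        have e2 := IsSpectralData.mem_zeroSignSet_iff h₂ hS₂ (y := t)
        simp only [hedge, true_and] at e1 e2
        rw [← e1, ← e2]
      refine tendsto_sub_mul (a := -(1 / 2)) (by norm_num) ?_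
      rw [funext hKsum]
      by_cases hD : dirFun Y₁ L t = 0
      · have hA := fun a b => ((h₁.initial_isBigO_edge hd1 ha1 a b).2 hD).1
        have hB := fun a b => ((h₂.initial_isBigO_edge hd2 ha2 a b).2 (hDD.1 hD)).2
        simpa using (isBigO_rpow_mul le_rfl (hA i 0) (hB 0 j)).add
          (isBigO_rpow_mul le_rfl (hA i 1) (hB 1 j))
      · have hA := fun a b => ((h₁.initial_isBigO_edge hd1 ha1 a b).1 hD).1
        have hB := fun a b => ((h₂.initial_isBigO_edge hd2 ha2 a b).1 (mt hDD.2 hD)).2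
        simpa using (isBigO_rpow_mul le_rfl (hA i 0) (hB 0 j)).add
          (isBigO_rpow_mul le_rfl (hA i 1) (hB 1 j))
    rcases IsSpectralData.inBand_or_gap h₁ hS₁ hedge with ⟨k, hk, hm⟩ | ⟨n, hn⟩
    · -- in a gap the numerator vanishes at the Dirichlet eigenvalue, for both potentials
      have ht1 := IsSpectralData.mem_gap h₁ hS₁ hk hm
      have ht2 := IsSpectralData.mem_gap h₂ hS₂ hk hm
      have hd1 : discSq Y₁ L t ≠ 0 := fun h0 => by
        rw [h₁.discSq_real_eq_zero_iff] at h0; linarith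
      have hd2 : discSq Y₂ L t ≠ 0 := fun h0 => by
        rw [h₂.discSq_real_eq_zero_iff] at h0; linarith
      have hD : dirFun Y₁ L t = 0 := by
        rcases htZ with h0 | h0 | h0
        exacts [absurd h0 hd1, absurd h0 hd2, h0]
      have hγ := IsSpectralData.eq_γ h₁ hS₁ hk (Ioo_subset_Icc_self hm) hD
      have hD2 : dirFun Y₂ L t = 0 := by
        rw [hγ]; exact (h₂.isDirichletEigenvalue_iff _).1 (hS₂.γ_dirichlet k hk)
      have hσ1 : S.σ k = dirichletSign Y₁ L t := by rw [hγ]; exact hS₁.σ_eq k hk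
      have hσ2 : S.σ k = dirichletSign Y₂ L t := by rw [hγ]; exact hS₂.σ_eq k hk
      have hσ0 : S.σ k ≠ 0 := by
        rw [hσ1, Ne, h₁.dirichletSign_eq_zero_iff hD, not_le]; exact ht1
      obtain ⟨s₁, s₂, hc1, hc2, hsq1, hsq2, hn1, hn2, he⟩ := hKgap t ht1
      have hr1 := h₁.matN_row_eq_zero hD hsq1 hn1
      have hr2 := h₂.matN_row_eq_zero hD2 hsq2 hn2
      rw [← hσ1] at hr1
      rw [← hσ2] at hr2
      have hPt : P (s₁ t) (s₂ t) t = 0 := by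
        simp only [hP, Matrix.mul_apply, Fin.sum_univ_two]
        obtain ⟨a1, a2, a3, a4⟩ := IsPeriodicDirac.matNadj_apply Y₁ L (s₁ t) t
        cases hσ : S.σ k with
        | zero => exact absurd hσ hσ0
        | neg =>
          have e1 := hr1.1 hσ
          have e2 := hr2.1 hσ
          rw [e2 j]
          obtain rfl | rfl : i = 0 ∨ i = 1 := by omega
          · rw [a2, e1]; ring
          · rw [a4, e1]; ring
        | pos =>
          have e1 := hr1.2 hσ
          have e2 := hr2.2 hσ
          rw [e2 j]
          obtain rfl | rfl : i = 0 ∨ i = 1 := by omega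
          · rw [a1, e1]; ring
          · rw [a3, e1]; ring
      have hs0 : s₂ t ≠ 0 := by
        intro h0; rw [h0] at hsq2; simp at hsq2; exact hd2 hsq2.symm
      have hlimP : Tendsto (fun z => P (s₁ z) (s₂ z) z) (𝓝[≠] (t : ℂ)) (𝓝 0) := by
        have := (hPc hc1 hc2).tendsto
        rw [hPt] at this
        exact this.mono_left nhdsWithin_le_nhds
      have hO1 := isBigO_rpow_mul le_rfl (isTheta_sub_rpow (t : ℂ) (𝓝[≠] (t : ℂ))).1
        (h₁.dirFun_inv_isBigO hD)
      have hO2 := (IsPeriodicDirac.inv_isBigO_one hc2 hs0).mono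
        (nhdsWithin_le_nhds (s := {(t : ℂ)}ᶜ))
      simp only [add_neg_cancel, Real.rpow_zero] at hO1
      have hO := ((isBigO_refl (fun z => P (s₁ z) (s₂ z) z) (𝓝[≠] (t : ℂ))).norm_right.mul
        (hO1.mul hO2))
      simp only [mul_one] at hO
      have hlim := (hO.trans_tendsto (by simpa using hlimP.norm)).mono_left
        (nhdsWithin_im_ne_zero_le t)
      refine hlim.congr' ?_
      filter_upwards [he] with z hz
      rw [← hz]; ring
    · -- inside a band both factors are bounded
      have hband : ∀ {q : ℝ → ℂ} {Y : ℝ → ℂ → Mat2}, IsPeriodicDirac L q Y →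
          IsSpectralData q L Y S →
          (mA Y L t).re ^ 2 < 1 ∨ discSq Y L t = 0 ∧ halfDiff Y L t = 0 := by
        intro q Y h hS
        rcases (IsSpectralData.InBand.re_sq_le h hS hn).lt_or_eq with h1 | h1
        · exact Or.inl h1
        · have h2 := (h.discSq_real_eq_zero_iff t).2 h1
          exact Or.inr ⟨h2, IsSpectralData.InBand.halfDiff_eq_zero h hS hn h2⟩
      have hA := fun a b => (h₁.initial_isBigO_band (hband h₁ hS₁) a b).1
      have hB := fun a b => (h₂.initial_isBigO_band (hband h₂ hS₂) a b).2
      refine tendsto_sub_mul (a := 0) (by norm_num) ?_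
      rw [funext hKsum]
      simpa using (isBigO_rpow_mul le_rfl (hA i 0) (hB 0 j)).add
        (isBigO_rpow_mul le_rfl (hA i 1) (hB 1 j))

/-- Two potentials with the same spectral data have the same normalized Bloch matrix. -/
lemma matX_eq_of_spectralData (h₁ : IsPeriodicDirac L q₁ Y₁) (h₂ : IsPeriodicDirac L q₂ Y₂)
    (hS₁ : IsSpectralData q₁ L Y₁ S) (hS₂ : IsSpectralData q₂ L Y₂ S) (x : ℝ) {z : ℂ}
    (hz : z.im ≠ 0) : matX Y₁ L x z = matX Y₂ L x z := by
  choose F hFd hF using exists_entire_transition h₁ h₂ hS₁ hS₂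
  set T : ℂ → Mat2 := fun z =>
    (1 / 2 : ℂ) • (Y₁ x z * Matrix.of (fun i j => F i j z) * (Y₂ x z).adjugate) with hT
  have hTd : ∀ i j, Differentiable ℂ fun z => T z i j := by
    intro i j
    have e1 := h₁.differentiable_entry x
    have e2 := h₂.differentiable_entry x
    have hadj : ∀ a b, Differentiable ℂ fun z => (Y₂ x z).adjugate a b := by
      intro a b
      simp only [Matrix.adjugate_fin_two]
      fin_cases a <;> fin_cases b
      · exact e2 1 1
      · exact (e2 0 1).neg
      · exact (e2 1 0).neg
      · exact e2 0 0
    simp only [hT, Matrix.smul_apply, Matrix.mul_apply, Fin.sum_univ_two, Matrix.of_apply,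
      smul_eq_mul]
    exact (((((e1 i 0).mul (hFd 0 0)).add ((e1 i 1).mul (hFd 1 0))).mul (hadj 0 j)).add
      ((((e1 i 0).mul (hFd 0 1)).add ((e1 i 1).mul (hFd 1 1))).mul (hadj 1 j))).const_mul _
  have hTX : ∀ z : ℂ, z.im ≠ 0 → T z = matX Y₁ L x z * matXinv Y₂ L x z := by
    intro z hz
    have e : Matrix.of (fun i j => F i j z) = ((dirFun Y₁ L z)⁻¹ * (sRoot Y₂ L z)⁻¹) •
        (matNadj Y₁ L (sRoot Y₁ L z) z * matN Y₂ L (sRoot Y₂ L z) z) := by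
      ext i j
      rw [Matrix.of_apply, hF i j z hz, Matrix.smul_apply, smul_eq_mul, mul_comm]
    have e2 : Y₁ x z * matNadj Y₁ L (sRoot Y₁ L z) z * expSigma3 (Complex.I * z * x) *
        (expSigma3 (-(Complex.I * z * x)) * matN Y₂ L (sRoot Y₂ L z) z * (Y₂ x z).adjugate) =
        Y₁ x z * (matNadj Y₁ L (sRoot Y₁ L z) z * ((expSigma3 (Complex.I * z * x) *
        expSigma3 (-(Complex.I * z * x))) * matN Y₂ L (sRoot Y₂ L z) z)) * (Y₂ x z).adjugate := by
      simp only [Matrix.mul_assoc]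
    rw [hT, h₁.matX_eq x hz, matXinv, Matrix.smul_mul, Matrix.mul_smul, smul_smul, e2,
      expSigma3_mul, add_neg_cancel, expSigma3_zero, Matrix.one_mul]
    simp only [e, Matrix.mul_smul, Matrix.smul_mul, smul_smul]
    congr 1
    rw [mul_inv]; ring
  have hδ : 0 < Real.pi / (4 * L) := by have := h₁.pos; have := Real.pi_pos; positivity
  have hlim : Tendsto T (Bornology.cobounded ℂ ⊓ 𝓟 (awayFromLattice L (Real.pi / (4 * L))))
      (𝓝 1) := by
    have h3 := (h₁.tendsto_matX (h₁.isBlochFilter_awayFromLattice hδ) x).mul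
      (h₂.tendsto_matXinv (h₂.isBlochFilter_awayFromLattice hδ) x)
    rw [mul_one] at h3
    refine h3.congr' ?_
    filter_upwards [mem_inf_of_right (mem_principal_self _)] with z hz
    exact (hTX z hz.1).symm
  have hT1 : T z = 1 := by
    ext i j
    exact eq_of_tendsto_awayFromLattice h₁.pos (hTd i j)
      (tendsto_pi_nhds.1 (tendsto_pi_nhds.1 hlim i) j) z
  rw [hTX z hz] at hT1
  have := congrArg (· * matX Y₂ L x z) hT1
  simpa [Matrix.mul_assoc, h₂.matXinv_mul_matX x hz] using this

/-- The spectral data determine the potential. -/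
theorem eq_of_spectralData (h₁ : IsPeriodicDirac L q₁ Y₁) (h₂ : IsPeriodicDirac L q₂ Y₂)
    (hS₁ : IsSpectralData q₁ L Y₁ S) (hS₂ : IsSpectralData q₂ L Y₂ S) : q₁ = q₂ := by
  funext x
  have hf₁ := h₁.isBlochFilter_awayFromLattice one_pos
  have hf₂ := h₂.isBlochFilter_awayFromLattice one_pos
  have hne := awayFromLattice_neBot (L := L) (δ := 1)
  have e1 := h₁.tendsto_commutator hf₁ x
  have e2 := h₂.tendsto_commutator hf₂ x
  have e3 := tendsto_nhds_unique (e1.congr' (by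
    filter_upwards [mem_inf_of_right (mem_principal_self _)] with z hz
    rw [matX_eq_of_spectralData h₁ h₂ hS₁ hS₂ x hz.1])) e2
  have e4 := congrFun (congrFun e3 0) 1
  simpa [potentialMatrix] using e4

end Uniqueness

/-! ### Canonical products of genus one -/

lemma norm_one_sub_mul_exp_sub_one_le {w : ℂ} (hw : ‖w‖ ≤ 1) :
    ‖(1 - w) * Complex.exp w - 1‖ ≤ 3 * ‖w‖ ^ 2 := by
  have e : (1 - w) * Complex.exp w - 1 = (Complex.exp w - 1 - w) - w * (Complex.exp w - 1) := by
    ring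
  have h1 := Complex.norm_exp_sub_one_sub_id_le hw
  have h2 := Complex.norm_exp_sub_one_le hw
  rw [e]
  refine (norm_sub_le _ _).trans ?_
  rw [norm_mul]
  nlinarith [norm_nonneg w]

open Classical in
/-- A majorant of the logarithm of a primary factor: `|primaryFactor μ z| ≤ exp (w |z|²)` with
`w = primaryWeight μ`. -/
def primaryWeight (μ : ℂ) : ℝ := if μ = 0 then 1 else 3 / ‖μ‖ ^ 2

lemma primaryWeight_nonneg (μ : ℂ) : 0 ≤ primaryWeight μ := by
  unfold primaryWeight; split_ifs <;> positivity

lemma primaryWeight_mul {μ : ℂ} (hμ : μ ≠ 0) (z : ℂ) :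
    primaryWeight μ * ‖z‖ ^ 2 = 3 * ‖z / μ‖ ^ 2 := by
  have := norm_pos_iff.mpr hμ
  rw [primaryWeight, if_neg hμ, norm_div]
  field_simp

lemma norm_primaryFactor_sub_one_le {μ z : ℂ} (hμ : μ ≠ 0) (h : ‖z‖ ≤ ‖μ‖) :
    ‖primaryFactor μ z - 1‖ ≤ primaryWeight μ * ‖z‖ ^ 2 := by
  rw [primaryWeight_mul hμ, primaryFactor, if_neg hμ]
  exact norm_one_sub_mul_exp_sub_one_le (by
    rw [norm_div]; exact div_le_one_of_le₀ h (norm_nonneg _))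

lemma norm_primaryFactor_le (μ z : ℂ) :
    ‖primaryFactor μ z‖ ≤ Real.exp (primaryWeight μ * ‖z‖ ^ 2) := by
  by_cases hμ : μ = 0
  · rw [primaryFactor, primaryWeight, if_pos hμ, if_pos hμ, one_mul]
    refine le_trans ?_ (Real.add_one_le_exp _)
    nlinarith [sq_nonneg (‖z‖ - 1)]
  rcases le_or_gt ‖z‖ ‖μ‖ with h | h
  · have h1 := norm_primaryFactor_sub_one_le hμ h
    have h2 := norm_le_insert' (primaryFactor μ z) 1
    rw [norm_one] at h2
    have h3 := Real.add_one_le_exp (primaryWeight μ * ‖z‖ ^ 2)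
    linarith
  · rw [primaryWeight_mul hμ, primaryFactor, if_neg hμ, norm_mul]
    have hw : 1 ≤ ‖z / μ‖ := by
      rw [norm_div, one_le_div (norm_pos_iff.mpr hμ)]; exact h.le
    set w := z / μ
    have h1 : ‖1 - w‖ ≤ Real.exp ‖w‖ := by
      refine (norm_sub_le _ _).trans ?_
      rw [norm_one, add_comm]; exact Real.add_one_le_exp _
    have h2 : ‖Complex.exp w‖ ≤ Real.exp ‖w‖ := Complex.norm_exp_le_exp_norm w
    refine (mul_le_mul h1 h2 (norm_nonneg _) (Real.exp_nonneg _)).trans ?_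
    rw [← Real.exp_add, Real.exp_le_exp]
    nlinarith

/-- A lower bound of a primary factor at distance at least `δ` from its zero. Compared with the
upper bound one power of `|z|` is lost, because the factors with `|μ| < 2 |z|` may be as small as
`δ / (2 |z|)`. -/
lemma le_norm_primaryFactor {δ : ℝ} (hδ : 0 < δ) {μ z : ℂ} (hz : 1 ≤ ‖z‖) (h : δ ≤ ‖z - μ‖) :
    Real.exp (-((8 / δ + 4) * primaryWeight μ * ‖z‖ ^ 3)) ≤ ‖primaryFactor μ z‖ := by
  have hz0 : 0 < ‖z‖ := by linarith
  have hK : 0 < 8 / δ := by positivity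
  by_cases hμ : μ = 0
  · rw [primaryFactor, if_pos hμ]
    refine le_trans (Real.exp_le_one_iff.mpr ?_) hz
    have := primaryWeight_nonneg μ
    have : 0 ≤ (8 / δ + 4) * primaryWeight μ * ‖z‖ ^ 3 := by positivity
    linarith
  have hμ0 := norm_pos_iff.mpr hμ
  have e : (8 / δ + 4) * primaryWeight μ * ‖z‖ ^ 3 = (8 / δ + 4) * ‖z‖ * (3 * ‖z / μ‖ ^ 2) := by
    rw [← primaryWeight_mul hμ]; ring
  rw [e]
  have hw : ‖z / μ‖ = ‖z‖ / ‖μ‖ := norm_div _ _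
  -- For small `z / μ` the factor is close to `1`; otherwise `|1 - z / μ| = |z - μ| / |μ|` is
  -- bounded below by `δ / (2 |z|)`.
  rcases le_or_gt ‖z / μ‖ (1 / 2) with h' | h'
  · have h1 := norm_primaryFactor_sub_one_le (z := z) hμ (by
      rw [hw, div_le_iff₀ hμ0] at h'; linarith)
    rw [primaryWeight_mul hμ] at h1
    set u := 3 * ‖z / μ‖ ^ 2
    have hu0 : 0 ≤ u := by positivity
    have hu : u ≤ 3 / 4 := by simp only [u]; nlinarith [norm_nonneg (z / μ)]
    have h2 := norm_sub_norm_le (1 : ℂ) (1 - primaryFactor μ z)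
    rw [norm_one, sub_sub_cancel, norm_sub_rev] at h2
    have h3 : Real.exp (-(4 * u)) ≤ 1 - u := by
      rw [Real.exp_neg, inv_le_comm₀ (Real.exp_pos _) (by linarith)]
      refine le_trans ?_ (Real.add_one_le_exp _)
      rw [inv_le_iff_one_le_mul₀ (by linarith)]
      nlinarith
    refine le_trans (Real.exp_le_exp.mpr ?_) (h3.trans (by linarith))
    have : 4 ≤ (8 / δ + 4) * ‖z‖ := by nlinarith
    nlinarith
  · rw [primaryFactor, if_neg hμ, norm_mul]
    have hb : ‖μ‖ < 2 * ‖z‖ := by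
      rw [hw, lt_div_iff₀ hμ0] at h'; linarith
    have h1 : Real.exp (-(2 * ‖z‖ / δ)) ≤ ‖1 - z / μ‖ := by
      have e1 : 1 - z / μ = (μ - z) / μ := by field_simp
      rw [e1, norm_div, norm_sub_rev]
      have h2 : δ / (2 * ‖z‖) ≤ ‖z - μ‖ / ‖μ‖ := by gcongr
      refine le_trans ?_ h2
      have h3 : 2 * ‖z‖ / δ ≤ Real.exp (2 * ‖z‖ / δ) := by
        linarith [Real.add_one_le_exp (2 * ‖z‖ / δ)]
      have h4 := inv_anti₀ (by positivity) h3
      rwa [inv_div, ← Real.exp_neg] at h4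
    have h2 : Real.exp (-‖z / μ‖) ≤ ‖Complex.exp (z / μ)‖ := by
      rw [Complex.norm_exp, Real.exp_le_exp]
      exact (abs_le.mp (Complex.abs_re_le_norm _)).1
    refine le_trans ?_ (mul_le_mul h1 h2 (Real.exp_nonneg _) (norm_nonneg _))
    rw [← Real.exp_add, Real.exp_le_exp]
    have h3 : 2 * ‖z‖ / δ = 8 / δ * ‖z‖ * (1 / 4) := by ring
    rw [h3]
    have h4 : 1 / 4 ≤ 3 * ‖z / μ‖ ^ 2 := by nlinarith
    have h5 : ‖z / μ‖ ≤ 4 * ‖z‖ * (3 * ‖z / μ‖ ^ 2) := by nlinarith [norm_nonneg (z / μ)]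
    have h6 : 8 / δ * ‖z‖ * (1 / 4) ≤ 8 / δ * ‖z‖ * (3 * ‖z / μ‖ ^ 2) := by gcongr
    linarith

lemma differentiable_primaryFactor (μ : ℂ) : Differentiable ℂ (primaryFactor μ) := by
  unfold primaryFactor
  split_ifs <;> fun_prop

lemma primaryFactor_eq_zero_iff {μ z : ℂ} : primaryFactor μ z = 0 ↔ z = μ := by
  unfold primaryFactor
  split_ifs with h
  · rw [h]
  · simp only [mul_eq_zero, Complex.exp_ne_zero, or_false]
    rw [sub_eq_zero, eq_div_iff h, one_mul, eq_comm]

lemma exists_hasDerivAt_primaryFactor (μ : ℂ) : ∃ d ≠ 0, HasDerivAt (primaryFactor μ) d μ := by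
  by_cases h : μ = 0
  · refine ⟨1, one_ne_zero, ?_⟩
    have : primaryFactor μ = id := by ext z; simp [primaryFactor, h]
    rw [this]; exact hasDerivAt_id _
  · refine ⟨-(1 / μ) * Complex.exp 1, by simp [h], ?_⟩
    have : primaryFactor μ = fun z => (1 - z / μ) * Complex.exp (z / μ) := by
      ext z; simp [primaryFactor, h]
    rw [this]
    have h1 : HasDerivAt (fun z : ℂ => 1 - z / μ) (-(1 / μ)) μ :=
      ((hasDerivAt_id μ).div_const μ).const_sub 1
    have h2 : HasDerivAt (fun z : ℂ => Complex.exp (z / μ)) (Complex.exp (μ / μ) * (1 / μ)) μ :=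
      ((hasDerivAt_id μ).div_const μ).cexp
    refine (h1.mul h2).congr_deriv ?_
    rw [div_self h]; ring

section Product

variable {ι : Type*} {a : ι → ℂ}

lemma eventually_norm_primaryFactor_sub_one_le (hs : Summable fun i => primaryWeight (a i)) (R : ℝ) :
    ∀ᶠ i in cofinite, ∀ z ∈ Metric.ball (0 : ℂ) R,
      ‖primaryFactor (a i) z - 1‖ ≤ primaryWeight (a i) * R ^ 2 := by
  have h1 : ∀ᶠ i in cofinite, primaryWeight (a i) < min 1 (3 / (R ^ 2 + 1)) :=
    hs.tendsto_cofinite_zero.eventually (gt_mem_nhds (by positivity))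
  filter_upwards [h1] with i hi z hz
  rw [mem_ball_zero_iff] at hz
  have hne : a i ≠ 0 := by
    intro h
    rw [primaryWeight, if_pos h] at hi
    exact absurd (hi.trans_le (min_le_left _ _)) (lt_irrefl _)
  have h2 := hi.trans_le (min_le_right _ _)
  rw [primaryWeight, if_neg hne] at h2
  have hpos := norm_pos_iff.mpr hne
  rw [div_lt_div_iff₀ (by positivity) (by positivity)] at h2
  have hle : ‖z‖ ≤ ‖a i‖ := by
    by_contra hcon
    nlinarith [norm_nonneg z]
  refine (norm_primaryFactor_sub_one_le hne hle).trans ?_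
  have := primaryWeight_nonneg (a i)
  gcongr

lemma hasProdLocallyUniformlyOn_primaryFactor (hs : Summable fun i => primaryWeight (a i)) (R : ℝ) :
    HasProdLocallyUniformlyOn (fun i z => primaryFactor (a i) z)
      (fun z => ∏' i, primaryFactor (a i) z) (Metric.ball 0 R) := by
  have h := Summable.hasProdLocallyUniformlyOn_one_add (f := fun i z => primaryFactor (a i) z - 1)
    Metric.isOpen_ball (hs.mul_right (R ^ 2)) (eventually_norm_primaryFactor_sub_one_le hs R)
    (fun i => ((differentiable_primaryFactor _).continuous.sub continuous_const).continuousOn)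
  simpa using h

lemma hasProd_primaryFactor (hs : Summable fun i => primaryWeight (a i)) (z : ℂ) :
    HasProd (fun i => primaryFactor (a i) z) (∏' i, primaryFactor (a i) z) :=
  (hasProdLocallyUniformlyOn_primaryFactor hs (‖z‖ + 1)).hasProd
    (mem_ball_zero_iff.mpr (lt_add_one _))

lemma differentiable_tprod_primaryFactor (hs : Summable fun i => primaryWeight (a i)) :
    Differentiable ℂ fun z => ∏' i, primaryFactor (a i) z := by
  intro z
  refine ((hasProdLocallyUniformlyOn_primaryFactor hs (‖z‖ + 1)).differentiableOn
    (Eventually.of_forall fun s => ?_) Metric.isOpen_ball).differentiableAt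
    (Metric.isOpen_ball.mem_nhds (mem_ball_zero_iff.mpr (lt_add_one _)))
  exact (Differentiable.fun_finsetProd fun i _ => differentiable_primaryFactor (a i)).differentiableOn

lemma tprod_primaryFactor_ne_zero (hs : Summable fun i => primaryWeight (a i)) {z : ℂ}
    (hz : ∀ i, a i ≠ z) : ∏' i, primaryFactor (a i) z ≠ 0 := by
  have h := tprod_one_add_ne_zero_of_summable (f := fun i => primaryFactor (a i) z - 1)
    (fun i => by
      rw [add_sub_cancel]
      exact fun h => hz i (primaryFactor_eq_zero_iff.mp h).symm) ?_
  · simpa using h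
  · refine Summable.of_norm_bounded_eventually (hs.mul_right ((‖z‖ + 1) ^ 2)) ?_
    filter_upwards [eventually_norm_primaryFactor_sub_one_le hs (‖z‖ + 1)] with i hi
    rw [norm_norm]
    exact hi z (mem_ball_zero_iff.mpr (lt_add_one _))

lemma norm_tprod_primaryFactor_le (hs : Summable fun i => primaryWeight (a i)) (z : ℂ) :
    ‖∏' i, primaryFactor (a i) z‖ ≤ Real.exp ((∑' i, primaryWeight (a i)) * ‖z‖ ^ 2) := by
  refine le_of_tendsto (hasProd_primaryFactor hs z).norm ?_
  refine Eventually.of_forall fun s => ?_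
  simp only
  refine (Finset.prod_le_prod (fun i _ => norm_nonneg _)
    fun i _ => norm_primaryFactor_le (a i) z).trans ?_
  rw [← Real.exp_sum, Real.exp_le_exp, ← Finset.sum_mul]
  exact mul_le_mul_of_nonneg_right
    (hs.sum_le_tsum _ fun i _ => primaryWeight_nonneg _) (by positivity)

lemma le_norm_tprod_primaryFactor (hs : Summable fun i => primaryWeight (a i)) {δ : ℝ} (hδ : 0 < δ)
    {z : ℂ} (hz : 1 ≤ ‖z‖) (h : ∀ i, δ ≤ ‖z - a i‖) :
    Real.exp (-((8 / δ + 4) * (∑' i, primaryWeight (a i)) * ‖z‖ ^ 3)) ≤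
      ‖∏' i, primaryFactor (a i) z‖ := by
  refine ge_of_tendsto (hasProd_primaryFactor hs z).norm ?_
  refine Eventually.of_forall fun s => ?_
  simp only
  refine le_trans ?_ (Finset.prod_le_prod (fun i _ => Real.exp_nonneg _)
    fun i _ => le_norm_primaryFactor hδ hz (h i))
  rw [← Real.exp_sum, Real.exp_le_exp, Finset.sum_neg_distrib, neg_le_neg_iff, ← Finset.sum_mul,
    ← Finset.mul_sum]
  have := hs.sum_le_tsum s fun i _ => primaryWeight_nonneg (a i)
  gcongr

/-- The zeros of the product are simple. -/
lemma exists_hasDerivAt_tprod_primaryFactor (ha : Function.Injective a)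
    (hs : Summable fun i => primaryWeight (a i)) (i : ι) :
    ∏' j, primaryFactor (a j) (a i) = 0 ∧
      ∃ d ≠ 0, HasDerivAt (fun z => ∏' j, primaryFactor (a j) z) d (a i) := by
  classical
  let b : ↥({i}ᶜ : Set ι) → ℂ := fun j => a j
  have hsb : Summable fun j => primaryWeight (b j) := hs.subtype _
  have hsplit : (fun z => ∏' j, primaryFactor (a j) z) =
      fun z => primaryFactor (a i) z * ∏' j, primaryFactor (b j) z := by
    ext z
    have h := Multipliable.tprod_mul_tprod_compl (f := fun j => primaryFactor (a j) z)
      (s := ({i} : Set ι)) (hasProd_fintype _).multipliable (hasProd_primaryFactor hsb z).multipliable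
    rw [← h, tprod_singleton (f := fun j => primaryFactor (a j) z)]
  have hb : ∏' j, primaryFactor (b j) (a i) ≠ 0 :=
    tprod_primaryFactor_ne_zero hsb fun j h => j.2 (ha h)
  have h0 : primaryFactor (a i) (a i) = 0 := primaryFactor_eq_zero_iff.mpr rfl
  obtain ⟨d, hd, hd'⟩ := exists_hasDerivAt_primaryFactor (a i)
  refine ⟨?_, d * ∏' j, primaryFactor (b j) (a i), mul_ne_zero hd hb, ?_⟩
  · rw [congrFun hsplit (a i), h0, zero_mul]
  · rw [hsplit]
    refine (hd'.mul (differentiable_tprod_primaryFactor hsb (a i)).hasDerivAt).congr_deriv ?_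
    rw [h0]; ring

end Product

/-! ### Products over the Dirichlet eigenvalues -/

/-- A set with at linearly many points in discs is summable with exponent two. -/
lemma summable_inv_sq_of_card_le {ι : Type*} {d : ι → ℝ} {C : ℝ} (hC : 0 ≤ C) (hd : ∀ i, 1 ≤ d i)
    (hcard : ∀ (r : ℝ) (u : Finset ι), 1 ≤ r → (∀ i ∈ u, d i ≤ r) → (u.card : ℝ) ≤ C * r) :
    Summable fun i => (d i ^ 2)⁻¹ := by
  classical
  -- The points are sorted into the dyadic shells `2 ^ n ≤ d < 2 ^ (n + 1)`.
  let n : ι → ℕ := fun i => Nat.log 2 ⌊d i⌋₊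
  have hfl : ∀ i, ⌊d i⌋₊ ≠ 0 := fun i => (Nat.floor_pos.mpr (hd i)).ne'
  have hn1 : ∀ i, (2 : ℝ) ^ n i ≤ d i := fun i => by
    have h := Nat.pow_log_le_self 2 (hfl i)
    have h' : ((2 ^ n i : ℕ) : ℝ) ≤ (⌊d i⌋₊ : ℝ) := Nat.cast_le.mpr h
    push_cast at h'
    exact h'.trans (Nat.floor_le (by linarith [hd i]))
  have hn2 : ∀ i, d i ≤ 2 ^ (n i + 1) := fun i => by
    have h : ⌊d i⌋₊ + 1 ≤ 2 ^ (n i + 1) := Nat.lt_pow_succ_log_self (by norm_num) _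
    have h' : ((⌊d i⌋₊ + 1 : ℕ) : ℝ) ≤ ((2 ^ (n i + 1) : ℕ) : ℝ) := Nat.cast_le.mpr h
    push_cast at h'
    exact (Nat.lt_floor_add_one _).le.trans h'
  have hgeo : Summable fun k : ℕ => 2 * C * (1 / 2 : ℝ) ^ k :=
    (summable_geometric_two).mul_left _
  refine summable_of_sum_le (c := ∑' k : ℕ, 2 * C * (1 / 2 : ℝ) ^ k) (fun i => by positivity)
    fun u => ?_
  rw [← Finset.sum_fiberwise_of_maps_to (g := n) (t := u.image n)
    (fun i hi => Finset.mem_image_of_mem _ hi)]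
  refine le_trans (Finset.sum_le_sum fun k _ => ?_)
    (hgeo.sum_le_tsum (u.image n) fun k _ => by positivity)
  have h1 : ∀ i ∈ u.filter (fun i => n i = k), (d i ^ 2)⁻¹ ≤ ((4 : ℝ) ^ k)⁻¹ := fun i hi => by
    rw [Finset.mem_filter] at hi
    have h2 := hn1 i
    rw [hi.2] at h2
    have h4 : (4 : ℝ) ^ k = (2 ^ k) ^ 2 := by rw [← pow_mul, mul_comm, pow_mul]; norm_num
    rw [h4]
    gcongr
  refine (Finset.sum_le_card_nsmul _ _ _ h1).trans ?_
  have h3 := hcard (2 ^ (k + 1)) (u.filter fun i => n i = k) (one_le_pow₀ (by norm_num))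
    fun i hi => by
      rw [Finset.mem_filter] at hi
      exact hi.2 ▸ hn2 i
  rw [nsmul_eq_mul]
  refine (mul_le_mul_of_nonneg_right h3 (by positivity)).trans (le_of_eq ?_)
  have h4 : (4 : ℝ) ^ k = 2 ^ k * 2 ^ k := by rw [← mul_pow]; norm_num
  rw [h4, pow_succ, one_div, inv_pow]
  field_simp

namespace IsPeriodicDirac

variable {L : ℝ} {q : ℝ → ℂ} {Y : ℝ → ℂ → Mat2}

lemma norm_dirFun_le (h : IsPeriodicDirac L q Y) :
    ∃ K, 0 ≤ K ∧ ∀ z, ‖dirFun Y L z‖ ≤ 4 * Real.exp ((‖z‖ + K) * L) := by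
  obtain ⟨K, hK0, hK⟩ := h.exists_bound
  refine ⟨K, hK0, fun z => ?_⟩
  have hb := h.sol.norm_le hK L z
  rw [abs_of_pos h.pos] at hb
  unfold dirFun mA mB mC mD
  refine (norm_sub_le _ _).trans ?_
  have h1 := norm_add_le (Y L z 0 0 - Y L z 0 1) (Y L z 1 0)
  have h2 := norm_sub_le (Y L z 0 0) (Y L z 0 1)
  linarith [hb 0 0, hb 0 1, hb 1 0, hb 1 1]

lemma im_eq_zero_of_dirFun (h : IsPeriodicDirac L q Y) {μ : ℂ} (h0 : dirFun Y L μ = 0) :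
    μ.im = 0 := by
  by_contra hc
  exact h.dirFun_ne_zero hc h0

/-- The Dirichlet eigenvalues are the zeros of a function of exponential type, so that a disc of
radius `r` contains `O(r)` of them and their inverse squares are summable. -/
lemma summable_primaryWeight (h : IsPeriodicDirac L q Y) {ι : Type*} {a : ι → ℂ}
    (ha : Function.Injective a) (h0 : ∀ i, dirFun Y L (a i) = 0) :
    Summable fun i => primaryWeight (a i) := by
  obtain ⟨K, hK0, hK⟩ := h.norm_dirFun_le
  have hL := h.pos
  have hfI : dirFun Y L Complex.I ≠ 0 := h.dirFun_ne_zero (by simp)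
  have hfI' := norm_pos_iff.mpr hfI
  have him : ∀ i, (a i).im = 0 := fun i => h.im_eq_zero_of_dirFun (h0 i)
  -- For real `μ` the distance to the centre `i` of the discs is `√(1 + μ²)`.
  have hd2 : ∀ i, dist (a i) Complex.I ^ 2 = 1 + ‖a i‖ ^ 2 := fun i => by
    rw [Complex.dist_eq, ← Complex.normSq_eq_norm_sq, ← Complex.normSq_eq_norm_sq,
      Complex.normSq_apply, Complex.normSq_apply]
    simp [him i]
    ring
  have hd1 : ∀ i, 1 ≤ dist (a i) Complex.I := fun i => by
    nlinarith [hd2 i, sq_nonneg ‖a i‖, dist_nonneg (x := a i) (y := Complex.I)]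
  set l := |Real.log (4 / ‖dirFun Y L Complex.I‖)|
  have hlog2 := Real.log_pos one_lt_two
  have hs : Summable fun i => (dist (a i) Complex.I ^ 2)⁻¹ := by
    refine summable_inv_sq_of_card_le (C := (l + (1 + 3 + K) * L) / Real.log 2) (by positivity) hd1
      fun r u hr hu => ?_
    have h1 := two_pow_card_mul_norm_le h.differentiable_dirFun (u.map ⟨a, ha⟩) (c := Complex.I)
      (r := r) (M := 4 * Real.exp ((1 + 3 * r + K) * L)) (by linarith) (fun b hb => by
        rw [Finset.mem_map] at hb
        obtain ⟨i, hi, rfl⟩ := hb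
        exact ⟨h0 i, hu i hi⟩) (fun z hz => by
        rw [mem_sphere_iff_norm] at hz
        have h2 := norm_le_norm_add_norm_sub' z Complex.I
        rw [Complex.norm_I, hz] at h2
        exact (hK z).trans (by gcongr))
    rw [Finset.card_map, ← le_div_iff₀ hfI', mul_div_right_comm] at h1
    have h3 := Real.log_le_log (by positivity) h1
    rw [Real.log_mul (by positivity) (Real.exp_ne_zero _), Real.log_exp, Real.log_pow] at h3
    rw [div_mul_eq_mul_div, le_div_iff₀ hlog2]
    have h4 := le_abs_self (Real.log (4 / ‖dirFun Y L Complex.I‖))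
    have h5 : 0 ≤ l := abs_nonneg _
    refine h3.trans ?_
    have h6 : (1 + 3 * r + K) * L ≤ (1 + 3 + K) * L * r := by
      have : 1 + 3 * r + K ≤ (1 + 3 + K) * r := by nlinarith
      nlinarith
    nlinarith
  refine Summable.of_norm_bounded_eventually (hs.mul_left 6) ?_
  filter_upwards [hs.tendsto_cofinite_zero.eventually (gt_mem_nhds (show (0 : ℝ) < 1 / 2 by norm_num))]
    with i hi
  rw [hd2, inv_lt_comm₀ (by positivity) (by norm_num)] at hi
  have hne : a i ≠ 0 := fun hc => by rw [hc, norm_zero] at hi; norm_num at hi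
  rw [Real.norm_of_nonneg (primaryWeight_nonneg _), primaryWeight, if_neg hne, hd2,
    ← div_eq_mul_inv, div_le_div_iff₀ (by have := norm_pos_iff.mpr hne; positivity) (by positivity)]
  nlinarith

section DirichletProduct

variable (σ : SignType)

lemma summable_primaryWeight_sign (h : IsPeriodicDirac L q Y) :
    Summable fun μ : {μ : ℂ // IsDirichletEigenvalue q L μ ∧ dirichletSign Y L μ = σ} =>
      primaryWeight μ :=
  h.summable_primaryWeight Subtype.val_injective
    fun μ => (h.isDirichletEigenvalue_iff _).mp μ.2.1

lemma differentiable_dirichletProduct (h : IsPeriodicDirac L q Y) :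
    Differentiable ℂ (dirichletProduct q L Y σ) :=
  differentiable_tprod_primaryFactor (h.summable_primaryWeight_sign σ)

variable {σ}

lemma dirichletProduct_hasDerivAt (h : IsPeriodicDirac L q Y) {z : ℂ} (h0 : dirFun Y L z = 0)
    (hσ : dirichletSign Y L z = σ) :
    dirichletProduct q L Y σ z = 0 ∧ ∃ d ≠ 0, HasDerivAt (dirichletProduct q L Y σ) d z :=
  exists_hasDerivAt_tprod_primaryFactor Subtype.val_injective (h.summable_primaryWeight_sign σ)
    ⟨z, (h.isDirichletEigenvalue_iff z).mpr h0, hσ⟩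

lemma dirichletProduct_eq_zero_iff (h : IsPeriodicDirac L q Y) {z : ℂ} :
    dirichletProduct q L Y σ z = 0 ↔ dirFun Y L z = 0 ∧ dirichletSign Y L z = σ := by
  refine ⟨fun h0 => ?_, fun h0 => (h.dirichletProduct_hasDerivAt h0.1 h0.2).1⟩
  by_contra hc
  refine tprod_primaryFactor_ne_zero (h.summable_primaryWeight_sign σ) (fun μ hμ => hc ?_) h0
  rw [← hμ]
  exact ⟨(h.isDirichletEigenvalue_iff _).mp μ.2.1, μ.2.2⟩

variable (σ)

lemma exists_norm_dirichletProduct_le (h : IsPeriodicDirac L q Y) :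
    ∃ C, 0 ≤ C ∧ ∀ z, ‖dirichletProduct q L Y σ z‖ ≤ Real.exp (C * ‖z‖ ^ 2) :=
  ⟨_, tsum_nonneg fun _ => primaryWeight_nonneg _,
    norm_tprod_primaryFactor_le (h.summable_primaryWeight_sign σ)⟩

/-- The function `-2i ỹ₁₂(L, z)` is bounded below away from the lattice: the determinant of the
normalized Bloch matrix, which tends to `1`, is `2 s` divided by it. -/
lemma exists_le_norm_dirFun (h : IsPeriodicDirac L q Y) {δ : ℝ} (hδ : 0 < δ) :
    ∃ c R : ℝ, 0 < c ∧ ∀ z ∈ awayFromLattice L δ, R ≤ ‖z‖ → c ≤ ‖dirFun Y L z‖ := by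
  obtain ⟨c, R, hc, hcR⟩ := h.exists_le_norm_sRoot hδ
  have h1 := ((continuous_id (X := Mat2)).matrix_det.tendsto 1).comp
    (h.tendsto_matX (h.isBlochFilter_awayFromLattice hδ) 0)
  have h2 : ∀ᶠ z in Bornology.cobounded ℂ ⊓ 𝓟 (awayFromLattice L δ),
      ‖(matX Y L 0 z).det‖ < 2 := by
    refine h1.norm.eventually (gt_mem_nhds ?_)
    simp
  rw [eventually_inf_principal, (hasBasis_cobounded_norm (E := ℂ)).eventually_iff] at h2
  obtain ⟨R', -, hR'⟩ := h2
  refine ⟨c, max R R', hc, fun z hz hzR => ?_⟩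
  have hD := h.dirFun_ne_zero hz.1
  have hs := sRoot_sq Y L z
  have hdet := hR' (show z ∈ {x : ℂ | R' ≤ ‖x‖} from (le_max_right _ _).trans hzR) hz
  have e : dirFun Y L z * (matX Y L 0 z).det = 2 * sRoot Y L z := by
    rw [h.matX_eq 0 hz.1, h.sol.initial]
    simp only [Complex.ofReal_zero, mul_zero, expSigma3_zero, mul_one, one_mul, Matrix.det_smul,
      Fintype.card_fin]
    have : (matNadj Y L (sRoot Y L z) z).det = 2 * sRoot Y L z * dirFun Y L z := by
      simp only [matNadj, Matrix.det_fin_two_of, dirFun, halfDiff]; ring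
    rw [this]
    field_simp
  have e' := congrArg (‖·‖) e
  simp only [norm_mul, Complex.norm_ofNat] at e'
  have h3 := hcR z hz ((le_max_left _ _).trans hzR)
  have hp := norm_pos_iff.mpr hD
  nlinarith [norm_nonneg (matX Y L 0 z).det]

/-- Far out, the Dirichlet eigenvalues stay away from the points away from the lattice. -/
lemma exists_le_norm_sub_dirichlet (h : IsPeriodicDirac L q Y) {δ : ℝ} (hδ : 0 < δ) :
    ∃ R : ℝ, ∀ z ∈ awayFromLattice L δ, R ≤ ‖z‖ → ∀ μ : ℂ, dirFun Y L μ = 0 →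
      δ / 4 ≤ ‖z - μ‖ := by
  obtain ⟨c, R, hc, hcR⟩ := h.exists_le_norm_dirFun (show 0 < δ / 2 by linarith)
  refine ⟨R + δ, fun z hz hzR μ hμ => ?_⟩
  by_contra! hlt
  -- The lower bound holds at the nonreal points near `μ` and passes to the real point `μ`.
  have h1 := norm_le_of_im_ne_zero (F := fun _ => (c : ℂ)) (g := fun w => ‖dirFun Y L w‖) (z := μ)
    continuousAt_const h.differentiable_dirFun.continuous.norm.continuousAt ?_
  · rw [hμ, norm_zero, Complex.norm_of_nonneg hc.le] at h1
    linarith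
  · filter_upwards [Metric.ball_mem_nhds μ (show 0 < δ / 4 by linarith)] with w hw hi
    rw [mem_ball_iff_norm] at hw
    rw [Complex.norm_of_nonneg hc.le]
    have hzw : ‖z - w‖ ≤ δ / 2 := by
      have := norm_sub_le_norm_sub_add_norm_sub z μ w
      rw [norm_sub_rev μ w] at this
      linarith
    refine hcR w ⟨hi, fun k => ?_⟩ ?_
    · have h2 := hz.2 k
      have h3 := dist_triangle z w ((k * Real.pi / L : ℝ) : ℂ)
      rw [Complex.dist_eq z w] at h3
      linarith
    · have := norm_le_norm_add_norm_sub' z w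
      linarith

lemma exists_le_norm_dirichletProduct (h : IsPeriodicDirac L q Y) {δ : ℝ} (hδ : 0 < δ) :
    ∃ C R : ℝ, 0 ≤ C ∧ 1 ≤ R ∧ ∀ z ∈ awayFromLattice L δ, R ≤ ‖z‖ →
      Real.exp (-(C * ‖z‖ ^ 3)) ≤ ‖dirichletProduct q L Y σ z‖ := by
  obtain ⟨R, hR⟩ := h.exists_le_norm_sub_dirichlet hδ
  refine ⟨_, max R 1, ?_, le_max_right _ _, fun z hz hzR => le_norm_tprod_primaryFactor
    (h.summable_primaryWeight_sign σ) (show 0 < δ / 4 by linarith) ((le_max_right _ _).trans hzR)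
    fun μ => hR z hz ((le_max_left _ _).trans hzR) μ
      ((h.isDirichletEigenvalue_iff _).mp μ.2.1)⟩
  have : 0 ≤ ∑' μ : {μ : ℂ // IsDirichletEigenvalue q L μ ∧ dirichletSign Y L μ = σ},
    primaryWeight μ := tsum_nonneg fun _ => primaryWeight_nonneg _
  positivity

end DirichletProduct

lemma differentiable_fZero (h : IsPeriodicDirac L q Y) : Differentiable ℂ (fZero q L Y) := by
  have := h.differentiable_dirichletProduct 0
  unfold fZero
  fun_prop

lemma fZero_eq_zero_iff (h : IsPeriodicDirac L q Y) {z : ℂ} :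
    fZero q L Y z = 0 ↔ dirFun Y L z = 0 ∧ dirichletSign Y L z = 0 := by
  rw [← h.dirichletProduct_eq_zero_iff]
  simp [fZero]

lemma fZero_hasDerivAt (h : IsPeriodicDirac L q Y) {z : ℂ} (h0 : dirFun Y L z = 0)
    (hσ : dirichletSign Y L z = 0) : ∃ d ≠ 0, HasDerivAt (fZero q L Y) d z := by
  obtain ⟨h1, d, hd, hd'⟩ := h.dirichletProduct_hasDerivAt h0 hσ
  let E : ℂ → ℂ := fun z => 1 / 2 * Complex.exp (constA Y L * z + constB Y L)
  have hE : Differentiable ℂ E := by fun_prop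
  refine ⟨E z * d, mul_ne_zero (by simp [E]) hd, ?_⟩
  refine ((hE z).hasDerivAt.mul hd').congr_deriv ?_
  rw [h1]; ring

lemma exists_le_norm_fZero (h : IsPeriodicDirac L q Y) {δ : ℝ} (hδ : 0 < δ) :
    ∃ C R : ℝ, 0 ≤ C ∧ 1 ≤ R ∧ ∀ z ∈ awayFromLattice L δ, R ≤ ‖z‖ →
      Real.exp (-(C * ‖z‖ ^ 3)) ≤ ‖fZero q L Y z‖ := by
  obtain ⟨C, R, hC, hR1, hb⟩ := h.exists_le_norm_dirichletProduct 0 hδ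
  refine ⟨C + ‖constA Y L‖ + ‖constB Y L‖ + 1, R, by positivity, hR1, fun z hz hzR => ?_⟩
  have hz1 : 1 ≤ ‖z‖ := hR1.trans hzR
  have h1 : Real.exp (-(‖constA Y L‖ * ‖z‖ + ‖constB Y L‖)) ≤
      ‖Complex.exp (constA Y L * z + constB Y L)‖ := by
    rw [Complex.norm_exp, Real.exp_le_exp]
    have h2 := (abs_le.mp (Complex.abs_re_le_norm (constA Y L * z + constB Y L))).1
    have h3 := norm_add_le (constA Y L * z) (constB Y L)
    rw [norm_mul] at h3
    linarith
  have h2 : Real.exp (-1) ≤ ‖(1 / 2 : ℂ)‖ := by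
    rw [Real.exp_neg]
    have h3 := Real.add_one_le_exp (1 : ℝ)
    rw [show ‖(1 / 2 : ℂ)‖ = 2⁻¹ by norm_num]
    exact inv_anti₀ (by norm_num) (by linarith)
  rw [fZero, norm_mul, norm_mul]
  refine le_trans ?_ (mul_le_mul (mul_le_mul h2 h1 (Real.exp_nonneg _) (norm_nonneg _))
    (hb z hz hzR) (Real.exp_nonneg _) (by positivity))
  rw [← Real.exp_add, ← Real.exp_add, Real.exp_le_exp]
  have h3 : ‖z‖ ≤ ‖z‖ ^ 3 := le_self_pow₀ hz1 (by norm_num)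
  have h4 : 1 ≤ ‖z‖ ^ 3 := one_le_pow₀ hz1
  nlinarith [norm_nonneg (constA Y L), norm_nonneg (constB Y L)]

end IsPeriodicDirac

/-! ### Branches of roots by continuation along segments -/

section RootFrom

variable {g : ℂ → ℂ} {x₀ : ℝ}

lemma segment_ne_zero (h0 : g x₀ ≠ 0) (hg0 : ∀ z : ℂ, z.im ≠ 0 → g z ≠ 0) {z : ℂ} (hz : z.im ≠ 0)
    (t : ℝ) : g (x₀ + t * (z - x₀)) ≠ 0 := by
  by_cases ht : t = 0
  · simpa [ht] using h0
  · exact hg0 _ (by simpa using ⟨ht, hz⟩)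

lemma continuous_segment_logDeriv (hg : Differentiable ℂ g) (h0 : g x₀ ≠ 0)
    (hg0 : ∀ z : ℂ, z.im ≠ 0 → g z ≠ 0) :
    Continuous fun p : {z : ℂ // z.im ≠ 0} × ℝ =>
      ((p.1 : ℂ) - x₀) * logDeriv g (x₀ + p.2 * ((p.1 : ℂ) - x₀)) := by
  have hpath : Continuous fun p : {z : ℂ // z.im ≠ 0} × ℝ =>
      (x₀ : ℂ) + p.2 * ((p.1 : ℂ) - x₀) := by fun_prop
  have hg' : Continuous (deriv g) := (hg.contDiff (n := 1)).continuous_deriv le_rfl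
  simp only [logDeriv_apply]
  exact (by fun_prop : Continuous fun p : {z : ℂ // z.im ≠ 0} × ℝ => (p.1 : ℂ) - x₀).mul
    ((hg'.comp hpath).div (hg.continuous.comp hpath) fun p => segment_ne_zero h0 hg0 p.1.2 p.2)

lemma rootFrom_pow {n : ℕ} (hn : n ≠ 0) (hg : Differentiable ℂ g) (h0 : g x₀ ≠ 0)
    (hg0 : ∀ z : ℂ, z.im ≠ 0 → g z ≠ 0) {z : ℂ} (hz : z.im ≠ 0) :
    rootFrom n g x₀ z ^ n = g z := by
  have hn' : (n : ℂ) ≠ 0 := Nat.cast_ne_zero.mpr hn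
  set f : ℝ → ℂ := fun t => (z - x₀) * logDeriv g (x₀ + t * (z - x₀))
  have hf : Continuous f := (continuous_segment_logDeriv hg h0 hg0).comp
    (f := fun t : ℝ => ((⟨z, hz⟩ : {z : ℂ // z.im ≠ 0}), t)) (by fun_prop)
  -- `g` along the segment times the exponential of minus the integral is constant.
  set φ : ℝ → ℂ := fun t => g (x₀ + t * (z - x₀)) * Complex.exp (-∫ τ in (0 : ℝ)..t, f τ)
  have hφ : ∀ t, HasDerivAt φ 0 t := fun t => by
    have h1 : HasDerivAt (fun t : ℝ => (x₀ : ℂ) + t * (z - x₀)) (z - x₀) t := by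
      simpa using ((Complex.ofRealCLM.hasDerivAt (x := t)).mul_const (z - (x₀ : ℂ))).const_add
        (x₀ : ℂ)
    have h2 := (hg (x₀ + t * (z - x₀))).hasDerivAt.comp_of_eq t h1 rfl
    have h3 := (hf.integral_hasStrictDerivAt 0 t).hasDerivAt.neg.cexp
    refine (h2.mul h3).congr_deriv ?_
    have := segment_ne_zero h0 hg0 hz t
    simp only [f, logDeriv_apply, Function.comp_apply]
    field_simp
    ring
  have hc : φ 1 = φ 0 := is_const_of_deriv_eq_zero (fun t => (hφ t).differentiableAt)
    (fun t => (hφ t).deriv) 1 0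
  simp only [φ, Complex.ofReal_one, one_mul, add_sub_cancel, Complex.ofReal_zero, zero_mul,
    add_zero, intervalIntegral.integral_same, neg_zero, Complex.exp_zero, mul_one] at hc
  rw [Complex.exp_neg, ← div_eq_mul_inv, div_eq_iff (Complex.exp_ne_zero _)] at hc
  rw [rootFrom, ← Complex.exp_nat_mul, mul_div_cancel₀ _ hn', Complex.exp_add,
    Complex.exp_log h0, hc]

lemma continuousOn_rootFrom (n : ℕ) (hg : Differentiable ℂ g) (h0 : g x₀ ≠ 0)
    (hg0 : ∀ z : ℂ, z.im ≠ 0 → g z ≠ 0) : ContinuousOn (rootFrom n g x₀) {z | z.im ≠ 0} := by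
  rw [continuousOn_iff_continuous_domRestrict]
  have h1 : Continuous fun z : {z : ℂ // z.im ≠ 0} =>
      ∫ t in (0 : ℝ)..1, ((z : ℂ) - x₀) * logDeriv g (x₀ + t * ((z : ℂ) - x₀)) :=
    intervalIntegral.continuous_parametric_intervalIntegral_of_continuous'
      (continuous_segment_logDeriv hg h0 hg0) 0 1
  exact ((continuous_const.add h1).div_const _).cexp

end RootFrom

/-! ### The factors of the matrix `B` -/

open Classical in
/-- The scalar factor of the matrix `B`. -/
def scalarB (q : ℝ → ℂ) (L : ℝ) (Y : ℝ → ℂ → Mat2) (S : SpectralData) (γs : ℝ) (z : ℂ) : ℂ :=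
  (if 0 < z.im then Complex.I else 1) * rootFZero q L Y S γs z / rootDisc L Y S z

open Classical in
/-- The diagonal factor of the matrix `B`. -/
def diagB (q : ℝ → ℂ) (L : ℝ) (Y : ℝ → ℂ → Mat2) (z : ℂ) : Mat2 :=
  if 0 < z.im then !![dirichletProduct q L Y (-1) z, 0; 0, dirichletProduct q L Y 1 z]
  else !![dirichletProduct q L Y 1 z, 0; 0, dirichletProduct q L Y (-1) z]

open Classical in
/-- The inverse of the diagonal factor of the matrix `B`. -/
def diagBInv (q : ℝ → ℂ) (L : ℝ) (Y : ℝ → ℂ → Mat2) (z : ℂ) : Mat2 :=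
  if 0 < z.im then
    !![(dirichletProduct q L Y (-1) z)⁻¹, 0; 0, (dirichletProduct q L Y 1 z)⁻¹]
  else !![(dirichletProduct q L Y 1 z)⁻¹, 0; 0, (dirichletProduct q L Y (-1) z)⁻¹]

variable {L : ℝ} {q : ℝ → ℂ} {Y : ℝ → ℂ → Mat2} {S : SpectralData} {γs : ℝ}

lemma matrixB_eq (z : ℂ) : matrixB q L Y S γs z = scalarB q L Y S γs z • diagB q L Y z := by
  unfold matrixB scalarB diagB
  split_ifs <;> simp

namespace IsSpectralData

/-- The base point of the roots, the midpoint of gap number `0`, is no zero of the two functions. -/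
lemma center_ne_zero (h : IsPeriodicDirac L q Y) (hS : IsSpectralData q L Y S) :
    discSq Y L (S.center 0) ≠ 0 ∧ fZero q L Y (S.center 0) ≠ 0 := by
  have hlt := hS.gap_lt 0 hS.zero_mem
  have h1 : 1 < (mA Y L (S.center 0)).re ^ 2 := mem_gap h hS hS.zero_mem
    ⟨left_lt_add_div_two.mpr hlt, add_div_two_lt_right.mpr hlt⟩
  constructor
  · rw [Ne, h.discSq_real_eq_zero_iff]; exact h1.ne'
  · rw [Ne, h.fZero_eq_zero_iff]
    rintro ⟨h2, h3⟩
    exact absurd ((h.dirichletSign_eq_zero_iff h2).mp h3) (not_le.mpr h1)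

lemma fZero_ne_zero_of_im (h : IsPeriodicDirac L q Y) {z : ℂ} (hz : z.im ≠ 0) :
    fZero q L Y z ≠ 0 := fun h0 => h.dirFun_ne_zero hz (h.fZero_eq_zero_iff.mp h0).1

lemma dirichletProduct_ne_zero_of_im (h : IsPeriodicDirac L q Y) (σ : SignType) {z : ℂ}
    (hz : z.im ≠ 0) : dirichletProduct q L Y σ z ≠ 0 :=
  fun h0 => h.dirFun_ne_zero hz (h.dirichletProduct_eq_zero_iff.mp h0).1

lemma scalarB_pow (h : IsPeriodicDirac L q Y) (hS : IsSpectralData q L Y S) {z : ℂ}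
    (hz : z.im ≠ 0) : scalarB q L Y S γs z ^ 4 = fZero q L Y z ^ 2 / discSq Y L z := by
  obtain ⟨h1, h2⟩ := center_ne_zero h hS
  have e1 : rootDisc L Y S z ^ 4 = discSq Y L z := rootFrom_pow (n := 4) (g := discSq Y L)
    (by norm_num) h.differentiable_discSq h1 (fun _ hw => h.discSq_ne_zero hw) hz
  have e2 : rootFrom 2 (fZero q L Y) (S.center 0) z ^ 2 = fZero q L Y z := rootFrom_pow
    (by norm_num) h.differentiable_fZero h2 (fun _ hw => fZero_ne_zero_of_im h hw) hz
  have e3 : (if 0 < z.im then Complex.I else 1) ^ 4 = 1 := by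
    split_ifs <;> simp [Complex.I_pow_four]
  have e4 : (if z.im < 0 then (-1 : ℂ) ^ S.count γs (S.center 0) else 1) ^ 4 = 1 := by
    split_ifs
    · rw [← pow_mul, mul_comm, pow_mul]; norm_num
    · simp
  rw [scalarB, rootFZero, div_pow, mul_pow, mul_pow, e1, e3, e4, ← e2]
  ring

lemma scalarB_ne_zero (h : IsPeriodicDirac L q Y) (hS : IsSpectralData q L Y S) {z : ℂ}
    (hz : z.im ≠ 0) : scalarB q L Y S γs z ≠ 0 := by
  have h1 := scalarB_pow (γs := γs) h hS hz
  intro h0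
  rw [h0, zero_pow (by norm_num), eq_comm, div_eq_zero_iff] at h1
  exact h1.elim (pow_ne_zero 2 (fZero_ne_zero_of_im h hz)) (h.discSq_ne_zero hz)

lemma continuousOn_scalarB (h : IsPeriodicDirac L q Y) (hS : IsSpectralData q L Y S) :
    ContinuousOn (scalarB q L Y S γs) {z | 0 < z.im} ∧
      ContinuousOn (scalarB q L Y S γs) {z | z.im < 0} := by
  obtain ⟨h1, h2⟩ := center_ne_zero h hS
  have c1 : ContinuousOn (rootDisc L Y S) {z | z.im ≠ 0} := continuousOn_rootFrom 4
    (g := discSq Y L) h.differentiable_discSq h1 (fun _ hw => h.discSq_ne_zero hw)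
  have c2 : ContinuousOn (rootFrom 2 (fZero q L Y) (S.center 0)) {z | z.im ≠ 0} :=
    continuousOn_rootFrom 2 h.differentiable_fZero h2 (fun _ hw => fZero_ne_zero_of_im h hw)
  have c3 : ContinuousOn (fun z => rootFrom 2 (fZero q L Y) (S.center 0) z / rootDisc L Y S z)
      {z | z.im ≠ 0} := c2.div c1 fun z _ => Complex.exp_ne_zero _
  constructor
  · refine ((c3.mono fun z (hz : 0 < z.im) => hz.ne').const_mul Complex.I).congr
      fun z (hz : 0 < z.im) => ?_
    rw [scalarB, rootFZero, if_pos hz, if_neg hz.not_gt]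
    ring
  · refine ((c3.mono fun z (hz : z.im < 0) => hz.ne).const_mul
      ((-1 : ℂ) ^ S.count γs (S.center 0))).congr fun z (hz : z.im < 0) => ?_
    rw [scalarB, rootFZero, if_neg hz.not_gt, if_pos hz]
    ring

end IsSpectralData

lemma diagB_mul_diagBInv (h : IsPeriodicDirac L q Y) {z : ℂ} (hz : z.im ≠ 0) :
    diagB q L Y z * diagBInv q L Y z = 1 := by
  have h1 := IsSpectralData.dirichletProduct_ne_zero_of_im h 1 hz
  have h2 := IsSpectralData.dirichletProduct_ne_zero_of_im h (-1) hz
  unfold diagB diagBInv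
  split_ifs <;> simp [Matrix.one_fin_two, h1, h2]

/-! ### Quarter power singularities -/

lemma tendsto_nhdsWithin_im_ne_zero {F : ℂ → ℂ} {t l : ℂ}
    (hp : Tendsto F (𝓝[{z | 0 < z.im}] t) (𝓝 l)) (hm : Tendsto F (𝓝[{z | z.im < 0}] t) (𝓝 l)) :
    Tendsto F (𝓝[{z | z.im ≠ 0}] t) (𝓝 l) := by
  have e : {z : ℂ | z.im ≠ 0} = {z | 0 < z.im} ∪ {z | z.im < 0} := by
    ext z
    simp only [Set.mem_union, Set.mem_ofPred_eq]
    exact ne_iff_lt_or_gt.trans or_comm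
  rw [e, nhdsWithin_union]
  exact hp.sup hm

/-- `F` has boundary values at the real point `t` from both half planes, and the one from above is
`v` times the one from below. -/
def HasJump (F : ℂ → ℂ) (t : ℝ) (v : ℂ) : Prop :=
  ∃ l, Tendsto F (𝓝[{z | 0 < z.im}] (t : ℂ)) (𝓝 (v * l)) ∧
    Tendsto F (𝓝[{z | z.im < 0}] (t : ℂ)) (𝓝 l)

/-- If the jump of `A` turns by a factor `exp (i κ π / 2)` at `e`, then `A (z - e) ^ (κ / 4)` is
single-valued near `e` up to constants in the half planes, and a mild singularity is removable. -/
lemma isBigO_of_hasJump {A : ℂ → ℂ} (hA : DifferentiableOn ℂ A {z | z.im ≠ 0}) {e : ℝ}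
    {vL vR : ℂ} (hL : ∀ᶠ t in 𝓝[<] e, HasJump A t vL) (hR : ∀ᶠ t in 𝓝[>] e, HasJump A t vR)
    {κ : ℝ} (hv : vR = Complex.exp (κ * (Real.pi / 2 * Complex.I)) * vL) (hvR : vR ≠ 0) {a : ℝ}
    (ha : -1 < a + κ / 4)
    (hb : A =O[𝓝[{z | z.im ≠ 0}] (e : ℂ)] fun z => ‖z - e‖ ^ a) :
    A =O[𝓝[{z | z.im ≠ 0}] (e : ℂ)] fun z => ‖z - e‖ ^ (-(κ / 4)) := by
  classical
  -- A branch of `(z - e) ^ (κ / 4)`, with the cut to the left of `e`.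
  set ψ : ℂ → ℂ := fun z => Complex.exp (κ / 4 * Complex.log (z - e))
  have hψn : ∀ z : ℂ, z ≠ e → ‖ψ z‖ = ‖z - e‖ ^ (κ / 4) := fun z hz => by
    have hz' : 0 < ‖z - e‖ := norm_pos_iff.mpr (sub_ne_zero.mpr hz)
    simp only [ψ]
    rw [Complex.norm_exp, Real.rpow_def_of_pos hz', mul_comm (Real.log _)]
    have e1 : ((κ : ℂ) / 4) = ((κ / 4 : ℝ) : ℂ) := by push_cast; ring
    rw [e1, Complex.re_ofReal_mul, Complex.log_re]
  -- The constants that remove the jump `vR` on the right of `e`.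
  set c : ℂ → ℂ := fun z => if 0 < z.im then 1 else vR
  set R : ℂ → ℂ := fun z => c z * (A z * ψ z)
  have hcO : c =O[𝓝[{z | z.im ≠ 0}] (e : ℂ)] fun _ => (1 : ℝ) := by
    refine IsBigO.of_bound (max 1 ‖vR‖) (Eventually.of_forall fun z => ?_)
    simp only [c]
    split_ifs <;> simp
  have hne : ∀ᶠ z in 𝓝[{z : ℂ | z.im ≠ 0}] (e : ℂ), z ≠ (e : ℂ) := 
    eventually_mem_nhdsWithin.filter_mono (nhdsWithin_im_ne_zero_le e)
  have hψO : ψ =O[𝓝[{z | z.im ≠ 0}] (e : ℂ)] fun z => ‖z - e‖ ^ (κ / 4) := by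
    refine IsBigO.of_bound 1 ?_
    filter_upwards [hne] with z hz
    rw [hψn z hz, one_mul, Real.norm_of_nonneg (by positivity)]
  obtain ⟨ρ, hρ, hLρ, hRρ⟩ : ∃ ρ > 0, (∀ t ∈ Ioo (e - ρ) e, HasJump A t vL) ∧
      ∀ t ∈ Ioo e (e + ρ), HasJump A t vR := by
    obtain ⟨l, hl, hl'⟩ := (mem_nhdsLT_iff_exists_Ioo_subset).mp hL
    obtain ⟨u, hu, hu'⟩ := (mem_nhdsGT_iff_exists_Ioo_subset).mp hR
    refine ⟨min (e - l) (u - e), lt_min (sub_pos.mpr hl) (sub_pos.mpr hu), fun t ht => hl' ?_,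
      fun t ht => hu' ?_⟩
    · exact ⟨by linarith [ht.1, min_le_left (e - l) (u - e)], ht.2⟩
    · exact ⟨ht.1, by linarith [ht.2, min_le_right (e - l) (u - e)]⟩
  have hRd : DifferentiableOn ℂ R (Metric.ball (e : ℂ) ρ ∩ {z | z.im ≠ 0}) := by
    intro z hz
    have hz' : z.im ≠ 0 := hz.2
    have hc : c =ᶠ[𝓝 z] fun _ => c z := by
      rcases lt_or_gt_of_ne hz' with h | h
      · filter_upwards [(isOpen_lt Complex.continuous_im continuous_const).mem_nhds h] with w hw
        have hw' : w.im < 0 := hw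
        simp only [c, if_neg hw'.not_gt, if_neg h.not_gt]
      · filter_upwards [(isOpen_lt continuous_const Complex.continuous_im).mem_nhds h] with w hw
        have hw' : 0 < w.im := hw
        simp only [c, if_pos hw', if_pos h]
    have hψd : DifferentiableAt ℂ ψ z := by
      have h1 : DifferentiableAt ℂ (fun z : ℂ => Complex.log (z - e)) z :=
        (differentiableAt_id.sub_const (e : ℂ)).clog
          (Complex.mem_slitPlane_iff.mpr (Or.inr (by simpa using hz')))
      exact (h1.const_mul _).cexp
    have h2 : DifferentiableAt ℂ (fun w => c z * (A w * ψ w)) z :=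
      ((hA.differentiableAt (isOpen_im_ne_zero.mem_nhds hz')).mul hψd).const_mul _
    refine (h2.congr_of_eventuallyEq ?_).differentiableWithinAt
    filter_upwards [hc] with w hw
    simp only [R, hw]
  have hup : ∀ t : ℝ, Tendsto c (𝓝[{z | 0 < z.im}] (t : ℂ)) (𝓝 1) := fun t => by
    refine tendsto_const_nhds.congr' ?_
    filter_upwards [self_mem_nhdsWithin] with z hz
    exact (if_pos hz).symm
  have hdn : ∀ t : ℝ, Tendsto c (𝓝[{z | z.im < 0}] (t : ℂ)) (𝓝 vR) := fun t => by
    refine tendsto_const_nhds.congr' ?_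
    filter_upwards [self_mem_nhdsWithin] with z hz
    exact (if_neg (not_lt.mpr (le_of_lt hz))).symm
  -- The function `R` has no jump on either side, and its singularity at `e` is weaker than a pole.
  obtain ⟨F, hF, hFR⟩ := exists_extension (U := Metric.ball (e : ℂ) ρ) (T := R) (Z := {e})
    Metric.isOpen_ball hRd (fun t ht => by
      by_cases hte : t = e
      · rw [hte]; exact self_mem_nhdsWithin
      · exact (eventually_ne_nhds hte).filter_mono nhdsWithin_le_nhds) (fun t ht hte => by
      have hte' : t ≠ e := hte
      have htρ : |t - e| < ρ := by
        rw [mem_ball_iff_norm, ← Complex.ofReal_sub, Complex.norm_real] at ht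
        exact ht
      rw [abs_lt] at htρ
      rcases lt_or_gt_of_ne hte' with hlt | hgt
      · -- on the left the two boundary values of the logarithm differ by `2 π i`
        obtain ⟨l, h1, h2⟩ := hLρ t ⟨by linarith, hlt⟩
        have hre : ((t : ℂ) - e).re < 0 := by simpa using hlt
        have him : ((t : ℂ) - e).im = 0 := by simp
        have hsub : Tendsto (fun z : ℂ => z - e) (𝓝 (t : ℂ)) (𝓝 ((t : ℂ) - e)) :=
          (continuous_id.sub continuous_const).tendsto _
        have g1 := (Complex.tendsto_log_nhdsWithin_im_nonneg_of_re_neg_of_im_zero hre him).comp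
          (tendsto_nhdsWithin_iff.mpr ⟨hsub.mono_left (nhdsWithin_le_nhds (s := {z | 0 < z.im})),
            eventually_nhdsWithin_of_forall (s := {z : ℂ | 0 < z.im}) fun z hz => by
              simpa using le_of_lt hz⟩)
        have g2 := (Complex.tendsto_log_nhdsWithin_im_neg_of_re_neg_of_im_zero hre him).comp
          (tendsto_nhdsWithin_iff.mpr ⟨hsub.mono_left (nhdsWithin_le_nhds (s := {z | z.im < 0})),
            eventually_nhdsWithin_of_forall (s := {z : ℂ | z.im < 0}) fun z hz => by
              simpa using hz⟩)
        have k1 := (hup t).mul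
          (h1.mul ((g1.const_mul (κ / 4 : ℂ)).cexp))
        have k2 := (hdn t).mul
          (h2.mul ((g2.const_mul (κ / 4 : ℂ)).cexp))
        refine ⟨_, tendsto_nhdsWithin_im_ne_zero k1 ?_⟩
        convert (show Tendsto R _ (𝓝 _) from k2) using 2
        rw [hv, one_mul, mul_add, mul_sub, Complex.exp_add, Complex.exp_sub]
        have e1 : Complex.exp (κ * (Real.pi / 2 * Complex.I)) =
            Complex.exp (κ / 4 * (Real.pi * Complex.I)) *
              Complex.exp (κ / 4 * (Real.pi * Complex.I)) := by
          rw [← Complex.exp_add]; congr 1; ring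
        rw [e1]
        have := Complex.exp_ne_zero (κ / 4 * (Real.pi * Complex.I))
        field_simp
      · obtain ⟨l, h1, h2⟩ := hRρ t ⟨hgt, by linarith⟩
        have hψc : ContinuousAt ψ t := by
          have hs : (t : ℂ) - e ∈ Complex.slitPlane :=
            Complex.mem_slitPlane_iff.mpr (Or.inl (by simpa using hgt))
          exact (((continuousAt_id.sub continuousAt_const).clog hs).const_mul _).cexp
        have k1 := (hup t).mul
          (h1.mul (hψc.tendsto.mono_left nhdsWithin_le_nhds))
        have k2 := (hdn t).mul
          (h2.mul (hψc.tendsto.mono_left nhdsWithin_le_nhds))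
        refine ⟨_, tendsto_nhdsWithin_im_ne_zero k1 ?_⟩
        convert (show Tendsto R _ (𝓝 _) from k2) using 2
        ring) (fun t ht hte => by
      rw [Set.mem_singleton_iff] at hte
      subst hte
      have h1 := isBigO_rpow_mul (nhdsWithin_im_ne_zero_le t) hb hψO
      have h2 := hcO.mul h1
      simp only [one_mul] at h2
      have h3 := isBigO_rpow_mul (nhdsWithin_im_ne_zero_le t)
        (isTheta_sub_rpow (t : ℂ) (𝓝[{z | z.im ≠ 0}] (t : ℂ))).1 h2
      exact h3.trans_tendsto (tendsto_norm_sub_rpow _ (by linarith) _ nhdsWithin_le_nhds))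
  have hRO : R =O[𝓝[{z | z.im ≠ 0}] (e : ℂ)] fun _ => (1 : ℝ) := by
    have h1 : ContinuousAt F e := (hF.differentiableAt (Metric.ball_mem_nhds _ hρ)).continuousAt
    refine ((h1.tendsto.isBigO_one ℝ).mono nhdsWithin_le_nhds).congr' ?_ EventuallyEq.rfl
    filter_upwards [self_mem_nhdsWithin, nhdsWithin_le_nhds (Metric.ball_mem_nhds (e : ℂ) hρ)]
      with z hz hz'
    exact hFR z hz' hz
  have hcinv : (fun z => (c z)⁻¹) =O[𝓝[{z | z.im ≠ 0}] (e : ℂ)] fun _ => (1 : ℝ) := by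
    refine IsBigO.of_bound (max 1 ‖vR⁻¹‖) (Eventually.of_forall fun z => ?_)
    simp only [c]
    split_ifs <;> simp
  have hψinv : (fun z => (ψ z)⁻¹) =O[𝓝[{z | z.im ≠ 0}] (e : ℂ)] fun z => ‖z - e‖ ^ (-(κ / 4)) := by
    refine IsBigO.of_bound 1 ?_
    filter_upwards [hne] with z hz
    rw [norm_inv, hψn z hz, one_mul, Real.norm_of_nonneg (by positivity),
      Real.rpow_neg (norm_nonneg _)]
  have h4 := (hcinv.mul hψinv).mul hRO
  simp only [one_mul, mul_one] at h4
  refine h4.congr_left fun z => ?_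
  have hc0 : c z ≠ 0 := by
    simp only [c]; split_ifs
    · exact one_ne_zero
    · exact hvR
  have hψ0 : ψ z ≠ 0 := Complex.exp_ne_zero _
  simp only [R]
  field_simp

/-! ### Comparison of a solution of the Riemann-Hilbert problem with the Bloch solutions -/

/-- The inverse of the normalized Bloch matrix, as a function of the root `s` of `Δ² - 1`. -/
def transport (Y : ℝ → ℂ → Mat2) (L x : ℝ) (s z : ℂ) : Mat2 :=
  (2 * s)⁻¹ • (expSigma3 (-(Complex.I * z * x)) * matN Y L s z * (Y x z).adjugate)

lemma transport_neg (Y : ℝ → ℂ → Mat2) (L x : ℝ) (s z : ℂ) :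
    transport Y L x (-s) z = expSigma3 (-2 * Complex.I * z * x) * sigma1 * transport Y L x s z := by
  have e : expSigma3 (-2 * Complex.I * z * x) * sigma1 * expSigma3 (-(Complex.I * z * x)) =
      expSigma3 (-(Complex.I * z * x)) * sigma1 := by
    rw [Matrix.mul_assoc, sigma1_mul_expSigma3, ← Matrix.mul_assoc, expSigma3_mul]
    congr 2; ring
  rw [transport, transport, matN_neg, Matrix.mul_smul, ← Matrix.mul_assoc, ← Matrix.mul_assoc, e]
  simp only [Matrix.neg_mul, mul_neg, inv_neg, neg_smul, smul_neg, neg_neg,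
    Matrix.mul_assoc]

/-- The solution `Φ` multiplied by constant matrices and by the inverses of the diagonal factor of
`B` and of the normalized Bloch matrix. Its jumps across the real line are scalars. -/
def comparison (q : ℝ → ℂ) (L : ℝ) (Y : ℝ → ℂ → Mat2) (x : ℝ) (Φ : ℂ → Mat2) (z : ℂ) : Mat2 :=
  (1 / 2 : ℂ) • U.conjTranspose * Φ z * diagBInv q L Y z * matXinv Y L x z

section BigO

lemma isBigO_mul_apply {M N : ℂ → Mat2} {f g : ℂ → ℝ} {l : Filter ℂ}
    (hM : ∀ i j, (fun z => M z i j) =O[l] f) (hN : ∀ i j, (fun z => N z i j) =O[l] g)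
    (i j : Fin 2) : (fun z => (M z * N z) i j) =O[l] fun z => f z * g z := by
  simp only [Matrix.mul_apply, Fin.sum_univ_two]
  exact ((hM i 0).mul (hN 0 j)).add ((hM i 1).mul (hN 1 j))

lemma isBigO_apply_of_tendsto {M : ℂ → Mat2} {P : Mat2} {l : Filter ℂ} (h : Tendsto M l (𝓝 P))
    (i j : Fin 2) : (fun z => M z i j) =O[l] fun _ => (1 : ℝ) :=
  ((tendsto_pi_nhds.mp (tendsto_pi_nhds.mp h i)) j).isBigO_one ℝ

end BigO

lemma continuous_expSigma3 : Continuous expSigma3 := by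
  refine continuous_pi fun i => continuous_pi fun j => ?_
  obtain rfl | rfl : i = 0 ∨ i = 1 := by omega
  · obtain rfl | rfl : j = 0 ∨ j = 1 := by omega
    · exact Complex.continuous_exp
    · exact continuous_const
  · obtain rfl | rfl : j = 0 ∨ j = 1 := by omega
    · exact continuous_const
    · exact Complex.continuous_exp.comp continuous_neg

namespace IsPeriodicDirac

variable {L : ℝ} {q : ℝ → ℂ} {Y : ℝ → ℂ → Mat2} {x : ℝ}

lemma continuous_adjugate (h : IsPeriodicDirac L q Y) (x : ℝ) :
    Continuous fun z => (Y x z).adjugate :=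
  Continuous.matrix_adjugate (continuous_pi fun i => continuous_pi fun j =>
    (h.differentiable_entry x i j).continuous)

lemma continuousAt_transport (h : IsPeriodicDirac L q Y) {s : ℂ → ℂ} {t : ℂ}
    (hs : ContinuousAt s t) (hs0 : s t ≠ 0) : ContinuousAt (fun z => transport Y L x (s z) z) t := by
  have h1 : ContinuousAt (fun z => matN Y L (s z) z) t :=
    continuousAt_pi.mpr fun i => continuousAt_pi.mpr fun j => h.continuousAt_matN hs i j
  have h2 : ContinuousAt (fun z : ℂ => expSigma3 (-(Complex.I * z * x))) t :=
    (continuous_expSigma3.comp (by fun_prop)).continuousAt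
  exact ((continuousAt_const.mul hs).inv₀ (mul_ne_zero two_ne_zero hs0)).smul
    ((h2.mul h1).mul (h.continuous_adjugate x).continuousAt)

lemma tendsto_diagBInv (h : IsPeriodicDirac L q Y) {t : ℂ} (hp : dirichletProduct q L Y 1 t ≠ 0)
    (hm : dirichletProduct q L Y (-1) t ≠ 0) :
    Tendsto (diagBInv q L Y) (𝓝[{z | 0 < z.im}] t)
        (𝓝 !![(dirichletProduct q L Y (-1) t)⁻¹, 0; 0, (dirichletProduct q L Y 1 t)⁻¹]) ∧
      Tendsto (diagBInv q L Y) (𝓝[{z | z.im < 0}] t)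
        (𝓝 !![(dirichletProduct q L Y 1 t)⁻¹, 0; 0, (dirichletProduct q L Y (-1) t)⁻¹]) := by
  have cp := ((h.differentiable_dirichletProduct 1).continuous.continuousAt.inv₀ hp)
  have cm := ((h.differentiable_dirichletProduct (-1)).continuous.continuousAt.inv₀ hm)
  have key : ∀ f g : ℂ → ℂ, ContinuousAt f t → ContinuousAt g t →
      ContinuousAt (fun z => (!![f z, 0; 0, g z] : Mat2)) t := fun f g hf hg =>
    continuousAt_pi.mpr fun i => continuousAt_pi.mpr fun j => by
      fin_cases i <;> fin_cases j <;> simp <;> first | exact hf | exact hg | exact continuousAt_const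
  constructor
  · refine ((key _ _ cm cp).tendsto.mono_left nhdsWithin_le_nhds).congr' ?_
    filter_upwards [self_mem_nhdsWithin] with z hz
    exact (if_pos hz).symm
  · refine ((key _ _ cp cm).tendsto.mono_left nhdsWithin_le_nhds).congr' ?_
    filter_upwards [self_mem_nhdsWithin] with z hz
    exact (if_neg (not_lt.mpr (le_of_lt hz))).symm

lemma dirichletProduct_ne_zero (h : IsPeriodicDirac L q Y) (σ : SignType) {z : ℂ}
    (hz : dirFun Y L z ≠ 0) : dirichletProduct q L Y σ z ≠ 0 :=
  fun h0 => hz (h.dirichletProduct_eq_zero_iff.mp h0).1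

/-- On the closed bands the Dirichlet eigenvalues have sign zero. -/
lemma dirichletProduct_ne_zero_of_re_sq_le (h : IsPeriodicDirac L q Y) {σ : SignType} (hσ : σ ≠ 0)
    {t : ℝ} (ht : (mA Y L t).re ^ 2 ≤ 1) : dirichletProduct q L Y σ t ≠ 0 := fun h0 => by
  obtain ⟨h1, h2⟩ := h.dirichletProduct_eq_zero_iff.mp h0
  exact hσ (h2.symm.trans ((h.dirichletSign_eq_zero_iff h1).mpr ht))

lemma tendsto_comparison (h : IsPeriodicDirac L q Y) {Φ : ℂ → Mat2} {t : ℂ} {l : Filter ℂ}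
    (hl : l ≤ 𝓝 t) {P D : Mat2} (hP : Tendsto Φ l (𝓝 P)) (hD : Tendsto (diagBInv q L Y) l (𝓝 D))
    {s : ℂ → ℂ} (hs : ContinuousAt s t) (hs0 : s t ≠ 0) (he : ∀ᶠ z in l, sRoot Y L z = s z) :
    Tendsto (comparison q L Y x Φ) l
      (𝓝 ((1 / 2 : ℂ) • U.conjTranspose * P * D * transport Y L x (s t) t)) := by
  have h1 : Tendsto (matXinv Y L x) l (𝓝 (transport Y L x (s t) t)) := by
    refine ((h.continuousAt_transport (x := x) hs hs0).tendsto.mono_left hl).congr' ?_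
    filter_upwards [he] with z hz
    rw [← hz]; rfl
  exact ((tendsto_const_nhds.mul hP).mul hD).mul h1

end IsPeriodicDirac

namespace IsRHPSolution

variable {L : ℝ} {q : ℝ → ℂ} {Y : ℝ → ℂ → Mat2} {S : SpectralData} {γs : ℝ} {r : ℤ → ℝ} {x : ℝ}
  {Φ : ℂ → Mat2}

/-- In a band both boundary values are taken with the same root `s`, and the diagonal jump of `Φ`
exchanges the two diagonal factors; what is left is the sign. -/
lemma hasJump_band (hΦ : IsRHPSolution q L Y S γs r x Φ) (h : IsPeriodicDirac L q Y)
    (hS : IsSpectralData q L Y S) {n : ℤ} {t : ℝ} (ht : S.InBand n t) (h0 : discSq Y L t ≠ 0)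
    (hD : dirFun Y L t ≠ 0) (i j : Fin 2) :
    HasJump (fun z => comparison q L Y x Φ z i j) t ((-1 : ℂ) ^ (n + S.count γs t : ℤ)) := by
  obtain ⟨Φp, Φm, -, -, hp, hm, hb, -⟩ := hΦ.boundary
  have hlt : (mA Y L t).re ^ 2 < 1 := lt_of_le_of_ne (IsSpectralData.InBand.re_sq_le h hS ht)
    fun hc => h0 ((h.discSq_real_eq_zero_iff t).mpr hc)
  obtain ⟨s, hsa, hs2, -, hs⟩ := h.sRoot_near_band hlt
  have hs0 : s t ≠ 0 := fun hc => h0 (by rw [← hs2.self_of_nhds, hc]; ring)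
  have hte : t ∉ S.bandEdges := fun hc => h0 (IsSpectralData.edge_discSq h hS hc)
  have hfp := h.dirichletProduct_ne_zero 1 hD
  have hfm := h.dirichletProduct_ne_zero (-1) hD
  obtain ⟨d1, d2⟩ := h.tendsto_diagBInv hfp hfm
  have k1 := h.tendsto_comparison (x := x) nhdsWithin_le_nhds (hp t hte) d1 hsa.continuousAt hs0 (by
    filter_upwards [nhdsWithin_le_nhds hs, self_mem_nhdsWithin] with z hz hz'
    exact hz (ne_of_gt hz'))
  have k2 := h.tendsto_comparison (x := x) nhdsWithin_le_nhds (hm t hte) d2 hsa.continuousAt hs0 (by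
    filter_upwards [nhdsWithin_le_nhds hs, self_mem_nhdsWithin] with z hz hz'
    exact hz (ne_of_lt hz'))
  have e : (!![dirichletProduct q L Y (-1) t / dirichletProduct q L Y 1 t, 0; 0,
      dirichletProduct q L Y 1 t / dirichletProduct q L Y (-1) t] : Mat2) *
      !![(dirichletProduct q L Y (-1) t)⁻¹, 0; 0, (dirichletProduct q L Y 1 t)⁻¹] =
      !![(dirichletProduct q L Y 1 t)⁻¹, 0; 0, (dirichletProduct q L Y (-1) t)⁻¹] := by
    rw [Matrix.mul_fin_two]
    field_simp
    simp
  rw [hb n t ht, jumpBand] at k1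
  generalize (1 / 2 : ℂ) • U.conjTranspose = C at k1 k2
  rw [Matrix.mul_smul, Matrix.mul_smul, Matrix.smul_mul, Matrix.smul_mul, ← Matrix.mul_assoc C,
    Matrix.mul_assoc (C * Φm t), e] at k1
  exact ⟨_, tendsto_pi_nhds.mp (tendsto_pi_nhds.mp k1 i) j,
    tendsto_pi_nhds.mp (tendsto_pi_nhds.mp k2 i) j⟩

/-- Across a gap the root `s` changes its sign, which by `transport_neg` amounts to a factor
`exp (-2 i t x σ₃) σ₁`. This is also the matrix part of the jump of `Φ`, so that only a scalar `±i` is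
left. -/
lemma hasJump_gap (hΦ : IsRHPSolution q L Y S γs r x Φ) (h : IsPeriodicDirac L q Y)
    (hS : IsSpectralData q L Y S) {n : ℤ} (hn : n ∈ S.labels) {t : ℝ}
    (ht : t ∈ Ioo (S.E (2 * n - 1)) (S.E (2 * n))) (hD : dirFun Y L t ≠ 0) (i j : Fin 2) :
    HasJump (fun z => comparison q L Y x Φ z i j) t
      ((-1 : ℂ) ^ (n + S.count γs t : ℤ) * Complex.I) := by
  obtain ⟨Φp, Φm, -, -, hp, hm, -, hg⟩ := hΦ.boundary
  have hlt := IsSpectralData.mem_gap h hS hn ht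
  have h0 : discSq Y L t ≠ 0 := fun hc => hlt.ne' ((h.discSq_real_eq_zero_iff t).mp hc)
  obtain ⟨s, hsa, hs2, -, hsp, hsm⟩ := h.sRoot_near_gap hlt
  have hs0 : s t ≠ 0 := fun hc => h0 (by rw [← hs2.self_of_nhds, hc]; ring)
  have hte : t ∉ S.bandEdges := fun hc => h0 (IsSpectralData.edge_discSq h hS hc)
  have hfp := h.dirichletProduct_ne_zero 1 hD
  have hfm := h.dirichletProduct_ne_zero (-1) hD
  obtain ⟨d1, d2⟩ := h.tendsto_diagBInv hfp hfm
  have k1 := h.tendsto_comparison (x := x) nhdsWithin_le_nhds (hp t hte) d1 hsa.continuousAt hs0 (by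
    filter_upwards [nhdsWithin_le_nhds hsp, self_mem_nhdsWithin] with z hz hz'
    exact hz hz')
  -- From below the root is `-s`.
  have k2 := h.tendsto_comparison (x := x) (s := fun z => -s z) nhdsWithin_le_nhds (hm t hte) d2
    hsa.continuousAt.neg (neg_ne_zero.mpr hs0) (by
      filter_upwards [nhdsWithin_le_nhds hsm, self_mem_nhdsWithin] with z hz hz'
      exact hz hz')
  have e : ∀ a b c : ℂ, expSigma3 c * sigma1 * !![a, 0; 0, b] =
      !![b, 0; 0, a] * (expSigma3 c * sigma1) := fun a b c => by
    simp [expSigma3, sigma1, mul_comm]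
  rw [hg n hn t ht, jumpGap] at k1
  rw [transport_neg] at k2
  generalize (1 / 2 : ℂ) • U.conjTranspose = C at k1 k2
  rw [Matrix.mul_smul, Matrix.mul_smul, Matrix.smul_mul, Matrix.smul_mul, ← Matrix.mul_assoc C,
    Matrix.mul_assoc (C * Φm t), e, ← Matrix.mul_assoc (C * Φm t), Matrix.mul_assoc (_ * _)
    (_ * _) (transport _ _ _ _ _)] at k1
  exact ⟨_, tendsto_pi_nhds.mp (tendsto_pi_nhds.mp k1 i) j,
    tendsto_pi_nhds.mp (tendsto_pi_nhds.mp k2 i) j⟩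

end IsRHPSolution

/-! ### Local bounds of the comparison functions -/

lemma isBigO_im_ne_zero {F : ℂ → ℂ} {g : ℂ → ℝ} {t : ℂ} (hp : F =O[𝓝[{z | 0 < z.im}] t] g)
    (hm : F =O[𝓝[{z | z.im < 0}] t] g) : F =O[𝓝[{z | z.im ≠ 0}] t] g := by
  have e : {z : ℂ | z.im ≠ 0} = {z | 0 < z.im} ∪ {z | z.im < 0} := by
    ext z
    simp only [Set.mem_union, Set.mem_ofPred_eq]
    exact ne_iff_lt_or_gt.trans or_comm
  rw [e, nhdsWithin_union]
  exact hp.sup hm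

lemma differentiableAt_mul_apply {M N : ℂ → Mat2} {t : ℂ}
    (hM : ∀ i j, DifferentiableAt ℂ (fun z => M z i j) t)
    (hN : ∀ i j, DifferentiableAt ℂ (fun z => N z i j) t) (i j : Fin 2) :
    DifferentiableAt ℂ (fun z => (M z * N z) i j) t := by
  simp only [Matrix.mul_apply, Fin.sum_univ_two]
  exact ((hM i 0).mul (hN 0 j)).add ((hM i 1).mul (hN 1 j))

lemma sigma1_mul_zero (M : Mat2) (j : Fin 2) : (sigma1 * M) 0 j = M 1 j := by
  simp [sigma1, Matrix.mul_apply]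

lemma sigma1_mul_one (M : Mat2) (j : Fin 2) : (sigma1 * M) 1 j = M 0 j := by
  simp [sigma1, Matrix.mul_apply]

lemma differentiable_expSigma3_apply {f : ℂ → ℂ} (hf : Differentiable ℂ f) (i j : Fin 2) :
    Differentiable ℂ fun z => expSigma3 (f z) i j := by
  obtain rfl | rfl : i = 0 ∨ i = 1 := by omega
  · obtain rfl | rfl : j = 0 ∨ j = 1 := by omega
    · exact hf.cexp
    · exact differentiable_const _
  · obtain rfl | rfl : j = 0 ∨ j = 1 := by omega
    · exact differentiable_const _
    · exact hf.neg.cexp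

/-- The combination of the entries of `comparison` that extends to an entire function: its fourth
powers, in which the jumps disappear, divided by the fourth power of the scalar factor of `B`. -/
def comparisonQuartic (q : ℝ → ℂ) (L : ℝ) (Y : ℝ → ℂ → Mat2) (x : ℝ) (Φ : ℂ → Mat2) (i j : Fin 2)
    (z : ℂ) : ℂ :=
  comparison q L Y x Φ z i j ^ 4 * (discSq Y L z * (fZero q L Y z)⁻¹ ^ 2)

namespace IsPeriodicDirac

variable {L : ℝ} {q : ℝ → ℂ} {Y : ℝ → ℂ → Mat2} {x : ℝ}

lemma differentiableAt_matN (h : IsPeriodicDirac L q Y) {s : ℂ → ℂ} {t : ℂ}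
    (hs : DifferentiableAt ℂ s t) (i j : Fin 2) :
    DifferentiableAt ℂ (fun z => matN Y L (s z) z i j) t := by
  have hα := h.differentiable_halfDiff t
  have hb := h.differentiable_mB t
  have hc := h.differentiable_mC t
  obtain rfl | rfl : i = 0 ∨ i = 1 := by omega
  · obtain rfl | rfl : j = 0 ∨ j = 1 := by omega
    · exact (hα.add hs).add hc
    · exact (hb.sub hα).add hs
  · obtain rfl | rfl : j = 0 ∨ j = 1 := by omega
    · exact (hc.neg.sub hα).add hs
    · exact (hα.sub hb).add hs

lemma differentiableAt_diagBInv (h : IsPeriodicDirac L q Y) {z : ℂ} (hz : z.im ≠ 0)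
    (i j : Fin 2) : DifferentiableAt ℂ (fun z => diagBInv q L Y z i j) z := by
  have hp := (h.differentiable_dirichletProduct 1 z).inv
    (IsSpectralData.dirichletProduct_ne_zero_of_im h 1 hz)
  have hm := (h.differentiable_dirichletProduct (-1) z).inv
    (IsSpectralData.dirichletProduct_ne_zero_of_im h (-1) hz)
  have key : ∀ f g : ℂ → ℂ, DifferentiableAt ℂ f z → DifferentiableAt ℂ g z →
      DifferentiableAt ℂ (fun z => (!![f z, 0; 0, g z] : Mat2) i j) z := fun f g hf hg => by
    obtain rfl | rfl : i = 0 ∨ i = 1 := by omega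
    · obtain rfl | rfl : j = 0 ∨ j = 1 := by omega
      · exact hf
      · exact differentiableAt_const _
    · obtain rfl | rfl : j = 0 ∨ j = 1 := by omega
      · exact differentiableAt_const _
      · exact hg
  rcases lt_or_gt_of_ne hz with hlt | hgt
  · refine (key _ _ hp hm).congr_of_eventuallyEq ?_
    filter_upwards [(isOpen_lt Complex.continuous_im continuous_const).mem_nhds hlt] with w hw
    rw [diagBInv, if_neg (not_lt.mpr (le_of_lt hw))]
    rfl
  · refine (key _ _ hm hp).congr_of_eventuallyEq ?_
    filter_upwards [(isOpen_lt continuous_const Complex.continuous_im).mem_nhds hgt] with w hw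
    rw [diagBInv, if_pos hw]
    rfl

lemma differentiable_adjugate_apply (h : IsPeriodicDirac L q Y) (x : ℝ) (i j : Fin 2) :
    Differentiable ℂ fun z => (Y x z).adjugate i j := by
  simp only [Matrix.adjugate_fin_two]
  obtain rfl | rfl : i = 0 ∨ i = 1 := by omega
  · obtain rfl | rfl : j = 0 ∨ j = 1 := by omega
    · exact h.differentiable_entry x 1 1
    · exact (h.differentiable_entry x 0 1).neg
  · obtain rfl | rfl : j = 0 ∨ j = 1 := by omega
    · exact (h.differentiable_entry x 1 0).neg
    · exact h.differentiable_entry x 0 0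

lemma differentiableAt_comparison (h : IsPeriodicDirac L q Y) {Φ : ℂ → Mat2}
    (hΦ : ∀ i j, DifferentiableOn ℂ (fun z => Φ z i j) {z | z.im ≠ 0}) {z : ℂ} (hz : z.im ≠ 0)
    (i j : Fin 2) : DifferentiableAt ℂ (fun z => comparison q L Y x Φ z i j) z := by
  have hs := (h.analyticAt_sRoot hz).differentiableAt
  have hE : ∀ i j, DifferentiableAt ℂ (fun z : ℂ => expSigma3 (-(Complex.I * z * x)) i j) z :=
    fun i j => differentiable_expSigma3_apply (f := fun z => -(Complex.I * z * x))
      (by fun_prop) i j z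
  have hM := differentiableAt_mul_apply (differentiableAt_mul_apply hE
    (h.differentiableAt_matN hs)) fun i j => h.differentiable_adjugate_apply x i j z
  have hX : ∀ i j, DifferentiableAt ℂ (fun z => matXinv Y L x z i j) z := fun i j =>
    ((hs.const_mul 2).inv (mul_ne_zero two_ne_zero (h.sRoot_ne_zero hz))).mul (hM i j)
  have hC : ∀ i j, DifferentiableAt ℂ (fun _ : ℂ => ((1 / 2 : ℂ) • U.conjTranspose) i j) z :=
    fun i j => differentiableAt_const _
  have hP : ∀ i j, DifferentiableAt ℂ (fun z => Φ z i j) z := fun i j =>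
    (hΦ i j).differentiableAt (isOpen_im_ne_zero.mem_nhds hz)
  exact differentiableAt_mul_apply (differentiableAt_mul_apply (differentiableAt_mul_apply hC hP)
    (h.differentiableAt_diagBInv hz)) hX i j

lemma differentiableOn_comparisonQuartic (h : IsPeriodicDirac L q Y) {Φ : ℂ → Mat2}
    (hΦ : ∀ i j, DifferentiableOn ℂ (fun z => Φ z i j) {z | z.im ≠ 0}) (i j : Fin 2) :
    DifferentiableOn ℂ (comparisonQuartic q L Y x Φ i j) {z | z.im ≠ 0} := fun z hz =>
  (((h.differentiableAt_comparison hΦ hz i j).pow 4).mul ((h.differentiable_discSq z).mul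
    (((h.differentiable_fZero z).inv
      (IsSpectralData.fZero_ne_zero_of_im h hz)).pow 2))).differentiableWithinAt

lemma comparison_eq (q : ℝ → ℂ) (L : ℝ) (Y : ℝ → ℂ → Mat2) (x : ℝ) (Φ : ℂ → Mat2) (z : ℂ) :
    comparison q L Y x Φ z = (1 / 2 : ℂ) • U.conjTranspose * Φ z *
      expSigma3 (-(Complex.I * z * x)) *
      ((1 / 2 : ℂ) • (diagBInv q L Y z * ((sRoot Y L z)⁻¹ • matN Y L (sRoot Y L z) z))) *
      (Y x z).adjugate := by
  have e : diagBInv q L Y z * expSigma3 (-(Complex.I * z * x)) =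
      expSigma3 (-(Complex.I * z * x)) * diagBInv q L Y z := by
    unfold diagBInv
    split_ifs <;> simp [expSigma3, mul_comm]
  rw [comparison, matXinv, mul_inv]
  generalize (1 / 2 : ℂ) • U.conjTranspose = C
  simp only [Matrix.mul_smul, Matrix.smul_mul, smul_smul, ← Matrix.mul_assoc]
  rw [Matrix.mul_assoc (C * Φ z), e, ← Matrix.mul_assoc]
  norm_num

/-- A bound of `comparison` from a bound of `Φ` and one of the remaining singular factor. -/
lemma comparison_isBigO (h : IsPeriodicDirac L q Y) {Φ : ℂ → Mat2} {t : ℂ} {l : Filter ℂ}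
    (hl : l ≤ 𝓝 t) {f g : ℂ → ℝ} (hΦ : ∀ i j, (fun z => Φ z i j) =O[l] f)
    (hK : ∀ i j, (fun z => (diagBInv q L Y z *
      ((sRoot Y L z)⁻¹ • matN Y L (sRoot Y L z) z)) i j) =O[l] g) (i j : Fin 2) :
    (fun z => comparison q L Y x Φ z i j) =O[l] fun z => f z * g z := by
  have hE : ∀ i j, (fun z : ℂ => expSigma3 (-(Complex.I * z * x)) i j) =O[l] fun _ => (1 : ℝ) :=
    fun i j => (((differentiable_expSigma3_apply (f := fun z => -(Complex.I * z * x))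
      (by fun_prop) i j).continuous.tendsto t).isBigO_one ℝ).mono hl
  have hA : ∀ i j, (fun z : ℂ => (Y x z).adjugate i j) =O[l] fun _ => (1 : ℝ) :=
    fun i j => (((h.differentiable_adjugate_apply x i j).continuous.tendsto t).isBigO_one ℝ).mono hl
  have hC : ∀ i j, (fun _ : ℂ => ((1 / 2 : ℂ) • U.conjTranspose) i j) =O[l] fun _ => (1 : ℝ) :=
    fun i j => isBigO_const_const _ one_ne_zero _
  have hK' : ∀ i j, (fun z => ((1 / 2 : ℂ) • (diagBInv q L Y z *
      ((sRoot Y L z)⁻¹ • matN Y L (sRoot Y L z) z))) i j) =O[l] g :=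
    fun i j => (hK i j).const_mul_left (1 / 2 : ℂ)
  have := isBigO_mul_apply (isBigO_mul_apply (isBigO_mul_apply (isBigO_mul_apply hC hΦ) hE) hK') hA
    i j
  simp only [mul_one, one_mul] at this
  simpa only [← comparison_eq] using this

lemma diagBInv_isBigO (h : IsPeriodicDirac L q Y) {t : ℂ} (hp : dirichletProduct q L Y 1 t ≠ 0)
    (hm : dirichletProduct q L Y (-1) t ≠ 0) (i j : Fin 2) :
    (fun z => diagBInv q L Y z i j) =O[𝓝[{z | z.im ≠ 0}] t] fun _ => (1 : ℝ) :=
  isBigO_im_ne_zero (isBigO_apply_of_tendsto (h.tendsto_diagBInv hp hm).1 i j)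
    (isBigO_apply_of_tendsto (h.tendsto_diagBInv hp hm).2 i j)

/-- The singular factor on closed bands: a bound for `matN / s` is one for the whole factor. -/
lemma kernel_isBigO_of_re_sq_le (h : IsPeriodicDirac L q Y) {t : ℝ}
    (ht : (mA Y L t).re ^ 2 ≤ 1) {g : ℂ → ℝ}
    (hN : ∀ i j, (fun z => matN Y L (sRoot Y L z) z i j * (sRoot Y L z)⁻¹) =O[𝓝[≠] (t : ℂ)] g)
    (i j : Fin 2) : (fun z => (diagBInv q L Y z *
      ((sRoot Y L z)⁻¹ • matN Y L (sRoot Y L z) z)) i j) =O[𝓝[{z | z.im ≠ 0}] (t : ℂ)] g := by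
  have h1 := h.diagBInv_isBigO (h.dirichletProduct_ne_zero_of_re_sq_le (by decide) ht)
    (h.dirichletProduct_ne_zero_of_re_sq_le (by decide) ht)
  have h2 : ∀ i j, (fun z => ((sRoot Y L z)⁻¹ • matN Y L (sRoot Y L z) z) i j)
      =O[𝓝[{z | z.im ≠ 0}] (t : ℂ)] g := fun i j =>
    ((hN i j).mono (nhdsWithin_im_ne_zero_le t)).congr_left fun z => mul_comm _ _
  simpa only [one_mul] using isBigO_mul_apply h1 h2 i j

/-- The singular factor at a Dirichlet eigenvalue inside a gap: the row of `matN` that vanishes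
there is the one divided by the product vanishing there. -/
lemma kernel_isBigO_of_gap (h : IsPeriodicDirac L q Y) {t : ℝ} (ht : 1 < (mA Y L t).re ^ 2)
    (h0 : dirFun Y L t = 0) (i j : Fin 2) : (fun z => (diagBInv q L Y z *
      ((sRoot Y L z)⁻¹ • matN Y L (sRoot Y L z) z)) i j) =O[𝓝[{z | z.im ≠ 0}] (t : ℂ)]
        fun _ => (1 : ℝ) := by
  have hd0 : discSq Y L t ≠ 0 := fun hc => ht.ne' ((h.discSq_real_eq_zero_iff t).mp hc)
  obtain ⟨s, hsa, hs2, hsn, hsp, hsm⟩ := h.sRoot_near_gap ht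
  obtain ⟨row0, row1⟩ := h.matN_row_eq_zero h0 hs2.self_of_nhds hsn
  have hsinv : (fun z => (sRoot Y L z)⁻¹) =O[𝓝[{z | z.im ≠ 0}] (t : ℂ)] fun _ => (1 : ℝ) :=
    (h.sRoot_inv_isBigO_one hd0).mono nhdsWithin_le_nhds
  have hN1 : ∀ i j, (fun z => matN Y L (s z) z i j) =O[𝓝[≠] (t : ℂ)] fun _ => (1 : ℝ) :=
    fun i j => ((h.continuousAt_matN hsa.continuousAt i j).tendsto.isBigO_one ℝ).mono
      nhdsWithin_le_nhds
  have key : ∀ (σ : SignType) (i : Fin 2),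
      (dirichletSign Y L t = σ → ∀ j, matN Y L (s t) t i j = 0) → ∀ j,
      (fun z => (dirichletProduct q L Y σ z)⁻¹ * matN Y L (s z) z i j)
        =O[𝓝[{z | z.im ≠ 0}] (t : ℂ)] fun _ => (1 : ℝ) := fun σ i hrow j => by
    refine IsBigO.mono ?_ (nhdsWithin_im_ne_zero_le t)
    by_cases hσ : dirichletSign Y L t = σ
    · obtain ⟨hz, d, hd, hd'⟩ := h.dirichletProduct_hasDerivAt h0 hσ
      have h1 := (isTheta_rpow_inv ((isTheta_of_hasDerivAt hd' hd hz).trans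
        (isTheta_sub_rpow _ _))).1
      have h2 := (isBigO_sub_of_differentiableAt (h.differentiableAt_matN hsa.differentiableAt i j)
        (hrow hσ j)).mono (nhdsWithin_le_nhds (s := {(t : ℂ)}ᶜ))
      have h3 := isBigO_rpow_mul le_rfl h1 h2
      rw [neg_add_cancel] at h3
      exact isBigO_one_rpow.mp h3
    · have hne : dirichletProduct q L Y σ t ≠ 0 := fun hc =>
        hσ (h.dirichletProduct_eq_zero_iff.mp hc).2
      have h1 := (inv_isBigO_one (h.differentiable_dirichletProduct σ).continuous.continuousAt
        hne).mono (nhdsWithin_le_nhds (s := {(t : ℂ)}ᶜ))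
      simpa only [one_mul] using h1.mul (hN1 i j)
  have k0 := key (-1) 0 row0 j
  have k1 := key 1 1 row1 j
  have hup : 𝓝[{z : ℂ | 0 < z.im}] (t : ℂ) ≤ 𝓝[{z : ℂ | z.im ≠ 0}] (t : ℂ) :=
    nhdsWithin_mono _ fun z hz => ne_of_gt hz
  have hdn : 𝓝[{z : ℂ | z.im < 0}] (t : ℂ) ≤ 𝓝[{z : ℂ | z.im ≠ 0}] (t : ℂ) :=
    nhdsWithin_mono _ fun z hz => ne_of_lt hz
  have m0 := hsinv.mul k0
  have m1 := hsinv.mul k1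
  simp only [one_mul] at m0 m1
  refine isBigO_im_ne_zero ?_ ?_
  · have hev : ∀ᶠ z in 𝓝[{z : ℂ | 0 < z.im}] (t : ℂ), 0 < z.im ∧ sRoot Y L z = s z := by
      filter_upwards [nhdsWithin_le_nhds hsp, self_mem_nhdsWithin] with z hz hz'
      exact ⟨hz', hz hz'⟩
    obtain rfl | rfl : i = 0 ∨ i = 1 := by omega
    · refine (m0.mono hup).congr' ?_ EventuallyEq.rfl
      filter_upwards [hev] with z hz
      rw [diagBInv, if_pos hz.1, hz.2]
      simp [Matrix.mul_apply]
      ring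
    · refine (m1.mono hup).congr' ?_ EventuallyEq.rfl
      filter_upwards [hev] with z hz
      rw [diagBInv, if_pos hz.1, hz.2]
      simp [Matrix.mul_apply]
      ring
  · have hev : ∀ᶠ z in 𝓝[{z : ℂ | z.im < 0}] (t : ℂ), z.im < 0 ∧ sRoot Y L z = -s z := by
      filter_upwards [nhdsWithin_le_nhds hsm, self_mem_nhdsWithin] with z hz hz'
      exact ⟨hz', hz hz'⟩
    obtain rfl | rfl : i = 0 ∨ i = 1 := by omega
    · refine (m1.mono hdn).neg_left.congr' ?_ EventuallyEq.rfl
      filter_upwards [hev] with z hz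
      rw [diagBInv, if_neg hz.1.not_gt, hz.2, matN_neg, Matrix.mul_apply, Fin.sum_univ_two]
      simp [sigma1_mul_zero]
      ring
    · refine (m0.mono hdn).neg_left.congr' ?_ EventuallyEq.rfl
      filter_upwards [hev] with z hz
      rw [diagBInv, if_neg hz.1.not_gt, hz.2, matN_neg, Matrix.mul_apply, Fin.sum_univ_two]
      simp [sigma1_mul_one]
      ring

end IsPeriodicDirac

/-! ### Entire extension of the comparison functions -/

namespace IsRHPSolution

variable {L : ℝ} {q : ℝ → ℂ} {Y : ℝ → ℂ → Mat2} {S : SpectralData} {γs : ℝ} {r : ℤ → ℝ} {x : ℝ}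
  {Φ : ℂ → Mat2}

lemma isBigO_one_of_notMem_bandEdges (hΦ : IsRHPSolution q L Y S γs r x Φ) {t : ℝ}
    (ht : t ∉ S.bandEdges) (i j : Fin 2) :
    (fun z => Φ z i j) =O[𝓝[{z | z.im ≠ 0}] (t : ℂ)] fun _ => (1 : ℝ) := by
  obtain ⟨Φp, Φm, -, -, hp, hm, -, -⟩ := hΦ.boundary
  exact isBigO_im_ne_zero (isBigO_apply_of_tendsto (hp t ht) i j)
    (isBigO_apply_of_tendsto (hm t ht) i j)

/-- At a band edge the jump of `comparison` turns by `i`, or by `-i` if the edge is a Dirichlet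
eigenvalue: there the parity of the counting function changes. -/
lemma exists_hasJump_edge (hΦ : IsRHPSolution q L Y S γs r x Φ) (h : IsPeriodicDirac L q Y)
    (hS : IsSpectralData q L Y S) (hγ : S.IsNearestZeroSign γs) {e : ℝ} (he : e ∈ S.bandEdges)
    (i j : Fin 2) : ∃ vL vR : ℂ,
      (∀ᶠ t in 𝓝[<] e, HasJump (fun z => comparison q L Y x Φ z i j) t vL) ∧
      (∀ᶠ t in 𝓝[>] e, HasJump (fun z => comparison q L Y x Φ z i j) t vR) ∧ vR ≠ 0 ∧
      (dirFun Y L e ≠ 0 → vR = Complex.I * vL) ∧ (dirFun Y L e = 0 → vR = -Complex.I * vL) := by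
  obtain ⟨ε, hε, A, B, hA, hB, hodd, heven⟩ :=
    SpectralData.count_near (IsSpectralData.finite_zeroSignSet h hS) hγ e
  rw [IsSpectralData.mem_zeroSignSet_iff h hS] at hodd heven
  have hAL : ∀ᶠ t in 𝓝[<] e, S.count γs t = A := by
    filter_upwards [Ioo_mem_nhdsLT (show e - ε < e by linarith)] with t ht using hA t ht
  have hBR : ∀ᶠ t in 𝓝[>] e, S.count γs t = B := by
    filter_upwards [Ioo_mem_nhdsGT (show e < e + ε by linarith)] with t ht using hB t ht
  have hZ : ∀ᶠ t : ℝ in 𝓝[≠] e, discSq Y L t ≠ 0 ∧ dirFun Y L t ≠ 0 :=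
    (IsPeriodicDirac.tendsto_ofReal_nhdsNE e).eventually
      ((h.eventually_discSq_ne_zero e).and (h.eventually_dirFun_ne_zero e))
  have hZL := hZ.filter_mono (nhdsWithin_mono (s := Iio e) _ fun t (ht : t < e) => ht.ne)
  have hZR := hZ.filter_mono (nhdsWithin_mono (s := Ioi e) _ fun t (ht : e < t) => ht.ne')
  have hpow : ∀ (n : ℤ) (c : ℕ), (-1 : ℂ) ^ (n + c : ℤ) = (-1) ^ n * (-1) ^ c := fun n c => by
    rw [zpow_add₀ (by norm_num), zpow_natCast]
  have hsq : ∀ c : ℕ, ((-1 : ℂ) ^ c) ^ 2 = 1 := fun c => by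
    rw [← pow_mul, mul_comm, pow_mul]; norm_num
  have hpar : (dirFun Y L e ≠ 0 → (-1 : ℂ) ^ B = (-1) ^ A) ∧
      (dirFun Y L e = 0 → (-1 : ℂ) ^ B = -(-1) ^ A) := by
    refine ⟨fun hD => by rw [heven fun hc => hD hc.2], fun hD => ?_⟩
    have h1 := (hodd ⟨he, hD⟩).neg_one_pow (α := ℂ)
    rw [pow_add] at h1
    linear_combination (-1 : ℂ) ^ A * h1 - (-1) ^ B * hsq A
  have hne : ∀ m : ℤ, (-1 : ℂ) ^ m ≠ 0 := fun m => zpow_ne_zero _ (by norm_num)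
  -- Left of gap number `n` lies band number `n`, right of it band number `n + 1`.
  obtain ⟨n, hn, rfl | rfl⟩ := he
  · refine ⟨(-1) ^ (n + A : ℤ), (-1) ^ (n + B : ℤ) * Complex.I, ?_, ?_,
      mul_ne_zero (hne _) Complex.I_ne_zero, fun hD => ?_, fun hD => ?_⟩
    · have hband : ∀ᶠ t in 𝓝[<] (S.E (2 * n - 1)), S.InBand n t := by
        by_cases hn1 : n - 1 ∈ S.labels
        · have h1 := hS.band_lt (n - 1) hn1 n hn (by omega)
          rw [show 2 * (n - 1) = 2 * n - 2 by ring] at h1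
          filter_upwards [Ioo_mem_nhdsLT h1] with t ht
          exact ⟨Or.inr hn, fun _ => ht.1, fun _ => ht.2⟩
        · filter_upwards [self_mem_nhdsWithin] with t ht
          exact ⟨Or.inr hn, fun hc => absurd hc hn1, fun _ => ht⟩
      filter_upwards [hband, hAL, hZL] with t h1 h2 h3
      rw [← h2]
      exact hΦ.hasJump_band h hS h1 h3.1 h3.2 i j
    · filter_upwards [Ioo_mem_nhdsGT (hS.gap_lt n hn), hBR, hZR] with t h1 h2 h3
      rw [← h2]
      exact hΦ.hasJump_gap h hS hn h1 h3.2 i j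
    · rw [hpow, hpow, hpar.1 hD]; ring
    · rw [hpow, hpow, hpar.2 hD]; ring
  · refine ⟨(-1) ^ (n + A : ℤ) * Complex.I, (-1) ^ (n + 1 + B : ℤ), ?_, ?_, hne _, fun hD => ?_,
      fun hD => ?_⟩
    · filter_upwards [Ioo_mem_nhdsLT (hS.gap_lt n hn), hAL, hZL] with t h1 h2 h3
      rw [← h2]
      exact hΦ.hasJump_gap h hS hn h1 h3.2 i j
    · have hband : ∀ᶠ t in 𝓝[>] (S.E (2 * n)), S.InBand (n + 1) t := by
        have e1 : 2 * (n + 1) - 2 = 2 * n := by ring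
        by_cases hn1 : n + 1 ∈ S.labels
        · filter_upwards [Ioo_mem_nhdsGT (hS.band_lt n hn (n + 1) hn1 (by omega))] with t ht
          exact ⟨Or.inr hn1, fun _ => by rw [e1]; exact ht.1, fun _ => ht.2⟩
        · filter_upwards [self_mem_nhdsWithin] with t ht
          exact ⟨Or.inl (by rwa [add_sub_cancel_right]), fun _ => by rw [e1]; exact ht,
            fun hc => absurd hc hn1⟩
      filter_upwards [hband, hBR, hZR] with t h1 h2 h3
      have := hΦ.hasJump_band h hS h1 h3.1 h3.2 i j
      rwa [h2] at this
    · rw [hpow, hpow, hpar.1 hD, zpow_add₀ (by norm_num), zpow_one]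
      linear_combination -((-1) ^ n * (-1) ^ A) * Complex.I_sq
    · rw [hpow, hpow, hpar.2 hD, zpow_add₀ (by norm_num), zpow_one]
      linear_combination ((-1) ^ n * (-1) ^ A) * Complex.I_sq

lemma isBigO_rpow_pow {f : ℂ → ℂ} {t : ℂ} {a : ℝ} {l : Filter ℂ}
    (hf : f =O[l] fun z => ‖z - t‖ ^ a) (n : ℕ) :
    (fun z => f z ^ n) =O[l] fun z => ‖z - t‖ ^ (a * n) := by
  refine (hf.pow n).congr_right fun z => ?_
  rw [Real.rpow_mul (norm_nonneg _), Real.rpow_natCast]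

/-- At a band edge the exponents of `|z - e|` in the bounds of the fourth power of `comparison`
(from `isBigO_of_hasJump`), of `Δ² - 1` and of `(f⁰)⁻²` add up to zero. -/
lemma comparisonQuartic_isBigO_edge (hΦ : IsRHPSolution q L Y S γs r x Φ)
    (h : IsPeriodicDirac L q Y) (hS : IsSpectralData q L Y S) (hγ : S.IsNearestZeroSign γs) {e : ℝ}
    (he : e ∈ S.bandEdges) (i j : Fin 2) :
    comparisonQuartic q L Y x Φ i j =O[𝓝[{z | z.im ≠ 0}] (e : ℂ)] fun _ => (1 : ℝ) := by
  have hle := nhdsWithin_im_ne_zero_le e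
  have h0 := IsSpectralData.edge_discSq h hS he
  have hne := IsSpectralData.edge_halfDiff h hS he
  have hre := IsSpectralData.edge_re_sq h hS he
  obtain ⟨vL, vR, hL, hR, hvR, hv1, hv2⟩ := hΦ.exists_hasJump_edge h hS hγ he i j
  have hAd : DifferentiableOn ℂ (fun z => comparison q L Y x Φ z i j) {z | z.im ≠ 0} :=
    fun z hz => (h.differentiableAt_comparison hΦ.holomorphic hz i j).differentiableWithinAt
  have hd1 : discSq Y L =O[𝓝[{z | z.im ≠ 0}] (e : ℂ)] fun z => ‖z - e‖ ^ (1 : ℝ) :=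
    (isBigO_sub_of_differentiableAt (h.differentiable_discSq _) h0).mono nhdsWithin_le_nhds
  have hΦe := hΦ.quarticRoot e he
  have hA : ∀ (κ a b : ℝ), (vR = Complex.exp (κ * (Real.pi / 2 * Complex.I)) * vL) →
      (∀ i j, (fun z => matN Y L (sRoot Y L z) z i j * (sRoot Y L z)⁻¹) =O[𝓝[≠] (e : ℂ)]
        fun z => ‖z - e‖ ^ b) → -(1 / 4) + b = a → -1 < a + κ / 4 →
      (fun z => comparison q L Y x Φ z i j) =O[𝓝[{z | z.im ≠ 0}] (e : ℂ)]
        fun z => ‖z - e‖ ^ (-(κ / 4)) := fun κ a b hv hN hab ha => by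
    refine isBigO_of_hasJump hAd hL hR hv hvR ha ?_
    refine (h.comparison_isBigO nhdsWithin_le_nhds hΦe
      (h.kernel_isBigO_of_re_sq_le hre.le hN) i j).congr' EventuallyEq.rfl ?_
    filter_upwards [eventually_mem_nhdsWithin.filter_mono hle] with z hz
    rw [← Real.rpow_add (norm_pos_iff.2 (sub_ne_zero.2 hz)), hab]
  -- If the edge is a Dirichlet eigenvalue, the jump turns by `-i` (`κ = -1`) and `f⁰` has a zero;
  -- otherwise it turns by `i` (`κ = 1`) and `f⁰` has none.
  by_cases hD : dirFun Y L e = 0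
  · obtain ⟨d, hd, hd'⟩ := h.fZero_hasDerivAt hD
      ((h.dirichletSign_eq_zero_iff hD).mpr hre.le)
    have hz0 := h.fZero_eq_zero_iff.mpr ⟨hD, (h.dirichletSign_eq_zero_iff hD).mpr hre.le⟩
    have hf := isBigO_rpow_pow ((isTheta_rpow_inv ((isTheta_of_hasDerivAt hd' hd hz0).trans
      (isTheta_sub_rpow _ _))).1.mono hle) 2
    have hA' := isBigO_rpow_pow (hA (-1) (-(1 / 4)) 0 (by
      rw [hv2 hD]
      simp [Complex.exp_neg, Complex.exp_pi_div_two_mul_I]) (fun i j =>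
      ((h.initial_isBigO_edge h0 hne i j).2 hD).2) (by norm_num) (by norm_num)) 4
    have := isBigO_rpow_mul hle hA' (isBigO_rpow_mul hle hd1 hf)
    rw [show -(-1 / 4 : ℝ) * (4 : ℕ) + (1 + -1 * (2 : ℕ)) = 0 by norm_num] at this
    exact isBigO_one_rpow.mp this
  · have hz0 : fZero q L Y e ≠ 0 := fun hc => hD (h.fZero_eq_zero_iff.mp hc).1
    have hf := isBigO_rpow_pow (t := e) (a := 0) (isBigO_one_rpow.mpr ((IsPeriodicDirac.inv_isBigO_one
      h.differentiable_fZero.continuous.continuousAt hz0).mono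
      (nhdsWithin_le_nhds (s := {z : ℂ | z.im ≠ 0})))) 2
    have hA' := isBigO_rpow_pow (hA 1 (-(3 / 4)) (-(1 / 2)) (by
      rw [hv1 hD]
      simp [Complex.exp_pi_div_two_mul_I]) (fun i j =>
      ((h.initial_isBigO_edge h0 hne i j).1 hD).2) (by norm_num) (by norm_num)) 4
    have := isBigO_rpow_mul hle hA' (isBigO_rpow_mul hle hd1 hf)
    rw [show -(1 / 4 : ℝ) * (4 : ℕ) + (1 + 0 * (2 : ℕ)) = 0 by norm_num] at this
    exact isBigO_one_rpow.mp this

/-- At a closed gap the double zero of `Δ² - 1` cancels the square of the simple zero of `f⁰`. -/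
lemma comparisonQuartic_isBigO_band (hΦ : IsRHPSolution q L Y S γs r x Φ)
    (h : IsPeriodicDirac L q Y) (hS : IsSpectralData q L Y S) {n : ℤ} {t : ℝ}
    (ht : S.InBand n t) (hte : t ∉ S.bandEdges) (h0 : discSq Y L t = 0) (i j : Fin 2) :
    comparisonQuartic q L Y x Φ i j =O[𝓝[{z | z.im ≠ 0}] (t : ℂ)] fun _ => (1 : ℝ) := by
  have hle := nhdsWithin_im_ne_zero_le t
  have hre := IsSpectralData.InBand.re_sq_le h hS ht
  have h1 := IsSpectralData.InBand.halfDiff_eq_zero h hS ht h0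
  obtain ⟨-, -, hD⟩ := h.monodromy_of_halfDiff_eq_zero h0 h1
  have hσ := (h.dirichletSign_eq_zero_iff hD).mpr hre
  obtain ⟨d, hd, hd'⟩ := h.fZero_hasDerivAt hD hσ
  have hf := isBigO_rpow_pow ((isTheta_rpow_inv ((isTheta_of_hasDerivAt hd' hd
    (h.fZero_eq_zero_iff.mpr ⟨hD, hσ⟩)).trans (isTheta_sub_rpow _ _))).1.mono hle) 2
  have hA := h.comparison_isBigO (x := x) nhdsWithin_le_nhds
    (hΦ.isBigO_one_of_notMem_bandEdges hte) (h.kernel_isBigO_of_re_sq_le hre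
      fun i j => (h.initial_isBigO_band (Or.inr ⟨h0, h1⟩) i j).2) i j
  simp only [one_mul] at hA
  have hA' := isBigO_rpow_pow hA 4
  have := isBigO_rpow_mul hle hA' (isBigO_rpow_mul hle
    ((h.discSq_isTheta_collapsed h0 h1).1.mono hle) hf)
  rw [show (0 : ℝ) * (4 : ℕ) + (2 + -1 * (2 : ℕ)) = 0 by norm_num] at this
  exact isBigO_one_rpow.mp this

/-- At a Dirichlet eigenvalue inside a gap `f⁰` does not vanish, and `comparison` is bounded. -/
lemma comparisonQuartic_isBigO_gap (hΦ : IsRHPSolution q L Y S γs r x Φ)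
    (h : IsPeriodicDirac L q Y) {t : ℝ} (ht : 1 < (mA Y L t).re ^ 2) (hte : t ∉ S.bandEdges)
    (hD : dirFun Y L t = 0) (i j : Fin 2) :
    comparisonQuartic q L Y x Φ i j =O[𝓝[{z | z.im ≠ 0}] (t : ℂ)] fun _ => (1 : ℝ) := by
  have hz0 : fZero q L Y t ≠ 0 := fun hc => absurd
    ((h.dirichletSign_eq_zero_iff hD).mp (h.fZero_eq_zero_iff.mp hc).2) (not_le.mpr ht)
  have hf := ((IsPeriodicDirac.inv_isBigO_one h.differentiable_fZero.continuous.continuousAt hz0).mono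
      (nhdsWithin_le_nhds (s := {z : ℂ | z.im ≠ 0}))).pow 2
  have hd := ((h.differentiable_discSq.continuous.tendsto (t : ℂ)).isBigO_one ℝ).mono
    (nhdsWithin_le_nhds (s := {z : ℂ | z.im ≠ 0}))
  have hA := (h.comparison_isBigO (x := x) nhdsWithin_le_nhds
    (hΦ.isBigO_one_of_notMem_bandEdges hte) (h.kernel_isBigO_of_gap ht hD) i j).pow 4
  have := hA.mul (hd.mul hf)
  simp only [one_pow, mul_one] at this
  exact this

/-- The fourth powers of the entries of `comparison`, suitably normalized, extend to entire
functions. -/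
lemma exists_entire_comparisonQuartic (hΦ : IsRHPSolution q L Y S γs r x Φ)
    (h : IsPeriodicDirac L q Y) (hS : IsSpectralData q L Y S) (hγ : S.IsNearestZeroSign γs)
    (i j : Fin 2) : ∃ T : ℂ → ℂ, Differentiable ℂ T ∧
      ∀ z : ℂ, z.im ≠ 0 → T z = comparisonQuartic q L Y x Φ i j z := by
  have hext := exists_extension (U := univ) (T := comparisonQuartic q L Y x Φ i j)
    (Z := {t : ℝ | discSq Y L t = 0 ∨ dirFun Y L t = 0}) isOpen_univ (by
      rw [Set.univ_inter]; exact h.differentiableOn_comparisonQuartic hΦ.holomorphic i j)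
    (fun t _ => by
      filter_upwards [(IsPeriodicDirac.tendsto_ofReal_nhdsNE t).eventually
        ((h.eventually_discSq_ne_zero t).and (h.eventually_dirFun_ne_zero t))] with t' ht' hc
      exact hc.elim ht'.1 ht'.2)
    (fun t _ ht => by
      rw [Set.mem_ofPred_eq, not_or] at ht
      have hte : t ∉ S.bandEdges := fun hc => ht.1 (IsSpectralData.edge_discSq h hS hc)
      have hz0 : fZero q L Y t ≠ 0 := fun hc => ht.2 (h.fZero_eq_zero_iff.mp hc).1
      -- The jump factors are fourth roots of unity, so the fourth powers have none.
      have hjump : ∃ v : ℂ, v ^ 4 = 1 ∧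
          HasJump (fun z => comparison q L Y x Φ z i j) t v := by
        have h4 : ∀ m : ℤ, ((-1 : ℂ) ^ m) ^ 4 = 1 := fun m => by
          rw [← zpow_natCast, ← zpow_mul, mul_comm, zpow_mul]; norm_num
        rcases IsSpectralData.inBand_or_gap h hS hte with ⟨k, hk, hm⟩ | ⟨n, hn⟩
        · exact ⟨_, by rw [mul_pow, h4, Complex.I_pow_four, one_mul],
            hΦ.hasJump_gap h hS hk hm ht.2 i j⟩
        · exact ⟨_, h4 _, hΦ.hasJump_band h hS hn ht.1 ht.2 i j⟩
      obtain ⟨v, hv, l, hp, hm⟩ := hjump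
      have hc : ContinuousAt (fun z => discSq Y L z * (fZero q L Y z)⁻¹ ^ 2) (t : ℂ) :=
        h.differentiable_discSq.continuous.continuousAt.mul
          ((h.differentiable_fZero.continuous.continuousAt.inv₀ hz0).pow 2)
      have k1 := (hp.pow 4).mul (hc.tendsto.mono_left (nhdsWithin_le_nhds (s := {z : ℂ | 0 < z.im})))
      have k2 := (hm.pow 4).mul (hc.tendsto.mono_left (nhdsWithin_le_nhds (s := {z : ℂ | z.im < 0})))
      rw [mul_pow, hv, one_mul] at k1
      exact ⟨_, tendsto_nhdsWithin_im_ne_zero k1 k2⟩)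
    (fun t _ ht => by
      have hO : comparisonQuartic q L Y x Φ i j =O[𝓝[{z | z.im ≠ 0}] (t : ℂ)]
          fun _ => (1 : ℝ) := by
        by_cases hte : t ∈ S.bandEdges
        · exact hΦ.comparisonQuartic_isBigO_edge h hS hγ hte i j
        rcases IsSpectralData.inBand_or_gap h hS hte with ⟨k, hk, hm⟩ | ⟨n, hn⟩
        · have hgt := IsSpectralData.mem_gap h hS hk hm
          exact hΦ.comparisonQuartic_isBigO_gap h hgt hte (ht.resolve_left fun hc =>
            hgt.ne' ((h.discSq_real_eq_zero_iff t).mp hc)) i j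
        · have h0 : discSq Y L t = 0 := by
            by_contra hc
            exact (h.dirFun_ne_zero_of_band (lt_of_le_of_ne
              (IsSpectralData.InBand.re_sq_le h hS hn) fun h1 =>
                hc ((h.discSq_real_eq_zero_iff t).mpr h1))) (ht.resolve_left hc)
          exact hΦ.comparisonQuartic_isBigO_band h hS hn hte h0 i j
      have h1 : Tendsto (fun z : ℂ => z - (t : ℂ)) (𝓝[{z | z.im ≠ 0}] (t : ℂ)) (𝓝 0) := by
        have : Tendsto (fun z : ℂ => z - (t : ℂ)) (𝓝 (t : ℂ)) (𝓝 ((t : ℂ) - t)) :=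
          (continuous_id.sub continuous_const).tendsto _
        rw [sub_self] at this
        exact this.mono_left nhdsWithin_le_nhds
      have h2 := ((isLittleO_one_iff ℝ).mpr h1).mul_isBigO hO
      rw [mul_one] at h2
      exact (isLittleO_one_iff ℝ).mp h2)
  obtain ⟨T, hT, hT'⟩ := hext
  exact ⟨T, differentiableOn_univ.mp hT, fun z hz => hT' z (mem_univ z) hz⟩

end IsRHPSolution

/-! ### Growth of the comparison functions -/

/-- `f` has at most Gaussian growth on the set `D`. -/
def HasGaussianGrowth (D : Set ℂ) (f : ℂ → ℂ) : Prop :=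
  ∃ C, 0 ≤ C ∧ ∀ z ∈ D, ‖f z‖ ≤ Real.exp (C * (1 + ‖z‖ ^ 2))

namespace HasGaussianGrowth

variable {D : Set ℂ} {f g : ℂ → ℂ}

lemma mul (hf : HasGaussianGrowth D f) (hg : HasGaussianGrowth D g) :
    HasGaussianGrowth D fun z => f z * g z := by
  obtain ⟨C₁, h1, b1⟩ := hf
  obtain ⟨C₂, h2, b2⟩ := hg
  refine ⟨C₁ + C₂, by positivity, fun z hz => ?_⟩
  rw [norm_mul, add_mul, Real.exp_add]
  exact mul_le_mul (b1 z hz) (b2 z hz) (norm_nonneg _) (Real.exp_nonneg _)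

lemma add (hf : HasGaussianGrowth D f) (hg : HasGaussianGrowth D g) :
    HasGaussianGrowth D fun z => f z + g z := by
  obtain ⟨C₁, h1, b1⟩ := hf
  obtain ⟨C₂, h2, b2⟩ := hg
  refine ⟨C₁ + C₂ + 1, by positivity, fun z hz => ?_⟩
  have e1 : Real.exp (C₁ * (1 + ‖z‖ ^ 2)) ≤ Real.exp ((C₁ + C₂) * (1 + ‖z‖ ^ 2)) :=
    Real.exp_le_exp.mpr (by nlinarith [mul_nonneg h2 (sq_nonneg ‖z‖)])
  have e2 : Real.exp (C₂ * (1 + ‖z‖ ^ 2)) ≤ Real.exp ((C₁ + C₂) * (1 + ‖z‖ ^ 2)) :=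
    Real.exp_le_exp.mpr (by nlinarith [mul_nonneg h1 (sq_nonneg ‖z‖)])
  have e3 : 2 ≤ Real.exp (1 * (1 + ‖z‖ ^ 2)) := by
    have := Real.add_one_le_exp (1 * (1 + ‖z‖ ^ 2))
    nlinarith [sq_nonneg ‖z‖]
  rw [add_mul (C₁ + C₂), Real.exp_add]
  have h3 := norm_add_le (f z) (g z)
  nlinarith [b1 z hz, b2 z hz, Real.exp_pos ((C₁ + C₂) * (1 + ‖z‖ ^ 2))]

lemma of_norm_le (hg : HasGaussianGrowth D g) (h : ∀ z ∈ D, ‖f z‖ ≤ ‖g z‖) :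
    HasGaussianGrowth D f := by
  obtain ⟨C, hC, b⟩ := hg
  exact ⟨C, hC, fun z hz => (h z hz).trans (b z hz)⟩

lemma neg (hf : HasGaussianGrowth D f) : HasGaussianGrowth D fun z => -f z :=
  hf.of_norm_le fun z _ => (norm_neg (f z)).le

lemma sub (hf : HasGaussianGrowth D f) (hg : HasGaussianGrowth D g) :
    HasGaussianGrowth D fun z => f z - g z := by
  simpa only [sub_eq_add_neg] using hf.add hg.neg

lemma const (c : ℂ) : HasGaussianGrowth D fun _ => c := by
  refine ⟨‖c‖, norm_nonneg _, fun z _ => ?_⟩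
  have := Real.add_one_le_exp (‖c‖ * (1 + ‖z‖ ^ 2))
  nlinarith [mul_nonneg (norm_nonneg c) (sq_nonneg ‖z‖)]

lemma pow (hf : HasGaussianGrowth D f) (n : ℕ) : HasGaussianGrowth D fun z => f z ^ n := by
  induction n with
  | zero => simpa using const (D := D) 1
  | succ n ih => simpa only [pow_succ] using ih.mul hf

lemma matrix_mul {M N : ℂ → Mat2} (hM : ∀ i j, HasGaussianGrowth D fun z => M z i j)
    (hN : ∀ i j, HasGaussianGrowth D fun z => N z i j) (i j : Fin 2) :
    HasGaussianGrowth D fun z => (M z * N z) i j := by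
  simp only [Matrix.mul_apply, Fin.sum_univ_two]
  exact ((hM i 0).mul (hN 0 j)).add ((hM i 1).mul (hN 1 j))

/-- Exponential type is Gaussian growth. -/
lemma of_exp {a b : ℝ} (ha : 0 ≤ a) (hb : 0 ≤ b)
    (h : ∀ z ∈ D, ‖f z‖ ≤ Real.exp ((‖z‖ + b) * a)) : HasGaussianGrowth D f := by
  refine ⟨(1 + b) * a, by positivity, fun z hz => (h z hz).trans (Real.exp_le_exp.mpr ?_)⟩
  have h1 : ‖z‖ + b ≤ (1 + b) * (1 + ‖z‖ ^ 2) := by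
    nlinarith [sq_nonneg (‖z‖ - 1), mul_nonneg hb (sq_nonneg ‖z‖)]
  nlinarith

lemma expSigma3_apply (x : ℝ) (i j : Fin 2) :
    HasGaussianGrowth D fun z => expSigma3 (-(Complex.I * z * x)) i j := by
  have h1 : ∀ w : ℂ → ℂ, (∀ z, ‖w z‖ ≤ ‖z‖ * |x|) → HasGaussianGrowth D fun z => Complex.exp (w z) :=
    fun w hw => of_exp (abs_nonneg x) le_rfl fun z _ =>
      (Complex.norm_exp_le_exp_norm _).trans (Real.exp_le_exp.mpr (by simpa using hw z))
  obtain rfl | rfl : i = 0 ∨ i = 1 := by omega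
  · obtain rfl | rfl : j = 0 ∨ j = 1 := by omega
    · exact h1 _ fun z => by simp
    · exact const 0
  · obtain rfl | rfl : j = 0 ∨ j = 1 := by omega
    · exact const 0
    · exact h1 _ fun z => by simp

end HasGaussianGrowth

namespace IsPeriodicDirac

variable {L : ℝ} {q : ℝ → ℂ} {Y : ℝ → ℂ → Mat2} {D : Set ℂ}

lemma gaussian_entry (h : IsPeriodicDirac L q Y) (x : ℝ) (i j : Fin 2) :
    HasGaussianGrowth D fun z => Y x z i j := by
  obtain ⟨K, hK0, hK⟩ := h.exists_bound
  exact HasGaussianGrowth.of_exp (abs_nonneg x) hK0 fun z _ => h.sol.norm_le hK x z i j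

lemma gaussian_adjugate (h : IsPeriodicDirac L q Y) (x : ℝ) (i j : Fin 2) :
    HasGaussianGrowth D fun z => (Y x z).adjugate i j := by
  simp only [Matrix.adjugate_fin_two]
  obtain rfl | rfl : i = 0 ∨ i = 1 := by omega
  · obtain rfl | rfl : j = 0 ∨ j = 1 := by omega
    · exact h.gaussian_entry x 1 1
    · exact (h.gaussian_entry x 0 1).neg
  · obtain rfl | rfl : j = 0 ∨ j = 1 := by omega
    · exact (h.gaussian_entry x 1 0).neg
    · exact h.gaussian_entry x 0 0

lemma gaussian_matN (h : IsPeriodicDirac L q Y) (i j : Fin 2) :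
    HasGaussianGrowth D fun z => matN Y L (sRoot Y L z) z i j := by
  have hα : HasGaussianGrowth D (halfDiff Y L) :=
    (((h.gaussian_entry L 0 0).sub (h.gaussian_entry L 1 1)).mul
      (HasGaussianGrowth.const (2⁻¹))).of_norm_le fun z _ => by
        rw [halfDiff, mA, mD, div_eq_mul_inv]
  have hb : HasGaussianGrowth D (mB Y L) := h.gaussian_entry L 0 1
  have hc : HasGaussianGrowth D (mC Y L) := h.gaussian_entry L 1 0
  have hd : HasGaussianGrowth D (discSq Y L) := by
    have h1 : HasGaussianGrowth D fun z => (Y L z 0 0 + Y L z 1 1) * 2⁻¹ :=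
      ((h.gaussian_entry L 0 0).add (h.gaussian_entry L 1 1)).mul (HasGaussianGrowth.const (2⁻¹))
    exact ((h1.pow 2).sub (HasGaussianGrowth.const 1)).of_norm_le fun z _ => by
      rw [discSq, discriminant_eq, mA, mD, div_eq_mul_inv]
  -- The root `s` satisfies `|s|² = |Δ² - 1|`.
  have hs : HasGaussianGrowth D (sRoot Y L) := by
    obtain ⟨C, hC, hb⟩ := hd
    refine ⟨C, hC, fun z hz => ?_⟩
    have h1 := hb z hz
    have h2 : 1 ≤ Real.exp (C * (1 + ‖z‖ ^ 2)) := Real.one_le_exp (by positivity)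
    rw [← sRoot_sq, norm_pow] at h1
    by_contra! hcon
    nlinarith [norm_nonneg (sRoot Y L z)]
  obtain rfl | rfl : i = 0 ∨ i = 1 := by omega
  · obtain rfl | rfl : j = 0 ∨ j = 1 := by omega
    · exact (hα.add hs).add hc
    · exact (hb.sub hα).add hs
  · obtain rfl | rfl : j = 0 ∨ j = 1 := by omega
    · exact (hc.neg.sub hα).add hs
    · exact (hα.sub hb).add hs

lemma gaussian_dirichletProduct (h : IsPeriodicDirac L q Y) (σ : SignType) :
    HasGaussianGrowth D (dirichletProduct q L Y σ) := by
  obtain ⟨C, hC, hb⟩ := h.exists_norm_dirichletProduct_le σ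
  exact ⟨C, hC, fun z _ => (hb z).trans (Real.exp_le_exp.mpr (by nlinarith))⟩

/-- Multiplication by the two products removes the poles of the inverse of the diagonal factor. -/
lemma gaussian_diagBInv (h : IsPeriodicDirac L q Y) (hD : ∀ z ∈ D, z.im ≠ 0) (i j : Fin 2) :
    HasGaussianGrowth D fun z =>
      dirichletProduct q L Y 1 z * dirichletProduct q L Y (-1) z * diagBInv q L Y z i j := by
  obtain ⟨C₁, h1, b1⟩ := h.gaussian_dirichletProduct (D := D) 1
  obtain ⟨C₂, h2, b2⟩ := h.gaussian_dirichletProduct (D := D) (-1)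
  refine ⟨C₁ + C₂, by positivity, fun z hz => ?_⟩
  have hp := IsSpectralData.dirichletProduct_ne_zero_of_im h 1 (hD z hz)
  have hm := IsSpectralData.dirichletProduct_ne_zero_of_im h (-1) (hD z hz)
  have hp' : ‖dirichletProduct q L Y 1 z‖ ≤ Real.exp ((C₁ + C₂) * (1 + ‖z‖ ^ 2)) :=
    (b1 z hz).trans (Real.exp_le_exp.mpr (by nlinarith [mul_nonneg h2 (sq_nonneg ‖z‖)]))
  have hm' : ‖dirichletProduct q L Y (-1) z‖ ≤ Real.exp ((C₁ + C₂) * (1 + ‖z‖ ^ 2)) :=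
    (b2 z hz).trans (Real.exp_le_exp.mpr (by nlinarith [mul_nonneg h1 (sq_nonneg ‖z‖)]))
  have h0 := Real.exp_nonneg ((C₁ + C₂) * (1 + ‖z‖ ^ 2))
  have e1 : ∀ a b : ℂ, b ≠ 0 → a * b * b⁻¹ = a := fun a b hb => mul_inv_cancel_right₀ hb a
  have e2 : ∀ a b : ℂ, a ≠ 0 → a * b * a⁻¹ = b := fun a b ha => by
    rw [mul_comm a b]; exact mul_inv_cancel_right₀ ha b
  unfold diagBInv
  beta_reduce
  obtain rfl | rfl : i = 0 ∨ i = 1 := by omega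
  · obtain rfl | rfl : j = 0 ∨ j = 1 := by omega
    · split_ifs <;> simp only [Matrix.of_apply, Matrix.cons_val', Matrix.cons_val_zero,
        Matrix.cons_val_fin_one, e1 _ _ hm, e2 _ _ hp] <;> assumption
    · split_ifs <;> simpa using h0
  · obtain rfl | rfl : j = 0 ∨ j = 1 := by omega
    · split_ifs <;> simpa using h0
    · split_ifs <;> simp only [Matrix.of_apply, Matrix.cons_val', Matrix.cons_val_one,
        Matrix.cons_val_fin_one, e1 _ _ hm, e2 _ _ hp] <;> assumption

lemma gaussian_comparison (h : IsPeriodicDirac L q Y) (hD : ∀ z ∈ D, z.im ≠ 0) {Φ : ℂ → Mat2}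
    (hΦ : ∀ i j, HasGaussianGrowth D fun z => Φ z i j) (x : ℝ) (i j : Fin 2) :
    HasGaussianGrowth D fun z => comparison q L Y x Φ z i j *
      (sRoot Y L z * (dirichletProduct q L Y 1 z * dirichletProduct q L Y (-1) z)) := by
  have hK : ∀ i j, HasGaussianGrowth D fun z => ((1 / 2 : ℂ) •
      (((dirichletProduct q L Y 1 z * dirichletProduct q L Y (-1) z) • diagBInv q L Y z) *
        matN Y L (sRoot Y L z) z)) i j := fun i j =>
    (HasGaussianGrowth.const (1 / 2)).mul (HasGaussianGrowth.matrix_mul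
      (h.gaussian_diagBInv hD) h.gaussian_matN i j)
  have h1 := HasGaussianGrowth.matrix_mul (HasGaussianGrowth.matrix_mul
    (HasGaussianGrowth.matrix_mul (HasGaussianGrowth.matrix_mul
      (M := fun _ => (1 / 2 : ℂ) • U.conjTranspose) (fun i j => HasGaussianGrowth.const _) hΦ)
      (HasGaussianGrowth.expSigma3_apply x)) hK) (h.gaussian_adjugate x) i j
  refine h1.of_norm_le fun z hz => le_of_eq ?_
  have hs := h.sRoot_ne_zero (hD z hz)
  congr 1
  rw [comparison_eq]
  generalize (1 / 2 : ℂ) • U.conjTranspose = C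
  set p := dirichletProduct q L Y 1 z * dirichletProduct q L Y (-1) z
  have e : ((1 / 2 : ℂ) • ((p • diagBInv q L Y z) * matN Y L (sRoot Y L z) z)) =
      (sRoot Y L z * p) • ((1 / 2 : ℂ) • (diagBInv q L Y z *
        ((sRoot Y L z)⁻¹ • matN Y L (sRoot Y L z) z))) := by
    rw [Matrix.smul_mul, Matrix.mul_smul, smul_smul, smul_smul, smul_smul]
    congr 1
    field_simp
  rw [e]
  generalize ((1 / 2 : ℂ) • (diagBInv q L Y z *
    ((sRoot Y L z)⁻¹ • matN Y L (sRoot Y L z) z))) = X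
  rw [Matrix.mul_smul, Matrix.smul_mul, Matrix.smul_apply, smul_eq_mul, mul_comm]

end IsPeriodicDirac

namespace SpectralData.AdmissibleRadii

variable {L : ℝ} {q : ℝ → ℂ} {Y : ℝ → ℂ → Mat2} {S : SpectralData} {r : ℤ → ℝ}

/-- The discs are locally finite, so that unions of them are closed. -/
lemma isOpen_notMem_closedBall (hr : S.AdmissibleRadii r) (h : IsPeriodicDirac L q Y)
    (hS : IsSpectralData q L Y S) {J : Set ℤ} (hJ : J ⊆ S.labels) :
    IsOpen {w : ℂ | ∀ j ∈ J, w ∉ Metric.closedBall (S.center j : ℂ) (r j)} := by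
  obtain ⟨R, hR⟩ := hr.upper
  rw [isOpen_iff_mem_nhds]
  intro w hw
  set ρ := ‖w‖ + 1 + R with hρ
  have hfin : {j ∈ J | |S.center j| ≤ ρ}.Finite := by
    refine (IsSpectralData.finite_labels h hS (-ρ) (ρ + R)).subset fun j hj => ?_
    have h1 := hr.gap_le j (hJ hj.1)
    have h2 := hR j (hJ hj.1)
    have h3 := hS.gap_lt j (hJ hj.1)
    have h4 := abs_le.mp hj.2
    have h5 : S.center j = (S.E (2 * j - 1) + S.E (2 * j)) / 2 := rfl
    exact ⟨hJ hj.1, by linarith, by linarith⟩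
  have h1 : (⋂ j ∈ {j ∈ J | |S.center j| ≤ ρ}, (Metric.closedBall (S.center j : ℂ) (r j))ᶜ) ∈ 𝓝 w :=
    (Filter.biInter_mem hfin).mpr fun j hj =>
      Metric.isClosed_closedBall.isOpen_compl.mem_nhds (hw j hj.1)
  filter_upwards [h1, Metric.ball_mem_nhds w one_pos] with w' hw' hb j hj
  by_cases hjρ : |S.center j| ≤ ρ
  · exact Set.mem_iInter₂.mp hw' j ⟨hj, hjρ⟩
  · intro hc
    rw [mem_closedBall_iff_norm] at hc
    rw [mem_ball_iff_norm] at hb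
    have h2 := hR j (hJ hj)
    have h3 := norm_le_norm_add_norm_sub' (S.center j : ℂ) w'
    have h4 := norm_le_norm_add_norm_sub' w' w
    rw [Complex.norm_real, Real.norm_eq_abs, norm_sub_rev] at h3
    linarith

/-- Gaussian growth on the domain outside the discs implies Gaussian growth: far out, the maximum
principle applies to each disc separately. -/
lemma gaussian_univ (hr : S.AdmissibleRadii r) (h : IsPeriodicDirac L q Y)
    (hS : IsSpectralData q L Y S) {G : ℂ → ℂ} (hG : Differentiable ℂ G)
    (hgr : HasGaussianGrowth (S.growthDomain r) G) : HasGaussianGrowth univ G := by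
  obtain ⟨C, hC, hb⟩ := hgr
  obtain ⟨R, hR⟩ := hr.upper
  obtain ⟨c, hc, hcr⟩ := hr.lower
  obtain ⟨N, hN⟩ := hr.disjoint
  have hR0 : 0 < R := hc.trans_le ((hcr 0 hS.zero_mem).trans (hR 0 hS.zero_mem))
  have hg : Continuous fun w : ℂ => Real.exp (C * (1 + ‖w‖ ^ 2)) := by fun_prop
  have hout : ∀ w : ℂ, (∀ j ∈ S.labels, w ∉ Metric.closedBall (S.center j : ℂ) (r j)) →
      ‖G w‖ ≤ Real.exp (C * (1 + ‖w‖ ^ 2)) := fun w hw => by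
    refine norm_le_of_im_ne_zero hG.continuous.continuousAt hg.continuousAt ?_
    filter_upwards [(hr.isOpen_notMem_closedBall h hS subset_rfl).mem_nhds hw] with w' hw' hi
    exact hb w' ⟨hi, hw'⟩
  -- A point of the circle is approached from outside along its ray.
  have hsph : ∀ k ∈ S.labels, ∀ w ∈ Metric.sphere (S.center k : ℂ) (r k),
      (∀ j ∈ S.labels, j ≠ k → w ∉ Metric.closedBall (S.center j : ℂ) (r j)) →
      ‖G w‖ ≤ Real.exp (C * (1 + ‖w‖ ^ 2)) := fun k hk w hw hwj => by
    rw [mem_sphere_iff_norm] at hw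
    set p : ℝ → ℂ := fun ε => S.center k + (1 + ε) * (w - S.center k)
    have hp : Continuous p := by fun_prop
    have hp0 : p 0 = w := by simp [p]
    have hlim : Tendsto p (𝓝[>] 0) (𝓝 w) := by
      have := hp.tendsto 0
      rw [hp0] at this
      exact this.mono_left nhdsWithin_le_nhds
    refine le_of_tendsto_of_tendsto ((hG.continuous.norm.tendsto w).comp hlim)
      ((hg.tendsto w).comp hlim) ?_
    have hO := (hr.isOpen_notMem_closedBall h hS (sdiff_subset (s := S.labels) (t := {k}))).mem_nhds
      (show w ∈ _ from fun j hj => hwj j hj.1 hj.2)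
    filter_upwards [hlim hO, self_mem_nhdsWithin] with ε hε hε0
    refine hout _ fun j hj => ?_
    by_cases hjk : j = k
    · rw [hjk, mem_closedBall_iff_norm]
      have hε0' : 0 < ε := hε0
      have e1 : p ε - S.center k = ((1 + ε : ℝ) : ℂ) * (w - S.center k) := by
        simp [p]
      rw [e1, norm_mul, hw, Complex.norm_of_nonneg (by linarith)]
      have := hcr k hk
      nlinarith
    · exact hε j ⟨hj, hjk⟩
  obtain ⟨ρ, hρ⟩ : ∃ ρ, ∀ j ∈ Icc (-N) N, |S.center j| + r j ≤ ρ := by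
    obtain ⟨ρ, hρ⟩ := ((Set.finite_Icc (-N) N).image fun j => |S.center j| + r j).bddAbove
    exact ⟨ρ, fun j hj => hρ (mem_image_of_mem _ hj)⟩
  have hnear : ∀ j, |j| ≤ N → ∀ w ∈ Metric.closedBall (S.center j : ℂ) (r j), ‖w‖ ≤ ρ :=
    fun j hj w hw => by
      rw [mem_closedBall_iff_norm] at hw
      have h1 := hρ j (abs_le.mp hj)
      have h2 := norm_le_norm_add_norm_sub' w (S.center j : ℂ)
      rw [Complex.norm_real, Real.norm_eq_abs] at h2
      linarith
  obtain ⟨B, hB⟩ := (isCompact_closedBall (0 : ℂ) (ρ + 2 * R)).exists_bound_of_continuousOn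
    hG.continuous.continuousOn
  -- For `|w| ≤ |z| + 2 R` the bound at `w` is one at `z`, as `(|z| + 2 R)² ≤ 2 |z|² + 8 R²`.
  refine ⟨C * (2 + 8 * R ^ 2) + |B|, by positivity, fun z _ => ?_⟩
  have hmono : ∀ a : ℝ, a ≤ C * (2 + 8 * R ^ 2) * (1 + ‖z‖ ^ 2) →
      Real.exp a ≤ Real.exp ((C * (2 + 8 * R ^ 2) + |B|) * (1 + ‖z‖ ^ 2)) := fun a ha =>
    Real.exp_le_exp.mpr (by
      have : 0 ≤ |B| * (1 + ‖z‖ ^ 2) := by positivity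
      linarith)
  rcases le_or_gt ‖z‖ (ρ + 2 * R) with hz | hz
  · refine (hB z (mem_closedBall_zero_iff.mpr hz)).trans ?_
    refine le_trans ?_ (Real.add_one_le_exp _)
    have h1 : 0 ≤ C * (2 + 8 * R ^ 2) * (1 + ‖z‖ ^ 2) := by positivity
    have h2 : 0 ≤ |B| * ‖z‖ ^ 2 := by positivity
    nlinarith [le_abs_self B]
  -- Far out the only discs are those with `|k| > N`, which are pairwise disjoint.
  by_cases hzk : ∃ k ∈ S.labels, z ∈ Metric.closedBall (S.center k : ℂ) (r k)
  · obtain ⟨k, hk, hzk⟩ := hzk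
    have hkN : N < |k| := by
      by_contra! hcon
      have := hnear k hcon z hzk
      linarith
    have hrk := hR k hk
    have hdist : ∀ w ∈ Metric.sphere (S.center k : ℂ) (r k), ‖z - w‖ ≤ 2 * R := fun w hw => by
      rw [mem_closedBall_iff_norm] at hzk
      rw [mem_sphere_iff_norm] at hw
      have := norm_sub_le_norm_sub_add_norm_sub z (S.center k : ℂ) w
      rw [norm_sub_rev (S.center k : ℂ) w] at this
      linarith
    refine (norm_le_of_forall_mem_sphere (r := r k) hG.differentiableOn
      (hc.trans_le (hcr k hk)).ne' (fun w hw => ?_) hzk).trans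
      (hmono (C * (1 + (‖z‖ + 2 * R) ^ 2)) ?_)
    · have hd := hdist w hw
      have h1 := norm_le_norm_add_norm_sub' z w
      have h2 := norm_le_norm_add_norm_sub' w z
      rw [norm_sub_rev] at h2
      refine (hsph k hk w hw fun j hj hjk hwj => ?_).trans (Real.exp_le_exp.mpr (by gcongr; linarith))
      rcases le_or_gt |j| N with hjN | hjN
      · have := hnear j hjN w hwj
        linarith
      · exact Set.disjoint_left.mp (hN j hj k hk hjk hjN hkN) hwj (Metric.sphere_subset_closedBall hw)
    · rw [mul_assoc]
      refine mul_le_mul_of_nonneg_left ?_ hC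
      nlinarith [sq_nonneg (‖z‖ - 2 * R), sq_nonneg (R * ‖z‖)]
  · push Not at hzk
    refine (hout z hzk).trans (hmono _ ?_)
    rw [mul_assoc]
    refine mul_le_mul_of_nonneg_left ?_ hC
    nlinarith [sq_nonneg (R * ‖z‖), sq_nonneg R, sq_nonneg ‖z‖]

end SpectralData.AdmissibleRadii

/-! ### Boundedness from sectors -/

/-- Phragmén–Lindelöf in the sector `|arg z| ≤ π / 8`. -/
lemma norm_le_of_sector {f : ℂ → ℂ} (hf : Differentiable ℂ f) {K : ℝ}
    (hgr : ∀ z, ‖f z‖ ≤ Real.exp (K * (1 + ‖z‖) ^ 3)) (hK : 0 ≤ K) {M : ℝ}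
    (hM : ∀ z : ℂ, Real.sin (Real.pi / 8) * ‖z‖ ≤ |z.im| → ‖f z‖ ≤ M) {z : ℂ} (hz : 0 < z.re) :
    ‖f z‖ ≤ M := by
  have hpi := Real.pi_pos
  have hs0 : 0 < Real.sin (Real.pi / 8) := Real.sin_pos_of_pos_of_lt_pi (by linarith) (by linarith)
  by_cases hzs : Real.sin (Real.pi / 8) * ‖z‖ ≤ |z.im|
  · exact hM z hzs
  push Not at hzs
  have hz0 : z ≠ 0 := fun hc => by simp [hc] at hz
  have hzn : 0 < ‖z‖ := norm_pos_iff.mpr hz0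
  have hedge : ∀ w : ℂ, |Real.sin w.im| = Real.sin (Real.pi / 8) → ‖f (Complex.exp w)‖ ≤ M :=
    fun w hw => hM _ (by
      rw [Complex.norm_exp, Complex.exp_im, abs_mul, hw, abs_of_pos (Real.exp_pos _), mul_comm])
  have hlog : |(Complex.log z).im| ≤ Real.pi / 8 := by
    rw [Complex.log_im, Complex.arg_of_re_nonneg hz.le]
    have h1 : |z.im / ‖z‖| ≤ Real.sin (Real.pi / 8) := by
      rw [abs_div, abs_of_pos hzn, div_le_iff₀ hzn]; exact hzs.le
    rw [abs_le] at h1 ⊢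
    rw [← Real.sin_neg] at h1
    constructor
    · rw [Real.le_arcsin_iff_sin_le' ⟨by linarith, by linarith⟩]; exact h1.1
    · rw [Real.arcsin_le_iff_le_sin' ⟨by linarith, by linarith⟩]; exact h1.2
  -- The logarithm maps the sector to a strip of width `π / 4`, in which growth like
  -- `exp (exp (3 |Re w|))` is allowed, since `3 < 4`.
  have hkey := PhragmenLindelof.horizontal_strip (f := fun w => f (Complex.exp w))
    (a := -(Real.pi / 8)) (b := Real.pi / 8) (C := M) (z := Complex.log z)
    (hf.comp Complex.differentiable_exp).diffContOnCl
    ⟨3, by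
      rw [lt_div_iff₀ (by linarith)]; linarith, K * 8, by
      refine IsBigO.of_bound 1 (Eventually.of_forall fun w => ?_)
      rw [one_mul, Real.norm_of_nonneg (Real.exp_nonneg _)]
      refine (hgr _).trans (Real.exp_le_exp.mpr ?_)
      rw [Complex.norm_exp, mul_assoc]
      refine mul_le_mul_of_nonneg_left ?_ hK
      have h1 : Real.exp w.re ≤ Real.exp |w.re| := Real.exp_le_exp.mpr (le_abs_self _)
      have h2 : 1 ≤ Real.exp |w.re| := Real.one_le_exp (abs_nonneg _)
      have h3 : Real.exp (3 * |w.re|) = Real.exp |w.re| ^ 3 := by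
        rw [← Real.exp_nat_mul]; norm_num
      rw [h3]
      calc (1 + Real.exp w.re) ^ 3 ≤ (2 * Real.exp |w.re|) ^ 3 := by
            gcongr; linarith
        _ = 8 * Real.exp |w.re| ^ 3 := by ring⟩
    (fun w hw => hedge w (by
      rw [hw, Real.sin_neg, abs_neg, abs_of_pos hs0]))
    (fun w hw => hedge w (by rw [hw, abs_of_pos hs0]))
    (abs_le.mp hlog).1 (abs_le.mp hlog).2
  simpa only [Complex.exp_log hz0] using hkey

/-- An entire function of finite order at most three with a limit in sectors off the real line is
constant. -/
lemma eq_of_tendsto_sector {f : ℂ → ℂ} (hf : Differentiable ℂ f) {K : ℝ} (hK : 0 ≤ K)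
    (hgr : ∀ z, ‖f z‖ ≤ Real.exp (K * (1 + ‖z‖) ^ 3)) {c : ℂ}
    (hlim : ∀ δ > 0, Tendsto f (Bornology.cobounded ℂ ⊓ 𝓟 {z | δ * ‖z‖ ≤ |z.im|}) (𝓝 c)) (z : ℂ) :
    f z = c := by
  have hpi := Real.pi_pos
  have hs0 : 0 < Real.sin (Real.pi / 8) := Real.sin_pos_of_pos_of_lt_pi (by linarith) (by linarith)
  obtain ⟨M, hM⟩ : ∃ M, ∀ z : ℂ, Real.sin (Real.pi / 8) * ‖z‖ ≤ |z.im| → ‖f z‖ ≤ M := by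
    have hev := (hlim _ hs0).norm.eventually (gt_mem_nhds (lt_add_one ‖c‖))
    rw [eventually_inf_principal, (hasBasis_cobounded_norm (E := ℂ)).eventually_iff] at hev
    obtain ⟨R, -, hR⟩ := hev
    obtain ⟨B, hB⟩ := (isCompact_closedBall (0 : ℂ) R).exists_bound_of_continuousOn
      hf.continuous.continuousOn
    refine ⟨max B (‖c‖ + 1), fun z hz => ?_⟩
    rcases le_total ‖z‖ R with h1 | h1
    · exact (hB z (mem_closedBall_zero_iff.mpr h1)).trans (le_max_left _ _)
    · exact (hR h1 hz).le.trans (le_max_right _ _)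
  have hbd : ∀ z, ‖f z‖ ≤ M := fun z => by
    rcases lt_trichotomy z.re 0 with h1 | h1 | h1
    · have := norm_le_of_sector (f := fun w => f (-w)) (hf.comp differentiable_neg)
        (fun w => by simpa using hgr (-w)) hK (fun w hw => hM (-w) (by simpa using hw))
        (z := -z) (by simpa using h1)
      simpa only [neg_neg] using this
    · refine hM z ?_
      have h2 : ‖z‖ = |z.im| := by
        exact (Complex.abs_im_eq_norm.mpr h1).symm
      rw [h2]
      exact mul_le_of_le_one_left (abs_nonneg _) (Real.sin_le_one _)
    · exact norm_le_of_sector hf hgr hK hM h1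
  have hcst : ∀ w, f w = f z := fun w => hf.apply_eq_apply_of_bounded
    (isBounded_iff_forall_norm_le.mpr ⟨M, by rintro _ ⟨w, rfl⟩; exact hbd w⟩) w z
  have hy : Tendsto (fun y : ℝ => (y : ℂ) * Complex.I) atTop
      (Bornology.cobounded ℂ ⊓ 𝓟 {z | 1 * ‖z‖ ≤ |z.im|}) := by
    refine tendsto_inf.2 ⟨?_, tendsto_principal.2 (Eventually.of_forall fun y => by simp)⟩
    rw [← tendsto_norm_atTop_iff_cobounded]
    simpa using tendsto_abs_atTop_atTop
  have h1 := (hlim 1 one_pos).comp hy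
  have h2 : (f ∘ fun y : ℝ => (y : ℂ) * Complex.I) = fun _ => f z := funext fun y => hcst _
  rw [h2] at h1
  exact tendsto_nhds_unique tendsto_const_nhds h1

namespace IsRHPSolution

variable {L : ℝ} {q : ℝ → ℂ} {Y : ℝ → ℂ → Mat2} {S : SpectralData} {γs : ℝ} {r : ℤ → ℝ} {x : ℝ}
  {Φ : ℂ → Mat2}

lemma gaussian (hΦ : IsRHPSolution q L Y S γs r x Φ) (i j : Fin 2) :
    HasGaussianGrowth (S.growthDomain r) fun z => Φ z i j := by
  obtain ⟨c, hc, M, hM, hb⟩ := hΦ.growth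
  refine ⟨c + M, by positivity, fun z hz => (hb z hz i j).trans ?_⟩
  have h1 : M ≤ Real.exp M := by linarith [Real.add_one_le_exp M]
  calc M * Real.exp (c * ‖z‖ ^ 2) ≤ Real.exp M * Real.exp (c * ‖z‖ ^ 2) := by gcongr
    _ ≤ _ := by
      rw [← Real.exp_add, Real.exp_le_exp]
      nlinarith [mul_nonneg hM.le (sq_nonneg ‖z‖)]

/-- The entire extension of `comparisonQuartic` has finite order: the zeros of the entire function
by which its numerator is divided stay away from the circles between lattice points. -/
lemma exists_growth_comparisonQuartic (hΦ : IsRHPSolution q L Y S γs r x Φ)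
    (h : IsPeriodicDirac L q Y) (hS : IsSpectralData q L Y S) (hr : S.AdmissibleRadii r)
    {i j : Fin 2} {T : ℂ → ℂ} (hT : Differentiable ℂ T)
    (hT' : ∀ z : ℂ, z.im ≠ 0 → T z = comparisonQuartic q L Y x Φ i j z) :
    ∃ K, 0 ≤ K ∧ ∀ z, ‖T z‖ ≤ Real.exp (K * (1 + ‖z‖) ^ 3) := by
  have hL := h.pos
  have hpi := Real.pi_pos
  set p : ℂ → ℂ := fun z => dirichletProduct q L Y 1 z * dirichletProduct q L Y (-1) z with hp
  have hpd : Differentiable ℂ p :=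
    (h.differentiable_dirichletProduct 1).mul (h.differentiable_dirichletProduct (-1))
  set G : ℂ → ℂ := fun z => T z * (discSq Y L z * (fZero q L Y z ^ 2 * p z ^ 4)) with hG
  have hGd : Differentiable ℂ G := hT.mul (h.differentiable_discSq.mul
    ((h.differentiable_fZero.pow 2).mul (hpd.pow 4)))
  have hGe : ∀ z ∈ S.growthDomain r, G z = (comparison q L Y x Φ z i j *
      (sRoot Y L z * p z)) ^ 4 := fun z hz => by
    have hz0 := IsSpectralData.fZero_ne_zero_of_im h hz.1
    simp only [hG]
    rw [hT' z hz.1, comparisonQuartic, ← IsPeriodicDirac.sRoot_sq]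
    field_simp
  have hgr : HasGaussianGrowth univ G := hr.gaussian_univ h hS hGd
    (((h.gaussian_comparison (fun z hz => hz.1) hΦ.gaussian x i j).pow 4).of_norm_le
      fun z hz => by rw [hGe z hz])
  obtain ⟨C, hC, hCb⟩ := hgr
  have hδ : 0 < Real.pi / (4 * L) := by positivity
  obtain ⟨c, R₀, hc, hcR⟩ := h.exists_le_norm_sRoot hδ
  obtain ⟨C₁, R₁, h1, -, hb1⟩ := h.exists_le_norm_dirichletProduct 1 hδ
  obtain ⟨C₂, R₂, h2, -, hb2⟩ := h.exists_le_norm_dirichletProduct (-1) hδ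
  obtain ⟨C₃, R₃, h3, -, hb3⟩ := h.exists_le_norm_fZero hδ
  set R := max (max R₀ R₁) (max R₂ (max R₃ 0))
  set K := C + |Real.log (c ^ 2)| + 2 * C₃ + 4 * (C₁ + C₂)
  have hK : 0 ≤ K := by positivity
  -- Away from the lattice all factors of the denominator have lower bounds of order three.
  have hlow : ∀ z ∈ awayFromLattice L (Real.pi / (4 * L)), R ≤ ‖z‖ →
      ‖T z‖ ≤ Real.exp (K * (1 + max ‖z‖ 0) ^ 3) := fun z hz hzR => by
    have g0 := hcR z hz (le_trans (by simp [R]) hzR)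
    have g1 := hb1 z hz (le_trans (by simp [R]) hzR)
    have g2 := hb2 z hz (le_trans (by simp [R]) hzR)
    have g3 := hb3 z hz (le_trans (by simp [R]) hzR)
    rw [max_eq_left (norm_nonneg z)]
    set e := ‖z‖ ^ 3
    have hden : Real.exp (-(|Real.log (c ^ 2)| + (2 * C₃ + 4 * (C₁ + C₂)) * e)) ≤
        ‖discSq Y L z * (fZero q L Y z ^ 2 * p z ^ 4)‖ := by
      have k0 : Real.exp (-|Real.log (c ^ 2)|) ≤ ‖discSq Y L z‖ := by
        rw [← IsPeriodicDirac.sRoot_sq, norm_pow]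
        refine le_trans ?_ (pow_le_pow_left₀ hc.le g0 2)
        rw [← Real.le_log_iff_exp_le (by positivity)]
        exact neg_abs_le _
      have k1 : Real.exp (-((C₁ + C₂) * e)) ≤ ‖p z‖ := by
        simp only [hp]
        rw [norm_mul]
        refine le_trans (le_of_eq ?_) (mul_le_mul g1 g2 (Real.exp_nonneg _) (norm_nonneg _))
        rw [← Real.exp_add]; congr 1; ring
      rw [norm_mul, norm_mul, norm_pow, norm_pow]
      refine le_trans (le_of_eq ?_) (mul_le_mul k0 (mul_le_mul
        (pow_le_pow_left₀ (Real.exp_nonneg _) g3 2) (pow_le_pow_left₀ (Real.exp_nonneg _) k1 4)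
        (by positivity) (by positivity)) (by positivity) (by positivity))
      rw [← Real.exp_nat_mul, ← Real.exp_nat_mul, ← Real.exp_add, ← Real.exp_add]
      congr 1; push_cast; ring
    have hnum := hCb z (mem_univ z)
    simp only [hG] at hnum
    rw [norm_mul] at hnum
    have h4 : ‖T z‖ * Real.exp (-(|Real.log (c ^ 2)| + (2 * C₃ + 4 * (C₁ + C₂)) * e)) ≤
        Real.exp (C * (1 + ‖z‖ ^ 2)) :=
      (mul_le_mul_of_nonneg_left hden (norm_nonneg _)).trans hnum
    rw [Real.exp_neg, ← div_eq_mul_inv, div_le_iff₀ (Real.exp_pos _), ← Real.exp_add] at h4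
    refine h4.trans (Real.exp_le_exp.mpr ?_)
    have n0 := norm_nonneg z
    have e1 : 1 + ‖z‖ ^ 2 ≤ (1 + ‖z‖) ^ 3 := by nlinarith [pow_nonneg n0 3, pow_nonneg n0 2]
    have e2 : e ≤ (1 + ‖z‖) ^ 3 := pow_le_pow_left₀ n0 (by linarith) 3
    have e3 : 1 ≤ (1 + ‖z‖) ^ 3 := one_le_pow₀ (by linarith)
    have m1 := mul_le_mul_of_nonneg_left e1 hC
    have m2 := mul_le_mul_of_nonneg_left e2 (show 0 ≤ 2 * C₃ + 4 * (C₁ + C₂) by positivity)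
    have m3 := mul_le_mul_of_nonneg_left e3 (abs_nonneg (Real.log (c ^ 2)))
    simp only [K]
    linarith
  have hmono : Monotone fun a : ℝ => Real.exp (K * (1 + max a 0) ^ 3) := fun a b hab => by
    refine Real.exp_le_exp.mpr (mul_le_mul_of_nonneg_left ?_ hK)
    have : max a 0 ≤ max b 0 := max_le_max_right 0 hab
    exact pow_le_pow_left₀ (by positivity) (by linarith) 3
  set d := 1 + R + 3 * (Real.pi / L)
  have hR0 : 0 ≤ R := by simp [R]
  have hd : 1 ≤ d := by
    have : 0 ≤ 3 * (Real.pi / L) := by positivity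
    simp only [d]; linarith
  refine ⟨K * d ^ 3, by positivity, fun z => (norm_le_of_awayFromLattice hL hT hmono hlow z).trans
    (Real.exp_le_exp.mpr ?_)⟩
  rw [mul_assoc, ← mul_pow]
  refine mul_le_mul_of_nonneg_left (pow_le_pow_left₀ (by positivity) ?_ 3) hK
  have h5 : max ‖z‖ R ≤ ‖z‖ + R := max_le (by linarith) (by linarith [norm_nonneg z])
  have h6 : 0 ≤ 3 * (Real.pi / L) := by positivity
  rw [max_eq_left (by positivity)]
  simp only [d]
  nlinarith [norm_nonneg z, mul_nonneg (norm_nonneg z) hR0, mul_nonneg (norm_nonneg z) h6]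

end IsRHPSolution

/-! ### Uniqueness of the solution and the reconstruction formula -/

lemma half_conjTranspose_U_mul_U : (1 / 2 : ℂ) • U.conjTranspose * U = 1 :=
  mul_eq_one_comm.1 IsPeriodicDirac.U_mul_conj

lemma sector_le_awayFromLattice (L : ℝ) {δ : ℝ} (hδ : 0 < δ) :
    Bornology.cobounded ℂ ⊓ 𝓟 {z : ℂ | δ * ‖z‖ ≤ |z.im|} ≤
      Bornology.cobounded ℂ ⊓ 𝓟 (awayFromLattice L 1) := by
  refine le_inf inf_le_left (le_principal_iff.mpr ?_)
  rw [mem_inf_principal]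
  filter_upwards [(tendsto_norm_cobounded_atTop (E := ℂ)).eventually_ge_atTop δ⁻¹] with z hz hz'
  have h1 : 1 ≤ |z.im| := by
    refine le_trans ?_ hz'
    rwa [← inv_le_iff_one_le_mul₀' hδ]
  refine ⟨fun h0 => by rw [h0] at h1; norm_num at h1, fun k => h1.trans ?_⟩
  rw [Complex.dist_eq]
  simpa using Complex.abs_im_le_norm (z - ((k * Real.pi / L : ℝ) : ℂ))

/-- A continuous function on a connected set whose fourth power is `1` there and which tends to `1`
along a curve in the set is `1`. -/
lemma eq_one_of_pow_four_eq_one {s : Set ℂ} (hs : IsPreconnected s)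
    {f : ℂ → ℂ} (hf : ContinuousOn f s) (h4 : ∀ z ∈ s, f z ^ 4 = 1) {l : Filter ℂ} [l.NeBot]
    (hl : ∀ᶠ z in l, z ∈ s) (hlim : Tendsto f l (𝓝 1)) {z : ℂ} (hz : z ∈ s) : f z = 1 := by
  have hfin : {w : ℂ | w ^ 4 = 1}.Finite := by
    refine (Polynomial.nthRoots 4 (1 : ℂ)).toFinset.finite_toSet.subset fun w hw => ?_
    simpa [Polynomial.mem_nthRoots] using hw
  have hc : ∀ w ∈ s, f w = f z := fun w hw =>
    hs.constant_of_mapsTo hfin.isDiscrete hf h4 hw hz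
  exact tendsto_nhds_unique (tendsto_const_nhds.congr' (hl.mono fun w hw => (hc w hw).symm)) hlim

namespace IsRHPSolution

variable {L : ℝ} {q : ℝ → ℂ} {Y : ℝ → ℂ → Mat2} {S : SpectralData} {γs : ℝ} {r : ℤ → ℝ} {x : ℝ}
  {Φ : ℂ → Mat2}

/-- The solution of the Riemann-Hilbert problem, freed of `U` and `B(z)`, is the normalized Bloch
matrix: the entries of their quotient have entire fourth powers of finite order with limits `0`
and `1` in sectors. -/
theorem half_conjTranspose_U_mul_eq (hΦ : IsRHPSolution q L Y S γs r x Φ)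
    (h : IsPeriodicDirac L q Y) (hS : IsSpectralData q L Y S) (hγ : S.IsNearestZeroSign γs)
    (hr : S.AdmissibleRadii r) {z : ℂ} (hz : z.im ≠ 0) :
    (1 / 2 : ℂ) • U.conjTranspose * Φ z * (matrixB q L Y S γs z)⁻¹ = matX Y L x z := by
  obtain ⟨W, hW, hWO⟩ := hΦ.normalization
  set R : ℂ → Mat2 := fun z => (1 + W z) * matXinv Y L x z with hR
  have hleft : ∀ z : ℂ, z.im ≠ 0 → (1 / 2 : ℂ) • U.conjTranspose * Φ z =
      (1 + W z) * matrixB q L Y S γs z := fun z hz => by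
    rw [hW z hz, ← Matrix.mul_assoc, ← Matrix.mul_assoc, half_conjTranspose_U_mul_U, Matrix.one_mul]
  have hcmp : ∀ z : ℂ, z.im ≠ 0 → comparison q L Y x Φ z = scalarB q L Y S γs z • R z :=
    fun z hz => by
      rw [comparison, hleft z hz, matrixB_eq, Matrix.mul_smul, Matrix.smul_mul, Matrix.smul_mul,
        Matrix.mul_assoc (1 + W z), diagB_mul_diagBInv h hz, Matrix.mul_one]
  have hlimR : ∀ δ > 0, Tendsto R (Bornology.cobounded ℂ ⊓ 𝓟 {z | δ * ‖z‖ ≤ |z.im|}) (𝓝 1) :=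
    fun δ hδ => by
      have h1 := (h.tendsto_matXinv (h.isBlochFilter_awayFromLattice one_pos) x).mono_left
        (sector_le_awayFromLattice L hδ)
      have h2 : Tendsto W (Bornology.cobounded ℂ ⊓ 𝓟 {z | δ * ‖z‖ ≤ |z.im|}) (𝓝 0) :=
        tendsto_pi_nhds.2 fun i => tendsto_pi_nhds.2 fun j => (hWO δ hδ i j).trans_tendsto
          (tendsto_inv₀_cobounded.mono_left inf_le_left)
      simpa using (h2.const_add 1).mul h1
  -- The entire extensions of the fourth powers of the entries are constant.
  have hpow : ∀ (i j : Fin 2) (z : ℂ), z.im ≠ 0 → R z i j ^ 4 = (1 : Mat2) i j ^ 4 :=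
    fun i j z hz => by
      obtain ⟨T, hT, hT'⟩ := hΦ.exists_entire_comparisonQuartic h hS hγ i j
      obtain ⟨K, hK, hgr⟩ := hΦ.exists_growth_comparisonQuartic h hS hr hT hT'
      have hTR : ∀ w : ℂ, w.im ≠ 0 → T w = R w i j ^ 4 := fun w hw => by
        have e1 := IsSpectralData.fZero_ne_zero_of_im h hw
        have e2 := h.discSq_ne_zero hw
        rw [hT' w hw, comparisonQuartic, hcmp w hw, Matrix.smul_apply, smul_eq_mul, mul_pow,
          IsSpectralData.scalarB_pow h hS hw]
        field_simp
      rw [← hTR z hz]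
      refine eq_of_tendsto_sector hT hK hgr (fun δ hδ => ?_) z
      have h1 := ((tendsto_pi_nhds.1 (tendsto_pi_nhds.1 (hlimR δ hδ) i) j).pow 4)
      refine h1.congr' ?_
      filter_upwards [sector_le_awayFromLattice L hδ
        (mem_inf_of_right (mem_principal_self _))] with w hw
      exact (hTR w hw.1).symm
  have hcont : ∀ (i : Fin 2) (s : Set ℂ), (∀ w ∈ s, w.im ≠ 0) →
      ContinuousOn (scalarB q L Y S γs) s → ContinuousOn (fun w => R w i i) s :=
    fun i s hs hc => by
      refine ContinuousOn.congr (f := fun w => (scalarB q L Y S γs w)⁻¹ *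
        comparison q L Y x Φ w i i) ?_ fun w hw => ?_
      · exact (hc.inv₀ fun w hw => IsSpectralData.scalarB_ne_zero h hS (hs w hw)).mul fun w hw =>
          (h.differentiableAt_comparison hΦ.holomorphic (hs w hw) i i).continuousAt.continuousWithinAt
      · have e := IsSpectralData.scalarB_ne_zero (γs := γs) h hS (hs w hw)
        simp only [hcmp w (hs w hw), Matrix.smul_apply, smul_eq_mul]
        field_simp
  have hray : ∀ a : ℝ, |a| = 1 → Tendsto (fun y : ℝ => ((a * y : ℝ) : ℂ) * Complex.I) atTop
      (Bornology.cobounded ℂ ⊓ 𝓟 {z | 1 * ‖z‖ ≤ |z.im|}) := fun a ha => by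
    refine tendsto_inf.2 ⟨?_, tendsto_principal.2 (Eventually.of_forall fun y => by simp)⟩
    rw [← tendsto_norm_atTop_iff_cobounded]
    simpa [ha] using tendsto_abs_atTop_atTop
  -- In each half plane a diagonal entry is a continuous fourth root of unity, and its limit along
  -- the imaginary axis is `1`.
  have hdiag : ∀ i : Fin 2, R z i i = 1 := fun i => by
    have hl : ∀ a : ℝ, |a| = 1 → Tendsto (fun w => R w i i)
        (map (fun y : ℝ => ((a * y : ℝ) : ℂ) * Complex.I) atTop) (𝓝 1) := fun a ha => by
      have := (tendsto_pi_nhds.1 (tendsto_pi_nhds.1 (hlimR 1 one_pos) i) i).comp (hray a ha)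
      rw [Matrix.one_apply_eq] at this
      exact tendsto_map'_iff.2 this
    have h4 : ∀ w : ℂ, w.im ≠ 0 → R w i i ^ 4 = 1 := fun w hw => by
      rw [hpow i i w hw, Matrix.one_apply_eq, one_pow]
    obtain ⟨c1, c2⟩ := IsSpectralData.continuousOn_scalarB (γs := γs) h hS
    rcases lt_or_gt_of_ne hz with hz | hz
    · exact eq_one_of_pow_four_eq_one (convex_halfSpace_im_lt 0).isPreconnected
        (hcont i _ (fun w (hw : w.im < 0) => hw.ne) c2) (fun w (hw : w.im < 0) => h4 w hw.ne)
        (eventually_map.2 ((eventually_gt_atTop 0).mono fun y hy => by simpa using hy))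
        (hl (-1) (by simp)) hz
    · exact eq_one_of_pow_four_eq_one (convex_halfSpace_im_gt 0).isPreconnected
        (hcont i _ (fun w (hw : 0 < w.im) => hw.ne') c1) (fun w (hw : 0 < w.im) => h4 w hw.ne')
        (eventually_map.2 ((eventually_gt_atTop 0).mono fun y hy => by simpa using hy))
        (hl 1 (by simp)) hz
  have hR1 : R z = 1 := by
    ext i j
    by_cases hij : i = j
    · rw [← hij, hdiag, Matrix.one_apply_eq]
    · have := hpow i j z hz
      rw [Matrix.one_apply_ne hij, zero_pow (by norm_num)] at this
      rw [Matrix.one_apply_ne hij]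
      exact eq_zero_of_pow_eq_zero this
  have hX : 1 + W z = matX Y L x z := by
    have := congrArg (· * matX Y L x z) hR1
    simpa [hR, Matrix.mul_assoc, h.matXinv_mul_matX x hz] using this
  have hB : matrixB q L Y S γs z * (matrixB q L Y S γs z)⁻¹ = 1 := by
    have e := IsSpectralData.scalarB_ne_zero (γs := γs) h hS hz
    have : matrixB q L Y S γs z * ((scalarB q L Y S γs z)⁻¹ • diagBInv q L Y z) = 1 := by
      rw [matrixB_eq, Matrix.smul_mul, Matrix.mul_smul, diagB_mul_diagBInv h hz, smul_smul,
        mul_inv_cancel₀ e, one_smul]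
    rwa [Matrix.inv_eq_right_inv this]
  rw [hleft z hz, Matrix.mul_assoc, hB, Matrix.mul_one, hX]

/-- The reconstruction formula: by uniqueness it is the one for the normalized Bloch matrix. -/
theorem tendsto_potentialMatrix (hΦ : IsRHPSolution q L Y S γs r x Φ)
    (h : IsPeriodicDirac L q Y) (hS : IsSpectralData q L Y S) (hγ : S.IsNearestZeroSign γs)
    (hr : S.AdmissibleRadii r) {δ : ℝ} (hδ : 0 < δ) :
    Tendsto
      (fun z : ℂ => (Complex.I * z) •
        (sigma3 * ((1 / 2 : ℂ) • U.conjTranspose * Φ z * (matrixB q L Y S γs z)⁻¹) -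
          ((1 / 2 : ℂ) • U.conjTranspose * Φ z * (matrixB q L Y S γs z)⁻¹) * sigma3))
      (Bornology.cobounded ℂ ⊓ 𝓟 (S.awayFromGaps δ)) (𝓝 (potentialMatrix q x)) := by
  have h1 := (h.tendsto_commutator (h.isBlochFilter_awayFromResolvent hδ) x).mono_left
    (inf_le_inf_left _ (principal_mono.mpr (IsSpectralData.awayFromGaps_subset h hS δ)))
  refine h1.congr' ?_
  filter_upwards [mem_inf_of_right (mem_principal_self _)] with z hz
  rw [hΦ.half_conjTranspose_U_mul_eq h hS hγ hr hz.1]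

end IsRHPSolution

end PeriodicDirac

end

open PeriodicDirac
theorem mainTheorem4 (L : ℝ) (hL : 0 < L) :
    -- the reconstruction formula
    (∀ q : ℝ → ℂ, Function.Periodic q L → ContDiffOn ℝ 2 q (Icc 0 L) → q ≠ 0 →
      ∀ Y : ℝ → ℂ → Mat2, IsPrincipalSolution q Y →
      ∀ S : SpectralData, IsSpectralData q L Y S →
      ∀ γs : ℝ, S.IsNearestZeroSign γs →
      ∀ r : ℤ → ℝ, S.AdmissibleRadii r →
      ∀ (x : ℝ) (Φ : ℂ → Mat2), IsRHPSolution q L Y S γs r x Φ →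
      ∀ δ > 0,
        Tendsto
          (fun z : ℂ => (Complex.I * z) •
            (sigma3 * ((1 / 2 : ℂ) • U.conjTranspose * Φ z * (matrixB q L Y S γs z)⁻¹) -
              ((1 / 2 : ℂ) • U.conjTranspose * Φ z * (matrixB q L Y S γs z)⁻¹) * sigma3))
          (Bornology.cobounded ℂ ⊓ 𝓟 (S.awayFromGaps δ)) (𝓝 (potentialMatrix q x))) ∧
    -- the spectral data determine the potential
    (∀ q₁ q₂ : ℝ → ℂ, Function.Periodic q₁ L → Function.Periodic q₂ L →
      ContDiffOn ℝ 2 q₁ (Icc 0 L) → ContDiffOn ℝ 2 q₂ (Icc 0 L) → q₁ ≠ 0 → q₂ ≠ 0 →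
      ∀ Y₁ Y₂ : ℝ → ℂ → Mat2, IsPrincipalSolution q₁ Y₁ → IsPrincipalSolution q₂ Y₂ →
      ∀ S : SpectralData, IsSpectralData q₁ L Y₁ S → IsSpectralData q₂ L Y₂ S → q₁ = q₂) := by
  refine ⟨?_, ?_⟩
  · intro q hp hc _ Y hY S hS γs hγ r hr x Φ hΦ δ hδ
    exact hΦ.tendsto_potentialMatrix ⟨hL, hp, hc, hY⟩ hS hγ hr hδ
  · intro q₁ q₂ hp₁ hp₂ hc₁ hc₂ _ _ Y₁ Y₂ hY₁ hY₂ S hS₁ hS₂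
    exact eq_of_spectralData ⟨hL, hp₁, hc₁, hY₁⟩ ⟨hL, hp₂, hc₂, hY₂⟩ hS₁ hS₂
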